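/- **Setting.** Let $V=\mathbb C^N$. For $X\in\mathrm{End}(V^{\otimes 2})$ let $X_i$ be $X$ acting in the factors $i,i+1$ of a tensor power of $V$. An *R-matrix* is an invertible $X$ with $X_1X_2X_1=X_2X_1X_2$. It is *skew invertible* if there is $\Psi_X\in\mathrm{End}(V^{\otimes2})$ with $\mathrm{Tr}_{(2)}X_{12}\Psi_{X,23}=\mathrm{Tr}_{(2)}\Psi_{X,12}X_{23}=P_{13}$ ($P$ the permutation), and *strict* skew invertible if moreover $C_X=\mathrm{Tr}_{(1)}\Psi_X$ or $D_X=\mathrm{Tr}_{(2)}\Psi_X$ is invertible. Let $\{R,F\}$ be a compatible pair of strict skew invertible R-matrices: $R_1F_2F_1=F_2F_1R_2$, $R_2F_1F_2=F_1F_2R_1$. The R-trace over $n$ factors is $\mathrm{Tr}_{R(1,\dots,n)}Y=\mathrm{Tr}(D_R^{\otimes n}Y)$. $R$ is of *BMW type* with parameters $q,\mu\in\mathbb C$, $q\ne0,\pm1$, $\mu\notin\{0,q,-q^{-1}\}$, if its minimal polynomial is $(x-q)(x+q^{-1})(x-\mu)$ and $K=\frac{(qI-R)(q^{-1}I+R)}{\mu(q-q^{-1})}$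 satisfies $K_2K_1=R_1^{\pm1}R_2^{\pm1}K_1$ (both signs) and $K_1K_2K_1=K_1$. Put $i_q=\frac{q^i-q^{-i}}{q-q^{-1}}$, $\eta=\frac{(q-\mu)(q^{-1}+\mu)}{\mu(q-q^{-1})}$, $$\sigma^-_i(x)=I+\tfrac{x-1}{q-q^{-1}}R_i+\tfrac{x-1}{q\mu^{-1}x+1}K_i,\qquad a^{(1)}=I,\quad a^{(i+1)}=\tfrac{q^i}{(i+1)_q}\,a^{(i)}\sigma^-_i(q^{-2i})a^{(i)},$$ and let $a^{(i)\uparrow1}$ be $a^{(i)}$ shifted by one tensor factor. For $k\ge2$, suppose that $R$ is of BMW type and that: $i_q\neq0$ and $a^{(i)}\ne0$ for $2\le i\le k$; $a^{(k)\uparrow1}\sigma_1^-(q^{-2k})a^{(k)\uparrow1}=0$. Then $R$ is of *type $Sp(2k)$* if $\mu=-q^{-1-2k}$, and of *type $O(k)$* if $\mu=q^{1-k}$ and $\mathrm{rk}\,a^{(k)}=1$. **Algebras.** $\mathcal M(R,F)$ is the unital $\mathbb C$-algebra generated by the entries of an $N\times N$ matrix $M$ with relations $R_1M_{\bar1}M_{\bar2}=M_{\bar1}M_{\bar2}R_1$,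 where $M_{\bar1}=M_1$, $M_{\overline{i+1}}=F_iM_{\bar i}F_i^{-1}$. For $Y$ in the algebra generated by $R_1^{\pm1},\dots,R_{n-1}^{\pm1}$ put $\mathrm{ch}(Y)=\mathrm{Tr}_{R(1,\dots,n)}(M_{\bar1}\cdots M_{\bar n}Y)$; the characteristic subalgebra $\mathcal C(R,F)$ is the subalgebra generated by all $\mathrm{ch}(Y)$, $n\ge0$. It contains $$p_0=\mathrm{Tr}_RI,\quad p_n=\mathrm{ch}(R_{n-1}\cdots R_1)\ (n\ge1),\qquad g=\eta^{-1}\mathrm{ch}(K_1),\qquad a_0=1,\ a_i=\mathrm{ch}(a^{(i)}).$$ For the types $O$, $\mathcal M^\bullet(R,F)$ is obtained by adjoining $g^{-1}$ with $g^{-1}g=gg^{-1}=1$, $g^{-1}M=(G^{-1}MG)g^{-1}$, where $G=\mathrm{Tr}_{(2,3)}K_2F_1^{-1}F_2^{-1}$; and $\mathcal C^\bullet(R,F)$ is the subalgebra of $\mathcal M^\bullet(R,F)$ generated by $g^{-1}$ and the characteristic elements. For the type $O(2\ell)$, $\ell\ge1$, the components $O^\pm(2\ell)$ have the characteristic algebras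 $\mathcal C^\pm(R,F)=\mathcal C^\bullet(R,F)/(a_{2\ell}=\pm g^\ell)$. For the type $O(2\ell-1)$, $\ell\ge2$ (written $O^\bullet(2\ell-1)$), put $g^{1/2}=g^{1-\ell}a_{2\ell-1}\in\mathcal C^\bullet(R,F)$. Let $\mathcal E_{2r}=\mathbb C[\nu_0,\dots,\nu_{2r}]/(\nu_i\nu_{2r+1-i}-\nu_0^2,\ 1\le i\le 2r)$ and $\mathcal E^\bullet_{2r}=\mathcal E_{2r}[\nu_0^{-1}]$. With $e_i$ the elementary symmetric functions, let $\pi$ be any homomorphism of unital $\mathbb C$-algebras as follows: - $\pi_{Sp(2k)}:\mathcal C(R,F)\to\mathcal E_{2k}$, $g\mapsto\nu_0^2$, $a_i\mapsto e_i(\nu_0,-\nu_0,\nu_1,\dots,\nu_{2k})$ for $1\le i\le k$; - $\pi_{O^+(2\ell)}:\mathcal C^+(R,F)\to\mathcal E^\bullet_{2\ell}$, $g\mapsto\nu_0^2$, $a_i\mapsto e_i(\nu_1,\dots,\nu_{2\ell})$ for $1\le i\le2\ell$; - $\pi_{O^-(2\ell)}:\mathcal C^-(R,F)\to\mathcal E^\bullet_{2\ell-2}$,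 $g\mapsto\nu_0^2$, $a_i\mapsto e_i(\nu_0,-\nu_0,\nu_1,\dots,\nu_{2\ell-2})$ for $1\le i\le2\ell$; - $\pi_{O^\bullet(2\ell-1)}:\mathcal C^\bullet(R,F)\to\mathcal E^\bullet_{2\ell-2}$, $g^{1/2}\mapsto\nu_0$, $a_i\mapsto e_i(\nu_0,\nu_1,\dots,\nu_{2\ell-2})$ for $1\le i\le2\ell-1$. **Statement.** Let $n\ge0$ and assume $i_q\ne0$ for $2\le i\le n$. Define $s_0=1$ and, for $1\le m\le n$, $s_m$ by $$\sum_{i=0}^{m-1}q^{-i}s_ip_{m-i}=m_q\,s_m+\sum_{i=1}^{[m/2]}\bigl(\mu q^{2i-m}+q^{m-2i-1}\bigr)s_{m-2i}\,g^i .$$ In each of the four cases the differences $\nu_i-\nu_j$ ($i\neq j$, the index $0$ included) are invertible in the total ring of fractions of the target of $\pi$; the following formulas hold, those for $p_n$ in this ring, with $h_m$ the complete symmetric functions ($h_m=0$ for $m<0$); and the image of $p_n$ is a polynomial in the $\nu_i$, i.e. lies in (the image of) $\mathcal E_{2r}$. *Type $Sp(2k)$:* $\ s_n\mapsto h_n(\nu_1,\dots,\nu_{2k})$,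 $\ p_n\mapsto q^{n-1}\sum_{i=1}^{2k}d_i\nu_i^n$, where $$d_i=\frac{\nu_i-q^{-4}\nu_{2k+1-i}}{\nu_i-\nu_{2k+1-i}}\prod_{\substack{j=1\\ j\ne i,\,2k+1-i}}^{2k}\frac{\nu_i-q^{-2}\nu_j}{\nu_i-\nu_j}.$$ *Type $O^+(2\ell)$:* $\ s_n\mapsto h_n(\nu_1,\dots,\nu_{2\ell})-\nu_0^2h_{n-2}(\nu_1,\dots,\nu_{2\ell})$, $\ p_n\mapsto q^{n-1}\sum_{i=1}^{2\ell}d_i\nu_i^n$, where $$d_i=\prod_{\substack{j=1\\ j\ne i,\,2\ell+1-i}}^{2\ell}\frac{\nu_i-q^{-2}\nu_j}{\nu_i-\nu_j}.$$ *Type $O^-(2\ell)$:* $\ s_n\mapsto h_n(\nu_1,\dots,\nu_{2\ell-2})$, $\ p_n\mapsto q^{n-1}\sum_{i=1}^{2\ell-2}d_i\nu_i^n+\bigl(1+(-1)^n\bigr)q^{1-2\ell}\nu_0^n$, where $$d_i=\frac{\nu_i-q^{-4}\nu_{2\ell-1-i}}{\nu_i-\nu_{2\ell-1-i}}\prod_{\substack{j=1\\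 j\ne i,\,2\ell-1-i}}^{2\ell-2}\frac{\nu_i-q^{-2}\nu_j}{\nu_i-\nu_j}.$$ *Type $O^\bullet(2\ell-1)$:* $\ s_n\mapsto h_n(\nu_1,\dots,\nu_{2\ell-2})+\nu_0h_{n-1}(\nu_1,\dots,\nu_{2\ell-2})$, $\ p_n\mapsto q^{n-1}\sum_{i=1}^{2\ell-2}d_i\nu_i^n+q^{2-2\ell}\nu_0^n$, where $$d_i=\frac{\nu_i-q^{-2}\nu_0}{\nu_i-\nu_0}\prod_{\substack{j=1\\ j\ne i,\,2\ell-1-i}}^{2\ell-2}\frac{\nu_i-q^{-2}\nu_j}{\nu_i-\nu_j}.$$ -/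

import Mathlib

namespace QMA

/-! ### Operators on tensor powers of `V = ℂ^N`

An operator on `V ⊗ V` is a matrix indexed by `Fin N × Fin N`; an operator on `V^{⊗n}`, possibly
with entries in an algebra `A`, is a matrix indexed by `Fin n → Fin N`.  Matrix multiplication is
composition.  Tensor factors are numbered from `0`. -/

/-- `End (V ⊗ V)`. -/
abbrev Op2 (N : ℕ) := Matrix (Fin N × Fin N) (Fin N × Fin N) ℂ

/-- `Mat_N(A)^{⊗ n}`, i.e. `End (V^{⊗ n}) ⊗ A`. -/
abbrev Op (N n : ℕ) (A : Type) := Matrix (Fin n → Fin N) (Fin n → Fin N) A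

/-- The operator `X ∈ End (V ⊗ V)` acting in the neighbouring tensor factors `m`, `m + 1` of
`V^{⊗ n}` (counted from `0`) and as the identity in the others. (If there is no factor `m + 1`, the
value is the irrelevant default `1`.) -/
def site {N : ℕ} (X : Op2 N) (n m : ℕ) : Op N n ℂ :=
  if h : m + 1 < n then
    Matrix.of fun i j =>
      if ∀ t : Fin n, t.val ≠ m → t.val ≠ m + 1 → i t = j t then
        X (i ⟨m, by omega⟩, i ⟨m + 1, h⟩) (j ⟨m, by omega⟩, j ⟨m + 1, h⟩)
      else 0
  else 1

/-- A matrix `M` over `A`, acting in the first tensor factor of `V^{⊗ n}`, `n ≥ 1`. -/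
def firstSite {N : ℕ} {A : Type} [Ring A] (M : Matrix (Fin N) (Fin N) A) (n : ℕ) : Op N n A :=
  if h : 0 < n then
    Matrix.of fun i j =>
      if ∀ t : Fin n, t.val ≠ 0 → i t = j t then M (i ⟨0, h⟩) (j ⟨0, h⟩) else 0
  else 1

/-- A numerical operator regarded as an operator with entries in the `ℂ`-algebra `A`. -/
def toAlg {N n : ℕ} (A : Type) [Ring A] [Algebra ℂ A] (Y : Op N n ℂ) : Op N n A :=
  Y.map (algebraMap ℂ A)

/-! ### R-matrices -/

/-- `X` is invertible and satisfies the Yang-Baxter equation. -/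
def IsRMatrix {N : ℕ} (X : Op2 N) : Prop :=
  IsUnit X ∧ site X 3 0 * site X 3 1 * site X 3 0 = site X 3 1 * site X 3 0 * site X 3 1

/-- `Ψ` is a skew inverse of `X`:
`Tr₍₂₎ X₁₂ Ψ₂₃ = Tr₍₂₎ Ψ₁₂ X₂₃ = P₁₃`, where `P` is the permutation operator. -/
def IsSkewInverse {N : ℕ} (X Ψ : Op2 N) : Prop :=
  (∀ a c a' c' : Fin N,
    ∑ b : Fin N, (site X 3 0 * site Ψ 3 1) ![a, b, c] ![a', b, c'] =
      if a = c' ∧ c = a' then 1 else 0) ∧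
  (∀ a c a' c' : Fin N,
    ∑ b : Fin N, (site Ψ 3 0 * site X 3 1) ![a, b, c] ![a', b, c'] =
      if a = c' ∧ c = a' then 1 else 0)

open Classical in
/-- The (unique) skew inverse of a skew invertible operator. -/
noncomputable def skewInv {N : ℕ} (X : Op2 N) : Op2 N :=
  if h : ∃ Ψ : Op2 N, IsSkewInverse X Ψ then h.choose else 0

/-- `C_X = Tr₍₁₎ Ψ_X`. -/
noncomputable def matC {N : ℕ} (X : Op2 N) : Matrix (Fin N) (Fin N) ℂ :=
  Matrix.of fun a b => ∑ c : Fin N, skewInv X (c, a) (c, b)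

/-- `D_X = Tr₍₂₎ Ψ_X`. -/
noncomputable def matD {N : ℕ} (X : Op2 N) : Matrix (Fin N) (Fin N) ℂ :=
  Matrix.of fun a b => ∑ c : Fin N, skewInv X (a, c) (b, c)

/-- `X` is strict skew invertible. -/
def IsStrictSkewInvertible {N : ℕ} (X : Op2 N) : Prop :=
  (∃ Ψ : Op2 N, IsSkewInverse X Ψ) ∧ (IsUnit (matC X) ∨ IsUnit (matD X))

/-- `{R, F}` is a compatible pair of strict skew invertible R-matrices. -/
structure IsCompatiblePair {N : ℕ} (R F : Op2 N) : Prop where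
  rmatrix_left : IsRMatrix R
  rmatrix_right : IsRMatrix F
  strict_left : IsStrictSkewInvertible R
  strict_right : IsStrictSkewInvertible F
  twist_left : site R 3 0 * site F 3 1 * site F 3 0 = site F 3 1 * site F 3 0 * site R 3 1
  twist_right : site R 3 1 * site F 3 0 * site F 3 1 = site F 3 0 * site F 3 1 * site R 3 0

/-- The `q`-number `i_q = (q^i - q^{-i}) / (q - q^{-1})`. -/
noncomputable def qnum (q : ℂ) (i : ℕ) : ℂ := (q ^ i - (q ^ i)⁻¹) / (q - q⁻¹)

/-- The raw data: two complex parameters and two operators on `V ⊗ V`, `V = ℂ^N`. -/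
structure Datum (N : ℕ) where
  q : ℂ
  mu : ℂ
  R : Op2 N
  F : Op2 N

namespace Datum

variable {N : ℕ} (P : Datum N)

/-- The image `K_{m+1}` on `V^{⊗ n}` of
`κ = μ^{-1} (q - q^{-1})^{-1} (q - σ) (q^{-1} + σ)`. -/
noncomputable def kap (n m : ℕ) : Op N n ℂ :=
  (P.mu * (P.q - P.q⁻¹))⁻¹ •
    ((P.q • (1 : Op N n ℂ) - site P.R n m) * (P.q⁻¹ • (1 : Op N n ℂ) + site P.R n m))

/-- `η = (q - μ) (q^{-1} + μ) / (μ (q - q^{-1}))`, so that `κ² = η κ`. -/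
noncomputable def eta : ℂ := (P.q - P.mu) * (P.q⁻¹ + P.mu) / (P.mu * (P.q - P.q⁻¹))

/-- `R` is of Birman-Murakami-Wenzl type with parameters `q`, `μ`. -/
structure IsBMW : Prop where
  q_ne_zero : P.q ≠ 0
  q_sq_ne_one : P.q ^ 2 ≠ 1
  mu_ne_zero : P.mu ≠ 0
  mu_ne_q : P.mu ≠ P.q
  mu_ne_neg_q_inv : P.mu ≠ -P.q⁻¹
  minimal : minpoly ℂ P.R =
    (Polynomial.X - Polynomial.C P.q) * (Polynomial.X + Polynomial.C P.q⁻¹) *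
      (Polynomial.X - Polynomial.C P.mu)
  rel_pos : P.kap 3 1 * P.kap 3 0 = site P.R 3 0 * site P.R 3 1 * P.kap 3 0
  rel_neg : P.kap 3 1 * P.kap 3 0 = site P.R⁻¹ 3 0 * site P.R⁻¹ 3 1 * P.kap 3 0
  rel_kkk : P.kap 3 0 * P.kap 3 1 * P.kap 3 0 = P.kap 3 0

/-- The image on `V^{⊗ n}` of the baxterized element
`σ⁻_{m+1}(x) = 1 + (x - 1)/(q - q^{-1}) σ + (x - 1)/(α x + 1) κ`, `α = q μ^{-1}`. -/
noncomputable def sigmaMinus (n m : ℕ) (x : ℂ) : Op N n ℂ :=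
  1 + ((x - 1) / (P.q - P.q⁻¹)) • site P.R n m +
    ((x - 1) / (P.q * P.mu⁻¹ * x + 1)) • P.kap n m

/-- The image on `V^{⊗ n}` of the `i`-th antisymmetrizer `a^{(i)}`, shifted by `s`: it acts in the
factors `s, …, s + i - 1` (counted from `0`).  The recursion is
`a^{(1)} = 1`, `a^{(i+1)} = q^i / (i+1)_q · a^{(i)} σ⁻_i(q^{-2i}) a^{(i)}`. -/
noncomputable def asym (n s : ℕ) : ℕ → Op N n ℂ
  | 0 => 1
  | 1 => 1
  | i + 2 => (P.q ^ (i + 1) / qnum P.q (i + 2)) •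
      (asym n s (i + 1) * P.sigmaMinus n (s + i) (P.q ^ (2 * (i + 1)))⁻¹ * asym n s (i + 1))

/-- The conditions common to the types `Sp(2k)` and `O(k)`: `i_q ≠ 0` for `2 ≤ i ≤ k`, the
antisymmetrizers of orders `2, …, k` do not vanish and the (unnormalized) antisymmetrizer of order
`k + 1` vanishes. -/
structure HasHeight (k : ℕ) : Prop where
  two_le : 2 ≤ k
  qnum_ne_zero : ∀ i, 2 ≤ i → i ≤ k → qnum P.q i ≠ 0
  rank_ne_zero : ∀ i, 2 ≤ i → i ≤ k → (P.asym i 0 i).rank ≠ 0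
  vanish : P.asym (k + 1) 1 k * P.sigmaMinus (k + 1) 0 (P.q ^ (2 * k))⁻¹ * P.asym (k + 1) 1 k = 0

/-- `R` is an `Sp(2k)`-type R-matrix: `μ = -q^{-1-2k}`. -/
structure IsSpType (k : ℕ) : Prop where
  bmw : P.IsBMW
  height : P.HasHeight k
  mu_eq : P.mu = -(P.q ^ (1 + 2 * k))⁻¹

/-- `R` is an `O(k)`-type R-matrix: `μ = q^{1-k}` and the last antisymmetrizer has rank one. -/
structure IsOType (k : ℕ) : Prop where
  bmw : P.IsBMW
  height : P.HasHeight k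
  mu_eq : P.mu = P.q ^ (1 - (k : ℤ))
  rank_eq_one : (P.asym k 0 k).rank = 1

/-! ### Matrix copies, characteristic elements

Here `A` is an arbitrary `ℂ`-algebra and `M` an `N × N` matrix over it. -/

section Char

variable {A : Type} [Ring A] [Algebra ℂ A] (M : Matrix (Fin N) (Fin N) A)

/-- The copies on `V^{⊗ n}`: `copy M n i` is the `(i+1)`-st copy, defined by
`M_{\bar 1} = M₁` and `M_{\overline{i+1}} = F_i M_{\bar i} F_i^{-1}`. -/
noncomputable def copy (n : ℕ) : ℕ → Op N n A
  | 0 => firstSite M n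
  | i + 1 => toAlg A (site P.F n i) * copy n i * toAlg A (site P.F⁻¹ n i)

/-- `M_{\bar 1} M_{\bar 2} ⋯ M_{\bar n}` on `V^{⊗ n}`. -/
noncomputable def copies (n : ℕ) : Op N n A :=
  ((List.range n).map (P.copy M n)).prod

/-- The R-trace over all `n` tensor factors, `Tr (D_R ⊗ ⋯ ⊗ D_R · X)`. -/
noncomputable def rTrace {n : ℕ} (X : Op N n A) : A :=
  ∑ i : Fin n → Fin N, ∑ j : Fin n → Fin N, (∏ t, matD P.R (i t) (j t)) • X j i

/-- `Tr_{R(1,…,n)} (M_{\bar 1} ⋯ M_{\bar n} Y)`; for `Y = ρ_R(α)` this is `ch(α)`. -/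
noncomputable def ch (n : ℕ) (Y : Op N n ℂ) : A :=
  P.rTrace (P.copies M n * toAlg A Y)

/-- The image `ρ_R(ℂ B_n)` of the group algebra of the braid group in `End (V^{⊗ n})`: the algebra
generated by the operators `R_1^{±1}, …, R_{n-1}^{±1}`. -/
noncomputable def braidAlg (n : ℕ) : Subalgebra ℂ (Op N n ℂ) :=
  Algebra.adjoin ℂ {Y | ∃ m, m + 1 < n ∧ (Y = site P.R n m ∨ Y = site P.R⁻¹ n m)}

/-- All elements `ch(α)`, `α ∈ ℂ B_n`, `n ≥ 0` (for `n = 0` these are the scalars). -/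
def charGens : Set A :=
  {x | ∃ (n : ℕ) (Y : Op N n ℂ), Y ∈ P.braidAlg n ∧ x = P.ch M n Y}

/-- The characteristic subalgebra. -/
noncomputable def charSub : Subalgebra ℂ A := Algebra.adjoin ℂ (P.charGens M)

/-- The characteristic subalgebra, extended by an element `z` of `A` (the inverse of the
2-contraction in the applications). -/
noncomputable def extCharSub (z : A) : Subalgebra ℂ A :=
  Algebra.adjoin ℂ (insert z (P.charGens M))

/-- The power sums: `p_0 = Tr_R I`, `p_n = ch(σ_{n-1} ⋯ σ_2 σ_1)`. -/
noncomputable def powerSum : ℕ → A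
  | 0 => algebraMap ℂ A (matD P.R).trace
  | n + 1 => P.ch M (n + 1) ((List.range n).reverse.map (site P.R (n + 1))).prod

/-- The 2-contraction `g = η^{-1} ch(κ_1)`. -/
noncomputable def contraction : A := P.eta⁻¹ • P.ch M 2 (P.kap 2 0)

/-- `a_0 = 1`, `a_i = ch(a^{(i)})`. -/
noncomputable def asymElt (i : ℕ) : A := if i = 0 then 1 else P.ch M i (P.asym i 0 i)

theorem site_mem (n m : ℕ) : site P.R n m ∈ P.braidAlg n := by
  by_cases h : m + 1 < n
  · exact Algebra.subset_adjoin ⟨m, h, Or.inl rfl⟩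
  · have h1 : site P.R n m = 1 := by unfold site; exact dif_neg h
    rw [h1]
    exact one_mem _

theorem kap_mem (n m : ℕ) : P.kap n m ∈ P.braidAlg n :=
  Subalgebra.smul_mem _ (mul_mem
    (sub_mem (Subalgebra.smul_mem _ (one_mem _) _) (P.site_mem n m))
    (add_mem (Subalgebra.smul_mem _ (one_mem _) _) (P.site_mem n m))) _

theorem sigmaMinus_mem (n m : ℕ) (x : ℂ) : P.sigmaMinus n m x ∈ P.braidAlg n :=
  add_mem (add_mem (one_mem _) (Subalgebra.smul_mem _ (P.site_mem n m) _))
    (Subalgebra.smul_mem _ (P.kap_mem n m) _)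

theorem asym_mem (n s : ℕ) : ∀ i, P.asym n s i ∈ P.braidAlg n
  | 0 => by rw [asym]; exact one_mem _
  | 1 => by rw [asym]; exact one_mem _
  | i + 2 => by
      rw [asym]
      exact Subalgebra.smul_mem _ (mul_mem (mul_mem (asym_mem n s (i + 1))
        (P.sigmaMinus_mem _ _ _)) (asym_mem n s (i + 1))) _

theorem powerSum_mem (n : ℕ) : P.powerSum M n ∈ P.charSub M := by
  cases n with
  | zero => exact Subalgebra.algebraMap_mem _ _
  | succ n =>
    refine Algebra.subset_adjoin ⟨n + 1, _, ?_, rfl⟩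
    refine list_prod_mem fun x hx => ?_
    obtain ⟨m, -, rfl⟩ := List.mem_map.1 hx
    exact P.site_mem _ _

theorem contraction_mem : P.contraction M ∈ P.charSub M :=
  by
  have h : P.ch M 2 (P.kap 2 0) ∈ P.charSub M :=
    Algebra.subset_adjoin ⟨2, _, P.kap_mem 2 0, rfl⟩
  exact Subalgebra.smul_mem _ h _

theorem asymElt_mem (i : ℕ) : P.asymElt M i ∈ P.charSub M := by
  by_cases h : i = 0
  · rw [asymElt, if_pos h]; exact one_mem _
  · rw [asymElt, if_neg h]
    exact Algebra.subset_adjoin ⟨i, _, P.asym_mem i 0 i, rfl⟩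

theorem charSub_le (z : A) : P.charSub M ≤ P.extCharSub M z :=
  Algebra.adjoin_mono (Set.subset_insert _ _)

end Char

/-- The elements `s_n` defined from the power sums `p_n` and the 2-contraction `g` by `s_0 = 1` and
the Newton recursion
`∑_{i=0}^{n-1} q^{-i} s_i p_{n-i} = n_q s_n + ∑_{i=1}^{[n/2]} (μ q^{2i-n} + q^{n-2i-1}) s_{n-2i} g^i`. -/
noncomputable def newtonS {A : Type} [Ring A] [Algebra ℂ A] (p : ℕ → A) (g : A) : ℕ → A
  | 0 => 1
  | n + 1 => (qnum P.q (n + 1))⁻¹ •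
      (∑ i : Fin (n + 1), (P.q ^ (i : ℕ))⁻¹ • (newtonS p g i * p (n + 1 - i)) -
        ∑ i : Fin ((n + 1) / 2),
          (P.mu * P.q ^ (2 * ((i : ℤ) + 1) - ((n : ℤ) + 1)) +
              P.q ^ (((n : ℤ) + 1) - 2 * ((i : ℤ) + 1) - 1)) •
            (newtonS p g (n + 1 - 2 * ((i : ℕ) + 1)) * g ^ ((i : ℕ) + 1)))
  termination_by n => n
  decreasing_by all_goals omega

/-! ### The quantum matrix algebra and its characteristic subalgebra -/

/-- The matrix of free generators. -/
def freeGen (N : ℕ) : Matrix (Fin N) (Fin N) (FreeAlgebra ℂ (Fin N × Fin N)) :=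
  Matrix.of fun a b => FreeAlgebra.ι ℂ (a, b)

/-- The entries of `R_1 M_{\bar 1} M_{\bar 2} = M_{\bar 1} M_{\bar 2} R_1`. -/
inductive QMRel : FreeAlgebra ℂ (Fin N × Fin N) → FreeAlgebra ℂ (Fin N × Fin N) → Prop
  | entry (i j : Fin 2 → Fin N) : QMRel
      ((toAlg (FreeAlgebra ℂ (Fin N × Fin N)) (site P.R 2 0) * P.copies (freeGen N) 2) i j)
      ((P.copies (freeGen N) 2 * toAlg (FreeAlgebra ℂ (Fin N × Fin N)) (site P.R 2 0)) i j)

/-- The quantum matrix algebra `M(R,F)`. -/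
abbrev QMAlg : Type := RingQuot P.QMRel

/-- The matrix of generators of `M(R,F)`. -/
noncomputable def gen : Matrix (Fin N) (Fin N) P.QMAlg :=
  Matrix.of fun a b => RingQuot.mkAlgHom ℂ P.QMRel (freeGen N a b)

/-- The characteristic subalgebra `C(R,F)` of `M(R,F)`. -/
abbrev CharAlg : Type := P.charSub P.gen

/-- `p_n ∈ C(R,F)`. -/
noncomputable def p (n : ℕ) : P.CharAlg := ⟨P.powerSum P.gen n, P.powerSum_mem P.gen n⟩

/-- `g ∈ C(R,F)`. -/
noncomputable def g : P.CharAlg := ⟨P.contraction P.gen, P.contraction_mem P.gen⟩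

/-- `a_i = ch(a^{(i)}) ∈ C(R,F)`. -/
noncomputable def a (i : ℕ) : P.CharAlg := ⟨P.asymElt P.gen i, P.asymElt_mem P.gen i⟩

/-- `s_n ∈ C(R,F)`. -/
noncomputable def s (n : ℕ) : P.CharAlg := P.newtonS P.p P.g n

/-! ### The extended quantum matrix algebra -/

/-- The matrix `G = Tr₍₂₃₎ K_2 F_1^{-1} F_2^{-1}`. -/
noncomputable def matG : Matrix (Fin N) (Fin N) ℂ :=
  Matrix.of fun a b => ∑ c : Fin N, ∑ d : Fin N,
    (P.kap 3 1 * site P.F⁻¹ 3 0 * site P.F⁻¹ 3 1) ![a, c, d] ![b, c, d]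

/-- The free algebra on the entries of `M` and one more generator, `g^{-1}`. -/
abbrev ExtFree (N : ℕ) : Type := FreeAlgebra ℂ (Option (Fin N × Fin N))

/-- The matrix of the generators `M` in the free algebra. -/
def extFreeGen (N : ℕ) : Matrix (Fin N) (Fin N) (ExtFree N) :=
  Matrix.of fun a b => FreeAlgebra.ι ℂ (some (a, b))

/-- The generator `g^{-1}` in the free algebra. -/
def extFreeInv (N : ℕ) : ExtFree N := FreeAlgebra.ι ℂ none

/-- The relations of `M(R,F)` together with `g^{-1} g = g g^{-1} = 1` and
`g^{-1} M = (G^{-1} M G) g^{-1}`. -/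
inductive ExtRel : ExtFree N → ExtFree N → Prop
  | entry (i j : Fin 2 → Fin N) : ExtRel
      ((toAlg (ExtFree N) (site P.R 2 0) * P.copies (extFreeGen N) 2) i j)
      ((P.copies (extFreeGen N) 2 * toAlg (ExtFree N) (site P.R 2 0)) i j)
  | inv_mul : ExtRel (extFreeInv N * P.contraction (extFreeGen N)) 1
  | mul_inv : ExtRel (P.contraction (extFreeGen N) * extFreeInv N) 1
  | inv_gen (a b : Fin N) : ExtRel
      (extFreeInv N * extFreeGen N a b)
      ((P.matG⁻¹.map (algebraMap ℂ (ExtFree N)) * extFreeGen N *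
        P.matG.map (algebraMap ℂ (ExtFree N))) a b * extFreeInv N)

/-- The extended quantum matrix algebra `M^•(R,F)`. -/
abbrev ExtAlg : Type := RingQuot P.ExtRel

/-- The matrix `M` over `M^•(R,F)`. -/
noncomputable def extGen : Matrix (Fin N) (Fin N) P.ExtAlg :=
  Matrix.of fun a b => RingQuot.mkAlgHom ℂ P.ExtRel (extFreeGen N a b)

/-- `g^{-1} ∈ M^•(R,F)`. -/
noncomputable def extInv : P.ExtAlg := RingQuot.mkAlgHom ℂ P.ExtRel (extFreeInv N)

/-- The extended characteristic subalgebra `C^•(R,F)`, generated by the characteristic elements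
and `g^{-1}`. -/
abbrev ExtCharAlg : Type := P.extCharSub P.extGen P.extInv

/-- `p_n ∈ C^•(R,F)`. -/
noncomputable def extP (n : ℕ) : P.ExtCharAlg :=
  ⟨P.powerSum P.extGen n, P.charSub_le _ _ (P.powerSum_mem P.extGen n)⟩

/-- `g ∈ C^•(R,F)`. -/
noncomputable def extG : P.ExtCharAlg :=
  ⟨P.contraction P.extGen, P.charSub_le _ _ (P.contraction_mem P.extGen)⟩

/-- `g^{-1} ∈ C^•(R,F)`. -/
noncomputable def extGInv : P.ExtCharAlg :=
  ⟨P.extInv, Algebra.subset_adjoin (Set.mem_insert _ _)⟩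

/-- `a_i = ch(a^{(i)}) ∈ C^•(R,F)`. -/
noncomputable def extA (i : ℕ) : P.ExtCharAlg :=
  ⟨P.asymElt P.extGen i, P.charSub_le _ _ (P.asymElt_mem P.extGen i)⟩

/-- `s_n ∈ C^•(R,F)`. -/
noncomputable def extS (n : ℕ) : P.ExtCharAlg := P.newtonS P.extP P.extG n

/-- `g^{1/2} = g^{1-ℓ} a_{2ℓ-1} ∈ C^•(R,F)`, for the type `O^•(2ℓ-1)`. -/
noncomputable def extRoot (l : ℕ) : P.ExtCharAlg := P.extGInv ^ (l - 1) * P.extA (2 * l - 1)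

/-- The relation `a_{2ℓ} = ε g^ℓ`. -/
inductive CompRel (l : ℕ) (ε : ℤˣ) : P.ExtCharAlg → P.ExtCharAlg → Prop
  | rel : CompRel l ε (P.extA (2 * l)) (((ε : ℤ) : ℂ) • P.extG ^ l)

/-- The characteristic algebras `C^±(R,F)` of the components `O^±(2ℓ)`: the quotients of
`C^•(R,F)` by the relation `a_{2ℓ} = ± g^ℓ`. -/
abbrev CompCharAlg (l : ℕ) (ε : ℤˣ) : Type := RingQuot (P.CompRel l ε)

/-- The projection `C^•(R,F) → C^±(R,F)`. -/
noncomputable def toComp (l : ℕ) (ε : ℤˣ) : P.ExtCharAlg →ₐ[ℂ] P.CompCharAlg l ε :=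
  RingQuot.mkAlgHom ℂ (P.CompRel l ε)

/-- The class of `s_n` in `C^±(R,F)`. -/
noncomputable def compS (l : ℕ) (ε : ℤˣ) (n : ℕ) : P.CompCharAlg l ε :=
  P.toComp l ε (P.extS n)

end Datum

/-! ### Spectral variables -/

/-- The ideal generated by `ν_i ν_{2r+1-i} - ν_0²`, `1 ≤ i ≤ 2r`.  Here `i.succ` runs through the
indices `1, …, 2r`, and `i.rev.succ` is the index `2r + 1 - i.succ`. -/
noncomputable def specIdeal (r : ℕ) : Ideal (MvPolynomial (Fin (2 * r + 1)) ℂ) :=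
  Ideal.span (Set.range fun i : Fin (2 * r) =>
    MvPolynomial.X i.succ * MvPolynomial.X i.rev.succ - MvPolynomial.X 0 ^ 2)

/-- The algebra `E_{2r}` of polynomials in the orthosymplectic spectral variables
`ν_0, …, ν_{2r}`. -/
abbrev SpecAlg (r : ℕ) : Type := MvPolynomial (Fin (2 * r + 1)) ℂ ⧸ specIdeal r

/-- The spectral variables `ν_0, …, ν_{2r}` in `E_{2r}`. -/
noncomputable def nu (r : ℕ) (i : Fin (2 * r + 1)) : SpecAlg r :=
  Ideal.Quotient.mk (specIdeal r) (MvPolynomial.X i)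

/-- The algebra `E^•_{2r}`, obtained from `E_{2r}` by inverting `ν_0`. -/
abbrev SpecAlgInv (r : ℕ) : Type := Localization.Away (nu r 0)

/-- The spectral variables in `E^•_{2r}`. -/
noncomputable def nuInv (r : ℕ) (i : Fin (2 * r + 1)) : SpecAlgInv r :=
  algebraMap (SpecAlg r) (SpecAlgInv r) (nu r i)

/-- The elementary symmetric function `e_n` of a finite family. -/
noncomputable def esym {m : ℕ} {B : Type} [CommRing B] [Algebra ℂ B] (x : Fin m → B) (n : ℕ) : B :=
  MvPolynomial.aeval x (MvPolynomial.esymm (Fin m) ℂ n)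

/-- The complete symmetric function `h_n` of a finite family, with `h_n = 0` for `n < 0`. -/
noncomputable def hsym {m : ℕ} {B : Type} [CommRing B] [Algebra ℂ B] (x : Fin m → B) (n : ℤ) : B :=
  if 0 ≤ n then MvPolynomial.aeval x (MvPolynomial.hsymm (Fin m) ℂ n.toNat) else 0

/-- The fraction `(x - c y) / (x - y)` in a commutative ring where `x - y` is invertible. -/
noncomputable def ratio {L : Type} [CommRing L] [Algebra ℂ L] (c : ℂ) (x y : L) : L :=
  (x - c • y) * Ring.inverse (x - y)

/-- `∏_{j ≠ i, 2r+1-i} (ν_i - q^{-2} ν_j) / (ν_i - ν_j)`, where `x = (ν_1, …, ν_{2r})`. -/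
noncomputable def prodRatio {r : ℕ} {L : Type} [CommRing L] [Algebra ℂ L] (q : ℂ)
    (x : Fin (2 * r) → L) (i : Fin (2 * r)) : L :=
  ∏ j ∈ Finset.univ.filter (fun j => j ≠ i ∧ j ≠ i.rev), ratio (q ^ 2)⁻¹ (x i) (x j)

/-- The total ring of fractions of `E_{2r}`. -/
abbrev SpecFrac (r : ℕ) : Type := FractionRing (SpecAlg r)

/-- The total ring of fractions of `E^•_{2r}`. -/
abbrev SpecFracInv (r : ℕ) : Type := FractionRing (SpecAlgInv r)

/-- The spectral variables as rational functions, `E_{2r}` case. -/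
noncomputable def nuF (r : ℕ) (i : Fin (2 * r + 1)) : SpecFrac r :=
  algebraMap (SpecAlg r) (SpecFrac r) (nu r i)

/-- The spectral variables as rational functions, `E^•_{2r}` case. -/
noncomputable def nuFInv (r : ℕ) (i : Fin (2 * r + 1)) : SpecFracInv r :=
  algebraMap (SpecAlgInv r) (SpecFracInv r) (nuInv r i)

namespace Datum

variable {N : ℕ} (P : Datum N)

/-! ### The spectral homomorphisms -/

/-- `π_{Sp(2k)} : C(R,F) → E_{2k}`,
`g ↦ ν_0²`, `a_i ↦ e_i(ν_0, -ν_0, ν_1, …, ν_{2k})` for `1 ≤ i ≤ k`. -/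
def IsSpectralSp (k : ℕ) (π : P.CharAlg →ₐ[ℂ] SpecAlg k) : Prop :=
  π P.g = nu k 0 ^ 2 ∧
  ∀ i, 1 ≤ i → i ≤ k →
    π (P.a i) = esym (Fin.cons (nu k 0) (Fin.cons (-nu k 0) fun j : Fin (2 * k) => nu k j.succ) :
      Fin (2 * k + 2) → SpecAlg k) i

/-- `π_{O^+(2ℓ)} : C^+(R,F) → E^•_{2ℓ}`,
`g ↦ ν_0²`, `a_i ↦ e_i(ν_1, …, ν_{2ℓ})` for `1 ≤ i ≤ 2ℓ`. -/
def IsSpectralOPlus (l : ℕ) (π : P.CompCharAlg l 1 →ₐ[ℂ] SpecAlgInv l) : Prop :=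
  π (P.toComp l 1 P.extG) = nuInv l 0 ^ 2 ∧
  ∀ i, 1 ≤ i → i ≤ 2 * l →
    π (P.toComp l 1 (P.extA i)) = esym (fun j : Fin (2 * l) => nuInv l j.succ) i

/-- `π_{O^-(2ℓ)} : C^-(R,F) → E^•_{2ℓ-2}`,
`g ↦ ν_0²`, `a_i ↦ e_i(ν_0, -ν_0, ν_1, …, ν_{2ℓ-2})` for `1 ≤ i ≤ 2ℓ`. -/
def IsSpectralOMinus (l : ℕ) (π : P.CompCharAlg l (-1) →ₐ[ℂ] SpecAlgInv (l - 1)) : Prop :=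
  π (P.toComp l (-1) P.extG) = nuInv (l - 1) 0 ^ 2 ∧
  ∀ i, 1 ≤ i → i ≤ 2 * l →
    π (P.toComp l (-1) (P.extA i)) =
      esym (Fin.cons (nuInv (l - 1) 0) (Fin.cons (-nuInv (l - 1) 0)
        fun j : Fin (2 * (l - 1)) => nuInv (l - 1) j.succ) :
          Fin (2 * (l - 1) + 2) → SpecAlgInv (l - 1)) i

/-- `π_{O^•(2ℓ-1)} : C^•(R,F) → E^•_{2ℓ-2}`,
`g^{1/2} ↦ ν_0`, `a_i ↦ e_i(ν_0, ν_1, …, ν_{2ℓ-2})` for `1 ≤ i ≤ 2ℓ-1`. -/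
def IsSpectralOOdd (l : ℕ) (π : P.ExtCharAlg →ₐ[ℂ] SpecAlgInv (l - 1)) : Prop :=
  π (P.extRoot l) = nuInv (l - 1) 0 ∧
  ∀ i, 1 ≤ i → i ≤ 2 * l - 1 →
    π (P.extA i) =
      esym (Fin.cons (nuInv (l - 1) 0) (fun j : Fin (2 * (l - 1)) => nuInv (l - 1) j.succ) :
        Fin (2 * (l - 1) + 1) → SpecAlgInv (l - 1)) i

/-! ### The weights `d_i`, for `i.succ = 1, …, 2r` -/

/-- The weights for `Sp(2k)`. -/
noncomputable def weightSp (k : ℕ) (i : Fin (2 * k)) : SpecFrac k :=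
  ratio (P.q ^ 4)⁻¹ (nuF k i.succ) (nuF k i.rev.succ) *
    prodRatio P.q (fun j => nuF k j.succ) i

/-- The weights for `O^+(2ℓ)`. -/
noncomputable def weightOPlus (l : ℕ) (i : Fin (2 * l)) : SpecFracInv l :=
  prodRatio P.q (fun j => nuFInv l j.succ) i

/-- The weights for `O^-(2r+2)`. -/
noncomputable def weightOMinus (r : ℕ) (i : Fin (2 * r)) : SpecFracInv r :=
  ratio (P.q ^ 4)⁻¹ (nuFInv r i.succ) (nuFInv r i.rev.succ) *
    prodRatio P.q (fun j => nuFInv r j.succ) i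

/-- The weights for `O^•(2r+1)`. -/
noncomputable def weightOOdd (r : ℕ) (i : Fin (2 * r)) : SpecFracInv r :=
  ratio (P.q ^ 2)⁻¹ (nuFInv r i.succ) (nuFInv r 0) *
    prodRatio P.q (fun j => nuFInv r j.succ) i

end Datum

end QMA

set_option linter.unusedSectionVars false

/-! The characteristic map is a multiplicative trace. Conjugation by `F_1 ⋯ F_k` moves an operator
one tensor factor to the right. By the twist relations it sends `R_j` to `R_{j+1}` (`sh_site`),
sends each matrix copy to the next (`sh_copy`), and commutes with the partial R-trace (`ptr_sh`).
Since `D ⊗ D` commutes with `R` (`sqOp_commute`) and the braid operators commute with the product of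
copies (`braidAlg_commute_copies`), the map `ch` satisfies `ch(xy) = ch(yx)` (`ch_mul_comm`) and is
multiplicative on operators in complementary factors (`ch_mul`). Composed with a homomorphism to a
commutative algebra it becomes a `TraceTower`, and from there on only the Birman-Murakami-Wenzl
relations and these trace properties are used.

Hooks link power sums to elementary functions. Let `U_{i,n}` be the trace of `a^{(i)}` with a cycle
through the remaining strands attached. Thus `U_{1,n} = p_n` and `U_{n,n} = a_n`. Expanding `σ⁻`
inside `a^{(i+1)}` gives `U_{i+1,n}` from `a_i p_{n-i}`, `U_{i,n}` and a contracted hook `W_{i,n}`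
(`U_succ`). In `W_{i+1,n}` the contracted pair can be carried off at the price of a factor `g`,
which leaves hooks on two strands fewer (`W_succ`). With `P = ∑_{n≥1} p_n X^n` and `t = g X²` these
are linear recursions for generating functions. They stop at the height, where the next
antisymmetrizer vanishes. Eliminating the hooks (`elimination`) leaves one linear relation between
`P` and the sums formed from `a_0, …, a_k` (`TraceTower.relation`).

If `a_i = e_i(x)` with variables paired by `x_i x_{σ i} = g`, the symmetry between `e_j` and
`e_{m-j}` simplifies this relation, with `λ = q - q⁻¹`, to `((1 - t)(P + λ⁻¹) - μ t) ∏ (1 - q x_i X)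
= λ⁻¹ (1 - q² t) ∏ (1 - q⁻¹ x_i X)` (`relation_orthogonal`, `relation_symplectic`). Cancelling the
factors of `±ν_0` leaves a quadratic numerator in place of `1 - q² t`, and everything is read off
from this.

For `s_n`: if `H = B / ∏ (1 - ν_i X)` with a suitable polynomial `B`, then `H(X/q)((1 - t)(P + λ⁻¹)
- μ t) = λ⁻¹ (1 - q⁻² t) H(qX)` (`newton_series`). Its coefficients are the Newton recursion, which
determines `s_n` because `m_q ≠ 0`. For `p_n`: `P` is a rational function with possible simple poles
at `1/(q ν_i)` and `±1/ν_0`, and the weights `d_i` are its residues up to normalization; this is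
proved as a polynomial interpolation identity (`weight_identity`). For polynomiality: the relation
can be solved for `P` over `E_{2r}`, because `(1 - t) ∏ (1 - q ν_i X)` has constant coefficient one.

Division is legitimate because `E_{2r}` embeds in a Laurent polynomial ring by `ν_0 ↦ u`, `ν_i ↦ u
v_i / v_{2r+1-i}` (`specHom_injective`): it is a domain in which distinct variables are not
proportional over the scalars. For `O^•(2ℓ-1)` only the image of `g^{1/2}` is prescribed. That `g`
goes to `ν_0²` follows from `a_k² = g^k`, which holds because the last antisymmetrizer has rank one
(`al_sq`): nested contractors identify antisymmetrization at their two ends. -/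

namespace QMA

/-! ### Local operators on tensor powers -/

section Loc

variable {N m n k : ℕ} {A : Type} [Ring A] [Algebra ℂ A]

open Classical in
/-- The operator `X` on `V^{⊗ m}` acting in the tensor factors `f 0, …, f (m - 1)` of
`V^{⊗ n}`. -/
noncomputable def loc (f : Fin m → Fin n) (X : Op N m A) : Op N n A :=
  Matrix.of fun i j => if ∀ t, t ∉ Set.range f → i t = j t then X (i ∘ f) (j ∘ f) else 0

open Classical in
theorem loc_apply (f : Fin m → Fin n) (X : Op N m A) (i j : Fin n → Fin N) :
    loc f X i j = if ∀ t, t ∉ Set.range f → i t = j t then X (i ∘ f) (j ∘ f) else 0 := rfl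

theorem extend_agree_iff (f : Fin m → Fin n) (p : Fin m → Fin N)
    (i j : Fin n → Fin N) :
    (∀ t, t ∉ Set.range f → Function.extend f p i t = j t) ↔ ∀ t, t ∉ Set.range f → i t = j t := by
  refine forall₂_congr fun t ht => ?_
  rw [Function.extend_apply' _ _ _ (by simpa using ht)]

theorem extend_comp_eq {f : Fin m → Fin n} (hf : f.Injective) (p : Fin m → Fin N)
    (i : Fin n → Fin N) : Function.extend f p i ∘ f = p := by
  funext s; simp [hf.extend_apply]

theorem extend_of_agree {f : Fin m → Fin n} (hf : f.Injective) {i l : Fin n → Fin N}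
    (h : ∀ t, t ∉ Set.range f → i t = l t) : Function.extend f (l ∘ f) i = l := by
  funext t
  by_cases ht : t ∈ Set.range f
  · obtain ⟨s, rfl⟩ := ht
    simp [hf.extend_apply]
  · rw [Function.extend_apply' _ _ _ (by simpa using ht), h t ht]

/-- The indices agreeing with `i` off the range of `f` are exactly the extensions of local indices.
Every product with a local operator reduces to this reindexing. -/
theorem sum_agree {M : Type} [AddCommMonoid M] {f : Fin m → Fin n} (hf : f.Injective)
    (i : Fin n → Fin N) (G : (Fin n → Fin N) → M) (p : (Fin n → Fin N) → Prop) [DecidablePred p]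
    (hp : ∀ l, p l ↔ ∀ t, t ∉ Set.range f → i t = l t) :
    ∑ l, (if p l then G l else 0) = ∑ p : Fin m → Fin N, G (Function.extend f p i) := by
  rw [← Finset.sum_filter]
  refine Finset.sum_bij' (fun l _ => l ∘ f) (fun p _ => Function.extend f p i) ?_ ?_ ?_ ?_ ?_
  · simp
  · intro p _
    simp only [Finset.mem_filter, Finset.mem_univ, true_and, hp]
    intro t ht
    rw [Function.extend_apply' _ _ _ (by simpa using ht)]
  · intro l hl
    simp only [Finset.mem_filter, Finset.mem_univ, true_and, hp] at hl
    exact extend_of_agree hf hl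
  · intro p _
    exact extend_comp_eq hf p i
  · intro l hl
    simp only [Finset.mem_filter, Finset.mem_univ, true_and, hp] at hl
    rw [extend_of_agree hf hl]

theorem loc_mul_apply {f : Fin m → Fin n} (hf : f.Injective) (X : Op N m A) (B : Op N n A)
    (i j : Fin n → Fin N) :
    (loc f X * B) i j = ∑ p : Fin m → Fin N, X (i ∘ f) p * B (Function.extend f p i) j := by
  classical
  rw [Matrix.mul_apply]
  simp only [loc_apply, ite_mul, zero_mul]
  rw [sum_agree hf i (fun l => X (i ∘ f) (l ∘ f) * B l j) _ fun l => Iff.rfl]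
  simp only [extend_comp_eq hf]

theorem mul_loc_apply {f : Fin m → Fin n} (hf : f.Injective) (X : Op N m A) (B : Op N n A)
    (i j : Fin n → Fin N) :
    (B * loc f X) i j = ∑ p : Fin m → Fin N, B i (Function.extend f p j) * X p (j ∘ f) := by
  classical
  rw [Matrix.mul_apply]
  have : ∀ l : Fin n → Fin N, (∀ t, t ∉ Set.range f → l t = j t) ↔
      (∀ t, t ∉ Set.range f → j t = l t) := fun l => forall₂_congr fun t _ => eq_comm
  simp only [loc_apply, mul_ite, mul_zero]
  rw [sum_agree hf j (fun l => B i l * X (l ∘ f) (j ∘ f)) _ this]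
  simp only [extend_comp_eq hf]

theorem loc_one {f : Fin m → Fin n} (hf : f.Injective) : loc f (1 : Op N m A) = 1 := by
  classical
  ext i j
  rw [loc_apply, Matrix.one_apply, Matrix.one_apply]
  by_cases h : i = j
  · simp [h]
  · rw [if_neg h]
    split_ifs with h1 h2
    · refine absurd ?_ h
      rw [← extend_of_agree hf h1, ← h2, extend_of_agree hf (fun _ _ => rfl)]
    · rfl
    · rfl

theorem loc_mul {f : Fin m → Fin n} (hf : f.Injective) (X Y : Op N m A) :
    loc f (X * Y) = loc f X * loc f Y := by
  classical
  ext i j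
  rw [loc_mul_apply hf]
  simp only [loc_apply, extend_agree_iff f, extend_comp_eq hf]
  split_ifs
  · rw [Matrix.mul_apply]
  · simp

/-- `loc f` as an algebra homomorphism. -/
noncomputable def locHom {f : Fin m → Fin n} (hf : f.Injective) : Op N m A →ₐ[ℂ] Op N n A :=
  AlgHom.ofLinearMap
    { toFun := loc f
      map_add' := fun X Y => by
        classical
        ext i j; simp only [loc_apply, Matrix.add_apply]; split_ifs <;> simp
      map_smul' := fun c X => by
        classical
        ext i j; simp only [loc_apply, Matrix.smul_apply, RingHom.id_apply]; split_ifs <;> simp }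
    (loc_one hf) (loc_mul hf)

@[simp] theorem locHom_apply {f : Fin m → Fin n} (hf : f.Injective) (X : Op N m A) :
    locHom hf X = loc f X := rfl

theorem loc_loc {f : Fin m → Fin n} {g : Fin n → Fin k} (hg : g.Injective) (X : Op N m A) :
    loc g (loc f X) = loc (g ∘ f) X := by
  classical
  ext i j
  simp only [loc_apply]
  by_cases h : ∀ t, t ∉ Set.range (g ∘ f) → i t = j t
  · rw [if_pos h, if_pos, if_pos]
    · rfl
    · intro s hs
      refine h _ fun ⟨u, hu⟩ => hs ⟨u, hg hu⟩
    · intro t ht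
      exact h t fun ⟨u, hu⟩ => ht ⟨f u, hu⟩
  · rw [if_neg h]
    split_ifs with h1 h2
    · refine absurd (fun t ht => ?_) h
      by_cases h3 : t ∈ Set.range g
      · obtain ⟨s, rfl⟩ := h3
        exact h2 s fun ⟨u, hu⟩ => ht ⟨u, by simp [hu]⟩
      · exact h1 t h3
    · rfl
    · rfl

theorem loc_id (X : Op N n A) : loc id X = X := by
  classical
  ext i j
  simp [loc_apply]

-- In disjoint positions no index is really summed: the sum over the positions of `f` is collapsed
-- by the Kronecker deltas of `loc g Y`.
open Classical in
theorem loc_mul_loc_apply {f : Fin m → Fin n} {g : Fin k → Fin n} (hf : f.Injective)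
    (hfg : ∀ s t, f s ≠ g t) (X : Op N m A) (Y : Op N k A) (i j : Fin n → Fin N) :
    (loc f X * loc g Y) i j =
      if ∀ t, t ∉ Set.range f → t ∉ Set.range g → i t = j t then
        X (i ∘ f) (j ∘ f) * Y (i ∘ g) (j ∘ g) else 0 := by
  rw [loc_mul_apply hf]
  have hg : ∀ p : Fin m → Fin N, Function.extend f p i ∘ g = i ∘ g := by
    intro p; funext s
    rw [Function.comp_apply, Function.extend_apply' _ _ _ (by simpa using fun x => hfg x s)]
    rfl
  have hc : ∀ p : Fin m → Fin N, (∀ t, t ∉ Set.range g → Function.extend f p i t = j t) ↔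
      (p = j ∘ f ∧ ∀ t, t ∉ Set.range f → t ∉ Set.range g → i t = j t) := by
    intro p
    constructor
    · intro h
      refine ⟨?_, fun t h1 h2 => ?_⟩
      · funext s
        have := h (f s) (fun ⟨u, hu⟩ => hfg _ _ hu.symm)
        rwa [hf.extend_apply] at this
      · have := h t h2
        rwa [Function.extend_apply' _ _ _ (by simpa using h1)] at this
    · rintro ⟨rfl, h⟩ t ht
      by_cases h1 : t ∈ Set.range f
      · obtain ⟨s, rfl⟩ := h1
        simp [hf.extend_apply]
      · rw [Function.extend_apply' _ _ _ (by simpa using h1)]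
        exact h t h1 ht
  simp only [loc_apply, hg, hc]
  split_ifs with h
  · rw [Finset.sum_eq_single (j ∘ f)]
    · rw [if_pos ⟨rfl, h⟩]
    · intro p _ hp
      rw [if_neg (fun h => hp h.1), mul_zero]
    · simp
  · refine Finset.sum_eq_zero fun p _ => ?_
    rw [if_neg (fun h' => h h'.2), mul_zero]

/-- Disjoint positions do not suffice over a noncommutative algebra, so the entries must commute as
well. In the applications at least one of the operators is numerical. -/
theorem loc_commute {f : Fin m → Fin n} {g : Fin k → Fin n} (hf : f.Injective) (hg : g.Injective)
    (hfg : ∀ s t, f s ≠ g t) {X : Op N m A} {Y : Op N k A}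
    (hXY : ∀ a b c d, Commute (X a b) (Y c d)) : Commute (loc f X) (loc g Y) := by
  classical
  ext i j
  rw [loc_mul_loc_apply hf hfg, loc_mul_loc_apply hg fun s t => (hfg t s).symm]
  have : (∀ t, t ∉ Set.range f → t ∉ Set.range g → i t = j t) ↔
      (∀ t, t ∉ Set.range g → t ∉ Set.range f → i t = j t) :=
    forall_congr' fun t => ⟨fun h a b => h b a, fun h a b => h b a⟩
  simp only [this, (hXY _ _ _ _).eq]

theorem toAlg_loc (f : Fin m → Fin n) (X : Op N m ℂ) : toAlg A (loc f X) = loc f (toAlg A X) := by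
  classical
  ext i j
  simp only [toAlg, Matrix.map_apply, loc_apply]
  split_ifs <;> simp

/-- `toAlg` as an algebra homomorphism. -/
noncomputable def toAlgHom (N n : ℕ) (A : Type) [Ring A] [Algebra ℂ A] : Op N n ℂ →ₐ[ℂ] Op N n A :=
  AlgHom.mapMatrix (Algebra.ofId ℂ A)

@[simp] theorem toAlgHom_apply (X : Op N n ℂ) : toAlgHom N n A X = toAlg A X := rfl

@[simp] theorem toAlg_self (X : Op N n ℂ) : toAlg ℂ X = X := rfl

@[simp] theorem toAlg_one : toAlg A (1 : Op N n ℂ) = 1 := map_one (toAlgHom N n A)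

@[simp] theorem toAlg_mul (X Y : Op N n ℂ) : toAlg A (X * Y) = toAlg A X * toAlg A Y :=
  map_mul (toAlgHom N n A) X Y

/-- An operator on `V ⊗ V` as an operator on `V^{⊗ 2}`. -/
def pairOp (X : Op2 N) : Op N 2 ℂ := Matrix.of fun i j => X (i 0, i 1) (j 0, j 1)

/-- The pair of neighbouring positions `m`, `m + 1`. -/
def nbr (n m : ℕ) (h : m + 1 < n) : Fin 2 → Fin n := ![⟨m, by omega⟩, ⟨m + 1, h⟩]

theorem nbr_injective (n m : ℕ) (h : m + 1 < n) : (nbr n m h).Injective := by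
  intro a b hab
  fin_cases a <;> fin_cases b <;> simp_all [nbr, Fin.ext_iff]

theorem mem_range_nbr {n m : ℕ} {h : m + 1 < n} {t : Fin n} :
    t ∈ Set.range (nbr n m h) ↔ t.val = m ∨ t.val = m + 1 := by
  simp only [nbr, Matrix.range_cons, Matrix.range_empty, Fin.ext_iff, Set.union_empty,
    Set.singleton_union, Set.mem_insert_iff, Set.mem_singleton_iff]

theorem site_eq_loc (X : Op2 N) {n m : ℕ} (h : m + 1 < n) :
    site X n m = loc (nbr n m h) (pairOp X) := by
  classical
  ext i j
  simp only [site, dif_pos h, Matrix.of_apply, loc_apply, mem_range_nbr, not_or, and_imp]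
  rfl

theorem pairOp_mul (X Y : Op2 N) : pairOp (X * Y) = pairOp X * pairOp Y := by
  ext i j
  simp only [pairOp, Matrix.of_apply, Matrix.mul_apply]
  exact (Fintype.sum_equiv (finTwoArrowEquiv (Fin N)) _ _ (fun p => rfl)).symm

theorem pairOp_one : pairOp (1 : Op2 N) = 1 := by
  ext i j
  simp only [pairOp, Matrix.of_apply, Matrix.one_apply]
  congr 1
  simp [funext_iff, Fin.forall_fin_two]

/-- `pairOp` as an algebra homomorphism. -/
def pairHom (N : ℕ) : Op2 N →ₐ[ℂ] Op N 2 ℂ :=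
  AlgHom.ofLinearMap
    { toFun := pairOp
      map_add' := fun _ _ => rfl
      map_smul' := fun _ _ => rfl } pairOp_one pairOp_mul

/-- `X ↦ site X n m` as an algebra homomorphism. -/
noncomputable def siteHom (N : ℕ) {n m : ℕ} (h : m + 1 < n) : Op2 N →ₐ[ℂ] Op N n ℂ :=
  (locHom (nbr_injective n m h)).comp (pairHom N)

theorem siteHom_apply {n m : ℕ} (h : m + 1 < n) (X : Op2 N) : siteHom N h X = site X n m :=
  (site_eq_loc X h).symm

/-- Relations given on three tensor factors, and operators given on few, reach every tensor power
through this. -/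
theorem loc_site (X : Op2 N) {f : Fin n → Fin k} (hf : f.Injective) {i j : ℕ} (hi : i + 1 < n)
    (hj : j + 1 < k) (h0 : (f ⟨i, by omega⟩).val = j) (h1 : (f ⟨i + 1, hi⟩).val = j + 1) :
    loc f (site X n i) = site X k j := by
  rw [site_eq_loc X hi, site_eq_loc X hj, loc_loc hf]
  congr 1
  funext t
  fin_cases t
  · exact Fin.ext h0
  · exact Fin.ext h1

theorem site_commute (X Y : Op2 N) {n i j : ℕ} (h : i + 2 ≤ j) (hj : j + 1 < n) :
    Commute (site X n i) (site Y n j) := by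
  rw [site_eq_loc X (by omega : i + 1 < n), site_eq_loc Y hj]
  refine loc_commute (nbr_injective _ _ _) (nbr_injective _ _ _) ?_ fun _ _ _ _ => Commute.all _ _
  intro s t
  fin_cases s <;> fin_cases t <;> simp [nbr] <;> omega

/-- A matrix over `A` as an operator on `V^{⊗ 1}`. -/
def oneOp (M : Matrix (Fin N) (Fin N) A) : Op N 1 A := Matrix.of fun i j => M (i 0) (j 0)

theorem firstSite_eq_loc (M : Matrix (Fin N) (Fin N) A) (h : 0 < n) :
    firstSite M n = loc (fun _ : Fin 1 => ⟨0, h⟩) (oneOp M) := by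
  classical
  ext i j
  have : ∀ t : Fin n, t ∉ Set.range (fun _ : Fin 1 => (⟨0, h⟩ : Fin n)) ↔ t.val ≠ 0 := by
    intro t; simp [Fin.ext_iff, eq_comm]
  simp only [firstSite, dif_pos h, Matrix.of_apply, loc_apply, this]
  rfl

theorem loc_firstSite (M : Matrix (Fin N) (Fin N) A) {f : Fin n → Fin k} (hf : f.Injective)
    (hn : 0 < n) (hf0 : (f ⟨0, hn⟩).val = 0) : loc f (firstSite M n) = firstSite M k := by
  have hk : 0 < k := lt_of_le_of_lt (Nat.zero_le _) (f ⟨0, hn⟩).isLt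
  rw [firstSite_eq_loc M hn, firstSite_eq_loc M hk, loc_loc hf]
  congr 1
  funext t
  exact Fin.ext hf0

theorem firstSite_commute (M : Matrix (Fin N) (Fin N) A) (Y : Op2 N) {j : ℕ} (h : 1 ≤ j)
    (hj : j + 1 < n) : Commute (toAlg A (site Y n j)) (firstSite M n) := by
  rw [site_eq_loc Y hj, toAlg_loc, firstSite_eq_loc M (by omega)]
  refine loc_commute (nbr_injective _ _ _) (Function.injective_of_subsingleton _) ?_
    fun a b _ _ => Algebra.commutes _ _
  intro s t
  fin_cases s <;> simp [nbr, Fin.ext_iff]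
  omega

end Loc

end QMA

namespace QMA

/-! ### Partial traces weighted by a matrix -/

section PartialTrace

variable {N m n k : ℕ} {A : Type} [Ring A] [Algebra ℂ A]

/-- The operator `X ⊗ 1`. -/
noncomputable def emb (X : Op N k A) : Op N (k + 1) A := loc Fin.castSucc X

/-- `emb` as an algebra homomorphism. -/
noncomputable def embHom (N k : ℕ) (A : Type) [Ring A] [Algebra ℂ A] :
    Op N k A →ₐ[ℂ] Op N (k + 1) A := locHom (Fin.castSucc_injective k)

@[simp] theorem embHom_apply (X : Op N k A) : embHom N k A X = emb X := rfl

theorem emb_mul (X Y : Op N k A) : emb (X * Y) = emb X * emb Y := map_mul (embHom N k A) X Y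

theorem emb_one : emb (1 : Op N k A) = 1 := map_one (embHom N k A)

theorem toAlg_emb (X : Op N k ℂ) : toAlg A (emb X) = emb (toAlg A X) := toAlg_loc _ _

theorem not_mem_range_castSucc {t : Fin (k + 1)} :
    t ∉ Set.range (Fin.castSucc : Fin k → Fin (k + 1)) ↔ t = Fin.last k := by
  constructor
  · intro h
    by_contra h2
    exact h ⟨t.castPred h2, Fin.castSucc_castPred t h2⟩
  · rintro rfl ⟨s, hs⟩
    exact absurd hs (Fin.castSucc_lt_last s).ne

theorem snoc_comp_castSucc (i : Fin k → Fin N) (a : Fin N) :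
    (Fin.snoc i a : Fin (k + 1) → Fin N) ∘ Fin.castSucc = i := by
  funext t; simp

theorem extend_castSucc_snoc (i p : Fin k → Fin N) (a : Fin N) :
    Function.extend Fin.castSucc p (Fin.snoc i a : Fin (k + 1) → Fin N) = Fin.snoc p a := by
  have h : ∀ t, t ∉ Set.range (Fin.castSucc : Fin k → Fin (k + 1)) →
      (Fin.snoc i a : Fin (k + 1) → Fin N) t = (Fin.snoc p a : Fin (k + 1) → Fin N) t := by
    intro t ht
    rw [not_mem_range_castSucc] at ht
    subst ht; simp
  have := extend_of_agree (Fin.castSucc_injective k) h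
  rwa [snoc_comp_castSucc] at this

theorem emb_snoc (X : Op N k A) (i j : Fin k → Fin N) (a b : Fin N) :
    emb X (Fin.snoc i a) (Fin.snoc j b) = if a = b then X i j else 0 := by
  classical
  simp only [emb, loc_apply, not_mem_range_castSucc, forall_eq, Fin.snoc_last, snoc_comp_castSucc]

theorem emb_mul_snoc (X : Op N k A) (B : Op N (k + 1) A) (i : Fin k → Fin N) (a : Fin N)
    (j : Fin (k + 1) → Fin N) :
    (emb X * B) (Fin.snoc i a) j = ∑ p, X i p * B (Fin.snoc p a) j := by
  rw [emb, loc_mul_apply (Fin.castSucc_injective k)]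
  simp only [snoc_comp_castSucc, extend_castSucc_snoc]

theorem mul_emb_snoc (X : Op N k A) (B : Op N (k + 1) A) (j : Fin k → Fin N) (a : Fin N)
    (i : Fin (k + 1) → Fin N) :
    (B * emb X) i (Fin.snoc j a) = ∑ p, B i (Fin.snoc p a) * X p j := by
  rw [emb, mul_loc_apply (Fin.castSucc_injective k)]
  simp only [snoc_comp_castSucc, extend_castSucc_snoc]

/-- The partial trace over the last tensor factor, weighted by `D`. -/
noncomputable def ptr (D : Matrix (Fin N) (Fin N) ℂ) (X : Op N (k + 1) A) : Op N k A :=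
  Matrix.of fun i j => ∑ a, ∑ b, D a b • X (Fin.snoc i b) (Fin.snoc j a)

theorem ptr_apply (D : Matrix (Fin N) (Fin N) ℂ) (X : Op N (k + 1) A) (i j : Fin k → Fin N) :
    ptr D X i j = ∑ a, ∑ b, D a b • X (Fin.snoc i b) (Fin.snoc j a) := rfl

/-- Together with `ptr_mul_emb` this makes the partial trace a bimodule map over the operators that
avoid the last factor. Noncommuting entries do no harm, since the weights are scalars. -/
theorem ptr_emb_mul (D : Matrix (Fin N) (Fin N) ℂ) (X : Op N k A) (Y : Op N (k + 1) A) :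
    ptr D (emb X * Y) = X * ptr D Y := by
  ext i j
  rw [Matrix.mul_apply]
  simp only [ptr_apply, emb_mul_snoc, Finset.smul_sum, Finset.mul_sum, mul_smul_comm]
  rw [Finset.sum_comm_cycle]

theorem ptr_mul_emb (D : Matrix (Fin N) (Fin N) ℂ) (X : Op N k A) (Y : Op N (k + 1) A) :
    ptr D (Y * emb X) = ptr D Y * X := by
  ext i j
  rw [Matrix.mul_apply]
  simp only [ptr_apply, mul_emb_snoc, Finset.smul_sum, Finset.sum_mul, smul_mul_assoc]
  rw [Finset.sum_comm_cycle]

/-- The partial trace as a linear map. -/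
noncomputable def ptrHom (k : ℕ) (A : Type) [Ring A] [Algebra ℂ A]
    (D : Matrix (Fin N) (Fin N) ℂ) : Op N (k + 1) A →ₗ[ℂ] Op N k A where
  toFun := ptr D
  map_add' X Y := by
    ext i j; simp only [ptr_apply, Matrix.add_apply, smul_add, Finset.sum_add_distrib]
  map_smul' c X := by
    ext i j
    simp only [ptr_apply, Matrix.smul_apply, Finset.smul_sum, RingHom.id_apply]
    simp only [smul_comm c]

@[simp] theorem ptrHom_apply (D : Matrix (Fin N) (Fin N) ℂ) (X : Op N (k + 1) A) :
    ptrHom k A D X = ptr D X := rfl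

theorem ptr_one (D : Matrix (Fin N) (Fin N) ℂ) :
    ptr D (1 : Op N (k + 1) A) = D.trace • (1 : Op N k A) := by
  ext i j
  rw [← emb_one]
  simp only [ptr_apply, emb_snoc, smul_ite, smul_zero, Finset.sum_ite_eq',
    Finset.mem_univ, if_true, Matrix.trace, Matrix.diag, Matrix.smul_apply, Finset.sum_smul,
    Finset.sum_ite_eq, Finset.sum_ite_eq']

theorem nbr_last_agree (i : Fin k → Fin N) (a b x y : Fin N) (t : Fin (k + 2))
    (ht : t ∉ Set.range (nbr (k + 2) k (by omega))) :
    (Fin.snoc (Fin.snoc i a : Fin (k + 1) → Fin N) b : Fin (k + 2) → Fin N) t =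
      (Fin.snoc (Fin.snoc i x : Fin (k + 1) → Fin N) y : Fin (k + 2) → Fin N) t := by
  rw [mem_range_nbr, not_or] at ht
  obtain ⟨s, rfl⟩ : ∃ s, Fin.castSucc s = t := by
    refine ⟨t.castPred fun h => ht.2 (by simp [h]), by simp⟩
  obtain ⟨u, rfl⟩ : ∃ u, Fin.castSucc u = s := by
    refine ⟨s.castPred fun h => ht.1 (by simp [h]), by simp⟩
  simp

theorem snoc_snoc_comp_nbr (i : Fin k → Fin N) (p : Fin 2 → Fin N) :
    (Fin.snoc (Fin.snoc i (p 0) : Fin (k + 1) → Fin N) (p 1) : Fin (k + 2) → Fin N) ∘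
      nbr (k + 2) k (by omega) = p := by
  funext t
  have h0 : (⟨k, by omega⟩ : Fin (k + 2)) = Fin.castSucc (Fin.last k) := by ext; simp
  have h1 : (⟨k + 1, by omega⟩ : Fin (k + 2)) = Fin.last (k + 1) := by ext; simp
  fin_cases t
  · change Fin.snoc _ _ (⟨k, by omega⟩ : Fin (k + 2)) = _
    rw [h0]; simp
  · change Fin.snoc _ _ (⟨k + 1, by omega⟩ : Fin (k + 2)) = _
    rw [h1]; simp

theorem site_last_apply (X : Op2 N) (i j : Fin k → Fin N) (a b c d : Fin N) :
    site X (k + 2) k (Fin.snoc (Fin.snoc i a : Fin (k + 1) → Fin N) b)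
      (Fin.snoc (Fin.snoc j c : Fin (k + 1) → Fin N) d) = if i = j then X (a, b) (c, d) else 0 := by
  classical
  rw [site_eq_loc X (by omega : k + 1 < k + 2), loc_apply]
  have h1 := snoc_snoc_comp_nbr i ![a, b]
  have h2 := snoc_snoc_comp_nbr j ![c, d]
  simp only [Matrix.cons_val_zero, Matrix.cons_val_one] at h1 h2
  rw [h1, h2]
  refine if_congr ⟨fun h => ?_, ?_⟩ rfl rfl
  · funext t
    have := h t.castSucc.castSucc (by rw [mem_range_nbr]; simp; omega)
    simpa using this
  · rintro rfl
    exact nbr_last_agree i a b c d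

theorem site_last_mul (X : Op2 N) (B : Op N (k + 2) A) (i : Fin k → Fin N) (a b : Fin N)
    (j : Fin (k + 2) → Fin N) :
    (toAlg A (site X (k + 2) k) * B) (Fin.snoc (Fin.snoc i a : Fin (k + 1) → Fin N) b) j =
      ∑ x, ∑ y, X (a, b) (x, y) • B (Fin.snoc (Fin.snoc i x : Fin (k + 1) → Fin N) y) j := by
  rw [site_eq_loc X (by omega : k + 1 < k + 2), toAlg_loc, loc_mul_apply (nbr_injective _ _ _),
    ← Fintype.sum_prod_type']
  refine Fintype.sum_equiv (finTwoArrowEquiv (Fin N)) _ _ fun p => ?_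
  have h1 := snoc_snoc_comp_nbr i ![a, b]
  simp only [Matrix.cons_val_zero, Matrix.cons_val_one] at h1
  have h2 := extend_of_agree (nbr_injective _ _ _) (nbr_last_agree i a b (p 0) (p 1))
  rw [snoc_snoc_comp_nbr i p] at h2
  rw [h1, h2, Algebra.smul_def]
  rfl

theorem mul_site_last (X : Op2 N) (B : Op N (k + 2) A) (j : Fin k → Fin N) (c d : Fin N)
    (i : Fin (k + 2) → Fin N) :
    (B * toAlg A (site X (k + 2) k)) i (Fin.snoc (Fin.snoc j c : Fin (k + 1) → Fin N) d) =
      ∑ x, ∑ y, X (x, y) (c, d) • B i (Fin.snoc (Fin.snoc j x : Fin (k + 1) → Fin N) y) := by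
  rw [site_eq_loc X (by omega : k + 1 < k + 2), toAlg_loc, mul_loc_apply (nbr_injective _ _ _),
    ← Fintype.sum_prod_type']
  refine Fintype.sum_equiv (finTwoArrowEquiv (Fin N)) _ _ fun p => ?_
  have h1 := snoc_snoc_comp_nbr j ![c, d]
  simp only [Matrix.cons_val_zero, Matrix.cons_val_one] at h1
  have h2 := extend_of_agree (nbr_injective _ _ _) (nbr_last_agree j c d (p 0) (p 1))
  rw [snoc_snoc_comp_nbr j p] at h2
  rw [h1, h2, Algebra.smul_def, Algebra.commutes]
  rfl

/-- The coefficients of the partial trace of a conjugation. -/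
theorem ptr_conj_apply (D : Matrix (Fin N) (Fin N) ℂ) (X Y : Op2 N) (Z : Op N (k + 1) A)
    (i j : Fin k → Fin N) (a c : Fin N) :
    ptr D (toAlg A (site X (k + 2) k) * emb Z * toAlg A (site Y (k + 2) k))
      (Fin.snoc i a) (Fin.snoc j c) =
      ∑ x, ∑ z, (∑ b, ∑ d, ∑ y, D d b * (X (a, b) (x, y) * Y (z, y) (c, d))) •
        Z (Fin.snoc i x) (Fin.snoc j z) := by
  simp only [ptr_apply, mul_site_last, site_last_mul, emb_snoc, smul_ite, smul_zero,
    Finset.sum_ite_eq, Finset.sum_ite_eq', Finset.mem_univ, if_true, Finset.smul_sum,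
    Finset.sum_smul, smul_smul]
  have e : ∀ f : Fin N → Fin N → Fin N → Fin N → Fin N → A,
      ∑ d, ∑ b, ∑ z, ∑ y, ∑ x, f d b z y x = ∑ x, ∑ z, ∑ b, ∑ d, ∑ y, f d b z y x := by
    intro f
    simp only [← Fintype.sum_prod_type']
    exact Fintype.sum_equiv ⟨fun p => ⟨p.2.2.2.2, p.2.2.1, p.2.1, p.1, p.2.2.2.1⟩,
      fun p => ⟨p.2.2.2.1, p.2.2.1, p.2.1, p.2.2.2.2, p.1⟩, fun _ => rfl, fun _ => rfl⟩ _ _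
      fun _ => rfl
  rw [e]
  refine Finset.sum_congr rfl fun x _ => Finset.sum_congr rfl fun z _ =>
    Finset.sum_congr rfl fun b _ => Finset.sum_congr rfl fun d _ =>
    Finset.sum_congr rfl fun y _ => ?_
  congr 1
  ring

/-- `Tr₍₂₎ D₂ X₁₂ Z₁ Y₁₂ = Tr (D Z)` for all `Z`. -/
def IsTraceConj (D : Matrix (Fin N) (Fin N) ℂ) (X Y : Op2 N) : Prop :=
  ∀ a c x z, ∑ b, ∑ d, ∑ y, D d b * (X (a, b) (x, y) * Y (z, y) (c, d)) =
    if a = c then D z x else 0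

theorem exists_snoc (i : Fin (k + 1) → Fin N) : ∃ j a, i = Fin.snoc j a :=
  ⟨Fin.init i, i (Fin.last k), (Fin.snoc_init_self i).symm⟩

/-- The defining identity concerns numerical coefficients only, so it applies to `Z` with entries in
any algebra. -/
theorem IsTraceConj.ptr_conj {D : Matrix (Fin N) (Fin N) ℂ} {X Y : Op2 N} (h : IsTraceConj D X Y)
    (Z : Op N (k + 1) A) :
    ptr D (toAlg A (site X (k + 2) k) * emb Z * toAlg A (site Y (k + 2) k)) = emb (ptr D Z) := by
  ext i j
  obtain ⟨i, a, rfl⟩ := exists_snoc i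
  obtain ⟨j, c, rfl⟩ := exists_snoc j
  rw [ptr_conj_apply, emb_snoc, ptr_apply]
  simp only [h a c]
  split_ifs
  · rw [Finset.sum_comm]
  · simp

end PartialTrace

/-! ### The matrix `D` of a skew invertible R-matrix -/

section Skew

variable {N : ℕ}

theorem site_zero_mul_site_one (X Y : Op2 N) (a b c a' b' c' : Fin N) :
    (site X 3 0 * site Y 3 1) ![a, b, c] ![a', b', c'] =
      ∑ e, X (a, b) (a', e) * Y (e, c) (b', c') := by
  have h3 : ∀ x y z : Fin N, (![x, y, z] : Fin 3 → Fin N) =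
      Fin.snoc (Fin.snoc ![x] y : Fin 2 → Fin N) z := by
    intro x y z; funext t; fin_cases t <;> rfl
  have h := mul_site_last (A := ℂ) Y (site X 3 0) ![a'] b' c' ![a, b, c]
  rw [toAlg_self] at h
  rw [h3 a' b' c', h]
  have h0 : site X 3 0 = emb (site X 2 0) :=
    (loc_site X (Fin.castSucc_injective 2) (by omega) (by omega) rfl rfl).symm
  have h4 : ∀ x y u v : Fin N, site X 2 0 (Fin.snoc ![x] y) (Fin.snoc ![u] v) =
      X (x, y) (u, v) := by
    intro x y u v
    have := site_last_apply (k := 0) X ![] ![] x y u v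
    rw [if_pos rfl] at this
    rw [← this]
    congr 1 <;> (funext t; fin_cases t <;> rfl)
  rw [h0, h3 a b c]
  simp only [emb_snoc, h4, smul_ite, smul_zero, Finset.sum_ite_eq, Finset.mem_univ,
    if_true, smul_eq_mul]
  refine Finset.sum_congr rfl fun e _ => ?_
  simp [mul_comm]

variable {R Ψ : Op2 N}

theorem IsSkewInverse.left (h : IsSkewInverse R Ψ) (a c a' c' : Fin N) :
    ∑ b, ∑ e, R (a, b) (a', e) * Ψ (e, c) (b, c') = if a = c' ∧ c = a' then 1 else 0 := by
  rw [← h.1 a c a' c']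
  simp only [site_zero_mul_site_one]

theorem IsSkewInverse.right (h : IsSkewInverse R Ψ) (a c a' c' : Fin N) :
    ∑ b, ∑ e, Ψ (a, b) (a', e) * R (e, c) (b, c') = if a = c' ∧ c = a' then 1 else 0 := by
  rw [← h.2 a c a' c']
  simp only [site_zero_mul_site_one]

/-- Contraction with `R` is a linear map on two-index tensors, and contraction with `Ψ` undoes it. A
system with coefficients `R` therefore determines its solution. -/
theorem IsSkewInverse.solve (h : IsSkewInverse R Ψ) {W V : Fin N → Fin N → ℂ}
    (hW : ∀ a x, ∑ b, ∑ y, R (a, b) (x, y) * W b y = V a x) (s s' : Fin N) :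
    W s' s = ∑ a, ∑ x, Ψ (s, x) (s', a) * V a x := by
  simp only [← hW, Finset.mul_sum, ← mul_assoc]
  have e : ∀ f : Fin N → Fin N → Fin N → Fin N → ℂ,
      ∑ a, ∑ x, ∑ b, ∑ y, f a x b y = ∑ b, ∑ y, ∑ x, ∑ a, f a x b y := by
    intro f
    simp only [← Fintype.sum_prod_type']
    exact Fintype.sum_equiv ⟨fun p => ⟨p.2.2.1, p.2.2.2, p.2.1, p.1⟩,
      fun p => ⟨p.2.2.2, p.2.2.1, p.1, p.2.1⟩, fun _ => rfl, fun _ => rfl⟩ _ _ fun _ => rfl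
  rw [e]
  simp only [← Finset.sum_mul, h.right, ite_mul, one_mul, zero_mul, ite_and]
  simp

/-- `D = Tr₍₂₎ Ψ`. -/
def trSnd (Ψ : Op2 N) : Matrix (Fin N) (Fin N) ℂ := Matrix.of fun a b => ∑ c, Ψ (a, c) (b, c)

/-- Trace the relation `Tr₍₂₎ R₁₂ Ψ₂₃ = P₁₃` over the third factor. -/
theorem IsSkewInverse.trace_right (h : IsSkewInverse R Ψ) (x y : Fin N) :
    ∑ a, ∑ b, trSnd Ψ a b * R (x, b) (y, a) = if x = y then 1 else 0 := by
  have : ∀ c, ∑ b, ∑ e, R (x, b) (y, e) * Ψ (e, c) (b, c) = if x = c ∧ c = y then 1 else 0 :=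
    fun c => h.left x c y c
  have h2 := Finset.sum_congr (rfl : (Finset.univ : Finset (Fin N)) = _) fun c _ => this c
  simp only [trSnd, Matrix.of_apply, Finset.sum_mul]
  have e : ∀ f : Fin N → Fin N → Fin N → ℂ,
      ∑ a, ∑ b, ∑ c, f a b c = ∑ c, ∑ b, ∑ a, f a b c := by
    intro f
    simp only [← Fintype.sum_prod_type']
    exact Fintype.sum_equiv ⟨fun p => ⟨p.2.2, p.2.1, p.1⟩,
      fun p => ⟨p.2.2, p.2.1, p.1⟩, fun _ => rfl, fun _ => rfl⟩ _ _ fun _ => rfl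
  rw [e]
  simp only [mul_comm (Ψ _ _)]
  rw [h2]
  simp [ite_and]

theorem ptr_site_last {k : ℕ} (h : IsSkewInverse R Ψ) :
    ptr (trSnd Ψ) (site R (k + 2) k) = 1 := by
  ext i j
  obtain ⟨i, a, rfl⟩ := exists_snoc i
  obtain ⟨j, c, rfl⟩ := exists_snoc j
  simp only [ptr_apply, site_last_apply]
  have := emb_snoc (1 : Op N (k) ℂ) i j a c
  rw [emb_one] at this
  rw [this]
  by_cases hij : i = j
  · subst hij
    simp only [if_true, smul_eq_mul, h.trace_right, Matrix.one_apply_eq]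
  · simp [hij]

/-- Testing the invariance on `Z = R₁` is enough: by `IsSkewInverse.solve` the coefficients of the
conjugation can be recovered from their contraction with `R`. -/
theorem isTraceConj_of_conj {X Y : Op2 N} (h : IsSkewInverse R Ψ)
    (hXY : ptr (trSnd Ψ) (site X 3 1 * site R 3 0 * site Y 3 1) = 1) :
    IsTraceConj (trSnd Ψ) X Y := by
  intro a c x z
  have key : ∀ s s', ∑ x, ∑ z, R (s, x) (s', z) *
      (∑ b, ∑ d, ∑ y, trSnd Ψ d b * (X (a, b) (x, y) * Y (z, y) (c, d))) =
        if s = s' then (if a = c then 1 else 0) else 0 := by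
    intro s s'
    have h1 := ptr_conj_apply (A := ℂ) (trSnd Ψ) X Y (site R 2 0) ![s] ![s'] a c
    have h0 : emb (site R 2 0) = site R 3 0 :=
      loc_site R (Fin.castSucc_injective 2) (by omega) (by omega) rfl rfl
    rw [h0] at h1
    simp only [toAlg_self] at h1
    rw [hXY] at h1
    have h4 : ∀ x y u v : Fin N, site R 2 0 (Fin.snoc ![x] y) (Fin.snoc ![u] v) =
        R (x, y) (u, v) := by
      intro x y u v
      have := site_last_apply (k := 0) R ![] ![] x y u v
      rw [if_pos rfl] at this
      rw [← this]
      congr 1 <;> (funext t; fin_cases t <;> rfl)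
    have h5 := emb_snoc (1 : Op N 1 ℂ) ![s] ![s'] a c
    rw [emb_one] at h5
    rw [h5] at h1
    simp only [h4, smul_eq_mul] at h1
    simp only [mul_comm (R _ _)]
    rw [← h1]
    have : (![s] : Fin 1 → Fin N) = ![s'] ↔ s = s' := by simp
    simp only [Matrix.one_apply, this]
    split_ifs <;> rfl
  have := h.solve key z x
  rw [this]
  simp only [mul_ite, mul_one, mul_zero]
  by_cases hac : a = c
  · simp [hac, trSnd]
  · simp [hac]

theorem IsRMatrix.inv_mul_self (h : IsUnit R) : R⁻¹ * R = 1 :=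
  Matrix.nonsing_inv_mul R ((Matrix.isUnit_iff_isUnit_det R).1 h)

theorem IsRMatrix.mul_inv_self (h : IsUnit R) : R * R⁻¹ = 1 :=
  Matrix.mul_nonsing_inv R ((Matrix.isUnit_iff_isUnit_det R).1 h)

theorem site_mul_inv (h : IsUnit R) {n m : ℕ} (hm : m + 1 < n) :
    site R n m * site R⁻¹ n m = 1 := by
  rw [← siteHom_apply hm, ← siteHom_apply hm, ← map_mul, IsRMatrix.mul_inv_self h, map_one]

theorem site_inv_mul (h : IsUnit R) {n m : ℕ} (hm : m + 1 < n) :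
    site R⁻¹ n m * site R n m = 1 := by
  rw [← siteHom_apply hm, ← siteHom_apply hm, ← map_mul, IsRMatrix.inv_mul_self h, map_one]

theorem emb_site {X : Op2 N} {k j : ℕ} (h : j + 1 < k) : emb (site X k j) = site X (k + 1) j :=
  loc_site X (Fin.castSucc_injective k) h (by omega) rfl rfl

/-- The twist relation rewrites `F₂ R₁ F₂⁻¹` as `F₁⁻¹ R₂ F₁`. Here `F₁` passes out of the trace over
the third factor, and the weighted trace of `R₂` is the identity. -/
theorem isTraceConj_right {F : Op2 N} (h : IsSkewInverse R Ψ) (hF : IsUnit F)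
    (ht : site R 3 1 * site F 3 0 * site F 3 1 = site F 3 0 * site F 3 1 * site R 3 0) :
    IsTraceConj (trSnd Ψ) F F⁻¹ := by
  refine isTraceConj_of_conj h ?_
  have h0 := site_inv_mul hF (by omega : 0 + 1 < 3)
  have h1 := site_mul_inv hF (by omega : 1 + 1 < 3)
  have : site F 3 1 * site R 3 0 * site F⁻¹ 3 1 = site F⁻¹ 3 0 * site R 3 1 * site F 3 0 := by
    calc site F 3 1 * site R 3 0 * site F⁻¹ 3 1
        = (site F⁻¹ 3 0 * site F 3 0) * site F 3 1 * site R 3 0 * site F⁻¹ 3 1 := by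
          rw [h0, one_mul]
      _ = site F⁻¹ 3 0 * (site F 3 0 * site F 3 1 * site R 3 0) * site F⁻¹ 3 1 := by
          simp only [mul_assoc]
      _ = site F⁻¹ 3 0 * site R 3 1 * site F 3 0 * (site F 3 1 * site F⁻¹ 3 1) := by
          rw [← ht]; simp only [mul_assoc]
      _ = _ := by rw [h1, mul_one]
  rw [this, ← emb_site (by omega : 0 + 1 < 2), ← emb_site (by omega : 0 + 1 < 2), ptr_mul_emb,
    ptr_emb_mul, ptr_site_last h, mul_one, site_inv_mul hF (by omega)]

theorem isTraceConj_left {F : Op2 N} (h : IsSkewInverse R Ψ) (hF : IsUnit F)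
    (ht : site R 3 0 * site F 3 1 * site F 3 0 = site F 3 1 * site F 3 0 * site R 3 1) :
    IsTraceConj (trSnd Ψ) F⁻¹ F := by
  refine isTraceConj_of_conj h ?_
  have h0 := site_mul_inv hF (by omega : 0 + 1 < 3)
  have h1 := site_inv_mul hF (by omega : 1 + 1 < 3)
  have : site F⁻¹ 3 1 * site R 3 0 * site F 3 1 = site F 3 0 * site R 3 1 * site F⁻¹ 3 0 := by
    calc site F⁻¹ 3 1 * site R 3 0 * site F 3 1
        = site F⁻¹ 3 1 * site R 3 0 * site F 3 1 * (site F 3 0 * site F⁻¹ 3 0) := by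
          rw [h0, mul_one]
      _ = site F⁻¹ 3 1 * (site R 3 0 * site F 3 1 * site F 3 0) * site F⁻¹ 3 0 := by
          simp only [mul_assoc]
      _ = (site F⁻¹ 3 1 * site F 3 1) * (site F 3 0 * site R 3 1 * site F⁻¹ 3 0) := by
          rw [ht]; simp only [mul_assoc]
      _ = _ := by rw [h1, one_mul]
  rw [this, ← emb_site (by omega : 0 + 1 < 2), ← emb_site (by omega : 0 + 1 < 2), ptr_mul_emb,
    ptr_emb_mul, ptr_site_last h, mul_one, site_mul_inv hF (by omega)]

/-- `D ⊗ D`. -/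
def sqOp (D : Matrix (Fin N) (Fin N) ℂ) : Op2 N := Matrix.of fun p q => D p.1 q.1 * D p.2 q.2

/-- The Yang-Baxter equation makes `{R, R}` a compatible pair, so conjugations by `R` and by `R⁻¹`
are both invisible to the partial trace. Solving the two identities by `Ψ` expresses `R⁻¹ D₂` and
`D₂ R⁻¹` through the same `Ψ` and a `D` in the other slot; comparing them shows that `D ⊗ D`
commutes with `R⁻¹`. -/
theorem sqOp_commute (h : IsSkewInverse R Ψ) (hR : IsRMatrix R) :
    Commute (sqOp (trSnd Ψ)) R := by
  have v2 := isTraceConj_right h hR.1 hR.2.symm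
  have v1 := isTraceConj_left h hR.1 hR.2
  set D := trSnd Ψ
  have hα : ∀ z s c s', ∑ d, D d s' * R⁻¹ (z, s) (c, d) = ∑ x, Ψ (s, x) (s', c) * D z x := by
    intro z s c s'
    have := h.solve (W := fun b y => ∑ d, D d b * R⁻¹ (z, y) (c, d))
      (V := fun a x => if a = c then D z x else 0) (fun a x => by
        rw [← v2 a c x z]
        refine Finset.sum_congr rfl fun b _ => ?_
        rw [Finset.sum_comm]
        refine Finset.sum_congr rfl fun d _ => ?_
        rw [Finset.mul_sum]
        exact Finset.sum_congr rfl fun y _ => by ring) s s'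
    rw [this]
    rw [Finset.sum_comm]
    simp
  have hβ : ∀ s a x s', ∑ b, D s b * R⁻¹ (a, b) (x, s') = ∑ z, Ψ (s, a) (s', z) * D z x := by
    intro s a x s'
    have := h.solve (W := fun y d => ∑ b, D d b * R⁻¹ (a, b) (x, y))
      (V := fun z c => if a = c then D z x else 0) (fun z c => by
        rw [← v1 a c x z]
        have e : ∀ f : Fin N → Fin N → Fin N → ℂ,
            ∑ b, ∑ d, ∑ y, f b d y = ∑ y, ∑ d, ∑ b, f b d y := by
          intro f
          simp only [← Fintype.sum_prod_type']
          exact Fintype.sum_equiv ⟨fun p => ⟨p.2.2, p.2.1, p.1⟩,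
            fun p => ⟨p.2.2, p.2.1, p.1⟩, fun _ => rfl, fun _ => rfl⟩ _ _ fun _ => rfl
        rw [e]
        refine Finset.sum_congr rfl fun y _ => Finset.sum_congr rfl fun d _ => ?_
        rw [Finset.mul_sum]
        exact Finset.sum_congr rfl fun b _ => by ring) s s'
    rw [this]
    simp
  have hinv : R⁻¹ * sqOp D = sqOp D * R⁻¹ := by
    ext ⟨z, s⟩ ⟨w, s'⟩
    simp only [Matrix.mul_apply, Fintype.sum_prod_type, sqOp, Matrix.of_apply]
    calc ∑ c, ∑ d, R⁻¹ (z, s) (c, d) * (D c w * D d s')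
        = ∑ c, (∑ d, D d s' * R⁻¹ (z, s) (c, d)) * D c w :=
          Finset.sum_congr rfl fun c _ => by
            rw [Finset.sum_mul]; exact Finset.sum_congr rfl fun d _ => by ring
      _ = ∑ c, ∑ x, Ψ (s, x) (s', c) * D z x * D c w :=
          Finset.sum_congr rfl fun c _ => by rw [hα, Finset.sum_mul]
      _ = ∑ x, D z x * ∑ c, Ψ (s, x) (s', c) * D c w := by
          rw [Finset.sum_comm]
          refine Finset.sum_congr rfl fun x _ => ?_
          rw [Finset.mul_sum]
          exact Finset.sum_congr rfl fun c _ => by ring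
      _ = ∑ x, ∑ b, D z x * D s b * R⁻¹ (x, b) (w, s') := by
          refine Finset.sum_congr rfl fun x _ => ?_
          rw [← hβ, Finset.mul_sum]
          exact Finset.sum_congr rfl fun c _ => by ring
  have hc : Commute R⁻¹ (sqOp D) := hinv
  have h1 := IsRMatrix.mul_inv_self hR.1
  have h2 := IsRMatrix.inv_mul_self hR.1
  change sqOp D * R = R * sqOp D
  calc sqOp D * R = R * (R⁻¹ * sqOp D) * R := by rw [← mul_assoc, h1, one_mul]
    _ = R * sqOp D := by rw [hinv, ← mul_assoc, mul_assoc, h2, mul_one]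

end Skew

end QMA

namespace QMA

namespace Datum

open QMA

variable {N : ℕ} (P : Datum N)

/-! ### Traces and the braid group action -/

section RTrace

variable {n m k : ℕ} {A : Type} [Ring A] [Algebra ℂ A]

theorem sum_snoc {M : Type} [AddCommMonoid M] (G : (Fin (k + 1) → Fin N) → M) :
    ∑ i, G i = ∑ a : Fin N, ∑ i : Fin k → Fin N, G (Fin.snoc i a) := by
  rw [← (Fin.snocEquiv (fun _ => Fin N)).sum_comp, Fintype.sum_prod_type]
  rfl

theorem rTrace_ptr (X : Op N (k + 1) A) : P.rTrace X = P.rTrace (ptr (matD P.R) X) := by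
  simp only [rTrace, ptr_apply, Finset.smul_sum, smul_smul, sum_snoc, Fin.prod_univ_castSucc,
    Fin.snoc_castSucc, Fin.snoc_last]
  rw [Finset.sum_comm]
  refine Finset.sum_congr rfl fun i _ => ?_
  rw [Finset.sum_comm_cycle]

theorem rTrace_add (X Y : Op N n A) : P.rTrace (X + Y) = P.rTrace X + P.rTrace Y := by
  simp only [rTrace, Matrix.add_apply, smul_add, Finset.sum_add_distrib]

theorem rTrace_smul (c : ℂ) (X : Op N n A) : P.rTrace (c • X) = c • P.rTrace X := by
  simp only [rTrace, Matrix.smul_apply, Finset.smul_sum, smul_comm c]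

/-- `D ⊗ ⋯ ⊗ D`. -/
def powOp (D : Matrix (Fin N) (Fin N) ℂ) (n : ℕ) : Op N n ℂ :=
  Matrix.of fun i j => ∏ t, D (i t) (j t)

theorem rTrace_eq_trace (X : Op N n A) :
    P.rTrace X = (toAlg A (powOp (matD P.R) n) * X).trace := by
  simp only [rTrace, Matrix.trace, Matrix.diag, Matrix.mul_apply, toAlg, Matrix.map_apply, powOp,
    Matrix.of_apply, Algebra.smul_def]

/-- Cyclicity fails for general matrices over a noncommutative algebra; here one factor has central
entries. -/
theorem trace_toAlg_mul_comm (x : Op N n ℂ) (Z : Op N n A) :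
    (toAlg A x * Z).trace = (Z * toAlg A x).trace := by
  simp only [Matrix.trace, Matrix.diag, Matrix.mul_apply, toAlg, Matrix.map_apply]
  rw [Finset.sum_comm]
  simp only [Algebra.commutes]

theorem prod_split {M : Type} [CommMonoid M] {f : Fin m → Fin n} (hf : f.Injective) (G : Fin n → M) :
    ∏ t, G t = (∏ s, G (f s)) * ∏ t ∈ (Finset.univ.image f)ᶜ, G t := by
  rw [← Finset.prod_mul_prod_compl (Finset.univ.image f), Finset.prod_image fun a _ b _ h => hf h]

theorem powOp_commute_site {X : Op2 N} {D : Matrix (Fin N) (Fin N) ℂ} (h : Commute (sqOp D) X)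
    {j : ℕ} (hj : j + 1 < n) : Commute (powOp D n) (site X n j) := by
  have h2 : pairOp (sqOp D) * pairOp X = pairOp X * pairOp (sqOp D) := by
    rw [← pairOp_mul, ← pairOp_mul, h.eq]
  have hf := nbr_injective n j hj
  set f := nbr n j hj with hfdef
  have h3 : ∀ a b : Fin 2 → Fin N, pairOp (sqOp D) a b = ∏ s, D (a s) (b s) := by
    intro a b; simp [pairOp, sqOp, Fin.prod_univ_two]
  rw [site_eq_loc X hj]
  ext i l
  rw [loc_mul_apply hf, mul_loc_apply hf]
  have e1 : ∀ p, powOp D n (Function.extend f p i) l =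
      pairOp (sqOp D) p (l ∘ f) * ∏ t ∈ (Finset.univ.image f)ᶜ, D (i t) (l t) := by
    intro p
    rw [powOp, Matrix.of_apply, prod_split hf, h3]
    congr 1
    · simp [hf.extend_apply]
    · refine Finset.prod_congr rfl fun t ht => ?_
      rw [Function.extend_apply' _ _ _ (by simpa using ht)]
  have e2 : ∀ p, powOp D n i (Function.extend f p l) =
      pairOp (sqOp D) (i ∘ f) p * ∏ t ∈ (Finset.univ.image f)ᶜ, D (i t) (l t) := by
    intro p
    rw [powOp, Matrix.of_apply, prod_split hf, h3]
    congr 1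
    · simp [hf.extend_apply]
    · refine Finset.prod_congr rfl fun t ht => ?_
      rw [Function.extend_apply' _ _ _ (by simpa using ht)]
  have h4 := congrFun (congrFun h2 (i ∘ f)) (l ∘ f)
  simp only [Matrix.mul_apply] at h4
  simp only [e1, e2]
  calc _ = (∑ p, pairOp (sqOp D) (i ∘ f) p * pairOp X p (l ∘ f)) *
        ∏ t ∈ (Finset.univ.image f)ᶜ, D (i t) (l t) := by
          rw [Finset.sum_mul]; exact Finset.sum_congr rfl fun _ _ => by ring
    _ = _ := by
          rw [h4, Finset.sum_mul]; exact Finset.sum_congr rfl fun _ _ => by ring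

theorem commute_of_inv {B : Type} [Ring B] {a b z : B} (h1 : a * b = 1) (h2 : b * a = 1)
    (h : Commute a z) : Commute b z := by
  change b * z = z * b
  calc b * z = b * (z * a) * b := by rw [mul_assoc, mul_assoc, h1, mul_one]
    _ = z * b := by rw [← h.eq, ← mul_assoc, h2, one_mul]

variable {P}

/-- What commutes with the operators `R_j` commutes with the image of the braid group algebra. -/
theorem braidAlg_induction (hR : IsUnit P.R) {B : Type} [Ring B] [Algebra ℂ B]
    (φ : Op N n ℂ →ₐ[ℂ] B) {z : B} (h : ∀ j, j + 1 < n → Commute (φ (site P.R n j)) z)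
    {Y : Op N n ℂ} (hY : Y ∈ P.braidAlg n) : Commute (φ Y) z := by
  have hle : P.braidAlg n ≤ (Subalgebra.centralizer ℂ {z}).comap φ := by
    refine Algebra.adjoin_le ?_
    rintro Y ⟨j, hj, rfl | rfl⟩
    · rw [SetLike.mem_coe, Subalgebra.mem_comap, Subalgebra.mem_centralizer_iff]
      rintro _ rfl
      exact (h j hj).eq.symm
    · have h1 := congrArg φ (site_mul_inv hR hj)
      have h2 := congrArg φ (site_inv_mul hR hj)
      rw [map_mul, map_one] at h1 h2
      rw [SetLike.mem_coe, Subalgebra.mem_comap, Subalgebra.mem_centralizer_iff]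
      rintro _ rfl
      exact (commute_of_inv h1 h2 (h j hj)).eq.symm
  have := hle hY
  rw [Subalgebra.mem_comap, Subalgebra.mem_centralizer_iff] at this
  exact (this z rfl).symm

theorem isSkewInverse_skewInv (h : IsStrictSkewInvertible P.R) :
    IsSkewInverse P.R (skewInv P.R) := by
  unfold skewInv
  rw [dif_pos h.1]
  exact h.1.choose_spec

theorem matD_eq : matD P.R = trSnd (skewInv P.R) := rfl

/-- The R-trace is cyclic with respect to numerical operators commuting with `D ⊗ ⋯ ⊗ D`, and the
represented braid algebra consists of such operators. -/
theorem rTrace_mul_comm (hP : IsCompatiblePair P.R P.F) {x : Op N n ℂ} (hx : x ∈ P.braidAlg n)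
    (Z : Op N n A) : P.rTrace (toAlg A x * Z) = P.rTrace (Z * toAlg A x) := by
  have hc : Commute x (powOp (matD P.R) n) :=
    braidAlg_induction hP.rmatrix_left.1 (AlgHom.id ℂ (Op N n ℂ)) (fun j hj =>
      (powOp_commute_site (sqOp_commute (isSkewInverse_skewInv hP.strict_left)
        hP.rmatrix_left) hj).symm) hx
  rw [rTrace_eq_trace, rTrace_eq_trace, ← mul_assoc, ← toAlg_mul, ← hc.eq, toAlg_mul, mul_assoc,
    trace_toAlg_mul_comm, mul_assoc]

end RTrace

/-! ### The shift by conjugation -/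

section Shift

variable {n m k : ℕ} {A : Type} [Ring A] [Algebra ℂ A]

/-- `F_1 ⋯ F_k`. -/
noncomputable def theta (F : Op2 N) : ∀ k, Op N (k + 1) ℂ
  | 0 => 1
  | k + 1 => emb (theta F k) * site F (k + 2) k

/-- `F_k^{-1} ⋯ F_1^{-1}`. -/
noncomputable def thetaInv (F : Op2 N) : ∀ k, Op N (k + 1) ℂ
  | 0 => 1
  | k + 1 => site F⁻¹ (k + 2) k * emb (thetaInv F k)

theorem theta_mul_inv {F : Op2 N} (hF : IsUnit F) : ∀ k, theta F k * thetaInv F k = 1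
  | 0 => mul_one _
  | k + 1 => by
    rw [theta, thetaInv, mul_assoc, ← mul_assoc (site F _ _), site_mul_inv hF (by omega), one_mul,
      ← emb_mul, theta_mul_inv hF k, emb_one]

theorem theta_inv_mul {F : Op2 N} (hF : IsUnit F) : ∀ k, thetaInv F k * theta F k = 1
  | 0 => mul_one _
  | k + 1 => by
    rw [theta, thetaInv, mul_assoc, ← mul_assoc (emb _), ← emb_mul, theta_inv_mul hF k, emb_one,
      one_mul, site_inv_mul hF (by omega)]

/-- The shift of an operator by one tensor factor, by conjugation with `F_1 ⋯ F_k`. -/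
noncomputable def sh (F : Op2 N) (Z : Op N k A) : Op N (k + 1) A :=
  toAlg A (theta F k) * emb Z * toAlg A (thetaInv F k)

theorem sh_one {F : Op2 N} (hF : IsUnit F) : sh F (1 : Op N k A) = 1 := by
  rw [sh, emb_one, mul_one, ← toAlg_mul, theta_mul_inv hF, toAlg_one]

theorem sh_mul {F : Op2 N} (hF : IsUnit F) (X Y : Op N k A) : sh F (X * Y) = sh F X * sh F Y := by
  have : toAlg A (thetaInv F k) * toAlg A (theta F k) = 1 := by
    rw [← toAlg_mul, theta_inv_mul hF, toAlg_one]
  simp only [sh, emb_mul]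
  calc _ = toAlg A (theta F k) * emb X * 1 * emb Y * toAlg A (thetaInv F k) := by
        simp only [mul_assoc, one_mul]
    _ = _ := by rw [← this]; simp only [mul_assoc]

/-- `sh` as an algebra homomorphism. -/
noncomputable def shHom {F : Op2 N} (hF : IsUnit F) (k : ℕ) (A : Type) [Ring A] [Algebra ℂ A] :
    Op N k A →ₐ[ℂ] Op N (k + 1) A :=
  AlgHom.ofLinearMap
    ((LinearMap.mulLeft ℂ (toAlg A (theta F k))).comp
      ((LinearMap.mulRight ℂ (toAlg A (thetaInv F k))).comp (embHom N k A).toLinearMap))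
    (by
      have := sh_one (A := A) (k := k) hF
      simpa [sh, mul_assoc] using this)
    (fun X Y => by
      have := sh_mul (A := A) (k := k) hF X Y
      simpa [sh, mul_assoc] using this)

@[simp] theorem shHom_apply {F : Op2 N} (hF : IsUnit F) (Z : Op N k A) :
    shHom hF k A Z = sh F Z := by
  simp [shHom, sh, mul_assoc]

theorem sh_toAlg (F : Op2 N) (X : Op N k ℂ) : sh F (toAlg A X) = toAlg A (sh F X) := by
  simp only [sh, toAlg_mul, toAlg_emb, toAlg_self]

/-- Of the conjugating factors only the last `F` touches the traced tensor factor, and conjugation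
by it is invisible to the trace. The others pass out and form the shift on one factor fewer. -/
theorem ptr_sh {F : Op2 N} {D : Matrix (Fin N) (Fin N) ℂ} (h : IsTraceConj D F F⁻¹)
    (Z : Op N (k + 1) A) : ptr D (sh F Z) = sh F (ptr D Z) := by
  have : sh F Z = emb (toAlg A (theta F k)) * (toAlg A (site F (k + 2) k) * emb Z *
      toAlg A (site F⁻¹ (k + 2) k)) * emb (toAlg A (thetaInv F k)) := by
    simp only [sh, theta, thetaInv, toAlg_mul, toAlg_emb, mul_assoc]
  rw [this, ptr_mul_emb, ptr_emb_mul, h.ptr_conj, sh]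

/-- Relations on three tensor factors hold in any three consecutive ones. -/
theorem loc_three (X : Op2 N) {L j : ℕ} (h : j + 2 < L) :
    loc (fun t : Fin 3 => (⟨t + j, by omega⟩ : Fin L)) (site X 3 0) = site X L j ∧
    loc (fun t : Fin 3 => (⟨t + j, by omega⟩ : Fin L)) (site X 3 1) = site X L (j + 1) := by
  have hf : Function.Injective (fun t : Fin 3 => (⟨t + j, by omega⟩ : Fin L)) := by
    intro a b hab
    simpa [Fin.ext_iff] using hab
  constructor
  · exact loc_site X hf (by omega) (by omega) (by simp) (by simp; omega)
  · exact loc_site X hf (by omega) (by omega) (by simp; omega) (by simp; omega)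

theorem loc_three_injective {L j : ℕ} (h : j + 2 < L) :
    Function.Injective (fun t : Fin 3 => (⟨t + j, by omega⟩ : Fin L)) := by
  intro a b hab
  simpa [Fin.ext_iff] using hab

theorem twist_site {X Y Z U V W : Op2 N} {L j : ℕ} (h : j + 2 < L)
    (ht : site X 3 1 * site Y 3 0 * site Z 3 1 = site U 3 0 * site V 3 1 * site W 3 0) :
    site X L (j + 1) * site Y L j * site Z L (j + 1) =
      site U L j * site V L (j + 1) * site W L j := by
  have := congrArg (locHom (loc_three_injective h)) ht
  simpa only [map_mul, locHom_apply, (loc_three _ h).1, (loc_three _ h).2] using this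

/-- If `Y` avoids the support of the last `F`, that `F` cancels against its inverse and induction
applies. If `Y` meets the last two factors, the twist relation carries it across the last two `F`,
and the earlier ones commute with the result; the intermediate position reduces to this by one
cancellation. -/
theorem sh_site {F Y : Op2 N} (hF : IsUnit F)
    (ht : site Y 3 1 * site F 3 0 * site F 3 1 = site F 3 0 * site F 3 1 * site Y 3 0) :
    ∀ {k j : ℕ}, j + 1 < k → sh F (site Y k j) = site Y (k + 1) (j + 1)
  | k + 2, j, hj => by
    have hθ : theta F (k + 2) = emb (emb (theta F k)) * (site F (k + 3) k *
        site F (k + 3) (k + 1)) := by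
      rw [theta, theta, emb_mul, emb_site (by omega), mul_assoc]
    rcases Nat.lt_or_ge j k with h | h
    · obtain ⟨k, rfl⟩ : ∃ k', k = k' + 1 := ⟨k - 1, by omega⟩
      have ih := sh_site hF ht (k := k + 2) (j := j) (by omega)
      rw [sh, toAlg_self, toAlg_self] at ih ⊢
      rw [theta, thetaInv, emb_site (by omega)]
      have hc := (site_commute Y F (n := k + 4) (i := j) (j := k + 2) (by omega) (by omega))
      calc _ = emb (theta F (k + 2)) * (site F (k + 4) (k + 2) * site Y (k + 4) j) *
            site F⁻¹ (k + 4) (k + 2) * emb (thetaInv F (k + 2)) := by simp only [mul_assoc]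
        _ = emb (theta F (k + 2)) * site Y (k + 4) j * (site F (k + 4) (k + 2) *
            site F⁻¹ (k + 4) (k + 2)) * emb (thetaInv F (k + 2)) := by
              rw [← hc.eq]; simp only [mul_assoc]
        _ = emb (theta F (k + 2) * emb (site Y (k + 2) j) * thetaInv F (k + 2)) := by
              rw [site_mul_inv hF (by omega), mul_one, emb_mul, emb_mul, emb_site (by omega),
                emb_site (by omega)]
        _ = _ := by rw [ih, emb_site (by omega)]
    · obtain rfl : j = k := by omega
      have h3 := twist_site (L := j + 3) (j := j) (by omega) ht
      have hcomm : Commute (site Y (j + 3) (j + 1)) (emb (emb (theta F j))) := by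
        rw [site_eq_loc Y (by omega : (j + 1) + 1 < j + 3), emb, emb,
          loc_loc (Fin.castSucc_injective _)]
        refine loc_commute (nbr_injective _ _ _) ?_ ?_ fun _ _ _ _ => Commute.all _ _
        · exact (Fin.castSucc_injective _).comp (Fin.castSucc_injective _)
        · intro s t
          have := t.isLt
          fin_cases s <;> simp [nbr, Fin.ext_iff] <;> omega
      rw [sh, toAlg_self, toAlg_self, emb_site (by omega)]
      have h1 : theta F (j + 2) * site Y (j + 3) j =
          site Y (j + 3) (j + 1) * theta F (j + 2) := by
        rw [hθ, mul_assoc, ← h3, mul_assoc (site Y _ _), ← mul_assoc, ← mul_assoc, ← hcomm.eq]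
        simp only [mul_assoc]
      rw [h1, mul_assoc, theta_mul_inv hF, mul_one]

theorem sh_site_inv {F Y : Op2 N} (hF : IsUnit F) (hY : IsUnit Y)
    (ht : site Y 3 1 * site F 3 0 * site F 3 1 = site F 3 0 * site F 3 1 * site Y 3 0)
    {k j : ℕ} (hj : j + 1 < k) : sh F (site Y⁻¹ k j) = site Y⁻¹ (k + 1) (j + 1) := by
  have h1 : sh F (site Y⁻¹ k j) * site Y (k + 1) (j + 1) = 1 := by
    rw [← sh_site hF ht hj, ← sh_mul hF, site_inv_mul hY hj, sh_one hF]
  have h2 := site_mul_inv hY (by omega : (j + 1) + 1 < k + 1)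
  calc _ = sh F (site Y⁻¹ k j) * (site Y (k + 1) (j + 1) * site Y⁻¹ (k + 1) (j + 1)) := by
        rw [h2, mul_one]
    _ = _ := by rw [← mul_assoc, h1, one_mul]

variable (M : Matrix (Fin N) (Fin N) A) {P}

/-- All `F` except the first commute with `M₁` and cancel against their inverses, leaving `F₁ M₁
F₁⁻¹`. -/
theorem sh_firstSite : ∀ {k : ℕ}, IsUnit P.F → 0 < k → sh P.F (firstSite M k) = P.copy M (k + 1) 1
  | 1, hF, _ => by
    have : emb (firstSite M 1) = firstSite M 2 :=
      loc_firstSite M (Fin.castSucc_injective 1) (by omega) rfl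
    simp [sh, theta, thetaInv, this, copy, emb_one]
  | k + 2, hF, _ => by
    have ih := sh_firstSite (k := k + 1) hF (by omega)
    have he : ∀ k, 0 < k → emb (firstSite M k) = firstSite M (k + 1) := fun k hk =>
      loc_firstSite M (Fin.castSucc_injective k) hk rfl
    rw [sh, he _ (by omega)] at ih ⊢
    have hc := firstSite_commute M P.F (n := k + 3) (j := k + 1) (by omega) (by omega)
    have h1 : toAlg A (site P.F (k + 3) (k + 1)) * toAlg A (site P.F⁻¹ (k + 3) (k + 1)) = 1 := by
      rw [← toAlg_mul, site_mul_inv hF (by omega), toAlg_one]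
    rw [theta, thetaInv, toAlg_mul, toAlg_mul]
    calc _ = toAlg A (emb (theta P.F (k + 1))) * (toAlg A (site P.F (k + 3) (k + 1)) *
          firstSite M (k + 3)) * toAlg A (site P.F⁻¹ (k + 3) (k + 1)) *
          toAlg A (emb (thetaInv P.F (k + 1))) := by simp only [mul_assoc]
      _ = toAlg A (emb (theta P.F (k + 1))) * firstSite M (k + 3) *
          (toAlg A (site P.F (k + 3) (k + 1)) * toAlg A (site P.F⁻¹ (k + 3) (k + 1))) *
          toAlg A (emb (thetaInv P.F (k + 1))) := by rw [hc.eq]; simp only [mul_assoc]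
      _ = emb (toAlg A (theta P.F (k + 1)) * firstSite M (k + 2) *
          toAlg A (thetaInv P.F (k + 1))) := by
            rw [h1, mul_one, emb_mul, emb_mul, he _ (by omega), toAlg_emb, toAlg_emb]
      _ = _ := by
            rw [ih]
            simp only [copy, emb_mul, ← toAlg_emb]
            rw [emb_site (by omega), emb_site (by omega), he _ (by omega)]

theorem loc_copy {f : Fin n → Fin k} (hf : f.Injective) (hfv : ∀ t, (f t).val = t.val) :
    ∀ {i : ℕ}, i < n → loc f (P.copy M n i) = P.copy M k i
  | 0, hi => loc_firstSite M hf hi (hfv _)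
  | i + 1, hi => by
    have hnk : i + 1 < k := by
      have := (f ⟨i + 1, hi⟩).isLt
      rwa [hfv] at this
    have h := loc_copy hf hfv (i := i) (by omega)
    rw [copy, copy, loc_mul hf, loc_mul hf, h, ← toAlg_loc, ← toAlg_loc,
      loc_site _ hf hi hnk (hfv _) (hfv _), loc_site _ hf hi hnk (hfv _) (hfv _)]

theorem sh_copy (hP : IsCompatiblePair P.R P.F) {k : ℕ} : ∀ {i : ℕ}, i < k → sh P.F (P.copy M k i) = P.copy M (k + 1) (i + 1)
  | 0, hi => by
    change sh P.F (firstSite M k) = _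
    exact sh_firstSite M hP.rmatrix_right.1 hi
  | i + 1, hi => by
    have hF := hP.rmatrix_right.1
    have ht := hP.rmatrix_right.2.symm
    have ih := sh_copy hP (k := k) (i := i) (by omega)
    rw [copy, sh_mul hF, sh_mul hF, sh_toAlg, sh_toAlg, sh_site hF ht hi,
      sh_site_inv hF hF ht hi, ih, copy]
    rfl

end Shift

end Datum

end QMA

namespace QMA

namespace Datum

variable {N : ℕ} {P : Datum N} {n m k : ℕ} {A : Type} [Ring A] [Algebra ℂ A]

/-! ### Commutation of the matrix copies with the R-matrices -/

section Copies

variable (M : Matrix (Fin N) (Fin N) A)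

theorem toAlg_commute {X Y : Op N n ℂ} (h : Commute X Y) : Commute (toAlg A X) (toAlg A Y) :=
  h.map (toAlgHom N n A)

theorem site_commute' (X Y : Op2 N) {n i j : ℕ} (h : i + 2 ≤ j ∨ j + 2 ≤ i) (hi : i + 1 < n)
    (hj : j + 1 < n) : Commute (site X n i) (site Y n j) := by
  rcases h with h | h
  · exact site_commute X Y h hj
  · exact (site_commute Y X h hi).symm

theorem site_commute_copy_of_lt (X : Op2 N) {j : ℕ} (hj : j + 1 < n) :
    ∀ {i : ℕ}, i + 1 ≤ j → Commute (toAlg A (site X n j)) (P.copy M n i)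
  | 0, h => firstSite_commute M X h hj
  | i + 1, h => by
    have ih := site_commute_copy_of_lt X hj (i := i) (by omega)
    exact ((toAlg_commute (site_commute' X P.F (by omega) hj (by omega))).mul_right ih).mul_right
      (toAlg_commute (site_commute' X P.F⁻¹ (by omega) hj (by omega)))

theorem commute_conj {B : Type} [Ring B] {x y c u v : B} (h1 : x * u = u * y) (huv : u * v = 1)
    (hvu : v * u = 1) (hc : Commute y c) : Commute x (u * c * v) := by
  have h2 : y * v = v * x := by
    calc y * v = v * (u * y) * v := by rw [← mul_assoc, hvu, one_mul]
      _ = v * x := by rw [← h1, mul_assoc, mul_assoc, huv, mul_one]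
  change x * (u * c * v) = u * c * v * x
  calc x * (u * c * v) = (x * u) * c * v := by simp only [mul_assoc]
    _ = u * (y * c) * v := by rw [h1]; simp only [mul_assoc]
    _ = u * c * (y * v) := by rw [hc.eq]; simp only [mul_assoc]
    _ = u * c * v * x := by rw [h2]; simp only [mul_assoc]

/-- The copy of index `j + 2` is the conjugate by `F_{j+1} F_j` of the copy of index `j`. The same
conjugation carries `R_{j+1}`, which commutes with the latter copy, to `R_j`. Beyond that index the
additional `F` commute with `R_j`. -/
theorem site_commute_copy_of_gt (hP : IsCompatiblePair P.R P.F) {j : ℕ} :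
    ∀ {i : ℕ}, j + 2 ≤ i → i < n → Commute (toAlg A (site P.R n j)) (P.copy M n i)
  | i + 1, h, hi => by
    have hF := hP.rmatrix_right.1
    rcases Nat.lt_or_ge (j + 1) i with h1 | h1
    · have ih : Commute (toAlg A (site P.R n j)) (P.copy M n i) :=
        site_commute_copy_of_gt hP (by omega) (by omega)
      exact ((toAlg_commute (site_commute' P.R P.F (n := n) (i := j) (j := i) (by omega)
        (by omega) (by omega))).mul_right ih).mul_right (toAlg_commute
        (site_commute' P.R P.F⁻¹ (n := n) (i := j) (j := i) (by omega) (by omega) (by omega)))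
    · obtain rfl : i = j + 1 := by omega
      have h3 := congrArg (locHom (loc_three_injective (L := n) (j := j) (by omega))) hP.twist_left
      simp only [map_mul, locHom_apply, (loc_three _ (by omega : j + 2 < n)).1,
        (loc_three _ (by omega : j + 2 < n)).2] at h3
      have hu : (site P.F n (j + 1) * site P.F n j) * (site P.F⁻¹ n j * site P.F⁻¹ n (j + 1)) = 1 := by
        rw [mul_assoc, ← mul_assoc (site P.F n j), site_mul_inv hF (by omega), one_mul,
          site_mul_inv hF (by omega)]
      have hv : (site P.F⁻¹ n j * site P.F⁻¹ n (j + 1)) * (site P.F n (j + 1) * site P.F n j) = 1 := by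
        rw [mul_assoc, ← mul_assoc (site P.F⁻¹ n (j + 1)), site_inv_mul hF (by omega), one_mul,
          site_inv_mul hF (by omega)]
      have key := commute_conj (x := toAlg A (site P.R n j)) (y := toAlg A (site P.R n (j + 1)))
        (u := toAlg A (site P.F n (j + 1) * site P.F n j))
        (v := toAlg A (site P.F⁻¹ n j * site P.F⁻¹ n (j + 1))) (c := P.copy M n j)
        (by rw [← toAlg_mul, ← toAlg_mul, ← mul_assoc, h3]) (by rw [← toAlg_mul, hu, toAlg_one])
        (by rw [← toAlg_mul, hv, toAlg_one])
        (site_commute_copy_of_lt M P.R (by omega) le_rfl)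
      have e : P.copy M n (j + 1 + 1) = toAlg A (site P.F n (j + 1) * site P.F n j) *
          P.copy M n j * toAlg A (site P.F⁻¹ n j * site P.F⁻¹ n (j + 1)) := by
        rw [copy, copy, toAlg_mul, toAlg_mul]; simp only [mul_assoc]
      rw [e]; exact key

theorem loc_copies {f : Fin m → Fin k} (hf : f.Injective) (hfv : ∀ t, (f t).val = t.val) (a : ℕ)
    (ha : a ≤ m) : loc f ((List.range a).map (P.copy M m)).prod =
      ((List.range a).map (P.copy M k)).prod := by
  rw [← locHom_apply hf, map_list_prod, List.map_map]
  congr 1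
  refine List.map_congr_left fun i hi => ?_
  exact loc_copy M hf hfv (by simp at hi; omega)

theorem copies_succ_emb (n : ℕ) :
    P.copies M (n + 1) = emb (P.copies M n) * P.copy M (n + 1) n := by
  rw [copies, List.range_succ, List.map_append, List.prod_append]
  simp only [List.map_cons, List.map_nil, List.prod_cons, List.prod_nil, mul_one]
  rw [copies, emb, loc_copies M (Fin.castSucc_injective n) (fun _ => rfl) n le_rfl]

theorem copies_succ_sh (hP : IsCompatiblePair P.R P.F) (n : ℕ) :
    P.copies M (n + 1) = firstSite M (n + 1) * sh P.F (P.copies M n) := by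
  rw [copies, List.range_succ_eq_map, List.map_cons, List.prod_cons, copies,
    ← shHom_apply hP.rmatrix_right.1, map_list_prod, List.map_map, List.map_map]
  congr 2
  refine List.map_congr_left fun i hi => ?_
  simp only [Function.comp_apply, shHom_apply]
  exact (sh_copy M hP (by simpa using hi)).symm

/-- For `j = 0`, split off the last copy, which commutes with `R₀` once there are at least three.
For `j + 1`, split off the first copy: the remaining ones are a shift, and `R_{j+1}` is the shift of
`R_j`. -/
theorem site_commute_copies (hP : IsCompatiblePair P.R P.F)
    (hM : toAlg A (site P.R 2 0) * P.copies M 2 = P.copies M 2 * toAlg A (site P.R 2 0)) :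
    ∀ {n j : ℕ}, j + 1 < n → Commute (toAlg A (site P.R n j)) (P.copies M n)
  | 2, 0, _ => hM
  | n + 3, 0, _ => by
    rw [copies_succ_emb]
    refine Commute.mul_right ?_ (site_commute_copy_of_gt M hP (by omega) (by omega))
    rw [← emb_site (by omega), toAlg_emb]
    exact (site_commute_copies hP hM (n := n + 2) (j := 0) (by omega)).map (embHom N _ A)
  | n + 1, j + 1, h => by
    rw [copies_succ_sh M hP]
    refine (firstSite_commute M P.R (by omega) h).mul_right ?_
    rw [← sh_site hP.rmatrix_right.1 hP.twist_right (by omega), ← sh_toAlg]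
    have := (site_commute_copies hP hM (n := n) (j := j) (by omega)).map
      (shHom hP.rmatrix_right.1 n A)
    simpa only [shHom_apply] using this

theorem braidAlg_commute_copies (hP : IsCompatiblePair P.R P.F)
    (hM : toAlg A (site P.R 2 0) * P.copies M 2 = P.copies M 2 * toAlg A (site P.R 2 0))
    {Y : Op N n ℂ} (hY : Y ∈ P.braidAlg n) : Commute (toAlg A Y) (P.copies M n) :=
  braidAlg_induction hP.rmatrix_left.1 (toAlgHom N n A)
    (fun _ hj => site_commute_copies M hP hM hj) hY

/-- An element of the braid algebra passes through the product of copies and then around the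
R-trace. -/
theorem ch_mul_comm (hP : IsCompatiblePair P.R P.F)
    (hM : toAlg A (site P.R 2 0) * P.copies M 2 = P.copies M 2 * toAlg A (site P.R 2 0))
    {x : Op N n ℂ} (hx : x ∈ P.braidAlg n) (Y : Op N n ℂ) :
    P.ch M n (x * Y) = P.ch M n (Y * x) := by
  rw [ch, ch, toAlg_mul, toAlg_mul, ← mul_assoc, ← (braidAlg_commute_copies M hP hM hx).eq,
    mul_assoc, rTrace_mul_comm hP hx, mul_assoc]

theorem ch_add (X Y : Op N n ℂ) : P.ch M n (X + Y) = P.ch M n X + P.ch M n Y := by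
  have : toAlg A (X + Y) = toAlg A X + toAlg A Y := map_add (toAlgHom N n A) X Y
  rw [ch, this, mul_add, rTrace_add]; rfl

theorem ch_smul (c : ℂ) (X : Op N n ℂ) : P.ch M n (c • X) = c • P.ch M n X := by
  have : toAlg A (c • X) = c • toAlg A X := map_smul (toAlgHom N n A) c X
  rw [ch, this, mul_smul_comm, rTrace_smul]; rfl

end Copies

/-! ### Multiplicativity of characteristic elements -/

/-- `V` is an iterated weighted partial trace of `W`. -/
inductive IterPtr (D : Matrix (Fin N) (Fin N) ℂ) (V : Op N m A) : ∀ k, Op N k A → Prop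
  | refl : IterPtr D V m V
  | step {k : ℕ} (W : Op N (k + 1) A) : IterPtr D V k (ptr D W) → IterPtr D V (k + 1) W

/-- An operator on the first `m` factors leaves each partial trace unchanged, so only the partially
traced operator enters. -/
theorem IterPtr.rTrace_eq {V : Op N m A} {W : Op N k A} (h : IterPtr (matD P.R) V k W) :
    ∃ hmk : m ≤ k, ∀ X : Op N m A, P.rTrace (loc (Fin.castLE hmk) X * W) = P.rTrace (X * V) := by
  induction h with
  | refl => exact ⟨le_rfl, fun X => by
      have : (Fin.castLE le_rfl : Fin m → Fin m) = id := rfl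
      rw [this, loc_id]⟩
  | @step k W _ ih =>
    obtain ⟨hmk, ih⟩ := ih
    refine ⟨by omega, fun X => ?_⟩
    have : loc (Fin.castLE (by omega : m ≤ k + 1)) X = emb (loc (Fin.castLE hmk) X) := by
      rw [emb, loc_loc (Fin.castSucc_injective k)]; rfl
    rw [this, rTrace_ptr, ptr_emb_mul, ih]

theorem IterPtr.sh {F : Op2 N} {D : Matrix (Fin N) (Fin N) ℂ} (h : IsTraceConj D F F⁻¹)
    {V : Op N m A} {W : Op N k A} (hW : IterPtr D V k W) :
    IterPtr D (sh F V) (k + 1) (sh F W) := by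
  induction hW with
  | refl => exact .refl
  | step W _ ih => exact .step _ (by rw [ptr_sh h]; exact ih)

/-- A scalar operator. -/
noncomputable def scal (N n : ℕ) (c : A) : Op N n A := Matrix.diagonal fun _ => c

/-- The entry `c` need not be central, but it commutes with the numerical entries of the conjugating
operator. -/
theorem sh_scal {F : Op2 N} (hF : IsUnit F) (c : A) : sh F (scal N k c) = scal N (k + 1) c := by
  have h1 : emb (scal N k c) = scal N (k + 1) c := by
    classical
    ext i j
    obtain ⟨i, a, rfl⟩ := exists_snoc i
    obtain ⟨j, b, rfl⟩ := exists_snoc j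
    rw [emb_snoc, scal, scal, Matrix.diagonal_apply, Matrix.diagonal_apply]
    have : (Fin.snoc i a : Fin (k + 1) → Fin N) = Fin.snoc j b ↔ a = b ∧ i = j := by
      constructor
      · intro h
        have h2 := congrFun h (Fin.last k)
        have h3 : (Fin.snoc i a : Fin (k + 1) → Fin N) ∘ Fin.castSucc =
          (Fin.snoc j b : Fin (k + 1) → Fin N) ∘ Fin.castSucc := by rw [h]
        rw [snoc_comp_castSucc, snoc_comp_castSucc] at h3
        exact ⟨by simpa using h2, h3⟩
      · rintro ⟨rfl, rfl⟩; rfl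
    simp only [this]
    split_ifs <;> simp_all
  have h2 : toAlg A (theta F k) * scal N (k + 1) c = scal N (k + 1) c * toAlg A (theta F k) := by
    ext i j
    rw [scal, Matrix.mul_diagonal, Matrix.diagonal_mul]
    exact Algebra.commutes _ _
  rw [sh, h1, h2, mul_assoc, ← toAlg_mul, theta_mul_inv hF, toAlg_one, mul_one]

theorem rTrace_mul_scal (X : Op N n A) (c : A) :
    P.rTrace (X * scal N n c) = P.rTrace X * c := by
  simp only [rTrace, scal, Matrix.mul_diagonal, Finset.sum_mul, smul_mul_assoc]

/-- The iterated shift. -/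
noncomputable def shIter (F : Op2 N) (Z : Op N n A) : ∀ m, Op N (n + m) A
  | 0 => Z
  | m + 1 => sh F (shIter F Z m)

/-- The iterated shift as an algebra homomorphism. -/
noncomputable def shIterHom {F : Op2 N} (hF : IsUnit F) (n : ℕ) (A : Type) [Ring A] [Algebra ℂ A] :
    ∀ m, Op N n A →ₐ[ℂ] Op N (n + m) A
  | 0 => AlgHom.id ℂ _
  | m + 1 => (shHom hF (n + m) A).comp (shIterHom hF n A m)

theorem shIterHom_apply {F : Op2 N} (hF : IsUnit F) (Z : Op N n A) :
    ∀ m, shIterHom hF n A m Z = shIter F Z m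
  | 0 => rfl
  | m + 1 => by rw [shIterHom, AlgHom.comp_apply, shIterHom_apply hF Z m, shHom_apply, shIter]

theorem iterPtr_rTrace (Z : Op N n A) : IterPtr (matD P.R) (scal N 0 (P.rTrace Z)) n Z := by
  induction n with
  | zero =>
    have : scal N 0 (P.rTrace Z) = Z := by
      ext i j
      rw [Subsingleton.elim i j, scal, Matrix.diagonal_apply_eq]
      simp only [rTrace, Finset.univ_unique, Finset.sum_singleton, Finset.univ_eq_empty,
        Finset.prod_empty, one_smul]
      congr 1 <;> exact Subsingleton.elim _ _
    rw [this]
    exact .refl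
  | succ n ih =>
    refine .step _ ?_
    rw [rTrace_ptr]
    exact ih _

/-- Partial traces commute with shifts. Tracing the shifted `Z` over the extra `n` factors thus
gives the shift of a scalar operator, that is, the scalar `Tr_R Z` on the first `m` factors. -/
theorem rTrace_loc_mul_shIter (hP : IsCompatiblePair P.R P.F) (X : Op N m A) (Z : Op N n A) :
    P.rTrace (loc (Fin.castLE (Nat.le_add_left m n)) X * shIter P.F Z m) =
      P.rTrace X * P.rTrace Z := by
  have hF := hP.rmatrix_right.1
  have ht : IsTraceConj (matD P.R) P.F P.F⁻¹ :=
    isTraceConj_right (isSkewInverse_skewInv hP.strict_left) hF hP.twist_right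
  have h : ∀ m, IterPtr (matD P.R) (scal N m (P.rTrace Z)) (n + m) (shIter P.F Z m) := by
    intro m
    induction m with
    | zero => exact iterPtr_rTrace Z
    | succ m ih =>
      rw [← sh_scal hF]
      exact ih.sh ht
  obtain ⟨_, h2⟩ := (h m).rTrace_eq
  rw [h2, rTrace_mul_scal]

/-- A numerical operator, moved by `m` tensor factors. -/
noncomputable def shiftOp (m : ℕ) (Y : Op N n ℂ) : Op N (n + m) ℂ := loc (fun t => Fin.addNat t m) Y

theorem addNat_injective (n m : ℕ) : Function.Injective (fun t : Fin n => Fin.addNat t m) := by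
  intro a b h
  simpa [Fin.ext_iff] using h

theorem shiftOp_site (X : Op2 N) {j : ℕ} (m : ℕ) (hj : j + 1 < n) :
    shiftOp m (site X n j) = site X (n + m) (j + m) :=
  loc_site X (addNat_injective n m) hj (by omega) (by simp) (by simp; omega)

theorem castLE_site (X : Op2 N) {j : ℕ} (h : n ≤ k) (hj : j + 1 < n) :
    loc (Fin.castLE h) (site X n j) = site X k j :=
  loc_site X (Fin.castLE_injective h) hj (by omega) rfl rfl

theorem shIter_site (hP : IsCompatiblePair P.R P.F) {j : ℕ} (hj : j + 1 < n) :
    ∀ m, shIter P.F (site P.R n j) m = site P.R (n + m) (j + m)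
  | 0 => rfl
  | m + 1 => by
    rw [shIter, shIter_site hP hj m]
    exact sh_site (k := n + m) (j := j + m) hP.rmatrix_right.1 hP.twist_right (by omega)

theorem shIter_site_inv (hP : IsCompatiblePair P.R P.F) {j : ℕ} (hj : j + 1 < n) :
    ∀ m, shIter P.F (site P.R⁻¹ n j) m = site P.R⁻¹ (n + m) (j + m)
  | 0 => rfl
  | m + 1 => by
    rw [shIter, shIter_site_inv hP hj m]
    exact sh_site_inv (k := n + m) (j := j + m) hP.rmatrix_right.1 hP.rmatrix_left.1 hP.twist_right (by omega)

theorem shIter_toAlg (F : Op2 N) (Z : Op N n ℂ) :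
    ∀ m, shIter F (toAlg A Z) m = toAlg A (shIter F Z m)
  | 0 => rfl
  | m + 1 => by rw [shIter, shIter_toAlg F Z m, sh_toAlg, shIter]

theorem shIter_braidAlg (hP : IsCompatiblePair P.R P.F) {Y : Op N n ℂ} (hY : Y ∈ P.braidAlg n)
    (m : ℕ) : shIter P.F Y m = shiftOp m Y := by
  have hle : P.braidAlg n ≤ AlgHom.equalizer (shIterHom hP.rmatrix_right.1 n ℂ m)
      (locHom (addNat_injective n m)) := by
    refine Algebra.adjoin_le ?_
    rintro Y ⟨j, hj, rfl | rfl⟩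
    · rw [SetLike.mem_coe, AlgHom.mem_equalizer, shIterHom_apply, shIter_site hP hj, locHom_apply]
      exact (shiftOp_site _ m hj).symm
    · rw [SetLike.mem_coe, AlgHom.mem_equalizer, shIterHom_apply, shIter_site_inv hP hj,
        locHom_apply]
      exact (shiftOp_site _ m hj).symm
  have := hle hY
  rwa [AlgHom.mem_equalizer, shIterHom_apply] at this

theorem shIter_copy (M : Matrix (Fin N) (Fin N) A) (hP : IsCompatiblePair P.R P.F) {i : ℕ}
    (hi : i < n) : ∀ m, shIter P.F (P.copy M n i) m = P.copy M (n + m) (m + i)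
  | 0 => by rw [Nat.zero_add]; rfl
  | m + 1 => by
    rw [shIter, shIter_copy M hP hi m, show m + 1 + i = (m + i) + 1 by omega]
    exact sh_copy (k := n + m) M hP (by omega)

theorem shIter_copies (M : Matrix (Fin N) (Fin N) A) (hP : IsCompatiblePair P.R P.F) (n m : ℕ) :
    shIter P.F (P.copies M n) m = ((List.range n).map fun i => P.copy M (n + m) (m + i)).prod := by
  rw [copies, ← shIterHom_apply hP.rmatrix_right.1, map_list_prod, List.map_map]
  congr 1
  refine List.map_congr_left fun i hi => ?_
  simp only [Function.comp_apply, shIterHom_apply]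
  exact shIter_copy M hP (by simpa using hi) m

theorem copies_add (M : Matrix (Fin N) (Fin N) A) (hP : IsCompatiblePair P.R P.F) (n m : ℕ) :
    P.copies M (n + m) =
      loc (Fin.castLE (Nat.le_add_left m n)) (P.copies M m) * shIter P.F (P.copies M n) m := by
  have h : List.range (n + m) = List.range (m + n) := by rw [add_comm]
  rw [shIter_copies M hP, copies, copies, loc_copies (P := P) M (Fin.castLE_injective (Nat.le_add_left m n))
    (fun _ => rfl) m le_rfl, h, List.range_add, List.map_append, List.prod_append, List.map_map]
  rfl

theorem castLE_mem (h : n ≤ k) {X : Op N n ℂ} (hX : X ∈ P.braidAlg n) :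
    loc (Fin.castLE h) X ∈ P.braidAlg k := by
  have hle : P.braidAlg n ≤ (P.braidAlg k).comap (locHom (Fin.castLE_injective h)) := by
    refine Algebra.adjoin_le ?_
    rintro Y ⟨j, hj, rfl | rfl⟩
    · rw [SetLike.mem_coe, Subalgebra.mem_comap, locHom_apply, castLE_site _ h hj]
      exact Algebra.subset_adjoin ⟨j, by omega, Or.inl rfl⟩
    · rw [SetLike.mem_coe, Subalgebra.mem_comap, locHom_apply, castLE_site _ h hj]
      exact Algebra.subset_adjoin ⟨j, by omega, Or.inr rfl⟩
  exact hle hX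

theorem shiftOp_mem (m : ℕ) {X : Op N n ℂ} (hX : X ∈ P.braidAlg n) :
    shiftOp m X ∈ P.braidAlg (n + m) := by
  have hle : P.braidAlg n ≤ (P.braidAlg (n + m)).comap (locHom (addNat_injective n m)) := by
    refine Algebra.adjoin_le ?_
    rintro Y ⟨j, hj, rfl | rfl⟩
    · rw [SetLike.mem_coe, Subalgebra.mem_comap, locHom_apply]
      exact Algebra.subset_adjoin ⟨j + m, by omega, Or.inl (shiftOp_site _ m hj)⟩
    · rw [SetLike.mem_coe, Subalgebra.mem_comap, locHom_apply]
      exact Algebra.subset_adjoin ⟨j + m, by omega, Or.inr (shiftOp_site _ m hj)⟩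
  exact hle hX

/-- Characteristic elements of products of operators in complementary tensor factors. -/
theorem ch_mul (M : Matrix (Fin N) (Fin N) A) (hP : IsCompatiblePair P.R P.F)
    {X : Op N m ℂ} (hX : X ∈ P.braidAlg m) {Y : Op N n ℂ} (hY : Y ∈ P.braidAlg n) :
    P.ch M (n + m) (loc (Fin.castLE (Nat.le_add_left m n)) X * shiftOp m Y) =
      P.ch M m X * P.ch M n Y := by
  have hF := hP.rmatrix_right.1
  -- The generators in the first `m` factors commute with the copies of index at least `m`, so `X`
  -- can be moved to the left and joined with the first `m` copies.
  have hc : Commute (toAlg A (loc (Fin.castLE (Nat.le_add_left m n)) X))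
      (shIter P.F (P.copies M n) m) := by
    refine braidAlg_induction hP.rmatrix_left.1
      ((toAlgHom N (n + m) A).comp (locHom (Fin.castLE_injective (Nat.le_add_left m n))))
      (fun j hj => ?_) hX
    rw [shIter_copies M hP, AlgHom.comp_apply, locHom_apply, castLE_site _ _ hj, toAlgHom_apply]
    refine Commute.list_prod_right _ _ fun z hz => ?_
    obtain ⟨i, hi, rfl⟩ := List.mem_map.1 hz
    exact site_commute_copy_of_gt M hP (by omega) (by simp at hi; omega)
  have h1 : P.copies M (n + m) * toAlg A (loc (Fin.castLE (Nat.le_add_left m n)) X * shiftOp m Y) =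
      loc (Fin.castLE (Nat.le_add_left m n)) (P.copies M m * toAlg A X) *
        shIter P.F (P.copies M n * toAlg A Y) m := by
    have h2 : shIter P.F (P.copies M n * toAlg A Y) m =
        shIter P.F (P.copies M n) m * toAlg A (shiftOp m Y) := by
      rw [← shIterHom_apply hF, map_mul, shIterHom_apply, shIterHom_apply, shIter_toAlg,
        shIter_braidAlg hP hY]
    rw [h2, copies_add M hP, loc_mul (Fin.castLE_injective _), toAlg_mul, ← toAlg_loc, mul_assoc,
      mul_assoc, ← mul_assoc (shIter _ _ _), ← hc.eq, mul_assoc]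
  rw [ch, h1, rTrace_loc_mul_shIter hP]
  rfl

theorem rTrace_one : P.rTrace (1 : Op N n A) = algebraMap ℂ A ((matD P.R).trace ^ n) := by
  induction n with
  | zero => simp [rTrace]
  | succ n ih =>
    rw [rTrace_ptr, ptr_one, rTrace_smul, ih, Algebra.smul_def, ← map_mul, pow_succ']

end Datum

end QMA

namespace QMA

/-! ### Abstract Birman-Murakami-Wenzl families -/

/-- Elements `r i`, `ri i`, `k i` (`i < L`) of an algebra, satisfying the relations of the generators,
their inverses and the contractors of a Birman-Murakami-Wenzl algebra. -/
structure BMWFamily {B : Type} [Ring B] [Algebra ℂ B] (q μ : ℂ) (L : ℕ) (r ri k : ℕ → B) : Prop where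
  q_ne : q ≠ 0
  lam_ne : q - q⁻¹ ≠ 0
  mu_ne : μ ≠ 0
  r_ri : ∀ {i}, i < L → r i * ri i = 1
  ri_r : ∀ {i}, i < L → ri i * r i = 1
  skein : ∀ {i}, i < L → ri i = r i - (q - q⁻¹) • (1 : B) + (q - q⁻¹) • k i
  r_k : ∀ {i}, i < L → r i * k i = μ • k i
  k_r : ∀ {i}, i < L → k i * r i = μ • k i
  braid : ∀ {i j}, i < L → j < L → (i + 1 = j ∨ j + 1 = i) → r i * r j * r i = r j * r i * r j
  k_k_right : ∀ {i j}, i < L → j < L → (i + 1 = j ∨ j + 1 = i) → k i * k j = k i * r j * r i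
  k_k_left : ∀ {i j}, i < L → j < L → (i + 1 = j ∨ j + 1 = i) → k i * k j = r j * r i * k j
  k_k_k : ∀ {i j}, i < L → j < L → (i + 1 = j ∨ j + 1 = i) → k i * k j * k i = k i
  far : ∀ {i j}, i < L → j < L → i + 2 ≤ j → Commute (r i) (r j)

/-- The baxterized element. -/
noncomputable def sigm {B : Type} [Ring B] [Algebra ℂ B] (q μ : ℂ) (r k : ℕ → B) (m : ℕ) (x : ℂ) : B :=
  1 + ((x - 1) / (q - q⁻¹)) • r m + ((x - 1) / (q * μ⁻¹ * x + 1)) • k m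

/-- The antisymmetrizers. -/
noncomputable def asymm {B : Type} [Ring B] [Algebra ℂ B] (q μ : ℂ) (r k : ℕ → B) (s : ℕ) : ℕ → B
  | 0 => 1
  | 1 => 1
  | i + 2 => (q ^ (i + 1) / qnum q (i + 2)) •
      (asymm q μ r k s (i + 1) * sigm q μ r k (s + i) (q ^ (2 * (i + 1)))⁻¹ *
        asymm q μ r k s (i + 1))

namespace BMWFamily

variable {B : Type} [Ring B] [Algebra ℂ B] {q μ : ℂ} {L : ℕ} {r ri k : ℕ → B}

/-- The relations are stable under reversing words, so one-sided statements give their mirror images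
without further computation. -/
theorem op (h : BMWFamily q μ L r ri k) :
    BMWFamily q μ L (fun i => MulOpposite.op (r i)) (fun i => MulOpposite.op (ri i))
      (fun i => MulOpposite.op (k i)) where
  q_ne := h.q_ne
  lam_ne := h.lam_ne
  mu_ne := h.mu_ne
  r_ri hi := by rw [← MulOpposite.op_mul, h.ri_r hi, MulOpposite.op_one]
  ri_r hi := by rw [← MulOpposite.op_mul, h.r_ri hi, MulOpposite.op_one]
  skein hi := by rw [h.skein hi]; simp
  r_k hi := by rw [← MulOpposite.op_mul, h.k_r hi, MulOpposite.op_smul]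
  k_r hi := by rw [← MulOpposite.op_mul, h.r_k hi, MulOpposite.op_smul]
  braid hi hj ha := by simp only [← MulOpposite.op_mul, ← mul_assoc, h.braid hi hj ha]
  k_k_right hi hj ha := by
    simp only [← MulOpposite.op_mul, ← mul_assoc, h.k_k_left hj hi ha.symm]
  k_k_left hi hj ha := by
    simp only [← MulOpposite.op_mul, ← mul_assoc, h.k_k_right hj hi ha.symm]
  k_k_k hi hj ha := by simp only [← MulOpposite.op_mul, ← mul_assoc, h.k_k_k hi hj ha]
  far hi hj ha := (h.far hi hj ha).op

variable (h : BMWFamily q μ L r ri k)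
include h

theorem k_eq {i : ℕ} (hi : i < L) : k i = (q - q⁻¹)⁻¹ • (ri i - r i) + 1 := by
  have h1 : ri i - r i = (q - q⁻¹) • (k i - 1) := by rw [h.skein hi]; module
  rw [h1, smul_smul, inv_mul_cancel₀ h.lam_ne, one_smul, sub_add_cancel]

theorem r_sq {i : ℕ} (hi : i < L) :
    r i * r i = 1 + (q - q⁻¹) • r i - (μ * (q - q⁻¹)) • k i := by
  have h1 := congrArg (r i * ·) (h.skein hi)
  simp only [h.r_ri hi, mul_add, mul_sub, mul_smul_comm, mul_one, h.r_k hi, smul_smul] at h1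
  rw [h1]
  module

/-- In `k i * k j * k i = k i` replace `k i * k j` by `k i * r j * r i`; the last generator acts on
`k i` by `μ`. -/
theorem k_r_k {i j : ℕ} (hi : i < L) (hj : j < L) (ha : i + 1 = j ∨ j + 1 = i) :
    k i * r j * k i = μ⁻¹ • k i := by
  have h1 := h.k_k_k hi hj ha
  rw [h.k_k_right hi hj ha, mul_assoc, h.r_k hi, mul_smul_comm] at h1
  have h2 := congrArg (μ⁻¹ • ·) h1
  simpa [smul_smul, inv_mul_cancel₀ h.mu_ne] using h2

theorem k_k {i : ℕ} (hi : i < L) :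
    k i * k i = ((q - μ) * (q⁻¹ + μ) / (μ * (q - q⁻¹))) • k i := by
  have h1 := congrArg (k i * ·) (h.r_sq hi)
  simp only [← mul_assoc, h.k_r hi, mul_add, mul_sub, mul_smul_comm, smul_mul_assoc, mul_one,
    smul_smul] at h1
  have hm : μ * (q - q⁻¹) ≠ 0 := mul_ne_zero h.mu_ne h.lam_ne
  have h2 : (μ * (q - q⁻¹)) • (k i * k i) =
      (μ * (q - q⁻¹)) • (((q - μ) * (q⁻¹ + μ) / (μ * (q - q⁻¹))) • k i) := by
    have h3 : (μ * (q - q⁻¹)) • (k i * k i) = k i + ((q - q⁻¹) * μ) • k i - (μ * μ) • k i := by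
      rw [h1]; module
    rw [h3, smul_smul, mul_div_cancel₀ _ hm]
    have := h.q_ne
    match_scalars
    field_simp
    ring
  exact smul_right_injective B hm h2

theorem far_k {i j : ℕ} (hi : i < L) (hj : j < L) (ha : i + 2 ≤ j ∨ j + 2 ≤ i) {x : B}
    (hx : x = r i ∨ x = ri i ∨ x = k i) {y : B} (hy : y = r j ∨ y = ri j ∨ y = k j) :
    Commute x y := by
  have h0 : Commute (r i) (r j) := ha.elim (h.far hi hj) fun ha => (h.far hj hi ha).symm
  have key : ∀ z : B, ∀ j, j < L → Commute z (r j) → Commute z (ri j) ∧ Commute z (k j) := by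
    intro z j hj hz
    have h1 : Commute z (ri j) := by
      change z * ri j = ri j * z
      calc z * ri j = ri j * (r j * z) * ri j := by rw [← mul_assoc, h.ri_r hj, one_mul]
        _ = ri j * z := by rw [← hz.eq, mul_assoc, mul_assoc, h.r_ri hj, mul_one]
    refine ⟨h1, ?_⟩
    rw [h.k_eq hj]
    exact ((h1.sub_right hz).smul_right _).add_right (Commute.one_right _)
  have h1 : Commute (r i) y := by
    rcases hy with rfl | rfl | rfl
    exacts [h0, (key _ j hj h0).1, (key _ j hj h0).2]
  rcases hx with rfl | rfl | rfl
  exacts [h1, (key _ i hi h1.symm).1.symm, (key _ i hi h1.symm).2.symm]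

/-- Inverses, contractors, baxterized elements and antisymmetrizers are built from the generators,
so an element carrying `r i` to `r j` carries all of them along. The following lemmas use only this
principle. -/
theorem semiconj_ri {i j : ℕ} (hi : i < L) (hj : j < L) {u : B} (hu : SemiconjBy u (r i) (r j)) :
    SemiconjBy u (ri i) (ri j) := by
  change u * ri i = ri j * u
  calc u * ri i = ri j * (r j * u) * ri i := by rw [← mul_assoc, h.ri_r hj, one_mul]
    _ = ri j * u := by rw [← hu.eq, mul_assoc, mul_assoc, h.r_ri hi, mul_one]

theorem semiconj_k {i j : ℕ} (hi : i < L) (hj : j < L) {u : B} (hu : SemiconjBy u (r i) (r j)) :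
    SemiconjBy u (k i) (k j) := by
  have h1 := h.semiconj_ri hi hj hu
  rw [h.k_eq hi, h.k_eq hj]
  unfold SemiconjBy at *
  rw [mul_add, add_mul, mul_smul_comm, smul_mul_assoc, mul_sub, sub_mul, h1, hu, mul_one, one_mul]

theorem semiconj_sigm {i j : ℕ} (hi : i < L) (hj : j < L) {u : B} (hu : SemiconjBy u (r i) (r j))
    (x : ℂ) : SemiconjBy u (sigm q μ r k i x) (sigm q μ r k j x) := by
  have h1 := h.semiconj_k hi hj hu
  unfold SemiconjBy sigm at *
  simp only [mul_add, add_mul, mul_smul_comm, smul_mul_assoc, mul_one, one_mul, h1, hu]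

theorem semiconj_asymm {s s' : ℕ} {u : B} : ∀ {m : ℕ}, (∀ t, t + 1 < m → s + t < L ∧ s' + t < L ∧
    SemiconjBy u (r (s + t)) (r (s' + t))) →
    SemiconjBy u (asymm q μ r k s m) (asymm q μ r k s' m)
  | 0, _ => by rw [asymm, asymm]; exact SemiconjBy.one_right u
  | 1, _ => by rw [asymm, asymm]; exact SemiconjBy.one_right u
  | m + 2, hu => by
    have ih := semiconj_asymm (m := m + 1) fun t ht => hu t (by omega)
    obtain ⟨h1, h2, h3⟩ := hu m (by omega)
    rw [asymm, asymm]
    have := (ih.mul_right (h.semiconj_sigm h1 h2 h3 (q ^ (2 * (m + 1)))⁻¹)).mul_right ih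
    unfold SemiconjBy at *
    rw [mul_smul_comm, smul_mul_assoc, this]

/-- Antisymmetrizers commute with distant generators. -/
theorem asymm_commute {s m j : ℕ} (hj : j < L) (hm : s + m ≤ L + 1) (ha : s + m ≤ j) {y : B}
    (hy : y = r j ∨ y = ri j ∨ y = k j) : Commute (asymm q μ r k s m) y := by
  refine Commute.symm (h.semiconj_asymm fun t ht => ⟨by omega, by omega, ?_⟩)
  exact h.far_k hj (by omega) (Or.inr (by omega)) hy (Or.inl rfl)

/-- Since `-q⁻¹` is a root of `x² = 1 + (q - q⁻¹) x`, the quadratic relation for `r i` applied to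
`a` leaves only the contractor term. -/
theorem k_mul_of_r_mul {i : ℕ} (hi : i < L) {a : B} (ha : r i * a = -q⁻¹ • a) : k i * a = 0 := by
  have h1 := congrArg (· * a) (h.r_sq hi)
  simp only [sub_mul, add_mul, one_mul, smul_mul_assoc, mul_assoc, ha, mul_smul_comm, smul_smul] at h1
  have h2 : (μ * (q - q⁻¹)) • (k i * a) = 0 := by
    have h3 : (μ * (q - q⁻¹)) • (k i * a) = a + ((q - q⁻¹) * -q⁻¹) • a - (-q⁻¹ * -q⁻¹) • a := by
      rw [h1]; module
    rw [h3]
    have := h.q_ne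
    match_scalars
    field_simp
    ring
  exact (smul_eq_zero.1 h2).resolve_left (mul_ne_zero h.mu_ne h.lam_ne)

/-- This is the case of the Yang-Baxter equation for baxterized elements in which one of them, at
`q⁻²`, projects onto sign vectors. After expansion, `e1` to `e6` reduce the words applied to `a`,
and the coefficients cancel identically in `x`. -/
theorem r_mul_sigm_mul_sigm {i j : ℕ} (hi : i < L) (hj : j < L) (hij : i + 1 = j ∨ j + 1 = i)
    {x : ℂ} (hx : q * x + μ ≠ 0) (hx' : q ^ 3 * x + μ ≠ 0) {a : B} (ha : r i * a = -q⁻¹ • a) :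
    (r j + q⁻¹ • 1) * (sigm q μ r k i (q ^ 2 * x) * (sigm q μ r k j x * a)) = 0 := by
  have hq := h.q_ne
  have hm := h.mu_ne
  have hl := h.lam_ne
  have ka := h.k_mul_of_r_mul hi ha
  have ria : ri i * a = -q • a := by
    have h1 := congrArg (ri i * ·) ha
    simp only [← mul_assoc, h.ri_r hi, one_mul, mul_smul_comm] at h1
    have h2 : ri i * a = -q • -q⁻¹ • (ri i * a) := by
      rw [smul_smul, neg_mul_neg, mul_inv_cancel₀ hq, one_smul]
    rw [h2, ← h1]
  have e1 : k i * (r j * a) = -q • (k i * (k j * a)) := by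
    have h1 : k i * r j * (r i * ri i * a) = k i * k j * (ri i * a) := by
      rw [h.k_k_right hi hj hij]; simp only [mul_assoc]
    rw [h.r_ri hi, one_mul, ria, mul_smul_comm] at h1
    simpa only [mul_assoc] using h1
  have e2 : r j * (r j * a) = a + (q - q⁻¹) • (r j * a) - (μ * (q - q⁻¹)) • (k j * a) := by
    rw [← mul_assoc, h.r_sq hj]
    simp only [sub_mul, add_mul, one_mul, smul_mul_assoc]
  have e3 : r j * (k j * a) = μ • (k j * a) := by rw [← mul_assoc, h.r_k hj, smul_mul_assoc]
  have e4 : r j * (r i * (r j * a)) = -q⁻¹ • (r i * (r j * a)) := by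
    have h1 := congrArg (· * a) (h.braid hj hi hij.symm)
    simp only [mul_assoc, ha, mul_smul_comm] at h1
    exact h1
  have e5 : r j * (r i * (k j * a)) = k i * (k j * a) := by
    have h1 := congrArg (· * a) (h.k_k_left hi hj hij)
    simp only [mul_assoc] at h1
    exact h1.symm
  have e6 : r j * (k i * (k j * a)) =
      r i * (k j * a) + (q - q⁻¹) • (k i * (k j * a)) - (q - q⁻¹) • (k j * a) := by
    have h1 := congrArg (· * (r i * (k j * a))) (h.r_sq hj)
    have h2 : k j * (r i * (k j * a)) = μ⁻¹ • (k j * a) := by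
      simpa only [mul_assoc, smul_mul_assoc] using congrArg (· * a) (h.k_r_k hj hi hij.symm)
    simp only [mul_assoc, e5, sub_mul, add_mul, one_mul, smul_mul_assoc, h2, smul_smul] at h1
    rw [h1]
    match_scalars <;> field_simp
  simp only [sigm, add_mul, mul_add, one_mul, mul_one, smul_mul_assoc, mul_smul_comm, smul_add,
    smul_smul, ha, ka, e1, e2, e3, e4, e5, e6, smul_zero, smul_sub, mul_zero]
  have hd : q * μ⁻¹ * x + 1 ≠ 0 := by
    intro h0
    apply hx
    have : μ * (q * μ⁻¹ * x + 1) = 0 := by rw [h0, mul_zero]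
    rw [← this]; field_simp
  have hd' : q * μ⁻¹ * (q ^ 2 * x) + 1 ≠ 0 := by
    intro h0
    apply hx'
    have : μ * (q * μ⁻¹ * (q ^ 2 * x) + 1) = 0 := by rw [h0, mul_zero]
    rw [← this]; field_simp
  have hl' : q ^ 2 - 1 ≠ 0 := by
    intro h0
    apply hl
    rw [show q - q⁻¹ = (q ^ 2 - 1) / q by field_simp, h0, zero_div]
  have hc : (x - 1) / (q * μ⁻¹ * x + 1) = μ * (x - 1) / (q * x + μ) := by
    rw [div_eq_div_iff hd hx]; field_simp
  have hc' : (q ^ 2 * x - 1) / (q * μ⁻¹ * (q ^ 2 * x) + 1) = μ * (q ^ 2 * x - 1) / (q ^ 3 * x + μ) := by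
    rw [div_eq_div_iff hd' hx']; field_simp
  rw [hc, hc']
  have hl2 : q - q⁻¹ = (q ^ 2 - 1) / q := by field_simp
  rw [hl2]
  generalize hd0 : q * x + μ = d at hx ⊢
  generalize hd1 : q ^ 3 * x + μ = d' at hx' ⊢
  match_scalars <;> field_simp <;> subst hd0 hd1 <;> ring

end BMWFamily

end QMA

/-! ### The q-numbers and the sign property of the antisymmetrizers. -/

namespace QMA

theorem qnum_one (q : ℂ) (h : q - q⁻¹ ≠ 0) : qnum q 1 = 1 := by
  rw [qnum, pow_one, div_self h]

theorem qnum_succ (q : ℂ) (hq : q ≠ 0) (h : q - q⁻¹ ≠ 0) (i : ℕ) :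
    qnum q (i + 1) = q ^ i + q⁻¹ * qnum q i := by
  have h1 : q ^ (i + 1) - (q ^ (i + 1))⁻¹ = q ^ i * (q - q⁻¹) + q⁻¹ * (q ^ i - (q ^ i)⁻¹) := by
    have : q ^ i ≠ 0 := pow_ne_zero _ hq
    rw [pow_succ]
    field_simp
    ring
  rw [qnum, qnum, h1, add_div, mul_div_assoc, div_self h, mul_one, mul_div_assoc]

theorem sub_one_div (q : ℂ) (hq : q ≠ 0) (i : ℕ) :
    ((q ^ (2 * i))⁻¹ - 1) / (q - q⁻¹) = -(q ^ i)⁻¹ * qnum q i := by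
  have : q ^ i ≠ 0 := pow_ne_zero _ hq
  rw [qnum, ← mul_div_assoc]
  congr 1
  rw [mul_comm 2, pow_mul]
  field_simp
  ring

namespace BMWFamily

variable {B : Type} [Ring B] [Algebra ℂ B] {q μ : ℂ} {L : ℕ} {r ri k : ℕ → B}
variable (h : BMWFamily q μ L r ri k)
include h

/-- On a sign vector the contractor term vanishes, and the baxterized element acts by `1 + q^{-m-2}
(m+1)_q = q^{-m-1} (m+2)_q`, which the normalization inverts. -/
theorem sigm_mul {i m : ℕ} (hi : i < L) {x : B} (hx : r i * x = -q⁻¹ • x) (hm : qnum q (m + 2) ≠ 0) :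
    (q ^ (m + 1) / qnum q (m + 2)) • (sigm q μ r k i (q ^ (2 * (m + 1)))⁻¹ * x) = x := by
  have hq := h.q_ne
  rw [sigm, sub_one_div q hq, add_mul, add_mul, one_mul, smul_mul_assoc, smul_mul_assoc, hx,
    h.k_mul_of_r_mul hi hx, smul_zero, add_zero, smul_smul]
  have h1 := qnum_succ q hq h.lam_ne (m + 1)
  have h2 : (q ^ (m + 1) / qnum q (m + 2)) * (1 + -(q ^ (m + 1))⁻¹ * qnum q (m + 1) * -q⁻¹) = 1 := by
    have h3 : q ^ (m + 1) ≠ 0 := pow_ne_zero _ hq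
    rw [div_mul_eq_mul_div, div_eq_one_iff_eq hm, h1]
    field_simp
  calc _ = ((q ^ (m + 1) / qnum q (m + 2)) * (1 + -(q ^ (m + 1))⁻¹ * qnum q (m + 1) * -q⁻¹)) • x := by
        module
    _ = x := by rw [h2, one_smul]

/-- An antisymmetrizer acts as the identity on the sign representation. -/
theorem asymm_mul {s : ℕ} {x : B} : ∀ {m : ℕ}, s + m ≤ L + 1 →
    (∀ i, 2 ≤ i → i ≤ m → qnum q i ≠ 0) → (∀ t, t + 1 < m → r (s + t) * x = -q⁻¹ • x) →
    asymm q μ r k s m * x = x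
  | 0, _, _, _ => by rw [asymm, one_mul]
  | 1, _, _, _ => by rw [asymm, one_mul]
  | m + 2, hm, hn, hx => by
    have ih := asymm_mul (m := m + 1) (by omega) (fun i h1 h2 => hn i h1 (by omega))
      fun t ht => hx t (by omega)
    have h1 := h.sigm_mul (i := s + m) (m := m) (by omega) (hx m (by omega)) (hn _ (by omega) le_rfl)
    rw [asymm, smul_mul_assoc, mul_assoc, mul_assoc, ih, ← mul_smul_comm, h1, ih]

/-- At `x = q⁻²` the baxterized element is a multiple of the projector onto the eigenvalue `-q⁻¹`;
its denominator is `q⁻¹ + μ` up to a nonzero factor. -/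
theorem r_mul_sigm {i : ℕ} (hi : i < L) (hd : q⁻¹ + μ ≠ 0) :
    r i * sigm q μ r k i (q ^ 2)⁻¹ = -q⁻¹ • sigm q μ r k i (q ^ 2)⁻¹ := by
  have hq := h.q_ne
  have hm := h.mu_ne
  have hl := h.lam_ne
  rw [sigm]
  simp only [mul_add, mul_one, mul_smul_comm, h.r_sq hi, h.r_k hi]
  have hc : ((q ^ 2)⁻¹ - 1) / (q * μ⁻¹ * (q ^ 2)⁻¹ + 1) = -(q⁻¹ * μ * (q - q⁻¹)) / (q⁻¹ + μ) := by
    have hd' : q * μ⁻¹ * (q ^ 2)⁻¹ + 1 ≠ 0 := by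
      have : q * μ⁻¹ * (q ^ 2)⁻¹ + 1 = (q⁻¹ + μ) * μ⁻¹ := by field_simp
      rw [this]
      exact mul_ne_zero hd (inv_ne_zero hm)
    rw [div_eq_div_iff hd' hd]
    field_simp
    ring
  have hb : ((q ^ 2)⁻¹ - 1) / (q - q⁻¹) = -q⁻¹ := by
    rw [div_eq_iff hl]
    field_simp
    ring
  rw [hc, hb]
  generalize hd0 : q⁻¹ + μ = d at hd ⊢
  have hmu : μ = d - q⁻¹ := by rw [← hd0]; ring
  match_scalars <;> field_simp
  · ring
  · rw [hmu]
    field_simp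
    ring

/-- All generators but the top one are absorbed by the left factor of the recursion. For the top
one, the left factor is unfolded once more and the smaller antisymmetrizer, which does not meet the
top generator, is moved out. What remains is a product of two baxterized elements on a sign vector,
to which `r_mul_sigm_mul_sigm` applies. -/
theorem r_mul_asymm {s : ℕ} : ∀ {m : ℕ}, s + m ≤ L + 1 →
    (∀ i, 2 ≤ i → i ≤ m → qnum q i ≠ 0) → (∀ i, 1 ≤ i → i < m → q * (q ^ (2 * i))⁻¹ + μ ≠ 0) →
    ∀ t, t + 1 < m → r (s + t) * asymm q μ r k s m = -q⁻¹ • asymm q μ r k s m := by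
  have hq := h.q_ne
  intro m
  induction m using Nat.strong_induction_on with
  | _ m ih =>
    intro hm hn hd t ht
    obtain ⟨m, rfl⟩ : ∃ m', m = m' + 2 := ⟨m - 2, by omega⟩
    have ih1 := ih (m + 1) (by omega) (by omega) (fun i h1 h2 => hn i h1 (by omega))
      (fun i h1 h2 => hd i h1 (by omega))
    rcases Nat.lt_or_ge t m with htm | htm
    · rw [asymm, mul_smul_comm, mul_assoc, ← mul_assoc (r _), ih1 t (by omega), smul_mul_assoc,
        smul_comm]
    · obtain rfl : t = m := by omega
      rcases Nat.eq_zero_or_pos t with rfl | ht0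
      · have hd1 := hd 1 le_rfl (by omega)
        rw [show q * (q ^ (2 * 1))⁻¹ + μ = q⁻¹ + μ by rw [mul_one, pow_two, mul_inv, mul_inv_cancel_left₀ hq]] at hd1
        rw [asymm, asymm, one_mul, mul_one, mul_smul_comm]
        have := h.r_mul_sigm (i := s + 0) (by omega) hd1
        rw [show 2 * (0 + 1) = 2 by rfl, this, smul_comm]
      · obtain ⟨m, rfl⟩ : ∃ m, t = m + 1 := ⟨t - 1, by omega⟩
        have ih0 := ih (m + 1) (by omega) (by omega) (fun i h1 h2 => hn i h1 (by omega))
          (fun i h1 h2 => hd i h1 (by omega))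
        -- The smaller antisymmetrizer is absorbed by the larger one, which by induction is already
        -- a sign vector for its generators.
        have hid := h.asymm_mul (s := s) (m := m + 1) (by omega)
          (fun i h1 h2 => hn i h1 (by omega)) (x := asymm q μ r k s (m + 2)) (fun t ht => by
            exact ih1 t (by omega))
        have hx1 := hd (m + 2) (by omega) (by omega)
        have hx2 := hd (m + 1) (by omega) (by omega)
        have key := h.r_mul_sigm_mul_sigm (i := s + m) (j := s + (m + 1)) (by omega) (by omega)
          (Or.inl rfl) hx1 (a := asymm q μ r k s (m + 2)) (by
            convert hx2 using 2
            have : q ^ (2 * (m + 2)) = q ^ 2 * q ^ (2 * (m + 1)) := by ring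
            rw [this]
            have : q ^ (2 * (m + 1)) ≠ 0 := pow_ne_zero _ hq
            field_simp) (ih1 m (by omega))
        rw [show q ^ 2 * (q ^ (2 * (m + 2)))⁻¹ = (q ^ (2 * (m + 1)))⁻¹ by
          have : q ^ (2 * (m + 2)) = q ^ 2 * q ^ (2 * (m + 1)) := by ring
          rw [this]
          have : q ^ (2 * (m + 1)) ≠ 0 := pow_ne_zero _ hq
          field_simp] at key
        have hc1 : Commute (asymm q μ r k s (m + 1)) (r (s + (m + 1))) :=
          h.asymm_commute (by omega) (by omega) (by omega) (Or.inl rfl)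
        have hc2 : Commute (asymm q μ r k s (m + 1))
            (sigm q μ r k (s + (m + 1)) (q ^ (2 * (m + 2)))⁻¹) :=
          (h.semiconj_sigm (by omega) (by omega) hc1 _)
        have hz : (r (s + (m + 1)) + q⁻¹ • 1) * asymm q μ r k s (m + 1 + 2) = 0 := by
          rw [asymm, mul_smul_comm]
          have hc3 : Commute (asymm q μ r k s (m + 1)) (r (s + (m + 1)) + q⁻¹ • 1) :=
            hc1.add_right ((Commute.one_right _).smul_right _)
          have e : asymm q μ r k s (m + 1 + 1) = (q ^ (m + 1) / qnum q (m + 2)) •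
            (asymm q μ r k s (m + 1) * sigm q μ r k (s + m) (q ^ (2 * (m + 1)))⁻¹ *
              asymm q μ r k s (m + 1)) := by rw [asymm]
          rw [mul_assoc, e, smul_mul_assoc, mul_smul_comm, ← e]
          set A := asymm q μ r k s (m + 1)
          set A2 := asymm q μ r k s (m + 1 + 1)
          have : (r (s + (m + 1)) + q⁻¹ • 1) * (A * sigm q μ r k (s + m) (q ^ (2 * (m + 1)))⁻¹ * A *
              (sigm q μ r k (s + (m + 1)) (q ^ (2 * (m + 1 + 1)))⁻¹ * A2)) = 0 := by
            calc _ = (r (s + (m + 1)) + q⁻¹ • 1) * A * (sigm q μ r k (s + m) (q ^ (2 * (m + 1)))⁻¹ *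
                  (A * sigm q μ r k (s + (m + 1)) (q ^ (2 * (m + 1 + 1)))⁻¹) * A2) := by
                  simp only [mul_assoc]
              _ = A * ((r (s + (m + 1)) + q⁻¹ • 1) * (sigm q μ r k (s + m) (q ^ (2 * (m + 1)))⁻¹ *
                  (sigm q μ r k (s + (m + 1)) (q ^ (2 * (m + 2)))⁻¹ * (A * A2)))) := by
                  rw [← hc3.eq, hc2.eq]; simp only [mul_assoc]
              _ = 0 := by rw [hid, key, mul_zero]
          rw [this, smul_zero, smul_zero]
        rw [add_mul, smul_mul_assoc, one_mul] at hz
        rw [eq_neg_of_add_eq_zero_left hz, neg_smul]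

omit h in
theorem asymm_op {s : ℕ} : ∀ {m : ℕ},
    asymm q μ (fun i => MulOpposite.op (r i)) (fun i => MulOpposite.op (k i)) s m =
      MulOpposite.op (asymm q μ r k s m)
  | 0 => by rw [asymm, asymm, MulOpposite.op_one]
  | 1 => by rw [asymm, asymm, MulOpposite.op_one]
  | m + 2 => by
    rw [asymm, asymm, asymm_op]
    simp only [sigm, MulOpposite.op_smul, MulOpposite.op_mul, MulOpposite.op_add, MulOpposite.op_one,
      mul_assoc]

theorem asymm_mul_r {s m : ℕ} (hm : s + m ≤ L + 1)
    (hn : ∀ i, 2 ≤ i → i ≤ m → qnum q i ≠ 0)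
    (hd : ∀ i, 1 ≤ i → i < m → q * (q ^ (2 * i))⁻¹ + μ ≠ 0) (t : ℕ) (ht : t + 1 < m) :
    asymm q μ r k s m * r (s + t) = -q⁻¹ • asymm q μ r k s m := by
  have h1 := h.op.r_mul_asymm hm hn hd t ht
  rw [asymm_op, ← MulOpposite.op_mul, ← MulOpposite.op_smul] at h1
  exact MulOpposite.op_injective h1

theorem asymm_mul_self {s m : ℕ} (hm : s + m ≤ L + 1)
    (hn : ∀ i, 2 ≤ i → i ≤ m → qnum q i ≠ 0)
    (hd : ∀ i, 1 ≤ i → i < m → q * (q ^ (2 * i))⁻¹ + μ ≠ 0) :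
    asymm q μ r k s m * asymm q μ r k s m = asymm q μ r k s m :=
  h.asymm_mul hm hn (h.r_mul_asymm hm hn hd)

/-! ### Identities on three and four strands -/

theorem k_k_inv {i j : ℕ} (hi : i < L) (hj : j < L) (ha : i + 1 = j ∨ j + 1 = i) :
    k i * ri j * ri i = k i * k j := by
  have h1 : k i * k j * (r i * r j) = k i := by
    rw [mul_assoc, ← mul_assoc (k j), ← h.k_k_right hj hi ha.symm, ← mul_assoc, h.k_k_k hi hj ha]
  calc k i * ri j * ri i = k i * k j * (r i * (r j * ri j) * ri i) := by
        conv_lhs => rw [← h1]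
        simp only [mul_assoc]
    _ = k i * k j := by rw [h.r_ri hj, mul_one, h.r_ri hi, mul_one]

theorem k_k_inv' {i j : ℕ} (hi : i < L) (hj : j < L) (ha : i + 1 = j ∨ j + 1 = i) :
    ri j * (ri i * k j) = k i * k j := by
  have h1 := h.op.k_k_inv hj hi ha.symm
  simp only [← MulOpposite.op_mul] at h1
  exact MulOpposite.op_injective h1

variable {l c u : ℕ} (hl : l < L) (hc : c < L) (hu : u < L) (hlc : l + 1 = c) (hcu : c + 1 = u)
include hl hc hu hlc hcu

/-- Write `r l * k c` as `ri c * k l * k c` and apply the skein relation to `ri c`. Its three terms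
reduce to a word in contractors, a word with one crossing, and a multiple of `k c`. -/
theorem k_r_r_k : k c * (r u * (r l * k c)) = k c * (k l * (k u * k c)) -
    (q - q⁻¹) • (k c * (r u * (k l * k c))) + ((q - q⁻¹) * μ⁻¹) • k c := by
  have e1 : r l * k c = ri c * (k l * k c) := by
    rw [h.k_k_left hl hc (Or.inl hlc), mul_assoc, ← mul_assoc (ri c), h.ri_r hc, one_mul]
  have e2 : k c * (r u * (r c * (k l * k c))) = k c * (k l * (k u * k c)) := by
    rw [← mul_assoc (r u), ← mul_assoc (k c) (r u * r c), ← mul_assoc (k c) (r u),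
      ← h.k_k_right hc hu (Or.inl hcu)]
    have := h.far_k hl hu (Or.inl (by omega)) (Or.inr (Or.inr rfl)) (Or.inr (Or.inr rfl))
    simp only [mul_assoc]
    rw [← mul_assoc (k u), ← this.eq, mul_assoc]
  have e3 : k c * (r u * (k c * (k l * k c))) = μ⁻¹ • k c := by
    have h1 := h.k_r_k hc hu (Or.inl hcu)
    rw [← mul_assoc (r u), ← mul_assoc (k c), ← mul_assoc (k c) (r u), h1, smul_mul_assoc, ← mul_assoc,
      h.k_k_k hc hl (Or.inr hlc)]
  rw [e1, h.skein hc]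
  simp only [add_mul, sub_mul, mul_add, mul_sub, smul_mul_assoc, one_mul, mul_smul_comm, e2, e3,
    smul_smul]

/-- One step of carrying a contracted pair from `l` to `c`, past a strand tied up in `r u`: the
contractor absorbs the crossings on both sides. -/
theorem conj_r : r l * (r c * (r u * (k l * (ri c * ri l)))) = k c * (r u * (k l * k c)) := by
  have e := h.far_k hl hu (Or.inl (by omega)) (Or.inr (Or.inr rfl)) (Or.inl rfl)
  have e1 : r l * (r c * k l) = k c * k l := by
    rw [h.k_k_left hc hl (Or.inr hlc), mul_assoc]
  calc _ = (r l * (r c * k l)) * (r u * (ri c * ri l)) := by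
        rw [← mul_assoc (r u), ← e.eq]; simp only [mul_assoc]
    _ = k c * (r u * (k l * ri c * ri l)) := by
        rw [e1, mul_assoc, ← mul_assoc (k l), e.eq]; simp only [mul_assoc]
    _ = _ := by rw [h.k_k_inv hl hc (Or.inl hlc)]

theorem conj_k : r l * (r c * (k u * (k l * (ri c * ri l)))) = k c * (k l * (k u * k c)) := by
  have e := h.far_k hl hu (Or.inl (by omega)) (Or.inr (Or.inr rfl)) (Or.inr (Or.inr rfl))
  have e1 : r l * (r c * k l) = k c * k l := by
    rw [h.k_k_left hc hl (Or.inr hlc), mul_assoc]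
  calc _ = (r l * (r c * k l)) * (k u * (ri c * ri l)) := by
        rw [← mul_assoc (k u), ← e.eq]; simp only [mul_assoc]
    _ = k c * (k u * (k l * ri c * ri l)) := by
        rw [e1, mul_assoc, ← mul_assoc (k l), e.eq]; simp only [mul_assoc]
    _ = _ := by rw [h.k_k_inv hl hc (Or.inl hlc), ← mul_assoc (k u), ← e.eq, mul_assoc]

/-- The word opens with two nested arcs, and a crossing of the arcs may be made at either end.
Algebraically both sides equal `ri c * k l * k u * k c`. -/
theorem r_mul_kkkk : r l * (k c * (k l * (k u * k c))) = r u * (k c * (k l * (k u * k c))) := by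
  have e := h.far_k hl hu (Or.inl (by omega)) (Or.inr (Or.inr rfl)) (Or.inr (Or.inr rfl))
  have e1 : r l * (k c * k l) = ri c * k l := by
    rw [← h.k_k_inv' hc hl (Or.inr hlc), ← mul_assoc, h.r_ri hl, one_mul]
  have e2 : r u * (k c * k u) = ri c * k u := by
    rw [← h.k_k_inv' hc hu (Or.inl hcu), ← mul_assoc, h.r_ri hu, one_mul]
  have e3 : r l * (k c * (k l * (k u * k c))) = ri c * k l * (k u * k c) := by
    rw [← e1]; simp only [mul_assoc]
  have e4 : r u * (k c * (k u * (k l * k c))) = ri c * k u * (k l * k c) := by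
    rw [← e2]; simp only [mul_assoc]
  rw [e3]
  conv_rhs => rw [← mul_assoc (k l), e.eq, mul_assoc, e4]
  rw [mul_assoc, ← mul_assoc (k l), e.eq]; simp only [mul_assoc]

end BMWFamily

end QMA

/-! ### Products of consecutive generators and the conjugations they induce. -/

namespace QMA

/-- `r (s + m - 1) ⋯ r (s + 1) r s`. -/
def desc {B : Type} [Ring B] (r : ℕ → B) (s : ℕ) : ℕ → B
  | 0 => 1
  | m + 1 => r (s + m) * desc r s m

/-- `r s r (s + 1) ⋯ r (s + m - 1)`. -/
def asc {B : Type} [Ring B] (r : ℕ → B) (s : ℕ) : ℕ → B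
  | 0 => 1
  | m + 1 => asc r s m * r (s + m)

/-- The braid moving the first two strands to the places `i`, `i + 1`. -/
def moveTwo {B : Type} [Ring B] (r : ℕ → B) : ℕ → B
  | 0 => 1
  | i + 1 => r i * r (i + 1) * moveTwo r i

/-- The inverse of `moveTwo`. -/
def moveTwoInv {B : Type} [Ring B] (ri : ℕ → B) : ℕ → B
  | 0 => 1
  | i + 1 => moveTwoInv ri i * (ri (i + 1) * ri i)

section Products

variable {B : Type} [Ring B] {r : ℕ → B}

theorem desc_commute {x : B} {s : ℕ} : ∀ {m : ℕ}, (∀ t, t < m → Commute x (r (s + t))) →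
    Commute x (desc r s m)
  | 0, _ => Commute.one_right x
  | m + 1, h => (h m (by omega)).mul_right (desc_commute fun t ht => h t (by omega))

theorem asc_commute {x : B} {s : ℕ} : ∀ {m : ℕ}, (∀ t, t < m → Commute x (r (s + t))) →
    Commute x (asc r s m)
  | 0, _ => Commute.one_right x
  | m + 1, h => (asc_commute fun t ht => h t (by omega)).mul_right (h m (by omega))

theorem asc_semiconj {u : B} {s s' : ℕ} : ∀ {m : ℕ},
    (∀ t, t < m → SemiconjBy u (r (s + t)) (r (s' + t))) →
    SemiconjBy u (asc r s m) (asc r s' m)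
  | 0, _ => SemiconjBy.one_right u
  | m + 1, h => (asc_semiconj fun t ht => h t (by omega)).mul_right (h m (by omega))

theorem desc_succ' (s : ℕ) : ∀ m : ℕ, desc r s (m + 1) = desc r (s + 1) m * r s
  | 0 => by simp [desc]
  | m + 1 => by
    rw [desc, desc_succ' s m, desc, ← mul_assoc, show s + (m + 1) = s + 1 + m by omega]

theorem asc_succ' (s : ℕ) : ∀ m : ℕ, asc r s (m + 1) = r s * asc r (s + 1) m
  | 0 => by simp [asc]
  | m + 1 => by
    rw [asc, asc_succ' s m, asc, ← mul_assoc, show s + (m + 1) = s + 1 + m by omega]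

end Products

namespace BMWFamily

variable {B : Type} [Ring B] [Algebra ℂ B] {q μ : ℂ} {L : ℕ} {r ri k : ℕ → B}
variable (h : BMWFamily q μ L r ri k)
include h

theorem r_commute {i j : ℕ} (hi : i < L) (hj : j < L) (ha : i + 2 ≤ j ∨ j + 2 ≤ i) :
    Commute (r i) (r j) := h.far_k hi hj ha (Or.inl rfl) (Or.inl rfl)

/-- The product of consecutive generators shifts each generator by one. One braid relation suffices,
because all other factors commute with it. -/
theorem asc_semiconj_r {t : ℕ} : ∀ {m : ℕ}, m ≤ L → t + 1 < m →
    SemiconjBy (asc r 0 m) (r t) (r (t + 1))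
  | m + 1, hm, ht => by
    rcases Nat.lt_or_ge (t + 1) m with h1 | h1
    · rw [asc]
      refine (asc_semiconj_r (by omega) h1).mul_left ?_
      exact h.r_commute (by omega) (by omega) (Or.inr (by omega))
    · obtain rfl : m = t + 1 := by omega
      have hc : Commute (r (t + 1)) (asc r 0 t) :=
        asc_commute fun s hs => h.r_commute (by omega) (by omega) (Or.inr (by omega))
      change asc r 0 t * r (0 + t) * r (0 + (t + 1)) * r t =
        r (t + 1) * (asc r 0 t * r (0 + t) * r (0 + (t + 1)))
      simp only [Nat.zero_add]
      calc _ = asc r 0 t * (r t * r (t + 1) * r t) := by simp only [mul_assoc]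
        _ = asc r 0 t * r (t + 1) * (r t * r (t + 1)) := by
          rw [h.braid (by omega) (by omega) (Or.inl rfl)]; simp only [mul_assoc]
        _ = _ := by rw [← hc.eq]; simp only [mul_assoc]

theorem exists_asc_inv : ∀ {m : ℕ}, m ≤ L → ∃ v, v * asc r 0 m = 1
  | 0, _ => ⟨1, by rw [asc, one_mul]⟩
  | m + 1, hm => by
    obtain ⟨v, hv⟩ := exists_asc_inv (m := m) (by omega)
    refine ⟨ri m * v, ?_⟩
    rw [asc, Nat.zero_add, mul_assoc, ← mul_assoc v, hv, one_mul, h.ri_r (by omega)]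

theorem mul_asc {a : B} {c : ℂ} : ∀ {m : ℕ}, (∀ t, t < m → a * r t = c • a) →
    a * asc r 0 m = c ^ m • a
  | 0, _ => by simp [asc]
  | m + 1, ha => by
    rw [asc, ← mul_assoc, mul_asc fun t ht => ha t (by omega), Nat.zero_add, smul_mul_assoc,
      ha m (by omega), smul_smul, pow_succ]

theorem asc_mul {a : B} {c : ℂ} : ∀ {m : ℕ}, (∀ t, t < m → r t * a = c • a) →
    asc r 0 m * a = c ^ m • a
  | 0, _ => by simp [asc]
  | m + 1, ha => by
    rw [asc, mul_assoc, Nat.zero_add, ha m (by omega), mul_smul_comm,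
      asc_mul fun t ht => ha t (by omega), smul_smul, pow_succ']

/-- The mirror image of a vanishing antisymmetrizer of order `m + 2` vanishes. -/
theorem asymm_sigm_asymm_eq_zero {m : ℕ} (hm : m < L)
    (hn : ∀ i, 2 ≤ i → i ≤ m + 1 → qnum q i ≠ 0)
    (hd : ∀ i, 1 ≤ i → i < m + 1 → q * (q ^ (2 * i))⁻¹ + μ ≠ 0) {x : ℂ}
    (hz : asymm q μ r k 1 (m + 1) * sigm q μ r k 0 x * asymm q μ r k 1 (m + 1) = 0) :
    asymm q μ r k 0 (m + 1) * sigm q μ r k m x * asymm q μ r k 0 (m + 1) = 0 := by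
  obtain ⟨v, hv⟩ := h.exists_asc_inv (m := m + 1) (by omega)
  set γ := asc r 0 (m + 1) with hγ
  set δ := asc r 0 m with hδ
  set a := asymm q μ r k 0 (m + 1) with ha
  set a' := asymm q μ r k 1 (m + 1) with ha'
  set c : ℂ := -q⁻¹
  have hc : c ≠ 0 := neg_ne_zero.2 (inv_ne_zero h.q_ne)
  have h1 : a * δ = c ^ m • a := h.mul_asc fun t ht => by
    have := h.asymm_mul_r (s := 0) (by omega) hn hd t (by omega)
    rwa [Nat.zero_add] at this
  have h2 : δ * a = c ^ m • a := h.asc_mul fun t ht => by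
    have := h.r_mul_asymm (s := 0) (by omega) hn hd t (by omega)
    rwa [Nat.zero_add] at this
  have h3 : γ * a = a' * γ := h.semiconj_asymm fun t ht => ⟨by omega, by omega, by
    have := h.asc_semiconj_r (t := t) (m := m + 1) (by omega) (by omega)
    rwa [Nat.zero_add, add_comm 1 t]⟩
  -- While `γ` raises every generator below the top by one, `γ * δ` carries the last generator to
  -- the first, since `γ δ r_m = γ γ = r_0 γ δ`.
  have h4 : SemiconjBy (γ * δ) (r m) (r 0) := by
    have e1 : γ * δ = asc r 1 m * γ := asc_semiconj (s := 0) (s' := 1) fun t ht => by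
      have := h.asc_semiconj_r (t := t) (m := m + 1) (by omega) (by omega)
      rwa [Nat.zero_add, add_comm 1 t]
    change γ * δ * r m = r 0 * (γ * δ)
    have e2 : γ = δ * r m := by rw [hγ, asc, Nat.zero_add]
    have e3 : γ = r 0 * asc r 1 m := by rw [hγ, asc_succ']
    calc γ * δ * r m = γ * γ := by rw [mul_assoc, ← e2]
      _ = r 0 * (γ * δ) := by rw [e1, ← mul_assoc, ← e3]
  have h5 := (h.semiconj_sigm (by omega) (by omega) h4 x).eq
  -- The antisymmetrizer turns `δ` into the nonzero scalar `(-q⁻¹)^m`, so the hypothesis times `γ *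
  -- δ` is a nonzero multiple of `γ` times the claim.
  have h6 : γ * (a * sigm q μ r k m x * a) = 0 := by
    have e1 : a' * sigm q μ r k 0 x * a' * (γ * δ) = c ^ m • (γ * (a * sigm q μ r k m x * a)) := by
      calc a' * sigm q μ r k 0 x * a' * (γ * δ) = a' * sigm q μ r k 0 x * (γ * (a * δ)) := by
            simp only [mul_assoc]; rw [← mul_assoc a' γ, ← h3]; simp only [mul_assoc]
        _ = a' * sigm q μ r k 0 x * (γ * (δ * a)) := by rw [h1, h2]
        _ = a' * (sigm q μ r k 0 x * (γ * δ)) * a := by simp only [mul_assoc]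
        _ = a' * γ * (δ * sigm q μ r k m x * a) := by rw [← h5]; simp only [mul_assoc]
        _ = γ * ((a * δ) * sigm q μ r k m x * a) := by rw [← h3]; simp only [mul_assoc]
        _ = c ^ m • (γ * (a * sigm q μ r k m x * a)) := by
          rw [h1]; simp only [smul_mul_assoc, mul_smul_comm]
    rw [hz, zero_mul] at e1
    have := e1.symm
    rw [smul_eq_zero] at this
    exact this.resolve_left (pow_ne_zero _ hc)
  calc a * sigm q μ r k m x * a = v * (γ * (a * sigm q μ r k m x * a)) := by
        rw [← mul_assoc v, hv, one_mul]
    _ = 0 := by rw [h6, mul_zero]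

/-! ### Moving a pair of strands -/

theorem moveTwo_commute {i j : ℕ} (hj : j < L) (hi : i + 2 ≤ j) : Commute (r j) (moveTwo r i) := by
  induction i with
  | zero => exact Commute.one_right _
  | succ i ih =>
    exact ((h.r_commute hj (by omega) (Or.inr (by omega))).mul_right
      (h.r_commute hj (by omega) (Or.inr (by omega)))).mul_right (ih (by omega))

/-- The moved pair crosses the two strands of this generator, whose places therefore drop by two.
The shortest such move, `i = j + 2`, needs two braid relations; beyond it the new factors commute
with `r j`. -/
theorem moveTwo_semiconj {i j : ℕ} (hi : i < L) (hj : j + 2 ≤ i) :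
    SemiconjBy (moveTwo r i) (r (j + 2)) (r j) := by
  induction i with
  | zero => omega
  | succ i ih =>
    rcases Nat.lt_or_ge i (j + 2) with h1 | h1
    · obtain rfl : i = j + 1 := by omega
      have hc := h.moveTwo_commute (i := j) (j := j + 2) (by omega) (by omega)
      change r (j + 1) * r (j + 1 + 1) * (r j * r (j + 1) * moveTwo r j) * r (j + 2) =
        r j * (r (j + 1) * r (j + 1 + 1) * (r j * r (j + 1) * moveTwo r j))
      have b1 := h.braid (i := j + 1) (j := j + 2) (by omega) (by omega) (Or.inl rfl)
      have b2 := h.braid (i := j + 1) (j := j) (by omega) (by omega) (Or.inr rfl)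
      have f := h.r_commute (i := j) (j := j + 2) (by omega) (by omega) (Or.inl le_rfl)
      have e : j + 1 + 1 = j + 2 := rfl
      simp only [e]
      calc _ = r (j + 1) * (r j * r (j + 2)) * r (j + 1) * (r (j + 2) * moveTwo r j) := by
            rw [f.eq, hc.eq]; simp only [mul_assoc]
        _ = r (j + 1) * r j * (r (j + 2) * r (j + 1) * r (j + 2)) * moveTwo r j := by
            simp only [mul_assoc]
        _ = (r (j + 1) * r j * r (j + 1)) * r (j + 2) * r (j + 1) * moveTwo r j := by
            rw [← b1]; simp only [mul_assoc]
        _ = r j * r (j + 1) * (r j * r (j + 2)) * r (j + 1) * moveTwo r j := by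
            rw [b2]; simp only [mul_assoc]
        _ = _ := by rw [f.eq]; simp only [mul_assoc]
    · rw [moveTwo]
      refine SemiconjBy.mul_left ?_ (ih (by omega) (by omega))
      exact (h.r_commute (by omega) (by omega) (Or.inr (by omega))).mul_left
        (h.r_commute (by omega) (by omega) (Or.inr (by omega)))

theorem moveTwo_inv_mul {i : ℕ} (hi : i < L) : moveTwoInv ri i * moveTwo r i = 1 := by
  induction i with
  | zero => simp [moveTwo, moveTwoInv]
  | succ i ih =>
    calc _ = moveTwoInv ri i * (ri (i + 1) * (ri i * r i) * r (i + 1)) * moveTwo r i := by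
          rw [moveTwo, moveTwoInv]; simp only [mul_assoc]
      _ = 1 := by rw [h.ri_r (by omega), mul_one, h.ri_r (by omega), mul_one, ih (by omega)]

/-- In each step the outer crossings are absorbed on both sides and `k (i + 1) * k i * k (i + 1) = k
(i + 1)` remains. -/
theorem move_k {i : ℕ} (hi : i < L) : moveTwo r i * (k 0 * moveTwoInv ri i) = k i := by
  induction i with
  | zero => simp [moveTwo, moveTwoInv]
  | succ i ih =>
    have e1 : r i * (r (i + 1) * k i) = k (i + 1) * k i := by
      rw [h.k_k_left (i := i + 1) (j := i) hi (by omega) (Or.inr rfl), mul_assoc]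
    calc _ = r i * (r (i + 1) * (moveTwo r i * (k 0 * moveTwoInv ri i))) * (ri (i + 1) * ri i) := by
          rw [moveTwo, moveTwoInv]; simp only [mul_assoc]
      _ = k (i + 1) * (k i * ri (i + 1) * ri i) := by
          rw [ih (by omega), e1]; simp only [mul_assoc]
      _ = k (i + 1) := by
          rw [h.k_k_inv (by omega) hi (Or.inl rfl), ← mul_assoc,
            h.k_k_k hi (by omega) (Or.inr rfl)]

/-- An element at the place `i + 2` is not met by the first `i` steps of the move, so only the last
step has to be computed. -/
theorem move_aux {i : ℕ} (hi : i + 2 < L) {x : B} (hx : x = r (i + 2) ∨ x = k (i + 2)) :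
    moveTwo r (i + 1) * (x * (k 0 * moveTwoInv ri (i + 1))) =
      r i * (r (i + 1) * (x * (k i * (ri (i + 1) * ri i)))) := by
  have hc := h.moveTwo_commute (i := i) (j := i + 2) hi le_rfl
  have hc' : Commute x (moveTwo r i) := by
    rcases hx with rfl | rfl
    · exact hc
    · exact (h.semiconj_k hi hi hc.symm).symm
  calc _ = r i * (r (i + 1) * ((moveTwo r i * x) * (k 0 * moveTwoInv ri i * (ri (i + 1) * ri i)))) := by
        rw [moveTwo, moveTwoInv]; simp only [mul_assoc]
    _ = r i * (r (i + 1) * (x * (moveTwo r i * (k 0 * moveTwoInv ri i) * (ri (i + 1) * ri i)))) := by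
        rw [← hc'.eq]; simp only [mul_assoc]
    _ = _ := by rw [h.move_k (by omega)]

theorem move_r {i : ℕ} (hi : i + 2 < L) :
    moveTwo r (i + 1) * (r (i + 2) * (k 0 * moveTwoInv ri (i + 1))) =
      k (i + 1) * (r (i + 2) * (k i * k (i + 1))) := by
  rw [h.move_aux hi (Or.inl rfl), h.conj_r (by omega) (by omega) hi rfl rfl]

theorem move_kk {i : ℕ} (hi : i + 2 < L) :
    moveTwo r (i + 1) * (k (i + 2) * (k 0 * moveTwoInv ri (i + 1))) =
      k (i + 1) * (k i * (k (i + 2) * k (i + 1))) := by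
  rw [h.move_aux hi (Or.inr rfl), h.conj_k (by omega) (by omega) hi rfl rfl]

end BMWFamily

end QMA

/-! ### The family attached to an R-matrix of BMW type, and the trace of D. -/

namespace QMA

theorem BMWFamily.of_injective {B C : Type} [Ring B] [Algebra ℂ B] [Ring C] [Algebra ℂ C] {q μ : ℂ}
    {L : ℕ} {r ri k : ℕ → B} (f : B →ₐ[ℂ] C) (hf : Function.Injective f)
    (h : BMWFamily q μ L (fun i => f (r i)) (fun i => f (ri i)) (fun i => f (k i))) :
    BMWFamily q μ L r ri k where
  q_ne := h.q_ne
  lam_ne := h.lam_ne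
  mu_ne := h.mu_ne
  r_ri hi := hf (by rw [map_mul, map_one, h.r_ri hi])
  ri_r hi := hf (by rw [map_mul, map_one, h.ri_r hi])
  skein hi := hf (by rw [map_add, map_sub, map_smul, map_smul, map_one, h.skein hi])
  r_k hi := hf (by rw [map_mul, map_smul, h.r_k hi])
  k_r hi := hf (by rw [map_mul, map_smul, h.k_r hi])
  braid hi hj ha := hf (by simp only [map_mul, h.braid hi hj ha])
  k_k_right hi hj ha := hf (by simp only [map_mul, h.k_k_right hi hj ha])
  k_k_left hi hj ha := hf (by simp only [map_mul, h.k_k_left hi hj ha])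
  k_k_k hi hj ha := hf (by simp only [map_mul, h.k_k_k hi hj ha])
  far hi hj ha := hf (by rw [map_mul, map_mul, (h.far hi hj ha).eq])

theorem map_asymm {B C : Type} [Ring B] [Algebra ℂ B] [Ring C] [Algebra ℂ C] {q μ : ℂ}
    {r k : ℕ → B} {r' k' : ℕ → C} (f : B →ₐ[ℂ] C) {s s' : ℕ} : ∀ {m : ℕ},
    (∀ t, t + 1 < m → f (r (s + t)) = r' (s' + t) ∧ f (k (s + t)) = k' (s' + t)) →
    f (asymm q μ r k s m) = asymm q μ r' k' s' m
  | 0, _ => by rw [asymm, asymm, map_one]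
  | 1, _ => by rw [asymm, asymm, map_one]
  | m + 2, h => by
    obtain ⟨h1, h2⟩ := h m (by omega)
    rw [asymm, asymm, map_smul, map_mul, map_mul, map_asymm (f := f) (r' := r') (k' := k') (s' := s') fun t ht => h t (by omega)]
    simp only [sigm, map_add, map_smul, map_one, h1, h2]

theorem map_desc {B C : Type} [Ring B] [Algebra ℂ B] [Ring C] [Algebra ℂ C]
    {r : ℕ → B} {r' : ℕ → C} (f : B →ₐ[ℂ] C) {s s' : ℕ} : ∀ {m : ℕ},
    (∀ t, t < m → f (r (s + t)) = r' (s' + t)) → f (desc r s m) = desc r' s' m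
  | 0, _ => map_one f
  | m + 1, h => by
    rw [desc, desc, map_mul, h m (by omega), map_desc (f := f) (r' := r') (s' := s') fun t ht => h t (by omega)]

/-- The relations of three strands which follow from half of them. -/
theorem three_strands {B : Type} [Ring B] [Algebra ℂ B] {l : ℂ} {r r' ri ri' k k' : B} (hl : l ≠ 0)
    (h1 : r * ri = 1) (h2 : ri * r = 1) (h1' : r' * ri' = 1) (h2' : ri' * r' = 1)
    (hk : k = l⁻¹ • (ri - r) + 1) (hk' : k' = l⁻¹ • (ri' - r') + 1)
    (hb : r * r' * r = r' * r * r') (pos : k' * k = r * r' * k) (neg : k' * k = ri * ri' * k)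
    (kkk : k * k' * k = k) :
    k' * k = k' * r * r' ∧ k * k' = k * r' * r ∧ k * k' = r' * r * k' ∧ k' * k * k' = k' := by
  have inv : ∀ {u x xi y yi : B}, x * xi = 1 → yi * y = 1 → u * x = y * u → u * xi = yi * u := by
    intro u x xi y yi hx hy hu
    calc u * xi = yi * (y * u) * xi := by rw [← mul_assoc, hy, one_mul]
      _ = yi * u := by rw [← hu, mul_assoc, mul_assoc, hx, mul_one]
  have s1 : (r * r') * r = r' * (r * r') := by rw [hb, mul_assoc]
  have s2 : (r' * r) * r' = r * (r' * r) := by rw [← hb, mul_assoc]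
  have t1 : (r * r') * k = k' * (r * r') := by
    rw [hk, hk', mul_add, add_mul, mul_smul_comm, smul_mul_assoc, mul_sub, sub_mul, s1,
      inv h1 h2' s1, mul_one, one_mul]
  have t2 : (r' * r) * k' = k * (r' * r) := by
    rw [hk, hk', mul_add, add_mul, mul_smul_comm, smul_mul_assoc, mul_sub, sub_mul, s2,
      inv h1' h2 s2, mul_one, one_mul]
  have e1 : k' * k = k' * r * r' := by rw [pos, t1, mul_assoc]
  have e2 : k' * k * (r' * r) = k' := by
    have h3 : k' * (ri * ri') = ri * ri' * k := by
      calc k' * (ri * ri') = ri * ri' * (r' * r * k') * (ri * ri') := by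
            rw [← mul_assoc (ri * ri'), mul_assoc ri, ← mul_assoc ri', h2', one_mul, h2, one_mul]
        _ = ri * ri' * k := by
          rw [t2, mul_assoc, mul_assoc k, mul_assoc r', ← mul_assoc r, h1, one_mul, h1', mul_one]
    rw [neg, ← h3, mul_assoc, mul_assoc ri, ← mul_assoc ri', h2', one_mul, h2, mul_one]
  have e3 : k * k' = k * r' * r := by
    calc k * k' = k * k' * k * (r' * r) := by
          conv_lhs => rw [← e2]
          simp only [mul_assoc]
      _ = _ := by rw [kkk, mul_assoc]
  refine ⟨e1, e3, by rw [e3, mul_assoc, ← t2], ?_⟩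
  rw [mul_assoc, e3, mul_assoc k, ← mul_assoc, e2]

namespace Datum

variable {N : ℕ} {P : Datum N} {n m : ℕ}

theorem IsBMW.lam_ne (hB : P.IsBMW) : P.q - P.q⁻¹ ≠ 0 := by
  intro h0
  apply hB.q_sq_ne_one
  have h1 : P.q = P.q⁻¹ := sub_eq_zero.1 h0
  calc P.q ^ 2 = P.q * P.q := pow_two _
    _ = P.q * P.q⁻¹ := by rw [← h1]
    _ = 1 := mul_inv_cancel₀ hB.q_ne_zero

theorem IsBMW.cubic (hB : P.IsBMW) :
    (P.R - P.q • 1) * (P.R + P.q⁻¹ • 1) * (P.R - P.mu • 1) = 0 := by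
  have h := minpoly.aeval ℂ P.R
  rw [hB.minimal] at h
  simpa [Algebra.algebraMap_eq_smul_one] using h

theorem kap_eq_siteHom (h : m + 1 < n) : P.kap n m = siteHom N h ((P.mu * (P.q - P.q⁻¹))⁻¹ •
    ((P.q • (1 : Op2 N) - P.R) * (P.q⁻¹ • (1 : Op2 N) + P.R))) := by
  rw [map_smul, map_mul, map_sub, map_add, map_smul, map_smul, map_one, siteHom_apply, kap]

theorem loc_kap {f : Fin m → Fin n} (hf : f.Injective) {i j : ℕ}
    (hr : loc f (site P.R m i) = site P.R n j) : loc f (P.kap m i) = P.kap n j := by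
  rw [← locHom_apply hf] at hr ⊢
  rw [kap, kap, map_smul, map_mul, map_sub, map_add, map_smul, map_smul, map_one, hr]

theorem site_mul_kap (hB : P.IsBMW) (h : m + 1 < n) :
    site P.R n m * P.kap n m = P.mu • P.kap n m ∧ P.kap n m * site P.R n m = P.mu • P.kap n m := by
  have h0 := hB.cubic
  rw [kap_eq_siteHom h, ← siteHom_apply h, ← map_mul, ← map_mul, ← map_smul]
  constructor <;> congr 1 <;> rw [← sub_eq_zero]
  · calc _ = -(P.mu * (P.q - P.q⁻¹))⁻¹ •
        ((P.R - P.q • 1) * (P.R + P.q⁻¹ • 1) * (P.R - P.mu • 1)) := by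
          simp only [mul_smul_comm, smul_mul_assoc, mul_add, add_mul, mul_sub, sub_mul, mul_one,
            one_mul, ← mul_assoc]
          module
      _ = 0 := by rw [h0, smul_zero]
  · calc _ = -(P.mu * (P.q - P.q⁻¹))⁻¹ •
        ((P.R - P.q • 1) * (P.R + P.q⁻¹ • 1) * (P.R - P.mu • 1)) := by
          simp only [mul_smul_comm, smul_mul_assoc, mul_add, add_mul, mul_sub, sub_mul, mul_one,
            one_mul, ← mul_assoc]
          module
      _ = 0 := by rw [h0, smul_zero]

theorem site_inv_eq (hR : IsUnit P.R) (hB : P.IsBMW) (h : m + 1 < n) :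
    site P.R⁻¹ n m =
      site P.R n m - (P.q - P.q⁻¹) • (1 : Op N n ℂ) + (P.q - P.q⁻¹) • P.kap n m := by
  have hm := hB.mu_ne_zero
  have hl := hB.lam_ne
  have hq := hB.q_ne_zero
  have e1 : site P.R n m * (site P.R n m - (P.q - P.q⁻¹) • (1 : Op N n ℂ) +
      (P.q - P.q⁻¹) • P.kap n m) = 1 := by
    rw [mul_add, mul_smul_comm, (site_mul_kap hB h).1, smul_smul, kap, smul_smul,
      mul_comm (P.q - P.q⁻¹), mul_inv_cancel₀ (mul_ne_zero hm hl), one_smul]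
    simp only [mul_add, mul_sub, add_mul, sub_mul, mul_smul_comm, smul_mul_assoc, mul_one, one_mul,
      smul_smul]
    have e2 : P.q⁻¹ • (P.q • (1 : Op N n ℂ) - site P.R n m) = 1 - P.q⁻¹ • site P.R n m := by
      rw [smul_sub, smul_smul, inv_mul_cancel₀ hq, one_smul]
    rw [e2]
    module
  calc site P.R⁻¹ n m = site P.R⁻¹ n m * (site P.R n m * (site P.R n m -
        (P.q - P.q⁻¹) • (1 : Op N n ℂ) + (P.q - P.q⁻¹) • P.kap n m)) := by rw [e1, mul_one]
    _ = _ := by rw [← mul_assoc, site_inv_mul hR h, one_mul]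

theorem kap_eq (hR : IsUnit P.R) (hB : P.IsBMW) (h : m + 1 < n) :
    P.kap n m = (P.q - P.q⁻¹)⁻¹ • (site P.R⁻¹ n m - site P.R n m) + 1 := by
  have h1 : site P.R⁻¹ n m - site P.R n m = (P.q - P.q⁻¹) • (P.kap n m - 1) := by
    rw [site_inv_eq hR hB h]; module
  rw [h1, smul_smul, inv_mul_cancel₀ hB.lam_ne, one_smul, sub_add_cancel]

theorem IsBMW.neighbours (hB : P.IsBMW) (hR : IsRMatrix P.R) (h : m + 2 < n) :
    (P.kap n (m + 1) * P.kap n m = P.kap n (m + 1) * site P.R n m * site P.R n (m + 1) ∧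
      P.kap n m * P.kap n (m + 1) = P.kap n m * site P.R n (m + 1) * site P.R n m ∧
      P.kap n m * P.kap n (m + 1) = site P.R n (m + 1) * site P.R n m * P.kap n (m + 1) ∧
      P.kap n (m + 1) * P.kap n m * P.kap n (m + 1) = P.kap n (m + 1)) ∧
    P.kap n m * P.kap n (m + 1) * P.kap n m = P.kap n m ∧
    P.kap n (m + 1) * P.kap n m = site P.R n m * site P.R n (m + 1) * P.kap n m ∧
    site P.R n m * site P.R n (m + 1) * site P.R n m =
      site P.R n (m + 1) * site P.R n m * site P.R n (m + 1) := by
  have hf := loc_three_injective h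
  have r1 := loc_three P.R h
  have r2 := loc_three P.R⁻¹ h
  have k1 := loc_kap hf r1.1
  have k2 := loc_kap hf r1.2
  have e1 := congrArg (locHom hf) hR.2
  have e2 := congrArg (locHom hf) hB.rel_pos
  have e3 := congrArg (locHom hf) hB.rel_neg
  have e4 := congrArg (locHom hf) hB.rel_kkk
  simp only [map_mul, locHom_apply, r1.1, r1.2, r2.1, r2.2, k1, k2] at e1 e2 e3 e4
  exact ⟨three_strands hB.lam_ne (site_mul_inv hR.1 (by omega)) (site_inv_mul hR.1 (by omega))
    (site_mul_inv hR.1 (by omega)) (site_inv_mul hR.1 (by omega)) (kap_eq hR.1 hB (by omega))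
    (kap_eq hR.1 hB (by omega)) e1 e2 e3 e4, e4, e2, e1⟩

theorem IsBMW.family (hB : P.IsBMW) (hR : IsRMatrix P.R) (n : ℕ) :
    BMWFamily P.q P.mu (n - 1) (site P.R n) (site P.R⁻¹ n) (P.kap n) where
  q_ne := hB.q_ne_zero
  lam_ne := hB.lam_ne
  mu_ne := hB.mu_ne_zero
  r_ri hi := site_mul_inv hR.1 (by omega)
  ri_r hi := site_inv_mul hR.1 (by omega)
  skein hi := site_inv_eq hR.1 hB (by omega)
  r_k hi := (site_mul_kap hB (by omega)).1
  k_r hi := (site_mul_kap hB (by omega)).2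
  braid := by
    rintro i j hi hj (rfl | rfl)
    · exact (hB.neighbours hR (by omega)).2.2.2
    · exact (hB.neighbours hR (by omega)).2.2.2.symm
  k_k_right := by
    rintro i j hi hj (rfl | rfl)
    · exact (hB.neighbours hR (by omega)).1.2.1
    · exact (hB.neighbours hR (by omega)).1.1
  k_k_left := by
    rintro i j hi hj (rfl | rfl)
    · exact (hB.neighbours hR (by omega)).1.2.2.1
    · exact (hB.neighbours hR (by omega)).2.2.1
  k_k_k := by
    rintro i j hi hj (rfl | rfl)
    · exact (hB.neighbours hR (by omega)).2.1
    · exact (hB.neighbours hR (by omega)).1.2.2.2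
  far hi hj ha := site_commute P.R P.R ha (by omega)

theorem asym_eq (n s : ℕ) : ∀ m, P.asym n s m = asymm P.q P.mu (site P.R n) (P.kap n) s m
  | 0 => rfl
  | 1 => rfl
  | m + 2 => by rw [asym, asymm, asym_eq n s (m + 1)]; rfl

/-- If the contractor vanished, `(R - q)(R + q⁻¹)` would annihilate `R`, against the cubic minimal
polynomial. -/
theorem kap_ne_zero (hB : P.IsBMW) : P.kap 2 0 ≠ 0 := by
  intro h0
  have hm := hB.mu_ne_zero
  have hl := hB.lam_ne
  have h1 : Function.Injective (siteHom N (n := 2) (m := 0) (by omega)) := by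
    intro X Y h
    rw [siteHom_apply, siteHom_apply] at h
    ext ⟨a, b⟩ ⟨c, d⟩
    have := congrFun (congrFun h ![a, b]) ![c, d]
    simpa [site, Fin.forall_fin_two] using this
  rw [kap_eq_siteHom (by omega), ← map_zero (siteHom N (n := 2) (m := 0) (by omega))] at h0
  have h2 := (smul_eq_zero.1 (h1 h0)).resolve_left (inv_ne_zero (mul_ne_zero hm hl))
  have h3 : Polynomial.aeval P.R ((Polynomial.X - Polynomial.C P.q) *
      (Polynomial.X + Polynomial.C P.q⁻¹)) = 0 := by
    have h4 : (P.R - P.q • 1) * (P.R + P.q⁻¹ • 1) = 0 := by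
      calc _ = -((P.q • (1 : Op2 N) - P.R) * (P.q⁻¹ • (1 : Op2 N) + P.R)) := by
            rw [← neg_mul, neg_sub, add_comm]
        _ = 0 := by rw [h2, neg_zero]
    simpa [Algebra.algebraMap_eq_smul_one] using h4
  have hne : (Polynomial.X - Polynomial.C P.q) * (Polynomial.X + Polynomial.C P.q⁻¹) ≠ 0 :=
    mul_ne_zero (Polynomial.X_sub_C_ne_zero _) (Polynomial.X_add_C_ne_zero _)
  have h5 := minpoly.dvd ℂ P.R h3
  have h6 := Polynomial.natDegree_le_of_dvd h5 hne
  rw [hB.minimal, Polynomial.natDegree_mul hne (Polynomial.X_sub_C_ne_zero _),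
    Polynomial.natDegree_X_sub_C] at h6
  omega

/-- Take the partial trace of the skein relation for `R₂⁻¹` and multiply by `K₁`. The traces of
`R₂`, `K₂` and `R₂⁻¹` then act on `K₁` by `1`, `μ` and `μ²`, and since `K₁ ≠ 0` a linear equation
for the trace of `D` is left. -/
theorem trace_matD (hP : IsCompatiblePair P.R P.F) (hB : P.IsBMW) :
    (matD P.R).trace = P.mu * P.eta := by
  have hR := hP.rmatrix_left
  have hm := hB.mu_ne_zero
  have hl := hB.lam_ne
  have hq := hB.q_ne_zero
  set d := (matD P.R).trace
  have F := hB.family hR 3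
  have hs := isSkewInverse_skewInv hP.strict_left
  have p1 : ptr (matD P.R) (site P.R 3 1) = 1 := by rw [matD_eq]; exact ptr_site_last hs
  have p0 : ptr (matD P.R) (1 : Op N 3 ℂ) = d • 1 := ptr_one _
  have eK : emb (P.kap 2 0) = P.kap 3 0 := loc_kap (Fin.castSucc_injective 2) (emb_site (by omega))
  have eR : emb (site P.R 2 0) = site P.R 3 0 := emb_site (by omega)
  have eRi : emb (site P.R⁻¹ 2 0) = site P.R⁻¹ 3 0 := emb_site (by omega)
  have kr := (site_mul_kap hB (n := 2) (m := 0) (by omega)).2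
  have kri : P.kap 2 0 * site P.R⁻¹ 2 0 = P.mu⁻¹ • P.kap 2 0 := by
    have : P.mu • (P.kap 2 0 * site P.R⁻¹ 2 0) = P.kap 2 0 := by
      rw [← smul_mul_assoc, ← kr, mul_assoc, site_mul_inv hR.1 (by omega), mul_one]
    rw [← this, smul_smul, inv_mul_cancel₀ hm, one_smul, this]
  have h1 : P.kap 2 0 * ptr (matD P.R) (P.kap 3 1) = P.mu • P.kap 2 0 := by
    rw [← ptr_emb_mul, eK, F.k_k_right (by omega) (by omega) (Or.inl rfl), ← eK, ← eR, ptr_mul_emb,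
      ptr_emb_mul, p1, mul_one, kr]
  have h2 : P.kap 2 0 * ptr (matD P.R) (site P.R⁻¹ 3 1) = (P.mu ^ 2) • P.kap 2 0 := by
    have : (P.kap 2 0 * ptr (matD P.R) (site P.R⁻¹ 3 1)) * site P.R⁻¹ 2 0 = P.mu • P.kap 2 0 := by
      rw [← ptr_emb_mul, ← ptr_mul_emb, eK, eRi, F.k_k_inv (by omega) (by omega) (Or.inl rfl), ← eK,
        ptr_emb_mul, h1]
    calc _ = (P.kap 2 0 * ptr (matD P.R) (site P.R⁻¹ 3 1)) * site P.R⁻¹ 2 0 * site P.R 2 0 := by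
          rw [mul_assoc, site_inv_mul hR.1 (by omega), mul_one]
      _ = _ := by rw [this, smul_mul_assoc, kr, smul_smul, pow_two]
  have h3 : ptr (matD P.R) (site P.R⁻¹ 3 1) = 1 - (P.q - P.q⁻¹) • (d • 1) +
      (P.q - P.q⁻¹) • ptr (matD P.R) (P.kap 3 1) := by
    rw [site_inv_eq hR.1 hB (by omega), ← p0, ← p1]
    change ptrHom 2 ℂ (matD P.R) _ = ptrHom 2 ℂ (matD P.R) _ -
      (P.q - P.q⁻¹) • ptrHom 2 ℂ (matD P.R) _ + (P.q - P.q⁻¹) • ptrHom 2 ℂ (matD P.R) _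
    rw [map_add, map_sub, map_smul, map_smul]
  have h4 := congrArg (P.kap 2 0 * ·) h3
  simp only [mul_add, mul_sub, mul_one, mul_smul_comm, h1, h2] at h4
  have h5 : (P.mu ^ 2 - 1 + (P.q - P.q⁻¹) * d - (P.q - P.q⁻¹) * P.mu) • P.kap 2 0 = 0 := by
    rw [← sub_eq_zero] at h4
    rw [← h4]
    module
  have h6 := (smul_eq_zero.1 h5).resolve_right (kap_ne_zero hB)
  have h7 : (P.q - P.q⁻¹) * d = (P.q - P.q⁻¹) * P.mu + 1 - P.mu ^ 2 := by linear_combination h6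
  have h8 : (P.q - P.q⁻¹) * (P.mu * P.eta) = (P.q - P.mu) * (P.q⁻¹ + P.mu) := by
    rw [eta, ← mul_assoc, mul_comm (P.q - P.q⁻¹), mul_div_cancel₀ _ (mul_ne_zero hm hl)]
  rw [← mul_right_inj' hl, h7, h8]
  field_simp
  ring

end Datum

end QMA

/-! ### Multiplicative traces on the braid algebras and the recursions for hooks. -/

namespace QMA

/-- The coefficient of the braid generator in `sigm`, at `x = q^{-2i}`. -/
noncomputable def coefR (q : ℂ) (i : ℕ) : ℂ := ((q ^ (2 * i))⁻¹ - 1) / (q - q⁻¹)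

/-- The coefficient of the contractor in `sigm`, at `x = q^{-2i}`. -/
noncomputable def coefK (q μ : ℂ) (i : ℕ) : ℂ :=
  ((q ^ (2 * i))⁻¹ - 1) / (q * μ⁻¹ * (q ^ (2 * i))⁻¹ + 1)

theorem sigm_eq {B : Type} [Ring B] [Algebra ℂ B] {q μ : ℂ} {r k : ℕ → B} (m i : ℕ) :
    sigm q μ r k m (q ^ (2 * i))⁻¹ = 1 + coefR q i • r m + coefK q μ i • k m := rfl

namespace Datum

variable {N : ℕ} {P : Datum N} {n m : ℕ}

theorem site_inv_mem (n m : ℕ) : site P.R⁻¹ n m ∈ P.braidAlg n := by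
  by_cases h : m + 1 < n
  · exact Algebra.subset_adjoin ⟨m, h, Or.inr rfl⟩
  · have h1 : site P.R⁻¹ n m = 1 := by unfold site; exact dif_neg h
    rw [h1]
    exact one_mem _

variable (P) in
/-- The generators of the represented braid group algebra. -/
noncomputable def br (n i : ℕ) : P.braidAlg n := ⟨site P.R n i, P.site_mem n i⟩

variable (P) in
/-- The inverses of the generators. -/
noncomputable def bri (n i : ℕ) : P.braidAlg n := ⟨site P.R⁻¹ n i, site_inv_mem n i⟩

variable (P) in
/-- The contractors. -/
noncomputable def bk (n i : ℕ) : P.braidAlg n := ⟨P.kap n i, P.kap_mem n i⟩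

variable (P) in
/-- The antisymmetrizers. -/
noncomputable def ba (n s i : ℕ) : P.braidAlg n := asymm P.q P.mu (P.br n) (P.bk n) s i

theorem coe_ba (n s i : ℕ) : (P.ba n s i : Op N n ℂ) = P.asym n s i := by
  rw [asym_eq]
  exact map_asymm (P.braidAlg n).val fun t _ => ⟨rfl, rfl⟩

theorem IsBMW.fam (hB : P.IsBMW) (hR : IsRMatrix P.R) (n : ℕ) :
    BMWFamily P.q P.mu (n - 1) (P.br n) (P.bri n) (P.bk n) :=
  BMWFamily.of_injective (P.braidAlg n).val Subtype.val_injective (hB.family hR n)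

theorem IsBMW.eta_ne (hB : P.IsBMW) : P.eta ≠ 0 := by
  have h1 : P.q - P.mu ≠ 0 := fun h => hB.mu_ne_q (sub_eq_zero.1 h).symm
  have h2 : P.q⁻¹ + P.mu ≠ 0 := fun h => hB.mu_ne_neg_q_inv (eq_neg_of_add_eq_zero_right h)
  exact div_ne_zero (mul_ne_zero h1 h2) (mul_ne_zero hB.mu_ne_zero hB.lam_ne)

/-- The first `m` strands. -/
noncomputable def incl (h : m ≤ n) : P.braidAlg m →ₐ[ℂ] P.braidAlg n :=
  ((locHom (Fin.castLE_injective h)).comp (P.braidAlg m).val).codRestrict (P.braidAlg n)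
    fun x => castLE_mem h x.2

/-- The last `n` strands. -/
noncomputable def shft (m : ℕ) : P.braidAlg n →ₐ[ℂ] P.braidAlg (n + m) :=
  ((locHom (addNat_injective n m)).comp (P.braidAlg n).val).codRestrict (P.braidAlg (n + m))
    fun x => shiftOp_mem m x.2

theorem incl_br (h : m ≤ n) {i : ℕ} (hi : i + 1 < m) : incl h (P.br m i) = P.br n i :=
  Subtype.ext (castLE_site P.R h hi)

theorem incl_bk (h : m ≤ n) {i : ℕ} (hi : i + 1 < m) : incl h (P.bk m i) = P.bk n i :=
  Subtype.ext (loc_kap (Fin.castLE_injective h) (castLE_site P.R h hi))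

theorem shft_br (m : ℕ) {i : ℕ} (hi : i + 1 < n) : shft m (P.br n i) = P.br (n + m) (i + m) :=
  Subtype.ext (shiftOp_site P.R m hi)

theorem shft_bk (m : ℕ) {i : ℕ} (hi : i + 1 < n) : shft m (P.bk n i) = P.bk (n + m) (i + m) :=
  Subtype.ext (loc_kap (addNat_injective n m) (shiftOp_site P.R m hi))

theorem incl_ba (h : m ≤ n) {s i : ℕ} (hi : s + i ≤ m) : incl h (P.ba m s i) = P.ba n s i :=
  map_asymm _ fun t ht => ⟨incl_br h (by omega), incl_bk h (by omega)⟩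

theorem shft_ba (m : ℕ) {s i : ℕ} (hi : s + i ≤ n) :
    shft m (P.ba n s i) = P.ba (n + m) (s + m) i :=
  map_asymm _ fun t ht => by
    rw [show s + m + t = s + t + m by omega]
    exact ⟨shft_br m (by omega), shft_bk m (by omega)⟩

theorem shft_desc (m : ℕ) {s i : ℕ} (hi : s + i < n) :
    shft m (desc (P.br n) s i) = desc (P.br (n + m)) (s + m) i :=
  map_desc _ fun t ht => by
    rw [show s + m + t = s + t + m by omega]
    exact shft_br m (by omega)

/-- A multiplicative family of traces on the represented braid group algebras. -/
structure TraceTower (P : Datum N) (E : Type) [CommRing E] [Algebra ℂ E] where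
  tr : ∀ n, P.braidAlg n →ₗ[ℂ] E
  tr_one : tr 0 1 = 1
  tr_comm : ∀ {n} (x y : P.braidAlg n), tr n (x * y) = tr n (y * x)
  tr_mul : ∀ {n m} (x : P.braidAlg m) (y : P.braidAlg n),
    tr (n + m) (incl (Nat.le_add_left m n) x * shft m y) = tr m x * tr n y

namespace TraceTower

variable {E : Type} [CommRing E] [Algebra ℂ E] (τ : P.TraceTower E)

/-- The image of the elementary symmetric functions. -/
noncomputable def al (i : ℕ) : E := τ.tr i (P.ba i 0 i)

/-- The image of the power sums. -/
noncomputable def pw (n : ℕ) : E := τ.tr n (desc (P.br n) 0 (n - 1))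

/-- The image of the contraction. -/
noncomputable def ga : E := P.eta⁻¹ • τ.tr 2 (P.bk 2 0)

/-- Traces of hooks, with the long row attached to the antisymmetrizer. -/
noncomputable def U (i n : ℕ) : E := τ.tr n (P.ba n 0 i * desc (P.br n) (i - 1) (n - i))

/-- Traces of disjoint products. -/
noncomputable def T (i n : ℕ) : E := τ.tr n (P.ba n 0 i * desc (P.br n) i (n - i - 1))

/-- Traces of hooks, with the long row attached by a contractor. -/
noncomputable def W (i n : ℕ) : E :=
  τ.tr n (P.ba n 0 i * P.bk n (i - 1) * desc (P.br n) i (n - i - 1))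

theorem al_zero : τ.al 0 = 1 := by
  rw [al, ba, asymm]; exact τ.tr_one

theorem T_eq {i w : ℕ} (hw : 1 ≤ w) : τ.T i (w + i) = τ.al i * τ.pw w := by
  rw [al, pw, ← τ.tr_mul, T, incl_ba _ (by omega), shft_desc i (by omega)]
  rw [Nat.zero_add, show w + i - i - 1 = w - 1 by omega]

theorem U_self (i : ℕ) : τ.U i i = τ.al i := by
  rw [U, al, Nat.sub_self, desc, mul_one]

variable (hB : P.IsBMW) (hR : IsRMatrix P.R)
include hB

theorem tr_bk : τ.tr 2 (P.bk 2 0) = P.eta • τ.ga := by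
  rw [ga, smul_smul, mul_inv_cancel₀ hB.eta_ne, one_smul]

/-- A contractor on two strands of its own contributes the factor `ch(κ₁) = η g`. -/
theorem tr_shft_mul (X : P.braidAlg m) :
    τ.tr (m + 2) (shft 2 X * P.bk (m + 2) 0) = P.eta • (τ.ga * τ.tr m X) := by
  have h1 := τ.tr_mul (P.bk 2 0) X
  rw [incl_bk _ (by omega), τ.tr_comm] at h1
  rw [h1, τ.tr_bk hB, smul_mul_assoc]

include hR

/-- By cyclicity the trace does not see the move, so a contracted pair in the middle can be split
off like one at the beginning. -/
theorem tr_move {i : ℕ} (hi : i ≤ m) (X : P.braidAlg m) :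
    τ.tr (m + 2) (moveTwo (P.br (m + 2)) i *
      (shft 2 X * (P.bk (m + 2) 0 * moveTwoInv (P.bri (m + 2)) i))) =
      P.eta • (τ.ga * τ.tr m X) := by
  rw [← τ.tr_shft_mul hB, ← mul_assoc (shft 2 X), τ.tr_comm, mul_assoc,
    (hB.fam hR (m + 2)).moveTwo_inv_mul (by omega), mul_one]

theorem kk {i : ℕ} (hi : i + 1 < n) : P.bk n i * P.bk n i = P.eta • P.bk n i :=
  (hB.fam hR n).k_k (by omega)

theorem move_mul {i j : ℕ} (hi : i ≤ m) (hj : j + 2 ≤ i) :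
    moveTwo (P.br (m + 2)) i * P.br (m + 2) (j + 2) = P.br (m + 2) j * moveTwo (P.br (m + 2)) i :=
  (hB.fam hR (m + 2)).moveTwo_semiconj (by omega) hj

theorem move_ba {i : ℕ} (hi : i ≤ m) :
    moveTwo (P.br (m + 2)) i * shft 2 (P.ba m 0 i) = P.ba (m + 2) 0 i * moveTwo (P.br (m + 2)) i := by
  rw [shft_ba 2 (by omega)]
  refine (hB.fam hR (m + 2)).semiconj_asymm fun t ht => ⟨by omega, by omega, ?_⟩
  rw [Nat.zero_add, Nat.zero_add, add_comm 2 t]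
  exact move_mul hB hR hi (by omega)

theorem move_desc {i w : ℕ} (hi : i + w < m) :
    moveTwo (P.br (m + 2)) i * shft 2 (desc (P.br m) i w) =
      desc (P.br (m + 2)) (i + 2) w * moveTwo (P.br (m + 2)) i := by
  rw [shft_desc 2 (by omega)]
  exact (desc_commute (r := P.br (m + 2)) fun t ht =>
    ((hB.fam hR (m + 2)).moveTwo_commute (by omega) (by omega)).symm).eq

/-- The antisymmetrizer before the pair and the descending product after it both pass through the
move and become their versions on two strands fewer. The pair is then split off. -/
theorem tr_move_mul {i w : ℕ} (hi : i + w < m) (x : P.braidAlg m) (y : P.braidAlg (m + 2))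
    (hy : moveTwo (P.br (m + 2)) i * (shft 2 x * (P.bk (m + 2) 0 * moveTwoInv (P.bri (m + 2)) i)) = y) :
    τ.tr (m + 2) (desc (P.br (m + 2)) (i + 2) w * (P.ba (m + 2) 0 i * y)) =
      P.eta • (τ.ga * τ.tr m (desc (P.br m) i w * (P.ba m 0 i * x))) := by
  rw [← τ.tr_move hB hR (i := i) (by omega), map_mul (shft 2), map_mul (shft 2), ← hy]
  congr 1
  simp only [← mul_assoc]
  rw [move_desc hB hR hi, mul_assoc (desc _ _ _) (moveTwo _ _) (shft 2 _), move_ba hB hR (by omega)]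
  simp only [mul_assoc]

-- As `y` commutes with the idempotent `a`, cyclicity merges the two copies of `a`, and the three
-- terms of the baxterized element separate.
omit hB hR in
theorem tr_sandwich {i s : ℕ} {a y : P.braidAlg n} (ha : a * a = a) (hy : Commute a y) :
    τ.tr n (a * sigm P.q P.mu (P.br n) (P.bk n) s (P.q ^ (2 * i))⁻¹ * a * y) =
      τ.tr n (a * y) + coefR P.q i • τ.tr n (a * (P.br n s * y)) +
        coefK P.q P.mu i • τ.tr n (a * (P.bk n s * y)) := by
  rw [mul_assoc, hy.eq, ← mul_assoc, τ.tr_comm, ← mul_assoc, ← mul_assoc, ha, sigm_eq, hy.eq.symm]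
  simp only [mul_add, add_mul, mul_one, mul_smul_comm, smul_mul_assoc, map_add, map_smul, mul_assoc]

variable {k : ℕ} (hn : ∀ t, 2 ≤ t → t ≤ k → qnum P.q t ≠ 0)
  (hd : ∀ t, 1 ≤ t → t < k → P.q * (P.q ^ (2 * t))⁻¹ + P.mu ≠ 0)
include hn hd

theorem ba_mul_self {s i : ℕ} (hin : s + i ≤ n - 1 + 1) (hk : i ≤ k) :
    P.ba n s i * P.ba n s i = P.ba n s i :=
  (hB.fam hR n).asymm_mul_self hin (fun t h1 h2 => hn t h1 (by omega))
    (fun t h1 h2 => hd t h1 (by omega))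

theorem tr_absorb {i : ℕ} (hi : 1 ≤ i) (hin : i < n) (hk : i < k) (y : P.braidAlg n)
    (hy : Commute (P.ba n 0 i) y) :
    qnum P.q (i + 1) • τ.tr n (P.ba n 0 (i + 1) * y) = P.q ^ i •
      (τ.tr n (P.ba n 0 i * y) + coefR P.q i • τ.tr n (P.ba n 0 i * (P.br n (i - 1) * y)) +
        coefK P.q P.mu i • τ.tr n (P.ba n 0 i * (P.bk n (i - 1) * y))) := by
  obtain ⟨i, rfl⟩ : ∃ j, i = j + 1 := ⟨i - 1, by omega⟩
  rw [← τ.tr_sandwich (ba_mul_self hB hR hn hd (by omega) (by omega)) hy]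
  have e : P.ba n 0 (i + 1 + 1) = (P.q ^ (i + 1) / qnum P.q (i + 1 + 1)) •
      (P.ba n 0 (i + 1) * sigm P.q P.mu (P.br n) (P.bk n) i (P.q ^ (2 * (i + 1)))⁻¹ *
        P.ba n 0 (i + 1)) := by
    rw [ba, asymm, Nat.zero_add]; rfl
  rw [e, smul_mul_assoc, map_smul, smul_smul, mul_div_cancel₀ _ (hn _ (by omega) (by omega))]
  rfl

theorem ba_commute {i j : ℕ} (hij : i ≤ j) (hj : j + 1 < n) {y : P.braidAlg n}
    (hy : y = P.br n j ∨ y = P.bk n j) : Commute (P.ba n 0 i) y :=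
  (hB.fam hR n).asymm_commute (by omega) (by omega) (by omega)
    (hy.imp id fun h => Or.inr h)

theorem ba_commute_desc {i j w : ℕ} (hij : i ≤ j) (hj : j + w < n) :
    Commute (P.ba n 0 i) (desc (P.br n) j w) :=
  desc_commute fun t ht => ba_commute hB hR hn hd (by omega) (by omega) (Or.inl rfl)

/-- By cyclicity the lowest crossing of the attached row is placed next to the antisymmetrizer,
where the expansion of the next antisymmetrizer produces it. -/
theorem U_eq {i : ℕ} (hi : 1 ≤ i) (hin : i < n) :
    τ.U i n = τ.tr n (P.ba n 0 i * (P.br n (i - 1) * desc (P.br n) i (n - i - 1))) := by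
  have hc := ba_commute_desc hB hR hn hd (n := n) (i := i) (j := i) (w := n - i - 1) le_rfl (by omega)
  have e : desc (P.br n) (i - 1) (n - i) = desc (P.br n) i (n - i - 1) * P.br n (i - 1) := by
    rw [show n - i = n - i - 1 + 1 by omega, desc_succ', show i - 1 + 1 = i by omega]; rfl
  rw [U, e, τ.tr_comm _ (_ * desc _ _ _), mul_assoc, ← hc.eq, ← mul_assoc, τ.tr_comm, ← mul_assoc]

/-- The recursion for hooks. -/
theorem U_succ {i : ℕ} (hi : 1 ≤ i) (hin : i < n) (hk : i < k) :
    qnum P.q (i + 1) • τ.U (i + 1) n =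
      P.q ^ i • (τ.T i n + coefR P.q i • τ.U i n + coefK P.q P.mu i • τ.W i n) := by
  have hc := ba_commute_desc hB hR hn hd (n := n) (i := i) (j := i) (w := n - i - 1) le_rfl (by omega)
  rw [τ.U_eq hB hR hn hd hi hin, U, Nat.add_sub_cancel, ← Nat.sub_sub,
    τ.tr_absorb hB hR hn hd hi hin hk _ hc, T, W, mul_assoc]

/-- The recursion for hooks stops at the height. -/
theorem U_height {i : ℕ} (hi : i + 1 = k) (hin : k < n)
    (hz : P.ba n 0 k * sigm P.q P.mu (P.br n) (P.bk n) i (P.q ^ (2 * k))⁻¹ * P.ba n 0 k = 0) :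
    τ.T k n + coefR P.q k • τ.U k n + coefK P.q P.mu k • τ.W k n = 0 := by
  have hc := ba_commute_desc hB hR hn hd (n := n) (i := k) (j := k) (w := n - k - 1) le_rfl (by omega)
  have h1 := τ.tr_sandwich (s := i) (i := k) (ba_mul_self hB hR hn hd (s := 0) (n := n) (by omega) le_rfl) hc
  rw [hz, zero_mul, map_zero] at h1
  rw [τ.U_eq hB hR hn hd (by omega) hin, T, W, h1, mul_assoc, show k - 1 = i by omega]

/-- The boundary case, with no cycle beyond the contracted pair. Multiplication by `η` doubles the
contractor, so that `1`, `r` and `k` stand between two contractors and contribute `η`, `μ⁻¹` and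
`1`. -/
theorem W_self {i : ℕ} (hi : 1 ≤ i) (hk : i < k) :
    qnum P.q (i + 1) • τ.W (i + 1) (i + 2) =
      (P.q ^ i * (P.eta + coefR P.q i * P.mu⁻¹ + coefK P.q P.mu i)) • (τ.ga * τ.al i) := by
  obtain ⟨i, rfl⟩ : ∃ j, i = j + 1 := ⟨i - 1, by omega⟩
  have h := hB.fam hR (i + 1 + 2)
  have hc : Commute (P.ba (i + 1 + 2) 0 (i + 1)) (P.bk (i + 1 + 2) (i + 1)) :=
    ba_commute hB hR hn hd le_rfl (by omega) (Or.inr rfl)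
  have e : τ.W (i + 1 + 1) (i + 1 + 2) =
      τ.tr _ (P.ba (i + 1 + 2) 0 (i + 1 + 1) * P.bk (i + 1 + 2) (i + 1)) := by
    rw [W, show i + 1 + 2 - (i + 1 + 1) - 1 = 0 by omega, desc, mul_one]; rfl
  have hkk := kk hB hR (n := i + 1 + 2) (i := i + 1) (by omega)
  have base : τ.tr (i + 1 + 2) (P.ba (i + 1 + 2) 0 (i + 1) * P.bk (i + 1 + 2) (i + 1)) =
      P.eta • (τ.ga * τ.al (i + 1)) := by
    have := τ.tr_move hB hR (i := i + 1) (m := i + 1) le_rfl (P.ba (i + 1) 0 (i + 1))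
    rw [← mul_assoc, move_ba hB hR le_rfl, mul_assoc, h.move_k (by omega)] at this
    exact this
  have red : ∀ x : P.braidAlg (i + 1 + 2), ∀ c : ℂ,
      P.bk (i + 1 + 2) (i + 1) * x * P.bk (i + 1 + 2) (i + 1) = c • P.bk (i + 1 + 2) (i + 1) →
      τ.tr _ (P.ba (i + 1 + 2) 0 (i + 1) * (x * P.bk (i + 1 + 2) (i + 1))) =
        c • (τ.ga * τ.al (i + 1)) := by
    intro x c hx
    have h1 : P.eta • τ.tr _ (P.ba (i + 1 + 2) 0 (i + 1) * (x * P.bk (i + 1 + 2) (i + 1))) =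
        P.eta • (c • (τ.ga * τ.al (i + 1))) := by
      rw [smul_comm P.eta c, ← base, ← map_smul, ← map_smul, ← mul_smul_comm, ← mul_smul_comm,
        ← mul_smul_comm, ← hkk, ← hx, ← mul_assoc x, ← mul_assoc, τ.tr_comm, ← mul_assoc, ← hc.eq]
      simp only [mul_assoc]
    exact smul_right_injective E hB.eta_ne h1
  rw [e, τ.tr_absorb hB hR hn hd (by omega) (by omega) hk _ hc, Nat.add_sub_cancel,
    red (P.br _ i) P.mu⁻¹ (h.k_r_k (by omega) (by omega) (Or.inr rfl)),
    red (P.bk _ i) 1 (by rw [one_smul]; exact h.k_k_k (by omega) (by omega) (Or.inr rfl)), base]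
  module

theorem W_one_two : τ.W 1 2 = P.eta • τ.ga := by
  rw [← τ.tr_bk hB, W, ba, asymm, one_mul]
  change τ.tr 2 (P.bk 2 0 * 1) = _
  rw [mul_one]

/-- Doubling the contractor encloses the one crossing that ties it to the cycle. It contributes
`μ⁻¹`, and the contracted pair becomes disjoint from the rest. -/
theorem W_one {m : ℕ} (hm : 1 ≤ m) : τ.W 1 (m + 2) = P.mu⁻¹ • (τ.ga * τ.pw m) := by
  have h := hB.fam hR (m + 2)
  have hkk := kk hB hR (n := m + 2) (i := 0) (by omega)
  have hc : Commute (P.bk (m + 2) 0) (desc (P.br (m + 2)) 2 (m - 1)) :=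
    desc_commute fun t ht => h.far_k (by omega) (by omega) (Or.inl (by omega)) (Or.inr (Or.inr rfl))
      (Or.inl rfl)
  have h1 : P.eta • τ.W 1 (m + 2) = P.eta • (P.mu⁻¹ • (τ.ga * τ.pw m)) := by
    rw [smul_comm P.eta, pw, ← τ.tr_shft_mul hB, shft_desc 2 (by omega), W, ba, asymm, one_mul,
      ← map_smul, ← map_smul, ← smul_mul_assoc, ← mul_smul_comm,
      ← h.k_r_k (i := 0) (j := 1) (by omega) (by omega) (Or.inl rfl), Nat.sub_self, ← hkk,
      show m + 2 - 1 - 1 = m - 1 + 1 by omega, desc_succ', mul_assoc, τ.tr_comm]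
    rw [Nat.zero_add, show 1 + 1 = 2 from rfl, ← mul_assoc, hc.eq]
    simp only [mul_assoc]
  exact smul_right_injective E hB.eta_ne h1

/-- The recursion for the contracted hooks. -/
theorem W_succ {i : ℕ} (hi : 1 ≤ i) (hm : i < m) (hk : i < k) :
    qnum P.q (i + 1) • τ.W (i + 1) (m + 2) = P.q ^ i • (τ.ga *
      (P.mu⁻¹ • τ.T i m + coefR P.q i • (τ.W i m - (P.q - P.q⁻¹) • τ.U i m +
        ((P.q - P.q⁻¹) * P.mu⁻¹) • τ.T i m) + coefK P.q P.mu i • τ.U i m)) := by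
  obtain ⟨i, rfl⟩ : ∃ j, i = j + 1 := ⟨i - 1, by omega⟩
  have h := hB.fam hR (m + 2)
  set a := P.ba (m + 2) 0 (i + 1) with ha
  set D := desc (P.br (m + 2)) (i + 3) (m - (i + 1) - 1) with hD
  set K := P.bk (m + 2) with hK
  set R := P.br (m + 2) with hRR
  have hcK : Commute a (K (i + 1)) := ba_commute hB hR hn hd le_rfl (by omega) (Or.inr rfl)
  have hcR : Commute a (R (i + 2)) := ba_commute hB hR hn hd (by omega) (by omega) (Or.inl rfl)
  have hcD : Commute a D := ba_commute_desc hB hR hn hd (by omega) (by omega)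
  have hKD : Commute (K (i + 1)) D := desc_commute fun t ht =>
    h.far_k (by omega) (by omega) (Or.inl (by omega)) (Or.inr (Or.inr rfl)) (Or.inl rfl)
  have hkk : K (i + 1) * K (i + 1) = P.eta • K (i + 1) := kk hB hR (by omega)
  have e : τ.W (i + 1 + 1) (m + 2) =
      τ.tr _ (P.ba (m + 2) 0 (i + 1 + 1) * (K (i + 1) * (D * R (i + 2)))) := by
    rw [W, show m + 2 - (i + 1 + 1) - 1 = m - (i + 1) - 1 + 1 by omega, desc_succ', mul_assoc]; rfl
  -- Multiplication by `η` doubles the contractor, and cyclicity carries one copy around, so that `R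
  -- (i + 2) * x` stands between two contractors.
  have red : ∀ x y : P.braidAlg (m + 2), K (i + 1) * (R (i + 2) * (x * K (i + 1))) = y →
      P.eta • τ.tr _ (a * (x * (K (i + 1) * (D * R (i + 2))))) = τ.tr _ (D * (a * y)) := by
    intro x y hy
    rw [← hy, ← map_smul, ← mul_smul_comm, ← mul_smul_comm, ← smul_mul_assoc, ← hkk]
    rw [← mul_assoc, mul_assoc (K _), ← mul_assoc (a * x), τ.tr_comm (a * x * K (i + 1))]
    congr 1
    calc _ = (K (i + 1) * D) * (R (i + 2) * a) * (x * K (i + 1)) := by simp only [mul_assoc]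
      _ = D * (K (i + 1) * a) * (R (i + 2) * (x * K (i + 1))) := by
        rw [hKD.eq, ← hcR.eq]; simp only [mul_assoc]
      _ = _ := by rw [← hcK.eq]; simp only [mul_assoc]
  have mv : ∀ (x : P.braidAlg m) (y : P.braidAlg (m + 2)), moveTwo R (i + 1) *
      (shft 2 x * (K 0 * moveTwoInv (P.bri (m + 2)) (i + 1))) = y →
      τ.tr _ (D * (a * y)) = P.eta • (τ.ga *
        τ.tr m (desc (P.br m) (i + 1) (m - (i + 1) - 1) * (P.ba m 0 (i + 1) * x))) :=
    fun x y hy => τ.tr_move_mul hB hR (by omega) x y hy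
  have hcd := ba_commute_desc hB hR hn hd (n := m) (i := i + 1) (j := i + 1) (w := m - (i + 1) - 1)
    le_rfl (by omega)
  -- The words that occur are images, under the move of a contracted pair, of `1`, `r i` and `k i`
  -- on `m` strands. They give `T`, `U` and `W` there.
  have m1 := mv 1 (K (i + 1)) (by rw [map_one, one_mul]; exact h.move_k (i := i + 1) (by omega))
  have m2 := mv (P.br m i) (K (i + 1) * (R (i + 2) * (K i * K (i + 1)))) (by rw [shft_br 2 (by omega)]; exact h.move_r (i := i) (by omega))
  have m3 := mv (P.bk m i) (K (i + 1) * (K i * (K (i + 2) * K (i + 1)))) (by rw [shft_bk 2 (by omega)]; exact h.move_kk (i := i) (by omega))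
  rw [mul_one, ← hcd.eq] at m1
  rw [τ.tr_comm (desc (P.br m) _ _), mul_assoc] at m2 m3
  change _ = P.eta • (τ.ga * τ.T (i + 1) m) at m1
  have eU := τ.U_eq hB hR hn hd (i := i + 1) (n := m) (by omega) hm
  have eW : τ.W (i + 1) m =
      τ.tr m (P.ba m 0 (i + 1) * (P.bk m i * desc (P.br m) (i + 1) (m - (i + 1) - 1))) := by
    rw [W, mul_assoc]; rfl
  rw [Nat.add_sub_cancel] at eU
  rw [← eU] at m2
  rw [← eW] at m3
  -- For the three terms of the baxterized element: `1` leaves a multiple of the contractor, `r i`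
  -- needs the four-strand reduction, and `k i` gives the word of `m2` itself.
  have r1 := red 1 _ rfl
  have r2 := red (R i) _ (h.k_r_r_k (l := i) (c := i + 1) (u := i + 2) (by omega) (by omega)
    (by omega) rfl rfl)
  have r3 := red (K i) _ rfl
  have er : K (i + 1) * (R (i + 2) * K (i + 1)) = P.mu⁻¹ • K (i + 1) := by
    rw [← mul_assoc]; exact h.k_r_k (by omega) (by omega) (Or.inl rfl)
  rw [one_mul, one_mul, er] at r1
  simp only [mul_add, mul_sub, mul_smul_comm, map_add, map_sub, map_smul, m1, m2, m3] at r1 r2 r3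
  have h1 : P.eta • (qnum P.q (i + 1 + 1) • τ.W (i + 1 + 1) (m + 2)) = P.eta • (P.q ^ (i + 1) • (τ.ga *
      (P.mu⁻¹ • τ.T (i + 1) m + coefR P.q (i + 1) • (τ.W (i + 1) m - (P.q - P.q⁻¹) • τ.U (i + 1) m +
        ((P.q - P.q⁻¹) * P.mu⁻¹) • τ.T (i + 1) m) + coefK P.q P.mu (i + 1) • τ.U (i + 1) m))) := by
    have ab : qnum P.q (i + 1 + 1) • τ.W (i + 1 + 1) (m + 2) = P.q ^ (i + 1) •
        (τ.tr (m + 2) (a * (K (i + 1) * (D * R (i + 2)))) + coefR P.q (i + 1) •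
          τ.tr (m + 2) (a * (R i * (K (i + 1) * (D * R (i + 2))))) + coefK P.q P.mu (i + 1) •
          τ.tr (m + 2) (a * (K i * (K (i + 1) * (D * R (i + 2)))))) := by
      rw [e]
      exact τ.tr_absorb hB hR hn hd (by omega) (by omega) hk _ (hcK.mul_right (hcD.mul_right hcR))
    rw [ab]
    simp only [mul_add, mul_sub, mul_smul_comm]
    linear_combination (norm := module) (P.q ^ (i + 1)) • r1 +
      (P.q ^ (i + 1) * coefR P.q (i + 1)) • r2 + (P.q ^ (i + 1) * coefK P.q P.mu (i + 1)) • r3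
  exact smul_right_injective E hB.eta_ne h1

end TraceTower

end Datum

end QMA

/-! ### Antisymmetrizers of rank one and nested contractors. -/

namespace QMA

theorem exists_vecMulVec {m : Type} [Fintype m] [DecidableEq m] {X : Matrix m m ℂ} (h : X.rank = 1) :
    ∃ u v : m → ℂ, X = Matrix.vecMulVec u v := by
  obtain ⟨⟨u, hu⟩, -, hv⟩ := finrank_eq_one_iff'.1 h
  have h1 : ∀ j, ∃ c : ℂ, c • u = X.mulVec (Pi.single j 1) := by
    intro j
    obtain ⟨c, hc⟩ := hv ⟨X.mulVec (Pi.single j 1), ⟨Pi.single j 1, rfl⟩⟩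
    exact ⟨c, congrArg Subtype.val hc⟩
  choose v hv using h1
  refine ⟨u, v, ?_⟩
  ext i j
  have := congrFun (hv j) i
  rw [Matrix.vecMulVec_apply, mul_comm]
  simpa using this.symm

theorem sandwich_vecMulVec {m : Type} [Fintype m] (u v : m → ℂ) (X : Matrix m m ℂ) :
    ∃ s : ℂ, Matrix.vecMulVec u v * X * Matrix.vecMulVec u v = s • Matrix.vecMulVec u v := by
  refine ⟨dotProduct (Matrix.vecMul v X) u, ?_⟩
  rw [Matrix.vecMulVec_mul, Matrix.vecMulVec_mul_vecMulVec]
  ext i j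
  simp [Matrix.vecMulVec_apply]
  ring

namespace Datum

variable {N : ℕ} {P : Datum N} {n m : ℕ}

theorem incl_commute_shft {h : m ≤ n + m} (x : P.braidAlg m) (y : P.braidAlg n) :
    Commute (incl h x) (shft m y) :=
  Subtype.ext (loc_commute (Fin.castLE_injective h) (addNat_injective n m)
    (fun s t hst => by
      have := congrArg Fin.val hst
      simp at this
      omega) fun _ _ _ _ => Commute.all _ _).eq

theorem bk_zero_commute_shft (y : P.braidAlg n) : Commute (P.bk (n + 2) 0) (shft 2 y) := by
  have := incl_commute_shft (h := Nat.le_add_left 2 n) (P.bk 2 0) y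
  rwa [incl_bk _ (by omega)] at this

/-- If the highest antisymmetrizer has rank one, it is also a rank one operator in any pair of
disjoint positions. -/
theorem ba_sandwich {k : ℕ} (hk : (P.asym k 0 k).rank = 1) (hn : n = k + k) (X : P.braidAlg n) :
    ∃ s : ℂ, P.ba n 0 k * P.ba n k k * X * (P.ba n 0 k * P.ba n k k) =
      s • (P.ba n 0 k * P.ba n k k) := by
  subst hn
  obtain ⟨u, v, huv⟩ := exists_vecMulVec hk
  have h1 : ((P.ba (k + k) 0 k * P.ba (k + k) k k : P.braidAlg (k + k)) : Op N (k + k) ℂ) =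
      Matrix.vecMulVec (fun i => u (i ∘ Fin.castLE (Nat.le_add_left k k)) * u (i ∘ fun t => Fin.addNat t k))
        (fun i => v (i ∘ Fin.castLE (Nat.le_add_left k k)) * v (i ∘ fun t => Fin.addNat t k)) := by
    have e1 : P.ba (k + k) 0 k = incl (Nat.le_add_left k k) (P.ba k 0 k) := (incl_ba _ (by omega)).symm
    have e2 : P.ba (k + k) k k = shft k (P.ba k 0 k) := by
      rw [shft_ba k (by omega), Nat.zero_add]
    rw [e1, e2]
    change loc _ (P.ba k 0 k : Op N k ℂ) * loc _ (P.ba k 0 k : Op N k ℂ) = _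
    rw [coe_ba, huv]
    ext i j
    rw [loc_mul_loc_apply (Fin.castLE_injective _) (fun s t hst => by
      have := congrArg Fin.val hst
      simp at this
      omega), if_pos]
    · simp only [Matrix.vecMulVec_apply]
      ring
    · intro t h1 h2
      exfalso
      rcases Nat.lt_or_ge t.val k with h3 | h3
      · exact h1 ⟨⟨t, h3⟩, rfl⟩
      · exact h2 ⟨⟨t - k, by omega⟩, Fin.ext (by simp; omega)⟩
  obtain ⟨s, hs⟩ := sandwich_vecMulVec
    (fun i => u (i ∘ Fin.castLE (Nat.le_add_left k k)) * u (i ∘ fun t => Fin.addNat t k))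
    (fun i => v (i ∘ Fin.castLE (Nat.le_add_left k k)) * v (i ∘ fun t => Fin.addNat t k))
    (X : Op N (k + k) ℂ)
  refine ⟨s, Subtype.ext ?_⟩
  rw [MulMemClass.coe_mul, MulMemClass.coe_mul, h1, hs]
  rw [← h1]
  rfl

variable (P) in
/-- The nested contractor on `2j` strands. -/
noncomputable def nest : ∀ j, P.braidAlg (2 * j)
  | 0 => 1
  | j + 1 => moveTwo (P.br (2 * j + 2)) j * (shft 2 (nest j) *
      (P.bk (2 * j + 2) 0 * moveTwoInv (P.bri (2 * j + 2)) j))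

variable (P) in
/-- The factor by which nested contractors absorb antisymmetrizers. -/
noncomputable def nestC (j : ℕ) : ℂ :=
  P.q ^ j / qnum P.q (j + 1) * (P.eta + coefR P.q j * P.mu⁻¹ + coefK P.q P.mu j)

namespace TraceTower

variable {E : Type} [CommRing E] [Algebra ℂ E] (τ : P.TraceTower E)
variable (hB : P.IsBMW) (hR : IsRMatrix P.R)
include hB hR

/-- By `move_k` the moved contractor is the contractor at the place `i`, so the product is an
instance of `k² = η k`. -/
theorem bk_mul_move {i : ℕ} (hi : i ≤ m) (X : P.braidAlg m) :
    P.bk (m + 2) i * (moveTwo (P.br (m + 2)) i *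
      (shft 2 X * (P.bk (m + 2) 0 * moveTwoInv (P.bri (m + 2)) i))) =
    P.eta • (moveTwo (P.br (m + 2)) i *
      (shft 2 X * (P.bk (m + 2) 0 * moveTwoInv (P.bri (m + 2)) i))) := by
  have h := hB.fam hR (m + 2)
  have hc := bk_zero_commute_shft X
  have hkk := kk hB hR (n := m + 2) (i := 0) (by omega)
  rw [← h.move_k (i := i) (by omega)]
  calc _ = moveTwo (P.br (m + 2)) i * (P.bk (m + 2) 0 * ((moveTwoInv (P.bri (m + 2)) i *
        moveTwo (P.br (m + 2)) i) * (shft 2 X * (P.bk (m + 2) 0 * moveTwoInv (P.bri (m + 2)) i)))) := by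
        simp only [mul_assoc]
    _ = moveTwo (P.br (m + 2)) i * (shft 2 X * ((P.bk (m + 2) 0 * P.bk (m + 2) 0) *
        moveTwoInv (P.bri (m + 2)) i)) := by
      rw [h.moveTwo_inv_mul (by omega), one_mul, ← mul_assoc (P.bk _ 0) (shft 2 X), hc.eq]
      simp only [mul_assoc]
    _ = _ := by rw [hkk]; simp only [smul_mul_assoc, mul_smul_comm]

theorem move_mul_bk {i : ℕ} (hi : i ≤ m) (X : P.braidAlg m) :
    moveTwo (P.br (m + 2)) i *
      (shft 2 X * (P.bk (m + 2) 0 * moveTwoInv (P.bri (m + 2)) i)) * P.bk (m + 2) i =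
    P.eta • (moveTwo (P.br (m + 2)) i *
      (shft 2 X * (P.bk (m + 2) 0 * moveTwoInv (P.bri (m + 2)) i))) := by
  have h := hB.fam hR (m + 2)
  have hkk := kk hB hR (n := m + 2) (i := 0) (by omega)
  rw [← h.move_k (i := i) (by omega)]
  calc _ = moveTwo (P.br (m + 2)) i * (shft 2 X * (P.bk (m + 2) 0 * ((moveTwoInv (P.bri (m + 2)) i *
        moveTwo (P.br (m + 2)) i) * (P.bk (m + 2) 0 * moveTwoInv (P.bri (m + 2)) i)))) := by
        simp only [mul_assoc]
    _ = moveTwo (P.br (m + 2)) i * (shft 2 X * ((P.bk (m + 2) 0 * P.bk (m + 2) 0) *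
        moveTwoInv (P.bri (m + 2)) i)) := by
      rw [h.moveTwo_inv_mul (by omega), one_mul]
      simp only [mul_assoc]
    _ = _ := by rw [hkk]; simp only [smul_mul_assoc, mul_smul_comm]

theorem move_mul_move {i : ℕ} (hi : i ≤ m) (X Y : P.braidAlg m) :
    (moveTwo (P.br (m + 2)) i *
      (shft 2 X * (P.bk (m + 2) 0 * moveTwoInv (P.bri (m + 2)) i))) * (moveTwo (P.br (m + 2)) i *
      (shft 2 Y * (P.bk (m + 2) 0 * moveTwoInv (P.bri (m + 2)) i))) = P.eta • (moveTwo (P.br (m + 2)) i *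
      (shft 2 (X * Y) * (P.bk (m + 2) 0 * moveTwoInv (P.bri (m + 2)) i))) := by
  have h := hB.fam hR (m + 2)
  have hc := bk_zero_commute_shft Y
  have hkk := kk hB hR (n := m + 2) (i := 0) (by omega)
  calc _ = moveTwo (P.br (m + 2)) i * (shft 2 X * (P.bk (m + 2) 0 * ((moveTwoInv (P.bri (m + 2)) i *
        moveTwo (P.br (m + 2)) i) * (shft 2 Y * (P.bk (m + 2) 0 * moveTwoInv (P.bri (m + 2)) i))))) := by
        simp only [mul_assoc]
    _ = moveTwo (P.br (m + 2)) i * (shft 2 X * (shft 2 Y * ((P.bk (m + 2) 0 * P.bk (m + 2) 0) *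
        moveTwoInv (P.bri (m + 2)) i))) := by
      rw [h.moveTwo_inv_mul (by omega), one_mul, ← mul_assoc (P.bk _ 0) (shft 2 Y), hc.eq]
      simp only [mul_assoc]
    _ = _ := by rw [hkk, map_mul]; simp only [smul_mul_assoc, mul_smul_comm, mul_assoc]

theorem ba_mul_move {i : ℕ} (hi : i ≤ m) (X : P.braidAlg m) :
    P.ba (m + 2) 0 i * (moveTwo (P.br (m + 2)) i *
      (shft 2 X * (P.bk (m + 2) 0 * moveTwoInv (P.bri (m + 2)) i))) = moveTwo (P.br (m + 2)) i *
      (shft 2 (P.ba m 0 i * X) * (P.bk (m + 2) 0 * moveTwoInv (P.bri (m + 2)) i)) := by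
  rw [← mul_assoc, ← move_ba hB hR hi, map_mul]
  simp only [mul_assoc]

variable {k : ℕ} (hn : ∀ t, 2 ≤ t → t ≤ k → qnum P.q t ≠ 0)
  (hd : ∀ t, 1 ≤ t → t < k → P.q * (P.q ^ (2 * t))⁻¹ + P.mu ≠ 0)
include hn hd

/-- Contracting the last strand of an antisymmetrizer gives back the one of lower order. Only the
inner baxterized element meets the contractors, and its three terms contribute `η`, `μ⁻¹` and `1`.
-/
theorem bk_ba_bk {j : ℕ} (hj : j < k) (hjn : j + 1 < n) :
    P.bk n j * P.ba n 0 (j + 1) * P.bk n j = P.nestC j • (P.ba n 0 j * P.bk n j) := by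
  have h := hB.fam hR n
  have hkk := kk hB hR (n := n) (i := j) hjn
  rcases Nat.eq_zero_or_pos j with rfl | hj0
  · rw [ba, asymm, ba, asymm, mul_one, one_mul, hkk, nestC]
    congr 1
    simp [coefR, coefK, qnum_one _ hB.lam_ne]
  · obtain ⟨i, rfl⟩ : ∃ i, j = i + 1 := ⟨j - 1, by omega⟩
    have e : P.ba n 0 (i + 1 + 1) = (P.q ^ (i + 1) / qnum P.q (i + 1 + 1)) •
        (P.ba n 0 (i + 1) * sigm P.q P.mu (P.br n) (P.bk n) i (P.q ^ (2 * (i + 1)))⁻¹ *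
          P.ba n 0 (i + 1)) := by
      rw [ba, asymm, Nat.zero_add]; rfl
    have hc : Commute (P.ba n 0 (i + 1)) (P.bk n (i + 1)) :=
      ba_commute hB hR hn hd le_rfl (by omega) (Or.inr rfl)
    have hs := ba_mul_self hB hR hn hd (n := n) (s := 0) (i := i + 1) (by omega) (by omega)
    have hk1 := h.k_r_k (i := i + 1) (j := i) (by omega) (by omega) (Or.inr rfl)
    have hk2 := h.k_k_k (i := i + 1) (j := i) (by omega) (by omega) (Or.inr rfl)
    have h1 : P.bk n (i + 1) * sigm P.q P.mu (P.br n) (P.bk n) i (P.q ^ (2 * (i + 1)))⁻¹ *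
        P.bk n (i + 1) = (P.eta + coefR P.q (i + 1) * P.mu⁻¹ + coefK P.q P.mu (i + 1)) •
          P.bk n (i + 1) := by
      rw [sigm_eq]
      simp only [mul_add, add_mul, mul_one, mul_smul_comm, smul_mul_assoc, hkk, hk1, hk2]
      module
    calc _ = (P.q ^ (i + 1) / qnum P.q (i + 1 + 1)) • (P.ba n 0 (i + 1) * (P.bk n (i + 1) *
          sigm P.q P.mu (P.br n) (P.bk n) i (P.q ^ (2 * (i + 1)))⁻¹ * P.bk n (i + 1)) *
          P.ba n 0 (i + 1)) := by
          rw [e, mul_smul_comm, smul_mul_assoc]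
          congr 1
          calc _ = (P.bk n (i + 1) * P.ba n 0 (i + 1)) * sigm P.q P.mu (P.br n) (P.bk n) i
                (P.q ^ (2 * (i + 1)))⁻¹ * (P.ba n 0 (i + 1) * P.bk n (i + 1)) := by
                simp only [mul_assoc]
            _ = _ := by rw [← hc.eq, hc.eq]; nth_rw 1 [← hc.eq]; simp only [mul_assoc]
      _ = _ := by
        rw [h1, mul_smul_comm, smul_mul_assoc, smul_smul, mul_assoc, ← hc.eq, ← mul_assoc, hs]
        rfl

theorem nest_ba_nest : ∀ {j : ℕ}, j ≤ k →
    P.nest j * P.ba (2 * j) 0 j * P.nest j = (∏ i ∈ Finset.range j, P.nestC i) • P.nest j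
  | 0, _ => by rw [nest, ba, asymm]; simp
  | j + 1, hj => by
    have ih := nest_ba_nest (j := j) (by omega)
    have hη := hB.eta_ne
    have e1 : P.bk (2 * j + 2) j * P.nest (j + 1) = P.eta • P.nest (j + 1) :=
      bk_mul_move hB hR (by omega) (P.nest j)
    have e2 : P.nest (j + 1) * P.bk (2 * j + 2) j = P.eta • P.nest (j + 1) :=
      move_mul_bk hB hR (by omega) (P.nest j)
    have e3 := bk_ba_bk hB hR hn hd (n := 2 * j + 2) (j := j) (by omega) (by omega)
    have e4 : P.nest (j + 1) * (P.ba (2 * j + 2) 0 j * P.nest (j + 1)) =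
        (P.eta * ∏ i ∈ Finset.range j, P.nestC i) • P.nest (j + 1) := by
      have := ba_mul_move hB hR (i := j) (m := 2 * j) (by omega) (P.nest j)
      change P.ba (2 * j + 2) 0 j * P.nest (j + 1) = _ at this
      rw [this]
      have := move_mul_move hB hR (i := j) (m := 2 * j) (by omega) (P.nest j) (P.ba (2 * j) 0 j * P.nest j)
      change P.nest (j + 1) * _ = _ at this
      rw [this, ← mul_assoc (P.nest j), ih, map_smul, smul_mul_assoc, mul_smul_comm, smul_smul]
      rfl
    have e5 : (P.eta * P.eta) • (P.nest (j + 1) * P.ba (2 * j + 2) 0 (j + 1) * P.nest (j + 1)) =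
        (P.eta * P.eta) • ((∏ i ∈ Finset.range (j + 1), P.nestC i) • P.nest (j + 1)) := by
      calc _ = (P.eta • P.nest (j + 1)) * P.ba (2 * j + 2) 0 (j + 1) * (P.eta • P.nest (j + 1)) := by
            simp only [smul_mul_assoc, mul_smul_comm, smul_smul]
        _ = P.nest (j + 1) * (P.bk (2 * j + 2) j * P.ba (2 * j + 2) 0 (j + 1) * P.bk (2 * j + 2) j) *
            P.nest (j + 1) := by
            conv_lhs => enter [1, 1]; rw [← e2]
            conv_lhs => enter [2]; rw [← e1]
            simp only [mul_assoc]
        _ = P.nestC j • (P.nest (j + 1) * (P.ba (2 * j + 2) 0 j * (P.bk (2 * j + 2) j * P.nest (j + 1)))) := by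
            rw [e3]; simp only [smul_mul_assoc, mul_smul_comm, mul_assoc]
        _ = _ := by
            rw [e1, mul_smul_comm, mul_smul_comm, e4, smul_smul, smul_smul, smul_smul,
              Finset.prod_range_succ]
            congr 1
            ring
    exact smul_right_injective _ (mul_ne_zero hη hη) e5

theorem tr_ba_nest : ∀ {j : ℕ}, j ≤ k →
    τ.tr (2 * j) (P.ba (2 * j) 0 j * P.nest j) = (∏ i ∈ Finset.range j, P.nestC i) • τ.ga ^ j
  | 0, _ => by
    rw [nest, ba, asymm, mul_one]
    simpa using τ.tr_one
  | j + 1, hj => by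
    have ih := tr_ba_nest (j := j) (by omega)
    have hη := hB.eta_ne
    have e1 : P.bk (2 * j + 2) j * P.nest (j + 1) = P.eta • P.nest (j + 1) :=
      bk_mul_move hB hR (by omega) (P.nest j)
    have e2 : P.nest (j + 1) * P.bk (2 * j + 2) j = P.eta • P.nest (j + 1) :=
      move_mul_bk hB hR (by omega) (P.nest j)
    have e3 := bk_ba_bk hB hR hn hd (n := 2 * j + 2) (j := j) (by omega) (by omega)
    have e4 : τ.tr (2 * j + 2) (P.ba (2 * j + 2) 0 j * P.nest (j + 1)) =
        P.eta • (τ.ga * ((∏ i ∈ Finset.range j, P.nestC i) • τ.ga ^ j)) := by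
      have := ba_mul_move hB hR (i := j) (m := 2 * j) (by omega) (P.nest j)
      change P.ba (2 * j + 2) 0 j * P.nest (j + 1) = _ at this
      rw [this, τ.tr_move hB hR (by omega), ih]
    have e5 : (P.eta * P.eta) • τ.tr (2 * j + 2) (P.ba (2 * j + 2) 0 (j + 1) * P.nest (j + 1)) =
        (P.eta * P.eta) • ((∏ i ∈ Finset.range (j + 1), P.nestC i) • τ.ga ^ (j + 1)) := by
      calc _ = τ.tr (2 * j + 2) (P.ba (2 * j + 2) 0 (j + 1) *
            (P.eta • (P.eta • P.nest (j + 1)))) := by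
            rw [smul_smul, mul_smul_comm, map_smul]
        _ = τ.tr (2 * j + 2) ((P.bk (2 * j + 2) j * P.ba (2 * j + 2) 0 (j + 1) *
              P.bk (2 * j + 2) j) * P.nest (j + 1)) := by
            rw [← e2, ← smul_mul_assoc, ← e1, ← mul_assoc, τ.tr_comm]
            simp only [mul_assoc]
        _ = P.nestC j • (P.eta • τ.tr (2 * j + 2) (P.ba (2 * j + 2) 0 j * P.nest (j + 1))) := by
            rw [e3, smul_mul_assoc, mul_assoc, e1, mul_smul_comm, map_smul, map_smul]
        _ = _ := by
            rw [e4, Finset.prod_range_succ, mul_smul_comm, ← pow_succ']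
            module
    exact smul_right_injective _ (mul_ne_zero hη hη) e5

-- The hypothesis on `Z` says that it opens with an arc at the place `i`. The new arc lies directly
-- inside it, and `r_mul_kkkk` slides a crossing of the two from the left ends to the right ends.
omit hn hd in
theorem br_mul_move {i : ℕ} (hi : i + 1 < m) {Z : P.braidAlg m} (hZ : P.bk m i * Z = P.eta • Z) :
    P.br (m + 2) i * (moveTwo (P.br (m + 2)) (i + 1) *
      (shft 2 Z * (P.bk (m + 2) 0 * moveTwoInv (P.bri (m + 2)) (i + 1)))) =
    P.br (m + 2) (i + 2) * (moveTwo (P.br (m + 2)) (i + 1) *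
      (shft 2 Z * (P.bk (m + 2) 0 * moveTwoInv (P.bri (m + 2)) (i + 1)))) := by
  have h := hB.fam hR (m + 2)
  have e3 := h.move_kk (i := i) (by omega)
  have e4 := h.r_mul_kkkk (l := i) (c := i + 1) (u := i + 2) (by omega) (by omega) (by omega) rfl rfl
  have hc := bk_zero_commute_shft Z
  have e6 : shft 2 (P.bk m i) = P.bk (m + 2) (i + 2) := shft_bk 2 (by omega)
  set M := moveTwo (P.br (m + 2)) (i + 1)
  set M' := moveTwoInv (P.bri (m + 2)) (i + 1)
  have hM : M' * M = 1 := h.moveTwo_inv_mul (by omega)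
  have e5 : P.eta • (M * (shft 2 Z * (P.bk (m + 2) 0 * M'))) =
      (P.bk (m + 2) (i + 1) * (P.bk (m + 2) i * (P.bk (m + 2) (i + 2) * P.bk (m + 2) (i + 1)))) *
        (M * (shft 2 Z * M')) := by
    rw [← e3]
    symm
    calc _ = M * (P.bk (m + 2) (i + 2) * (P.bk (m + 2) 0 * ((M' * M) * (shft 2 Z * M')))) := by
          simp only [mul_assoc]
      _ = M * ((P.bk (m + 2) (i + 2) * shft 2 Z) * (P.bk (m + 2) 0 * M')) := by
          rw [hM, one_mul, ← mul_assoc (P.bk _ 0), hc.eq]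
          simp only [mul_assoc]
      _ = _ := by
          rw [← e6, ← map_mul, hZ, map_smul, smul_mul_assoc, mul_smul_comm]
  have e7 : P.eta • (P.br (m + 2) i * (M * (shft 2 Z * (P.bk (m + 2) 0 * M')))) =
      P.eta • (P.br (m + 2) (i + 2) * (M * (shft 2 Z * (P.bk (m + 2) 0 * M')))) := by
    rw [← mul_smul_comm P.eta (P.br _ i), ← mul_smul_comm P.eta (P.br _ (i + 2)), e5, ← mul_assoc,
      ← mul_assoc (P.br _ (i + 2)), e4]
  exact smul_right_injective _ hB.eta_ne e7

omit hn hd in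
theorem br_mul_move_far {i t t' : ℕ} (hi : i ≤ m) (ht : t + 2 ≤ i) (ht' : i ≤ t') (htm : t' + 1 < m)
    {Z : P.braidAlg m} (hZ : P.br m t * Z = P.br m t' * Z) :
    P.br (m + 2) t * (moveTwo (P.br (m + 2)) i *
      (shft 2 Z * (P.bk (m + 2) 0 * moveTwoInv (P.bri (m + 2)) i))) =
    P.br (m + 2) (t' + 2) * (moveTwo (P.br (m + 2)) i *
      (shft 2 Z * (P.bk (m + 2) 0 * moveTwoInv (P.bri (m + 2)) i))) := by
  have h := hB.fam hR (m + 2)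
  have e1 : P.br (m + 2) t * moveTwo (P.br (m + 2)) i =
      moveTwo (P.br (m + 2)) i * shft 2 (P.br m t) := by
    rw [shft_br 2 (by omega), move_mul hB hR (by omega) (by omega)]
  have e2 : P.br (m + 2) (t' + 2) * moveTwo (P.br (m + 2)) i =
      moveTwo (P.br (m + 2)) i * shft 2 (P.br m t') := by
    rw [shft_br 2 (by omega)]
    exact (h.moveTwo_commute (by omega) (by omega)).eq
  rw [← mul_assoc, ← mul_assoc (P.br _ (t' + 2)), e1, e2, mul_assoc, mul_assoc,
    ← mul_assoc (shft 2 _) (shft 2 _), ← mul_assoc (shft 2 _) (shft 2 _), ← map_mul, ← map_mul, hZ]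

-- The nested arcs join each place to its mirror image, so a crossing of neighbouring arcs can be
-- made at either end. The innermost arc is the newest one.
omit hn hd in
theorem br_mul_nest : ∀ {j t : ℕ}, t + 1 < j →
    P.br (2 * j) t * P.nest j = P.br (2 * j) (2 * j - 2 - t) * P.nest j
  | j + 1, t, ht => by
    have h := hB.fam hR (2 * j + 2)
    change P.br (2 * j + 2) t * P.nest (j + 1) = P.br (2 * j + 2) (2 * j + 2 - 2 - t) * P.nest (j + 1)
    rw [Nat.add_sub_cancel]
    rcases Nat.lt_or_ge (t + 1) j with h1 | h1
    · have ih := br_mul_nest h1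
      have := br_mul_move_far hB hR (m := 2 * j) (i := j) (t' := 2 * j - 2 - t) (by omega) (by omega)
        (by omega) (by omega) ih
      rw [show 2 * j - 2 - t + 2 = 2 * j - t by omega] at this
      exact this
    · obtain ⟨i, rfl⟩ : ∃ i, j = i + 1 := ⟨j - 1, by omega⟩
      obtain rfl : t = i := by omega
      have e1 : P.bk (2 * t + 2) t * P.nest (t + 1) = P.eta • P.nest (t + 1) :=
        bk_mul_move hB hR (m := 2 * t) (by omega) (P.nest t)
      rw [show 2 * (t + 1) - t = t + 2 by omega]
      exact br_mul_move hB hR (m := 2 * t + 2) (by omega) e1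

theorem al_mul_al (hn' : n = k + k) :
    τ.tr n (P.ba n 0 k * P.ba n k k) = τ.al k * τ.al k := by
  subst hn'
  rw [al, ← τ.tr_mul, incl_ba _ (by omega), shft_ba k (by omega), Nat.zero_add]

/-- For antisymmetrizers of rank one. -/
theorem al_sq [IsDomain E] (hrk : (P.asym k 0 k).rank = 1) (hC : ∀ j < k, P.nestC j ≠ 0)
    (hg : τ.ga ≠ 0) : τ.al k ^ 2 = τ.ga ^ k := by
  set a := P.ba (2 * k) 0 k with ha
  set a' := P.ba (2 * k) k k with ha'
  set X := P.nest k with hX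
  set c := ∏ i ∈ Finset.range k, P.nestC i with hc
  have hc0 : c ≠ 0 := Finset.prod_ne_zero_iff.2 fun i hi => hC i (Finset.mem_range.1 hi)
  have f := hB.fam hR (2 * k)
  have haa : a * a = a := ba_mul_self hB hR hn hd (by omega) le_rfl
  have haa' : a' * a' = a' := ba_mul_self hB hR hn hd (by omega) le_rfl
  have hcom : Commute a a' := f.semiconj_asymm fun t ht => ⟨by omega, by omega,
    ba_commute hB hR hn hd (by omega) (by omega) (Or.inl rfl)⟩
  -- Generators of the second half act on the nested contractor as their mirror images in the first
  -- half, which `a` absorbs with the sign eigenvalue. Antisymmetrizing one end of the arcs thus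
  -- antisymmetrizes the other.
  have h1 : a' * (a * X) = a * X := by
    refine f.asymm_mul (by omega) hn fun t ht => ?_
    have e1 : Commute a (P.br (2 * k) (k + t)) :=
      ba_commute hB hR hn hd (by omega) (by omega) (Or.inl rfl)
    have e2 := br_mul_nest hB hR (j := k) (t := k - 2 - t) (by omega)
    rw [show 2 * k - 2 - (k - 2 - t) = k + t by omega] at e2
    have e3 := f.asymm_mul_r (s := 0) (m := k) (by omega) hn hd (k - 2 - t) (by omega)
    rw [Nat.zero_add] at e3
    change a * _ = -P.q⁻¹ • a at e3
    rw [← mul_assoc, ← e1.eq, mul_assoc, ← e2, ← mul_assoc, e3, smul_mul_assoc]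
  obtain ⟨s, hs⟩ := ba_sandwich hrk (two_mul k) X
  change a * a' * X * (a * a') = s • (a * a') at hs
  have h2 : X * a * X = c • X := nest_ba_nest hB hR hn hd le_rfl
  have h3 : τ.tr (2 * k) (a * X) = c • τ.ga ^ k := τ.tr_ba_nest hB hR hn hd le_rfl
  have h4 : τ.tr (2 * k) (a * a') = τ.al k * τ.al k := τ.al_mul_al hB hR hn hd (two_mul k)
  have h5 : a * a' * X = a * X := by rw [hcom.eq, mul_assoc, h1]
  have h6 : (a * a') * (a * a') = a * a' := by
    rw [mul_assoc, ← mul_assoc a', ← hcom.eq, mul_assoc a a', haa', ← mul_assoc, haa]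
  -- The rank condition makes the compression of `X` by `a * a'` a scalar `s`. Taking the trace of
  -- this compression in two ways gives the relation between `a_k²` and `g^k`.
  have h7 : s • (τ.al k * τ.al k) = c • τ.ga ^ k := by
    rw [← h4, ← h3, ← map_smul, ← hs, τ.tr_comm, ← mul_assoc (a * a') (a * a') X, h6, h5]
  -- Compressing twice and using `X a X = c X` gives `s² = c s` on `a * a'`. With `g ≠ 0` this
  -- forces `s = c`.
  have h8 : s • (s • (a * a')) = c • (s • (a * a')) := by
    have e1 : (a * a' * X * (a * a')) * (X * (a * a')) = c • (a * a' * X * (a * a')) := by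
      calc _ = a * a' * (X * (a * a' * X)) * (a * a') := by simp only [mul_assoc]
        _ = a * a' * (X * a * X) * (a * a') := by rw [h5, mul_assoc X]
        _ = _ := by rw [h2, mul_smul_comm, smul_mul_assoc]
    rw [hs, smul_mul_assoc, ← mul_assoc, hs] at e1
    exact e1
  have h9 := congrArg (τ.tr (2 * k)) h8
  simp only [map_smul, h4] at h9
  have h10 : τ.ga ^ k ≠ 0 := pow_ne_zero _ hg
  have h11 : (c * (s - c)) • τ.ga ^ k = 0 := by
    have : s • (c • τ.ga ^ k) = c • (c • τ.ga ^ k) := by rw [← h7]; exact h9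
    rw [mul_sub, sub_smul, mul_comm c s, mul_smul, mul_smul, this, sub_self]
  have h12 : s = c := by
    have := (smul_eq_zero.1 h11).resolve_right h10
    exact sub_eq_zero.1 ((mul_eq_zero.1 this).resolve_left hc0)
  rw [h12] at h7
  rw [pow_two]
  exact smul_right_injective _ hc0 h7

end TraceTower

end Datum

end QMA

namespace QMA

namespace Datum

variable {N : ℕ} {P : Datum N} {n m : ℕ}

/-! ### The traces given by the characteristic map -/

section Map

variable {A B : Type} [Ring A] [Algebra ℂ A] [Ring B] [Algebra ℂ B] (f : A →ₐ[ℂ] B)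
  (M : Matrix (Fin N) (Fin N) A)

theorem toAlg_map (X : Op N n ℂ) : (toAlg A X).map f = toAlg B X := by
  ext i j
  exact f.commutes _

theorem firstSite_map : (firstSite M n).map f = firstSite (M.map f) n := by
  unfold firstSite
  split_ifs
  · ext i j
    simp only [Matrix.map_apply, Matrix.of_apply]
    split_ifs
    · rfl
    · exact map_zero f
  · exact map_one f.mapMatrix

theorem copy_map : ∀ i, (P.copy M n i).map f = P.copy (M.map f) n i
  | 0 => firstSite_map f M
  | i + 1 => by
    change f.mapMatrix (_ * _ * _) = _ * _ * _
    rw [map_mul, map_mul]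
    change (toAlg A _).map f * (P.copy M n i).map f * (toAlg A _).map f = _
    rw [toAlg_map, toAlg_map, copy_map i]

theorem copies_map : (P.copies M n).map f = P.copies (M.map f) n := by
  change f.mapMatrix (List.prod _) = _
  rw [map_list_prod, List.map_map, copies]
  congr 2
  funext i
  exact copy_map f M i

/-- The exchange relation of the generators may be checked before passing to a quotient. -/
theorem exchange_map
    (h : ∀ i j, f ((toAlg A (site P.R 2 0) * P.copies M 2) i j) =
      f ((P.copies M 2 * toAlg A (site P.R 2 0)) i j)) :
    toAlg B (site P.R 2 0) * P.copies (M.map f) 2 = P.copies (M.map f) 2 * toAlg B (site P.R 2 0) := by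
  have h1 : f.mapMatrix (toAlg A (site P.R 2 0) * P.copies M 2) =
      f.mapMatrix (P.copies M 2 * toAlg A (site P.R 2 0)) := by
    ext i j
    exact h i j
  rw [map_mul, map_mul] at h1
  change (toAlg A _).map f * (P.copies M 2).map f = (P.copies M 2).map f * (toAlg A _).map f at h1
  rwa [toAlg_map, copies_map] at h1

end Map

theorem gen_exchange :
    toAlg P.QMAlg (site P.R 2 0) * P.copies P.gen 2 = P.copies P.gen 2 * toAlg P.QMAlg (site P.R 2 0) :=
  exchange_map (RingQuot.mkAlgHom ℂ P.QMRel) (freeGen N)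
    fun i j => RingQuot.mkAlgHom_rel ℂ (QMRel.entry i j)

theorem extGen_exchange :
    toAlg P.ExtAlg (site P.R 2 0) * P.copies P.extGen 2 =
      P.copies P.extGen 2 * toAlg P.ExtAlg (site P.R 2 0) :=
  exchange_map (RingQuot.mkAlgHom ℂ P.ExtRel) (extFreeGen N)
    fun i j => RingQuot.mkAlgHom_rel ℂ (ExtRel.entry i j)

section Tower

variable {A : Type} [Ring A] [Algebra ℂ A] {M : Matrix (Fin N) (Fin N) A}
  {C : Subalgebra ℂ A} (hC : P.charSub M ≤ C)
  {E : Type} [CommRing E] [Algebra ℂ E] (φ : C →ₐ[ℂ] E)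
  (hP : IsCompatiblePair P.R P.F)
  (hM : toAlg A (site P.R 2 0) * P.copies M 2 = P.copies M 2 * toAlg A (site P.R 2 0))

include hC in
theorem ch_mem {Y : Op N n ℂ} (hY : Y ∈ P.braidAlg n) : P.ch M n Y ∈ C :=
  hC (Algebra.subset_adjoin ⟨n, Y, hY, rfl⟩)

/-- The characteristic map followed by a homomorphism to a commutative algebra. -/
noncomputable def tower : P.TraceTower E where
  tr n :=
    { toFun := fun x => φ ⟨P.ch M n x.1, ch_mem hC x.2⟩
      map_add' := fun x y => by
        rw [← map_add]; exact congrArg φ (Subtype.ext (ch_add M _ _))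
      map_smul' := fun c x => by
        rw [RingHom.id_apply, ← map_smul]; exact congrArg φ (Subtype.ext (ch_smul M _ _)) }
  tr_one := by
    rw [← map_one φ]
    refine congrArg φ (Subtype.ext ?_)
    change P.rTrace (P.copies M 0 * toAlg A 1) = 1
    have h1 : toAlg A (1 : Op N 0 ℂ) = 1 := map_one (toAlgHom N 0 A)
    have h2 : P.copies M 0 = 1 := rfl
    rw [h1, h2, one_mul, rTrace_one, pow_zero, map_one]
  tr_comm x y := congrArg φ (Subtype.ext (ch_mul_comm M hP hM x.2 _))
  tr_mul x y := by
    refine Eq.trans ?_ (map_mul φ _ _)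
    exact congrArg φ (Subtype.ext (ch_mul M hP x.2 y.2))

theorem tower_al (i : ℕ) : (tower hC φ hP hM).al i = φ ⟨P.asymElt M i, hC (P.asymElt_mem M i)⟩ := by
  by_cases h : i = 0
  · subst h
    rw [TraceTower.al_zero, ← map_one φ]
    exact congrArg φ (Subtype.ext (show (1 : A) = P.asymElt M 0 from (if_pos rfl).symm))
  · refine congrArg φ (Subtype.ext ?_)
    change P.ch M i (P.ba i 0 i : Op N i ℂ) = P.asymElt M i
    rw [coe_ba, asymElt, if_neg h]

theorem tower_ga : (tower hC φ hP hM).ga = φ ⟨P.contraction M, hC (P.contraction_mem M)⟩ := by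
  rw [TraceTower.ga]
  change P.eta⁻¹ • φ _ = _
  rw [← map_smul]
  rfl

theorem prod_reverse_map_range {B : Type} [Ring B] (r : ℕ → B) :
    ∀ m, ((List.range m).reverse.map r).prod = desc r 0 m
  | 0 => rfl
  | m + 1 => by
    rw [List.range_succ, List.reverse_append, List.map_append, List.prod_append, desc,
      prod_reverse_map_range r m]
    simp

theorem tower_pw {n : ℕ} (hn : 1 ≤ n) :
    (tower hC φ hP hM).pw n = φ ⟨P.powerSum M n, hC (P.powerSum_mem M n)⟩ := by
  obtain ⟨n, rfl⟩ : ∃ m, n = m + 1 := ⟨n - 1, by omega⟩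
  refine congrArg φ (Subtype.ext ?_)
  change P.ch M (n + 1) (desc (P.br (n + 1)) 0 n : P.braidAlg (n + 1)).1 = P.powerSum M (n + 1)
  rw [powerSum, prod_reverse_map_range]
  congr 1
  exact map_desc (P.braidAlg (n + 1)).val fun t _ => rfl

end Tower

/-! ### The vanishing conditions -/

theorem qnum_ne_zero_iff {q : ℂ} (hq : q ≠ 0) (hl : q - q⁻¹ ≠ 0) (i : ℕ) :
    qnum q i ≠ 0 ↔ q ^ (2 * i) ≠ 1 := by
  have h0 : q ^ i ≠ 0 := pow_ne_zero _ hq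
  rw [qnum, div_ne_zero_iff, and_iff_left hl, sub_ne_zero, mul_comm, pow_mul, sq, not_iff_not]
  constructor
  · intro h; nth_rw 1 [h]; exact inv_mul_cancel₀ h0
  · intro h; exact eq_inv_of_mul_eq_one_left h

theorem HasHeight.pow_ne_one {k : ℕ} (hB : P.IsBMW) (h : P.HasHeight k) {m : ℕ} (h1 : 1 ≤ m)
    (h2 : m ≤ k) : P.q ^ (2 * m) ≠ 1 := by
  rcases h1.eq_or_lt with rfl | h3
  · exact hB.q_sq_ne_one
  · exact (qnum_ne_zero_iff hB.q_ne_zero hB.lam_ne m).1 (h.qnum_ne_zero m h3 h2)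

/-- The denominators of the baxterized elements, written with `y_i = μ q^{2i-1}`. -/
theorem den_ne_zero {q μ : ℂ} (hq : q ≠ 0) {t : ℕ} (h : 1 + μ * q ^ (2 * t) * q⁻¹ ≠ 0) :
    q * (q ^ (2 * t))⁻¹ + μ ≠ 0 := by
  intro h1
  apply h
  have h0 : q ^ (2 * t) ≠ 0 := pow_ne_zero _ hq
  field_simp at h1 ⊢
  linear_combination h1

/-- Here `μ q^{2t-1} = -q^{-2(k+1-t)}`, and `k + 1 - t` lies between `1` and `k`, where the
q-numbers are nonzero. -/
theorem IsSpType.one_add_ne_zero {k : ℕ} (h : P.IsSpType k) {t : ℕ} (h1 : 1 ≤ t) (h2 : t ≤ k) :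
    1 + P.mu * P.q ^ (2 * t) * P.q⁻¹ ≠ 0 := by
  have hq := h.bmw.q_ne_zero
  have h3 := h.height.pow_ne_one h.bmw (m := k + 1 - t) (by omega) (by omega)
  intro h4
  apply h3
  have e : P.q ^ (2 * (k + 1 - t)) * P.q ^ (2 * t) = P.q ^ (1 + 2 * k) * P.q := by
    rw [← pow_add, ← pow_succ]; congr 1; omega
  have h0 : P.q ^ (2 * t) ≠ 0 := pow_ne_zero _ hq
  have h0' : P.q ^ (1 + 2 * k) ≠ 0 := pow_ne_zero _ hq
  rw [h.mu_eq] at h4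
  field_simp at h4
  apply mul_right_cancel₀ h0
  rw [e, one_mul, mul_comm]
  linear_combination h4

theorem IsOType.mu_eq' {k : ℕ} (h : P.IsOType k) : P.mu = P.q * (P.q ^ k)⁻¹ := by
  rw [h.mu_eq, zpow_sub₀ h.bmw.q_ne_zero, zpow_one, zpow_natCast, div_eq_mul_inv]

/-- Here `μ q^{2t-1} = q^{2t-k}`. If this were `-1`, squaring would make the q-number of order `|2t
- k| ≤ k` vanish, or give `1 = -1` when `2t = k`. -/
theorem IsOType.one_add_ne_zero {k : ℕ} (h : P.IsOType k) {t : ℕ} (h2 : t ≤ k) :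
    1 + P.mu * P.q ^ (2 * t) * P.q⁻¹ ≠ 0 := by
  have hq := h.bmw.q_ne_zero
  have hk : P.q ^ k ≠ 0 := pow_ne_zero _ hq
  intro h4
  rw [h.mu_eq'] at h4
  have h5 : P.q ^ (2 * t) = -P.q ^ k := by
    field_simp at h4
    linear_combination h4
  rcases lt_trichotomy (2 * t) k with h6 | h6 | h6
  · have h3 := h.height.pow_ne_one h.bmw (m := k - 2 * t) (by omega) (by omega)
    have e : P.q ^ (k - 2 * t) * P.q ^ (2 * t) = P.q ^ k := by rw [← pow_add]; congr 1; omega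
    have e2 : P.q ^ (k - 2 * t) = -1 := by
      apply mul_right_cancel₀ hk
      linear_combination P.q ^ (k - 2 * t) * h5 - e
    apply h3
    rw [mul_comm, pow_mul, e2]; norm_num
  · rw [h6] at h5
    have : (2 : ℂ) * P.q ^ k = 0 := by linear_combination h5
    exact hk (by simpa using this)
  · have h3 := h.height.pow_ne_one h.bmw (m := 2 * t - k) (by omega) (by omega)
    have e : P.q ^ (2 * t - k) * P.q ^ k = P.q ^ (2 * t) := by rw [← pow_add]; congr 1; omega
    have e2 : P.q ^ (2 * t - k) = -1 := by
      apply mul_right_cancel₀ hk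
      linear_combination h5 + e
    apply h3
    rw [mul_comm, pow_mul, e2]; norm_num

/-- The vanishing of the highest antisymmetrizer, mirrored and on any number of strands. -/
theorem HasHeight.sandwich_eq_zero {k : ℕ} (h : P.HasHeight k) (hB : P.IsBMW) (hR : IsRMatrix P.R)
    (hd : ∀ t, 1 ≤ t → t < k → P.q * (P.q ^ (2 * t))⁻¹ + P.mu ≠ 0) (hn : k < n) {i : ℕ}
    (hi : i + 1 = k) :
    P.ba n 0 k * sigm P.q P.mu (P.br n) (P.bk n) i (P.q ^ (2 * k))⁻¹ * P.ba n 0 k = 0 := by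
  subst hi
  have h1 : P.ba (i + 1 + 1) 1 (i + 1) * sigm P.q P.mu (P.br _) (P.bk _) 0 (P.q ^ (2 * (i + 1)))⁻¹ *
      P.ba (i + 1 + 1) 1 (i + 1) = 0 := by
    apply Subtype.ext
    have := h.vanish
    rw [← coe_ba] at this
    exact this
  have h2 := (hB.fam hR (i + 1 + 1)).asymm_sigm_asymm_eq_zero (m := i) (by omega)
    (fun t h1 h2 => h.qnum_ne_zero t h1 h2) hd h1
  have h3 := congrArg (incl (P := P) (Nat.succ_le_of_lt hn)) h2
  rw [map_zero, map_mul, map_mul] at h3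
  change incl _ (P.ba _ 0 (i + 1)) * _ * incl _ (P.ba _ 0 (i + 1)) = 0 at h3
  rw [incl_ba _ (by omega)] at h3
  simpa only [sigm, map_add, map_smul, map_one, incl_br (P := P) (n := n) (Nat.succ_le_of_lt hn) (i := i) (by omega),
    incl_bk (P := P) (n := n) (Nat.succ_le_of_lt hn) (i := i) (by omega)] using h3

/-- Up to nonzero factors the bracket is `(q^{-2j} + q μ)(q^{1-j} - μ)(q^{1-j} + μ)`. For `μ =
q^{1-k}` the first factor is excluded from vanishing by `one_add_ne_zero` at `j + 1`, and the others
by `q^{2(k-j)} ≠ 1`. -/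
theorem IsOType.nestC_ne_zero {k : ℕ} (h : P.IsOType k) {j : ℕ} (hj : j < k) : P.nestC j ≠ 0 := by
  have hq := h.bmw.q_ne_zero
  have hl := h.bmw.lam_ne
  have hm := h.bmw.mu_ne_zero
  have h1 : qnum P.q (j + 1) ≠ 0 :=
    (qnum_ne_zero_iff hq hl _).2 (h.height.pow_ne_one h.bmw (by omega) (by omega))
  refine mul_ne_zero (div_ne_zero (pow_ne_zero _ hq) h1) ?_
  have hd := den_ne_zero hq (h.one_add_ne_zero (t := j) hj.le)
  have hj0 : P.q ^ j ≠ 0 := pow_ne_zero _ hq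
  have hk0 : P.q ^ k ≠ 0 := pow_ne_zero _ hq
  set Q := (P.q ^ (2 * j))⁻¹ with hQ
  have hden : P.q * P.mu⁻¹ * Q + 1 ≠ 0 := by
    intro h0
    apply hd
    field_simp at h0
    linear_combination h0
  have hQj : Q = (P.q ^ j)⁻¹ * (P.q ^ j)⁻¹ := by
    rw [hQ, mul_comm, pow_mul, sq, mul_inv]
  have hQ0 : Q ≠ 0 := inv_ne_zero (pow_ne_zero _ hq)
  have e : P.eta + coefR P.q j * P.mu⁻¹ + coefK P.q P.mu j =
      (Q + P.q * P.mu) * (P.q * (P.q ^ j)⁻¹ - P.mu) * (P.q * (P.q ^ j)⁻¹ + P.mu) /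
        (P.q * P.mu * (P.q - P.q⁻¹) * (P.q * Q + P.mu)) := by
    rw [coefR, coefK, eta, ← hQ]
    have e2 : P.q * P.mu⁻¹ * Q + 1 = (P.q * Q + P.mu) / P.mu := by field_simp
    have e3 : (P.q * (P.q ^ j)⁻¹ - P.mu) * (P.q * (P.q ^ j)⁻¹ + P.mu) = P.q ^ 2 * Q - P.mu ^ 2 := by
      rw [hQj]; ring
    have hq2 : P.q ^ 2 - 1 ≠ 0 := sub_ne_zero.2 h.bmw.q_sq_ne_one
    rw [e2, mul_assoc (Q + _), e3, show P.q - P.q⁻¹ = (P.q ^ 2 - 1) / P.q by field_simp]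
    clear_value Q
    generalize P.q = q at *
    generalize P.mu = μ at *
    field_simp
    ring
  rw [e]
  refine div_ne_zero (mul_ne_zero (mul_ne_zero ?_ ?_) ?_)
    (mul_ne_zero (mul_ne_zero (mul_ne_zero hq hm) hl) hd)
  · intro h0
    apply h.one_add_ne_zero (t := j + 1) (by omega)
    rw [hQ] at h0
    have h2 : P.q ^ (2 * j) ≠ 0 := pow_ne_zero _ hq
    rw [show 2 * (j + 1) = 2 * j + 2 by ring, pow_add]
    field_simp at h0 ⊢
    linear_combination h0
  all_goals
    intro h0
    apply h.height.pow_ne_one h.bmw (m := k - j) (by omega) (by omega)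
    have e4 : P.q ^ (2 * (k - j)) * P.q ^ (2 * j) = P.q ^ (2 * k) := by
      rw [← pow_add]; congr 1; omega
    apply mul_right_cancel₀ (pow_ne_zero (2 * j) hq)
    rw [e4, one_mul, mul_comm 2 k, mul_comm 2 j, pow_mul, pow_mul]
    rw [h.mu_eq'] at h0
    field_simp at h0
    rw [mul_zero] at h0
    have h0 := (mul_eq_zero.1 h0).resolve_left hq
  · linear_combination (P.q ^ k + P.q ^ j) * h0
  · linear_combination (P.q ^ k - P.q ^ j) * h0

end Datum

end QMA

namespace QMA

/-! ### Elimination in the recursion for hooks -/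

section Elimination

/-- The sums `∑_{j ≤ i} c^j x_j w^{i-j}`. -/
def hookSum {L : Type} [Semiring L] (c w : L) (x : ℕ → L) : ℕ → L
  | 0 => x 0
  | i + 1 => w * hookSum c w x i + c ^ (i + 1) * x (i + 1)

theorem hookSum_eq_sum {L : Type} [CommSemiring L] (c w : L) (x : ℕ → L) (i : ℕ) :
    hookSum c w x i = ∑ j ∈ Finset.range (i + 1), c ^ j * x j * w ^ (i - j) := by
  induction i with
  | zero => simp [hookSum]
  | succ i ih =>
    rw [hookSum, ih, Finset.sum_range_succ _ (i + 1), Finset.mul_sum, Nat.sub_self, pow_zero, mul_one]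
    congr 1
    refine Finset.sum_congr rfl fun j hj => ?_
    rw [show i + 1 - j = i - j + 1 by have := Finset.mem_range.1 hj; omega, pow_succ]
    ring

variable {L : Type} [Field L] {q μ t p : L} {al V w Q : ℕ → L} {k : ℕ}

theorem hookSum_rescale (hq : q ≠ 0) (i : ℕ) :
    hookSum q (-(t * q ^ 2)) al i = q ^ (2 * i) * hookSum q⁻¹ (-t) al i := by
  induction i with
  | zero => simp [hookSum]
  | succ i ih =>
    rw [hookSum, hookSum, ih, mul_add, inv_pow]
    have : q ^ i ≠ 0 := pow_ne_zero _ hq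
    field_simp
    ring

/-- The functions `u` are removed: `hB` replaces `u'` in `hA'`, and `hA` replaces the remaining `u`.
The combination on the left is chosen so that no denominators survive on the right. The alternative
in `h1` serves the index zero, where `1 + y` may vanish. -/
theorem elimination_step {l y y' x x' n n' v v' v'' u u' a a' η : L} (hq : q ≠ 0) (hμ : μ ≠ 0)
    (hl : l ≠ 0) (hlq : l = q - q⁻¹) (hx : x ≠ 0) (hx' : x' = x * q) (hy : y = μ * x ^ 2 * q⁻¹)
    (hy' : y' = μ * x' ^ 2 * q⁻¹) (hn : n = (x - x⁻¹) / l) (hn' : n' = (x' - x'⁻¹) / l)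
    (h1 : v = 0 ∧ u = 0 ∧ v' = x * a * p + n * a ∨ 1 + y ≠ 0) (h2 : 1 + y' ≠ 0)
    (hη : η = (q - μ) * (q⁻¹ + μ) / (μ * l))
    (hA : v' + v = x * a * p + n * a - l * y / (1 + y) * u)
    (hA' : v'' + v' = x' * a' * p + n' * a' - l * y' / (1 + y') * u')
    (hB : u' + t * u = t * (x⁻¹ * μ⁻¹ * a * p + l / (1 + y) * v +
      a * (x * η - n * μ⁻¹ - l * n))) :
    v'' + t * (q ^ 2 + y') / (1 + y') * v' + (v' + t * (q ^ 2 + y) / (1 + y) * v) =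
      x' * a' * p + n' * a' + t * a * (x * p + n + μ * x - q * x⁻¹) := by
  have hyy : y' = q ^ 2 * y := by rw [hy, hy', hx']; ring
  have hlq2 : l * q = q ^ 2 - 1 := by rw [hlq]; field_simp
  have hll : l ^ 2 * q ^ 2 = (q ^ 2 - 1) ^ 2 := by rw [← hlq2]; ring
  rcases h1 with ⟨rfl, rfl, h3⟩ | h1
  · have key : t * (q ^ 2 + y') / (1 + y') * (x * a * p + n * a) - l * y' / (1 + y') * (t * (x⁻¹ * μ⁻¹ * a * p +
      a * (x * η - n * μ⁻¹ - l * n))) = t * a * (x * p + n + μ * x - q * x⁻¹) := by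
      rw [hη, hn, hlq, hyy]
      rw [hyy] at h2
      rw [hlq] at hl
      have hq2 : q ^ 2 - 1 ≠ 0 := by
        intro h0; rw [hlq, ] at hlq2; rw [h0] at hlq2; exact (mul_ne_zero hl hq) hlq2
      rw [show q - q⁻¹ = (q ^ 2 - 1) / q by field_simp]
      rw [hy] at h2 ⊢
      have h4 : 1 + q * μ * x ^ 2 ≠ 0 := by
        intro h0; apply h2; rw [← h0]; field_simp
      rw [show 1 + q ^ 2 * (μ * x ^ 2 * q⁻¹) = 1 + q * μ * x ^ 2 by field_simp]
      field_simp
      ring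
    linear_combination hA' - l * y' / (1 + y') * hB + key + (t * (q ^ 2 + y') / (1 + y')) * h3
  · have key : t * q ^ 2 * (1 + y) / (1 + y') * (x * a * p + n * a) - l * y' / (1 + y') * (t * (x⁻¹ * μ⁻¹ * a * p +
      a * (x * η - n * μ⁻¹ - l * n))) = t * a * (x * p + n + μ * x - q * x⁻¹) := by
      rw [hη, hn, hlq, hyy]
      rw [hyy] at h2
      rw [hlq] at hl
      have hq2 : q ^ 2 - 1 ≠ 0 := by
        intro h0; rw [hlq, ] at hlq2; rw [h0] at hlq2; exact (mul_ne_zero hl hq) hlq2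
      rw [show q - q⁻¹ = (q ^ 2 - 1) / q by field_simp]
      rw [hy] at h2 ⊢
      have h4 : 1 + q * μ * x ^ 2 ≠ 0 := by
        intro h0; apply h2; rw [← h0]; field_simp
      rw [show 1 + q ^ 2 * (μ * x ^ 2 * q⁻¹) = 1 + q * μ * x ^ 2 by field_simp]
      field_simp
      ring
    have k1 : t * q ^ 2 * (1 + y) / (1 + y') * (l * y / (1 + y)) = l * y' / (1 + y') * t := by
      rw [hyy]; rw [hyy] at h2; field_simp
    have k2 : t * q ^ 2 * (1 + y) / (1 + y') + l * y' / (1 + y') * (t * (l / (1 + y))) =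
        t * (q ^ 2 + y) / (1 + y) := by
      rw [hyy]; rw [hyy] at h2; field_simp
      linear_combination t * y * hll
    have k3 : t * q ^ 2 * (1 + y) / (1 + y') = t * (q ^ 2 + y') / (1 + y') := by
      rw [hyy]; ring
    linear_combination hA' - l * y' / (1 + y') * hB + key + (t * q ^ 2 * (1 + y) / (1 + y')) * hA - u * k1 - v * k2 - v' * k3

/-- The solution of the eliminated recursion. -/
theorem eliminated_eq {l : L} (hq : q ≠ 0) (hl : l ≠ 0) (hlq : l = q - q⁻¹) (h0 : al 0 = 1) (hQ0 : Q 0 = p)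
    (hQ : ∀ i < k, Q (i + 1) + Q i = q ^ (i + 1) * al (i + 1) * p +
      (q ^ (i + 1) - (q ^ (i + 1))⁻¹) / l * al (i + 1) + t * al i * (q ^ i * p +
      (q ^ i - (q ^ i)⁻¹) / l + μ * q ^ i - q * (q ^ i)⁻¹)) {i : ℕ} (hi : i ≤ k) :
    Q i = t * al i * ((p + l⁻¹ + μ) * q ^ i - (l⁻¹ + q) * (q ^ i)⁻¹) +
      (((1 - t) * (p + l⁻¹) - μ * t) * hookSum q (-1) al i -
        (1 - t * q ^ 2) * l⁻¹ * hookSum q⁻¹ (-1) al i) := by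
  have hlq2 : l * q = q ^ 2 - 1 := by rw [hlq]; field_simp
  induction i with
  | zero =>
    rw [hQ0, hookSum, hookSum, h0, pow_zero]
    field_simp
    linear_combination t * hlq2
  | succ i ih =>
    have e1 := hQ i (by omega)
    rw [ih (by omega)] at e1
    rw [hookSum, hookSum, inv_pow]
    have hx : q ^ i ≠ 0 := pow_ne_zero _ hq
    have hx' : q ^ (i + 1) ≠ 0 := pow_ne_zero _ hq
    have e2 : (q ^ (i + 1))⁻¹ * q ^ 2 * l⁻¹ = (q ^ (i + 1))⁻¹ * q + (q ^ (i + 1))⁻¹ * l⁻¹ := by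
      field_simp; linear_combination -hlq2
    rw [div_eq_mul_inv, div_eq_mul_inv] at e1
    linear_combination e1 - (t * al (i + 1)) * e2

/-- The explicit `Q i` contains alternating sums. Summed again against powers of `-t`, these
collapse after multiplication by `1 - t`. The next lemma is the same with `q² t` in place of `t`. -/
theorem hookSum_neg_t {l : L} {c d : L} (hq : q ≠ 0) (hl : l ≠ 0) (hlq : l = q - q⁻¹) (h0 : al 0 = 1)
    (hc : c = (1 - t) * (p + l⁻¹) - μ * t) (hd : d = (1 - t * q ^ 2) * l⁻¹)
    (hQ : ∀ i ≤ k, Q i = t * al i * ((p + l⁻¹ + μ) * q ^ i - (l⁻¹ + q) * (q ^ i)⁻¹) +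
      (c * hookSum q (-1) al i - d * hookSum q⁻¹ (-1) al i)) {i : ℕ} (hi : i ≤ k) :
    (1 - t) * hookSum 1 (-t) Q i = -t * (q * hookSum q⁻¹ (-t) al i - μ * hookSum q (-t) al i) +
      (c * hookSum q (-1) al i - d * hookSum q⁻¹ (-1) al i) := by
  have hlq2 : l * q = q ^ 2 - 1 := by rw [hlq]; field_simp
  induction i with
  | zero =>
    rw [hookSum, hQ 0 hi, hookSum, hookSum, hookSum, hookSum, h0, pow_zero, hc, hd]
    field_simp
    linear_combination t ^ 2 * hlq2
  | succ i ih =>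
    have e1 := ih (by omega)
    have e2 := hQ (i + 1) hi
    have e3 : (q ^ (i + 1))⁻¹ * q ^ 2 * l⁻¹ = (q ^ (i + 1))⁻¹ * q + (q ^ (i + 1))⁻¹ * l⁻¹ := by
      have hx' : q ^ (i + 1) ≠ 0 := pow_ne_zero _ hq
      field_simp; linear_combination -hlq2
    simp only [hookSum] at e2 ⊢
    rw [inv_pow] at e2 ⊢
    rw [e2]
    generalize hookSum q (-1) al i = a1 at *
    generalize hookSum q⁻¹ (-1) al i = a2 at *
    generalize hookSum q (-t) al i = a3 at *
    generalize hookSum q⁻¹ (-t) al i = a4 at *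
    generalize hookSum 1 (-t) Q i = a5 at *
    subst hc hd
    linear_combination (-t) * e1 - t ^ 2 * al (i + 1) * e3
    
theorem hookSum_neg_t_q {l : L} {c d : L} (hq : q ≠ 0) (hl : l ≠ 0) (hlq : l = q - q⁻¹) (h0 : al 0 = 1)
    (hc : c = (1 - t) * (p + l⁻¹) - μ * t) (hd : d = (1 - t * q ^ 2) * l⁻¹)
    (hQ : ∀ i ≤ k, Q i = t * al i * ((p + l⁻¹ + μ) * q ^ i - (l⁻¹ + q) * (q ^ i)⁻¹) +
      (c * hookSum q (-1) al i - d * hookSum q⁻¹ (-1) al i)) {i : ℕ} (hi : i ≤ k) :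
    (1 - t * q ^ 2) * hookSum 1 (-(t * q ^ 2)) Q i =
      -(t * q) * hookSum q (-(t * q ^ 2)) al i * (l * p + 1 - μ * q⁻¹) +
      (c * hookSum q (-1) al i - d * hookSum q⁻¹ (-1) al i) := by
  have hlq2 : l * q = q ^ 2 - 1 := by rw [hlq]; field_simp
  have hll : l * l⁻¹ = 1 := mul_inv_cancel₀ hl
  have hqq : q * q⁻¹ = 1 := mul_inv_cancel₀ hq
  induction i with
  | zero =>
    rw [hookSum, hQ 0 hi, hookSum, hookSum, hookSum, h0, pow_zero, hc, hd]
    have e : q ^ 2 * l⁻¹ = q + l⁻¹ := by field_simp; linear_combination -hlq2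
    linear_combination (-t ^ 2 * q ^ 2) * e + t * p * hlq2 - μ * t * hqq
  | succ i ih =>
    have e1 := ih (by omega)
    have e2 := hQ (i + 1) hi
    have e3 : (q ^ (i + 1))⁻¹ * q ^ 2 * l⁻¹ = (q ^ (i + 1))⁻¹ * q + (q ^ (i + 1))⁻¹ * l⁻¹ := by
      have hx' : q ^ (i + 1) ≠ 0 := pow_ne_zero _ hq
      field_simp; linear_combination -hlq2
    simp only [hookSum] at e2 ⊢
    rw [inv_pow] at e2 ⊢
    rw [e2]
    generalize hookSum q (-1) al i = a1 at *
    generalize hookSum q⁻¹ (-1) al i = a2 at *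
    generalize hookSum q (-(t * q ^ 2)) al i = a3 at *
    generalize hookSum 1 (-(t * q ^ 2)) Q i = a5 at *
    subst hc hd
    have e : q ^ 2 * l⁻¹ = q + l⁻¹ := by field_simp; linear_combination -hlq2
    linear_combination (-(t * q ^ 2)) * e1 + al (i + 1) * q ^ (i + 1) * t * p * hlq2 -
      al (i + 1) * q ^ (i + 1) * t * e - al (i + 1) * q ^ (i + 1) * t * μ * hqq +
      al (i + 1) * (q ^ (i + 1))⁻¹ * (1 - t * q ^ 2) * t * e

/-- With `y_i = μ q^{2i-1}` as relative weight of the two sums of `Q`, the contribution of `V i`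
cancels in each step. At the height the right-hand side vanishes, and this closes the system. -/
theorem hookSum_telescope (hy : ∀ i, 1 ≤ i → i ≤ k → 1 + μ * q ^ (2 * i) * q⁻¹ ≠ 0) (hq : q ≠ 0)
    (hV : V 0 = 0) (hQ : ∀ i ≤ k, Q i = V (i + 1) +
      t * (q ^ 2 + μ * q ^ (2 * i) * q⁻¹) / (1 + μ * q ^ (2 * i) * q⁻¹) * V i) {i : ℕ} (hi : i ≤ k) :
    hookSum 1 (-(t * q ^ 2)) Q i + μ * q ^ (2 * i) * q⁻¹ * hookSum 1 (-t) Q i =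
      (1 + μ * q ^ (2 * i) * q⁻¹) * V (i + 1) := by
  induction i with
  | zero => rw [hookSum, hookSum, hQ 0 hi, hV]; ring
  | succ i ih =>
    have e1 := ih (by omega)
    have e2 := hy (i + 1) (by omega) hi
    rw [hookSum, hookSum, hQ (i + 1) hi]
    set y := μ * q ^ (2 * i) * q⁻¹ with hy
    have e3 : μ * q ^ (2 * (i + 1)) * q⁻¹ = q ^ 2 * y := by rw [hy]; ring
    rw [e3] at e2 ⊢
    have e4 : (1 + q ^ 2 * y) * (t * (q ^ 2 + q ^ 2 * y) / (1 + q ^ 2 * y)) = t * q ^ 2 * (1 + y) := by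
      field_simp
    linear_combination (-(t * q ^ 2)) * e1 + V (i + 1) * e4

/-- The relation between the generating functions of power sums and of elementary symmetric
functions, in terms of the elementary symmetric functions up to the height. -/
theorem elimination {l η : L} (hq : q ≠ 0) (hμ : μ ≠ 0) (hl : l ≠ 0) (hlq : l = q - q⁻¹)
    (hη : η = (q - μ) * (q⁻¹ + μ) / (μ * l)) (h0 : al 0 = 1)
    (hy : ∀ i, 1 ≤ i → i ≤ k → 1 + μ * q ^ (2 * i) * q⁻¹ ≠ 0)
    (hV : V 0 = 0) (hw : w 0 = 0) (hVk : V (k + 1) = 0)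
    (hA : ∀ i ≤ k, V (i + 1) + V i = q ^ i * al i * p + (q ^ i - (q ^ i)⁻¹) / l * al i -
      l * (μ * q ^ (2 * i) * q⁻¹) / (1 + μ * q ^ (2 * i) * q⁻¹) * w i)
    (hB : ∀ i < k, w (i + 1) + t * w i = t * ((q ^ i)⁻¹ * μ⁻¹ * al i * p +
      l / (1 + μ * q ^ (2 * i) * q⁻¹) * V i +
      al i * (q ^ i * η - (q ^ i - (q ^ i)⁻¹) / l * μ⁻¹ - l * ((q ^ i - (q ^ i)⁻¹) / l)))) :
    ((1 - t) * (p + l⁻¹) - μ * t) * (((1 - t) + μ * q ^ (2 * k) * q⁻¹ * (1 - t * q ^ 2)) *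
        hookSum q (-1) al k - t * q * q ^ (2 * k) * l * hookSum q⁻¹ (-t) al k) =
      (1 - t * q ^ 2) * (((1 - t) + μ * q ^ (2 * k) * q⁻¹ * (1 - t * q ^ 2)) * l⁻¹ *
        hookSum q⁻¹ (-1) al k - μ ^ 2 * q ^ (2 * k) * q⁻¹ * t * hookSum q (-t) al k) := by
  have hV1 : V 1 = p := by
    have := hA 0 (by omega)
    rw [hV, hw, h0] at this
    simpa using this
  set Q : ℕ → L := fun i => V (i + 1) +
      t * (q ^ 2 + μ * q ^ (2 * i) * q⁻¹) / (1 + μ * q ^ (2 * i) * q⁻¹) * V i with hQd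
  have hQ : ∀ i < k, Q (i + 1) + Q i = q ^ (i + 1) * al (i + 1) * p +
      (q ^ (i + 1) - (q ^ (i + 1))⁻¹) / l * al (i + 1) + t * al i * (q ^ i * p +
      (q ^ i - (q ^ i)⁻¹) / l + μ * q ^ i - q * (q ^ i)⁻¹) := by
    intro i hi
    have e : ∀ j, q ^ (2 * j) = (q ^ j) ^ 2 := fun j => by rw [mul_comm, pow_mul]
    refine elimination_step (u := w i) (u' := w (i + 1)) (x := q ^ i) (x' := q ^ (i + 1)) hq hμ hl hlq (pow_ne_zero _ hq) (pow_succ _ _)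
      (by rw [e]) (by rw [e]) rfl rfl ?_ (hy (i + 1) (by omega) (by omega)) hη (hA i hi.le) (hA (i + 1) (by omega))
      (hB i hi)
    -- At the index zero `1 + y₀` is not assumed to be nonzero; the vanishing of `V 0` and `w 0`
    -- takes its place.
    rcases Nat.eq_zero_or_pos i with rfl | h
    · refine Or.inl ⟨hV, hw, ?_⟩
      have := hA 0 (by omega)
      rwa [hV, hw, mul_zero, sub_zero, add_zero] at this
    · exact Or.inr (hy i h hi.le)
  have hQ0 : Q 0 = p := by rw [hQd]; simp only [hV, hV1]; ring
  have e0 : ∀ i ≤ k, _ := fun i hi => eliminated_eq (i := i) hq hl hlq h0 hQ0 hQ hi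
  have e1 := hookSum_neg_t hq hl hlq h0 rfl rfl e0 le_rfl
  have e2 := hookSum_neg_t_q hq hl hlq h0 rfl rfl e0 le_rfl
  have e3 := hookSum_telescope (Q := Q) hy hq hV (fun i _ => rfl) (le_refl k)
  rw [hVk, mul_zero] at e3
  rw [hookSum_rescale hq] at e2
  generalize hookSum q (-1) al k = a1 at *
  generalize hookSum q⁻¹ (-1) al k = a2 at *
  generalize hookSum q (-t) al k = a3 at *
  generalize hookSum q⁻¹ (-t) al k = a4 at *
  generalize hookSum 1 (-t) Q k = a5 at *
  generalize hookSum 1 (-(t * q ^ 2)) Q k = a6 at *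
  have hqq : q * q⁻¹ = 1 := mul_inv_cancel₀ hq
  have hll : l * l⁻¹ = 1 := mul_inv_cancel₀ hl
  have hlq2 : l * q = q ^ 2 - 1 := by rw [hlq]; field_simp
  linear_combination (1 - t) * (1 - t * q ^ 2) * e3 - (1 - t) * e2 -
    μ * q ^ (2 * k) * q⁻¹ * (1 - t * q ^ 2) * e1 - t * q * q ^ (2 * k) * a4 * (1 - t) * hll +
    t * q * q ^ (2 * k) * a4 * μ * t * hlq - t * q * q ^ (2 * k) * a4 * μ * t * q * hqq

end Elimination

end QMA

namespace QMA

/-! ### Generating functions of hooks -/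

open PowerSeries in
/-- The recursion for hooks in terms of generating functions, after elimination. -/
theorem hook_series {K : Type} [Field K] {q μ l η g : K} {al pw n b c : ℕ → K} {U T W : ℕ → ℕ → K}
    {k : ℕ} (hk : 1 ≤ k) (hq : q ≠ 0) (hμ : μ ≠ 0) (hl : l ≠ 0) (hlq : l = q - q⁻¹)
    (hη : η = (q - μ) * (q⁻¹ + μ) / (μ * l))
    (hy : ∀ i, 1 ≤ i → i ≤ k → 1 + μ * q ^ (2 * i) * q⁻¹ ≠ 0)
    (hn : ∀ i, n i = (q ^ i - (q ^ i)⁻¹) / l) (hb : ∀ i, q ^ i * b i = -n i)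
    (hc : ∀ i, 1 ≤ i → i ≤ k →
      q ^ i * c i = -(l * (μ * q ^ (2 * i) * q⁻¹) / (1 + μ * q ^ (2 * i) * q⁻¹) * n i))
    (hal : al 0 = 1) (hT : ∀ i w, 1 ≤ w → T i (w + i) = al i * pw w) (hUs : ∀ i, U i i = al i)
    (hU1 : ∀ m, 1 ≤ m → U 1 m = pw m)
    (hU : ∀ i m, 1 ≤ i → i < m → i < k →
      n (i + 1) * U (i + 1) m = q ^ i * (T i m + b i * U i m + c i * W i m))
    (hUk : ∀ m, k < m → T k m + b k * U k m + c k * W k m = 0)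
    (hW12 : W 1 2 = η * g) (hW1 : ∀ m, 1 ≤ m → W 1 (m + 2) = μ⁻¹ * (g * pw m))
    (hWs : ∀ i, 1 ≤ i → i < k →
      n (i + 1) * W (i + 1) (i + 2) = q ^ i * (η + b i * μ⁻¹ + c i) * (g * al i))
    (hW : ∀ i m, 1 ≤ i → i < m → i < k → n (i + 1) * W (i + 1) (m + 2) = q ^ i * (g *
      (μ⁻¹ * T i m + b i * (W i m - l * U i m + l * μ⁻¹ * T i m) + c i * U i m)))
    {p t : K⟦X⟧} (hp : p = mk fun m => if 1 ≤ m then pw m else 0) (ht : t = C g * X ^ 2) :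
    ((1 - t) * (p + C l⁻¹) - C μ * t) *
      (((1 - t) + C (μ * q ^ (2 * k) * q⁻¹) * (1 - t * C (q ^ 2))) *
        hookSum (C q) (-1) (fun i => C (al i) * X ^ i) k -
          t * C (q * q ^ (2 * k) * l) * hookSum (C q⁻¹) (-t) (fun i => C (al i) * X ^ i) k) =
      (1 - t * C (q ^ 2)) *
        (((1 - t) + C (μ * q ^ (2 * k) * q⁻¹) * (1 - t * C (q ^ 2))) * C l⁻¹ *
          hookSum (C q⁻¹) (-1) (fun i => C (al i) * X ^ i) k -
            C (μ ^ 2 * q ^ (2 * k) * q⁻¹) * t * hookSum (C q) (-t) (fun i => C (al i) * X ^ i) k) := by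
  have hn0 : n 0 = 0 := by rw [hn]; simp
  have hn1 : n 1 = 1 := by rw [hn, hlq, pow_one]; exact div_self (hlq ▸ hl)
  set y : ℕ → K := fun i => μ * q ^ (2 * i) * q⁻¹ with hyd
  -- The weight `i_q` absorbs the normalization of the recursion and makes `V 0` vanish. The cut at
  -- `k` makes `V (k + 1)` vanish, which is compatible with the recursion because of `hUk`.
  set V : ℕ → K⟦X⟧ := fun i => mk fun m => if i ≤ m ∧ i ≤ k then n i * U i m else 0 with hV
  set w : ℕ → K⟦X⟧ := fun i => mk fun m => if i < m then n i * W i m else 0 with hw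
  set a : ℕ → K⟦X⟧ := fun i => C (al i) * X ^ i with ha
  have cap : ∀ i m, coeff m (a i * p) = if i < m then T i m else 0 := by
    intro i m
    rw [ha, hp, mul_assoc, coeff_C_mul]
    by_cases him : i ≤ m
    · obtain ⟨d, rfl⟩ := Nat.exists_eq_add_of_le him
      rw [add_comm i d, add_comm d i, coeff_X_pow_mul' , if_pos him, Nat.add_sub_cancel_left, coeff_mk]
      rcases Nat.eq_zero_or_pos d with rfl | hd
      · simp
      · rw [if_pos (show 1 ≤ d from hd), if_pos (by omega), add_comm i d, hT i d hd]
    · rw [coeff_X_pow_mul', if_neg him, if_neg (by omega), mul_zero]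
  have ca : ∀ i m, coeff m (a i) = if m = i then al i else 0 := by
    intro i m
    rw [ha, coeff_C_mul, coeff_X_pow]; split_ifs <;> simp
  have ct : ∀ (f : K⟦X⟧) m, coeff (m + 2) (t * f) = g * coeff m f := by
    intro f m
    rw [ht, mul_assoc, coeff_C_mul, coeff_X_pow_mul]
  have ct' : ∀ (f : K⟦X⟧) m, m < 2 → coeff m (t * f) = 0 := by
    intro f m hm
    rw [ht, mul_assoc, coeff_C_mul, coeff_X_pow_mul', if_neg (by omega), mul_zero]
  replace hc : ∀ i, 1 ≤ i → i ≤ k → q ^ i * c i = -(l * y i / (1 + y i) * n i) := hc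
  have hyy : ∀ i, 1 ≤ i → i ≤ k → 1 + y i ≠ 0 := hy
  clear_value a V w y
  have hA : ∀ i ≤ k, V (i + 1) + V i = C (q ^ i) * a i * p + C (n i) * a i -
      C (l * y i / (1 + y i)) * w i := by
    intro i hi
    ext m
    rw [map_sub, map_add, map_add, mul_assoc, coeff_C_mul, coeff_C_mul, coeff_C_mul, cap, ca, hV, hw]
    simp only [coeff_mk]
    rcases lt_trichotomy m i with h | rfl | h
    · simp [show ¬ i + 1 ≤ m by omega, show ¬ i ≤ m by omega, show ¬ i < m by omega, show m ≠ i by omega]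
    · simp [hi, hUs]
    · rw [if_pos h, if_neg (show m ≠ i by omega), if_pos h, if_pos (show i ≤ m ∧ i ≤ k by omega)]
      rcases Nat.eq_zero_or_pos i with rfl | hi0
      · rw [if_pos (by omega), hn0, hn1, hU1 m h]
        have := hT 0 m h
        rw [add_zero] at this
        rw [this, hal]; ring
      · have h1 := hb i
        have h2 := hc i hi0 hi
        rcases hi.lt_or_eq with hik | rfl
        · rw [if_pos (by omega), hU i m hi0 h hik]
          linear_combination U i m * h1 + W i m * h2
        · rw [if_neg (by omega)]
          linear_combination U i m * h1 + W i m * h2 - q ^ i * hUk m h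
  have hB : ∀ i < k, w (i + 1) + t * w i = t * (C ((q ^ i)⁻¹ * μ⁻¹) * a i * p +
      C (l / (1 + y i)) * V i + a i * C (q ^ i * η - n i * μ⁻¹ - l * n i)) := by
    intro i hi
    ext m
    rcases Nat.lt_or_ge m 2 with hm | hm
    · rw [map_add, ct' _ _ hm, ct' _ _ hm, hw, coeff_mk, add_zero]
      split_ifs with h
      · omega
      · rfl
    obtain ⟨m, rfl⟩ : ∃ j, m = j + 2 := ⟨m - 2, by omega⟩
    rw [map_add, ct, ct, map_add, map_add, mul_assoc, coeff_C_mul, cap, coeff_C_mul, mul_comm (a i), coeff_C_mul,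
      ca, hV, hw]
    simp only [coeff_mk]
    rcases lt_trichotomy m i with h | rfl | h
    · simp [show ¬ i + 1 < m + 2 by omega, show ¬ i ≤ m by omega, show ¬ i < m by omega, show m ≠ i by omega]
    · rw [if_pos (by omega), if_neg (by omega), if_neg (by omega), if_pos (by omega), if_pos rfl]
      rcases Nat.eq_zero_or_pos m with rfl | h0
      · rw [hW12, hn0, hn1, hal]; ring
      · rw [hWs m h0 hi, hUs]
        have h1 := hb m
        have h2 := hc m h0 hi.le
        have h3 : l / (1 + y m) = l - l * y m / (1 + y m) := by
          have := hy m h0 hi.le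
          rw [← congrFun hyd m] at this
          field_simp
          ring
        linear_combination g * al m * μ⁻¹ * h1 + g * al m * h2 - g * al m * n m * h3
    · rw [if_pos (by omega), if_pos (by omega), if_pos (by omega), if_pos (by omega), if_neg (by omega)]
      rcases Nat.eq_zero_or_pos i with rfl | h0
      · have := hT 0 m h
        rw [add_zero] at this
        rw [hW1 m h, hn0, hn1, this, hal]; simp; ring
      · rw [hW i m h0 h hi]
        have h1 := hb i
        have h2 := hc i h0 hi.le
        have h3 : l / (1 + y i) = l - l * y i / (1 + y i) := by
          have := hy i h0 hi.le
          rw [← congrFun hyd i] at this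
          field_simp
          ring
        have h4 : l * n i = q ^ i - (q ^ i)⁻¹ := by rw [hn]; field_simp
        linear_combination g * (W i m - l * U i m + l * μ⁻¹ * T i m) * h1 + g * U i m * h2 -
          g * U i m * n i * h3 - g * μ⁻¹ * T i m * h4
  -- The elimination is carried out over a field, so the series are embedded in their field of
  -- fractions; the resulting identity has no denominators in the series.
  set L := FractionRing K⟦X⟧
  set f : K⟦X⟧ →+* L := algebraMap K⟦X⟧ L with hf
  have finj : Function.Injective f := IsFractionRing.injective _ _
  set d : K →+* L := f.comp C with hd
  have hdf : ∀ x, f (C x) = d x := fun x => rfl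
  have dinj : Function.Injective d := finj.comp C_injective
  have hfs : ∀ (c w : K⟦X⟧) i, f (hookSum c w a i) = hookSum (f c) (f w) (fun i => f (a i)) i := by
    intro c w i
    induction i with
    | zero => rfl
    | succ i ih => simp only [hookSum, map_add, map_mul, map_pow, ih]
  have key := elimination (L := L) (q := d q) (μ := d μ) (l := d l) (η := d η) (t := f t) (p := f p) (k := k)
    (al := fun i => f (a i)) (V := fun i => f (V i)) (w := fun i => f (w i))
    ((map_ne_zero d).2 hq) ((map_ne_zero d).2 hμ) ((map_ne_zero d).2 hl)
    (by rw [hlq, map_sub, map_inv₀]) (by rw [hη]; simp only [map_div₀, map_mul, map_sub, map_add, map_inv₀])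
    (by simp [ha, hal])
    (fun i h1 h2 => by
      have := (map_ne_zero d).2 (hy i h1 h2)
      simpa only [map_add, map_mul, map_one, map_pow, map_inv₀] using this)
    (by
      have : V 0 = 0 := by ext m; simp [hV, hn0]
      simp [this])
    (by
      have : w 0 = 0 := by ext m; simp [hw, hn0]
      simp [this])
    (by
      have : V (k + 1) = 0 := by ext m; simp [hV]
      simp [this])
    (fun i hi => by
      have := congrArg f (hA i hi)
      simpa only [hyd, hn, map_add, map_mul, map_one, map_pow, map_inv₀, hdf, map_sub, map_div₀] using this)
    (fun i hi => by
      have := congrArg f (hB i hi)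
      simpa only [hyd, hn, map_add, map_mul, map_one, map_pow, map_inv₀, hdf, map_sub, map_div₀] using this)
  apply finj
  simp only [map_add, map_mul, map_one, map_pow, map_inv₀, hdf, map_sub, map_div₀, hfs, map_neg]
  linear_combination key

end QMA

namespace QMA

/-! ### Generating functions of symmetric functions -/

section Symmetric

open PowerSeries Finset

variable {m : ℕ} {B : Type} [CommRing B] [Algebra ℂ B] (x : Fin m → B)

theorem esym_eq_sum (n : ℕ) : esym x n = ∑ t ∈ powersetCard n univ, ∏ i ∈ t, x i := by
  simp [esym, MvPolynomial.esymm]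

theorem esym_zero : esym x 0 = 1 := by
  rw [esym_eq_sum]; simp

theorem esym_map {B' : Type} [CommRing B'] [Algebra ℂ B'] (f : B →ₐ[ℂ] B') (n : ℕ) :
    f (esym x n) = esym (fun i => f (x i)) n := by
  rw [esym_eq_sum, esym_eq_sum, map_sum]
  simp only [map_prod]

theorem hsym_map {B' : Type} [CommRing B'] [Algebra ℂ B'] (f : B →ₐ[ℂ] B') (n : ℤ) :
    f (hsym x n) = hsym (fun i => f (x i)) n := by
  rw [hsym, hsym]
  split_ifs
  · rw [MvPolynomial.aeval_def, MvPolynomial.aeval_def, MvPolynomial.eval₂_eq, MvPolynomial.eval₂_eq]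
    simp
  · exact map_zero f

theorem prod_one_add_eq (a : B) :
    ∏ i, (1 + C (a * x i) * X) = ∑ j ∈ range (m + 1), C (a ^ j * esym x j) * (X : B⟦X⟧) ^ j := by
  rw [prod_one_add, sum_powerset, card_univ, Fintype.card_fin]
  refine sum_congr rfl fun j _ => ?_
  rw [esym_eq_sum, mul_sum, map_sum, sum_mul]
  refine sum_congr rfl fun t ht => ?_
  rw [prod_mul_distrib, prod_const, (mem_powersetCard.1 ht).2, ← map_prod, prod_mul_distrib, prod_const,
    (mem_powersetCard.1 ht).2]

/-- Pass to complementary subsets: for `s` of size `j`, `g^j` times the product of `x` off `s` is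
the full product times the product of `x ∘ σ` over `s`. -/
theorem esym_reflect {g : B} (σ : Equiv.Perm (Fin m)) (h : ∀ i, x i * x (σ i) = g) {j : ℕ} (hj : j ≤ m) :
    g ^ j * esym x (m - j) = (∏ i, x i) * esym x j := by
  have h1 : ∀ s ∈ powersetCard j (univ : Finset (Fin m)),
      g ^ j * ∏ i ∈ sᶜ, x i = (∏ i, x i) * ∏ i ∈ s, x (σ i) := by
    intro s hs
    rw [← (mem_powersetCard.1 hs).2, ← prod_const, ← prod_compl_mul_prod s x, mul_assoc, ← prod_mul_distrib,
      mul_comm]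
    congr 1
    exact prod_congr rfl fun i _ => (h i).symm
  have h2 : esym x (m - j) = ∑ s ∈ powersetCard j univ, ∏ i ∈ sᶜ, x i := by
    rw [esym_eq_sum]
    refine sum_nbij' (fun s => sᶜ) (fun s => sᶜ) ?_ ?_ (by simp) (by simp) (by simp)
    · intro s hs
      rw [mem_powersetCard] at hs ⊢
      refine ⟨subset_univ _, ?_⟩
      rw [card_compl, Fintype.card_fin, hs.2]; omega
    · intro s hs
      rw [mem_powersetCard] at hs ⊢
      refine ⟨subset_univ _, ?_⟩
      rw [card_compl, Fintype.card_fin, hs.2]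
  have h3 : esym x j = ∑ s ∈ powersetCard j univ, ∏ i ∈ s, x (σ i) := by
    rw [esym_eq_sum]
    refine (sum_nbij' (fun s => s.map σ.toEmbedding) (fun s => s.map σ.symm.toEmbedding) ?_ ?_ ?_ ?_ ?_).symm
    · intro s hs
      rw [mem_powersetCard] at hs ⊢
      exact ⟨subset_univ _, by rw [card_map, hs.2]⟩
    · intro s hs
      rw [mem_powersetCard] at hs ⊢
      exact ⟨subset_univ _, by rw [card_map, hs.2]⟩
    · intro s _; ext i; simp
    · intro s _; ext i; simp
    · intro s _; simp
  rw [h2, h3, mul_sum, mul_sum]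
  exact sum_congr rfl h1

theorem mk_pow_mul {S : Type} [CommRing S] (a : S) : mk (fun n => a ^ n) * (1 - C a * X) = 1 := by
  ext n
  rcases n with _ | n
  · simp
  · rw [mul_sub, mul_one, map_sub, ← mul_assoc, coeff_succ_mul_X, coeff_mul_C, coeff_mk, coeff_mk, coeff_one,
      if_neg (by omega), pow_succ, sub_self]

theorem hsym_natCast (n : ℕ) : hsym x n = ∑ s : Sym (Fin m) n, (s.1.map x).prod := by
  rw [hsym, if_pos (by omega), Int.toNat_natCast, MvPolynomial.hsymm, map_sum]
  refine sum_congr rfl fun s _ => ?_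
  rw [map_multiset_prod, Multiset.map_map]
  congr 2
  funext i
  simp

/-- Multisets of size `n` correspond to exponent vectors of weight `n`, which index the terms of the
coefficient in a product of geometric series. -/
theorem mk_hsym : mk (fun n => hsym x n) = ∏ i, mk fun n => x i ^ n := by
  ext n
  rw [coeff_mk, coeff_prod, hsym_natCast]
  have h1 : ∀ s : Sym (Fin m) n, (s.1.map x).prod = ∏ i, x i ^ (Sym.equivNatSum (Fin m) n s).1 i := by
    intro s
    rw [Finset.prod_multiset_map_count, ← prod_subset (subset_univ s.1.toFinset)]
    · rfl
    · intro i _ hi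
      refine (congrArg (x i ^ ·) ?_).trans (pow_zero _)
      rw [Sym.coe_equivNatSum_apply_apply]
      simpa using hi
  haveI : Fintype {P : Fin m →₀ ℕ // (P.sum fun _ => id) = n} :=
    Fintype.ofEquiv _ (Sym.equivNatSum (Fin m) n)
  rw [sum_congr rfl fun s _ => h1 s,
    Fintype.sum_equiv (Sym.equivNatSum (Fin m) n) _ (fun l => ∏ i, x i ^ l.1 i) fun s => rfl]
  refine (sum_subtype (finsuppAntidiag univ n) (fun l => ?_) (fun l : Fin m →₀ ℕ => ∏ i, x i ^ l i)).symm.trans ?_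
  · rw [mem_finsuppAntidiag]
    simp [Finsupp.sum_fintype]
  · simp only [coeff_mk]

theorem mk_hsym_mul : mk (fun n => hsym x n) * ∏ i, (1 - C (x i) * X) = 1 := by
  rw [mk_hsym, ← prod_mul_distrib]
  exact prod_eq_one fun i _ => mk_pow_mul _

/-- The convention of vanishing in negative degrees makes an index shift the multiplication by a
power of `X`. -/
theorem mk_hsym_sub (j : ℕ) :
    PowerSeries.mk (fun n : ℕ => hsym x ((n : ℤ) - j)) = X ^ j * PowerSeries.mk fun n : ℕ => hsym x n := by
  ext n
  rw [coeff_mk, coeff_X_pow_mul']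
  split_ifs with h
  · rw [coeff_mk, Nat.cast_sub h]
  · rw [hsym, if_neg (by omega)]

end Symmetric

namespace Datum

variable {N : ℕ} (P : Datum N)

theorem newtonS_map {A B : Type} [Ring A] [Algebra ℂ A] [Ring B] [Algebra ℂ B] (f : A →ₐ[ℂ] B)
    (p : ℕ → A) (g : A) (n : ℕ) :
    f (P.newtonS p g n) = P.newtonS (fun i => f (p i)) (f g) n := by
  induction n using Nat.strong_induction_on with
  | _ n ih =>
    rcases n with _ | n
    · rw [newtonS, newtonS, map_one]
    · rw [newtonS, newtonS, map_smul, map_sub, map_sum, map_sum]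
      congr 2
      · refine Finset.sum_congr rfl fun i _ => ?_
        rw [map_smul, map_mul, ih _ (by omega)]
      · refine Finset.sum_congr rfl fun i _ => ?_
        rw [map_smul, map_mul, map_pow, ih _ (by omega)]

end Datum

end QMA

/-! ### Substitution of paired variables in the hook relation. -/

namespace QMA

section Relation

open PowerSeries Finset

variable {K : Type} [Field K] [Algebra ℂ K] {q μ l g : K} {al : ℕ → K} {k m : ℕ} {p t : K⟦X⟧}

theorem hookSum_neg_one (a : K) {x : Fin m → K} (hkm : k ≤ m) (hal : ∀ j ≤ k, al j = esym x j) :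
    hookSum (C a) (-1) (fun i => C (al i) * X ^ i) k =
      (-1) ^ k * ∑ j ∈ range (k + 1), C ((-a) ^ j * esym x j) * (X : K⟦X⟧) ^ j := by
  rw [hookSum_eq_sum, mul_sum]
  refine sum_congr rfl fun j hj => ?_
  have hj' := mem_range.1 hj
  obtain ⟨d, rfl⟩ : ∃ d, k = j + d := ⟨k - j, by omega⟩
  have h2 : ((-1 : K⟦X⟧) ^ j) * (-1) ^ j = 1 := by rw [← mul_pow]; simp
  rw [hal j (by omega), Nat.add_sub_cancel_left, neg_pow a, map_mul, map_mul, map_pow, map_pow, map_neg, map_one, pow_add]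
  linear_combination -(C a ^ j * C (esym x j) * X ^ j * (-1) ^ d) * h2

/-- Reflection turns `g^{k-j} e_j` into a constant times `e_{k-j}`, while `X^j X^{2(k-j)} = X^k
X^{k-j}`. Read backwards, the sum is therefore a product over the variables with the inverse
parameter. -/
theorem hookSum_neg_t_of_reflect (ht : t = C g * X ^ 2) (a : K) {a' : K} (ha : a' * a = 1) {x : Fin k → K} (σ : Equiv.Perm (Fin k))
    (hσ : ∀ i, x i * x (σ i) = g) (hal : ∀ j ≤ k, al j = esym x j) :
    hookSum (C a) (-t) (fun i => C (al i) * X ^ i) k =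
      C ((∏ i, x i) * a ^ k) * X ^ k * ∏ i, (1 + C (-a' * x i) * X) := by
  rw [hookSum_eq_sum, prod_one_add_eq, mul_sum, ← sum_range_reflect]
  refine sum_congr rfl fun j hj => ?_
  have hj' := mem_range.1 hj
  obtain ⟨d, rfl⟩ : ∃ d, k = j + d := ⟨k - j, by omega⟩
  have h3 := esym_reflect x σ hσ (show j ≤ j + d by omega)
  rw [show j + d + 1 - 1 - j = d by omega, show j + d - d = j by omega, hal d (by omega), ht,
    neg_pow a', neg_pow (C g * X ^ 2)]
  have h4 : C g ^ j * C (esym x d) = C (∏ i, x i) * C (esym x j) := by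
    rw [← map_pow, ← map_mul, ← map_mul]
    rw [show j + d - j = d by omega] at h3
    rw [h3 ]
  have h5 : C a' ^ j * C a ^ j = (1 : K⟦X⟧) := by rw [← mul_pow, ← map_mul, ha, map_one, one_pow]
  simp only [map_mul, map_pow, map_neg, map_one, mul_pow, pow_add]
  linear_combination (C a ^ d * X ^ d * (-1) ^ j * (X ^ 2) ^ j) * h4 -
    (C (∏ i, x i) * C a ^ d * X ^ j * X ^ d * (-1) ^ j * C (esym x j) * X ^ j) * h5

/-- With a full set of `k` variables the two brackets are one and the same series `c` times the two
products, up to the constant `l⁻¹`. The constant coefficient of `c` is `±(1 + q^k)`, so `c` cancels.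
-/
theorem relation_orthogonal (hq : q ≠ 0) (hl : l ≠ 0) (hμ : μ = q * (q ^ k)⁻¹) (h1k : 1 + q ^ k ≠ 0) (ht : t = C g * X ^ 2)
    {x : Fin k → K} (σ : Equiv.Perm (Fin k))
    (hσ : ∀ i, x i * x (σ i) = g) (hal : ∀ j ≤ k, al j = esym x j)
    (h : ((1 - t) * (p + C l⁻¹) - C μ * t) *
      (((1 - t) + C (μ * q ^ (2 * k) * q⁻¹) * (1 - t * C (q ^ 2))) *
        hookSum (C q) (-1) (fun i => C (al i) * X ^ i) k -
          t * C (q * q ^ (2 * k) * l) * hookSum (C q⁻¹) (-t) (fun i => C (al i) * X ^ i) k) =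
      (1 - t * C (q ^ 2)) *
        (((1 - t) + C (μ * q ^ (2 * k) * q⁻¹) * (1 - t * C (q ^ 2))) * C l⁻¹ *
          hookSum (C q⁻¹) (-1) (fun i => C (al i) * X ^ i) k -
            C (μ ^ 2 * q ^ (2 * k) * q⁻¹) * t * hookSum (C q) (-t) (fun i => C (al i) * X ^ i) k)) :
    ((1 - t) * (p + C l⁻¹) - C μ * t) * ∏ i, (1 + C (-q * x i) * X) =
      (1 - t * C (q ^ 2)) * C l⁻¹ * ∏ i, (1 + C (-q⁻¹ * x i) * X) := by
  rw [hookSum_neg_one _ le_rfl hal, hookSum_neg_one _ le_rfl hal, ← prod_one_add_eq, ← prod_one_add_eq,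
    hookSum_neg_t_of_reflect ht _ (mul_inv_cancel₀ hq) σ hσ hal,
    hookSum_neg_t_of_reflect ht _ (inv_mul_cancel₀ hq) σ hσ hal] at h
  set E := ∏ i, (1 + C (-q * x i) * X) with hE
  set E' := ∏ i, (1 + C (-q⁻¹ * x i) * X) with hE'
  have hk : q ^ k ≠ 0 := pow_ne_zero _ hq
  have e0 : μ * q ^ (2 * k) * q⁻¹ = q ^ k := by rw [hμ]; field_simp; ring
  set c : K⟦X⟧ := (-1) ^ k * ((1 - t) + C (q ^ k) * (1 - t * C (q ^ 2))) -
    t * C (q * q ^ k * l * ∏ i, x i) * X ^ k with hc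
  have hc0 : c ≠ 0 := by
    intro h0
    have h2 := congrArg constantCoeff h0
    rw [hc] at h2
    have h3 : constantCoeff t = 0 := by rw [ht]; simp
    simp only [map_sub, map_mul, map_add, map_one, map_pow, map_neg, h3, constantCoeff_C, map_zero, sub_zero, zero_mul, mul_one] at h2
    rcases mul_eq_zero.1 h2 with h4 | h4
    · exact absurd h4 (pow_ne_zero _ (by simp))
    · exact h1k h4
  apply mul_left_cancel₀ hc0
  rw [e0] at h
  have e1 : C (q * q ^ (2 * k) * l) * C ((∏ i, x i) * q⁻¹ ^ k) = (C (q * q ^ k * l * ∏ i, x i) : K⟦X⟧) := by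
    rw [← map_mul]; congr 1; rw [inv_pow]; field_simp; ring
  have e2 : C (μ ^ 2 * q ^ (2 * k) * q⁻¹) * C ((∏ i, x i) * q ^ k) =
      (C l⁻¹ * C (q * q ^ k * l * ∏ i, x i) : K⟦X⟧) := by
    rw [← map_mul, ← map_mul]; congr 1; rw [hμ]; field_simp; ring
  rw [hc]
  linear_combination h + ((1 - t) * (p + C l⁻¹) - C μ * t) * t * X ^ k * E * e1 - (1 - t * C (q ^ 2)) * t * X ^ k * E' * e2

/-- As the product of the variables is `-g^{k+1}`, reflection gives `e_{2k+2-j} = -g^{k+1-j} e_j`,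
and in particular `e_{k+1} = 0`. The full product is thus determined by its lower half, whose mirror
image is the sum against `-t`. -/
theorem sum_symplectic (hg : g ≠ 0) (h2 : (2 : K) ≠ 0) {x : Fin (2 * k + 2) → K} (σ : Equiv.Perm (Fin (2 * k + 2)))
    (hσ : ∀ i, x i * x (σ i) = g) (hx : ∏ i, x i = -g ^ (k + 1)) (a : K) {a' : K} (haa : a * a' = 1)
    (ht : t = C g * X ^ 2) (hal : ∀ j ≤ k, al j = esym x j) :
    (-1) ^ k * ∏ i, (1 + C (-a * x i) * X) = hookSum (C a) (-1) (fun i => C (al i) * X ^ i) k -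
      t * C (a ^ (2 * k + 2)) * hookSum (C a') (-t) (fun i => C (al i) * X ^ i) k := by
  have hr : ∀ j ≤ k, esym x (2 * k + 2 - j) = -g ^ (k + 1 - j) * esym x j := by
    intro j hj
    have := esym_reflect x σ hσ (show j ≤ 2 * k + 2 by omega)
    rw [hx] at this
    apply mul_left_cancel₀ (pow_ne_zero j hg)
    rw [this, show g ^ (k + 1) = g ^ j * g ^ (k + 1 - j) by rw [← pow_add]; congr 1; omega]
    ring
  have hm : esym x (k + 1) = 0 := by
    have := esym_reflect x σ hσ (show k + 1 ≤ 2 * k + 2 by omega)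
    rw [hx, show 2 * k + 2 - (k + 1) = k + 1 by omega] at this
    have h3 : (2 * g ^ (k + 1)) * esym x (k + 1) = 0 := by linear_combination this
    exact (mul_eq_zero.1 h3).resolve_left (mul_ne_zero h2 (pow_ne_zero _ hg))
  rw [hookSum_neg_one a (show k ≤ 2 * k + 2 by omega) hal, prod_one_add_eq,
    show 2 * k + 2 + 1 = (k + 1) + 1 + (k + 1) by ring, sum_range_add, sum_range_succ _ (k + 1), hm, mul_zero,
    map_zero, zero_mul, add_zero, mul_add, sub_eq_add_neg]
  congr 1
  rw [hookSum_eq_sum, mul_sum, mul_sum, ← sum_neg_distrib, ← sum_range_reflect]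
  refine sum_congr rfl fun j hj => ?_
  have hj' := mem_range.1 hj
  obtain ⟨d, rfl⟩ : ∃ d, k = j + d := ⟨k - j, by omega⟩
  rw [hal j (by omega), show (j + d) + 1 + 1 + (j + d + 1 - 1 - j) = 2 * (j + d) + 2 - j by omega, hr j (by omega),
    show j + d + 1 - j = d + 1 by omega, show 2 * (j + d) + 2 - j = j + 2 * d + 2 by omega,
    show j + d - j = d by omega, ht]
  have h5 : C a ^ j * C a' ^ j = (1 : K⟦X⟧) := by rw [← mul_pow, ← map_mul, haa, map_one, one_pow]
  have h6 : ((-1 : K⟦X⟧) ^ j) * (-1) ^ j = 1 := by rw [← mul_pow]; simp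
  have h7 : ((-1 : K⟦X⟧) ^ d) * (-1) ^ d = 1 := by rw [← mul_pow]; simp
  rw [neg_pow a, neg_pow (C g * X ^ 2)]
  simp only [map_mul, map_pow, map_neg, map_one, mul_pow, pow_add, pow_mul, mul_neg, neg_mul]
  have h8 : ((-1 : K⟦X⟧) ^ 2) ^ d = 1 := by simp
  rw [h8]
  linear_combination ((C a ^ 2) ^ d * C a ^ 2 * C g ^ d * C g * C (esym x j) * X ^ j * (X ^ 2) ^ d * X ^ 2 *
    (-1) ^ d * C a ^ j) * (h5 - h6)

/-- For this `μ` the factor `(1 - t) + μ q^{2k-1} (1 - q² t)` is the constant `1 - q⁻²`, and the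
brackets become the sums evaluated in `sum_symplectic`. -/
theorem relation_symplectic (hq : q ≠ 0) (hl : l ≠ 0) (hlq : l = q - q⁻¹) (hμ : μ = -(q ^ (1 + 2 * k))⁻¹) (hg : g ≠ 0)
    (h2 : (2 : K) ≠ 0) (ht : t = C g * X ^ 2) {x : Fin (2 * k + 2) → K} (σ : Equiv.Perm (Fin (2 * k + 2)))
    (hσ : ∀ i, x i * x (σ i) = g) (hx : ∏ i, x i = -g ^ (k + 1)) (hal : ∀ j ≤ k, al j = esym x j)
    (h : ((1 - t) * (p + C l⁻¹) - C μ * t) *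
      (((1 - t) + C (μ * q ^ (2 * k) * q⁻¹) * (1 - t * C (q ^ 2))) *
        hookSum (C q) (-1) (fun i => C (al i) * X ^ i) k -
          t * C (q * q ^ (2 * k) * l) * hookSum (C q⁻¹) (-t) (fun i => C (al i) * X ^ i) k) =
      (1 - t * C (q ^ 2)) *
        (((1 - t) + C (μ * q ^ (2 * k) * q⁻¹) * (1 - t * C (q ^ 2))) * C l⁻¹ *
          hookSum (C q⁻¹) (-1) (fun i => C (al i) * X ^ i) k -
            C (μ ^ 2 * q ^ (2 * k) * q⁻¹) * t * hookSum (C q) (-t) (fun i => C (al i) * X ^ i) k)) :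
    ((1 - t) * (p + C l⁻¹) - C μ * t) * ∏ i, (1 + C (-q * x i) * X) =
      (1 - t * C (q ^ 2)) * C l⁻¹ * ∏ i, (1 + C (-q⁻¹ * x i) * X) := by
  have h1 := sum_symplectic hg h2 σ hσ hx q (mul_inv_cancel₀ hq) ht hal
  have h1' := sum_symplectic hg h2 σ hσ hx q⁻¹ (inv_mul_cancel₀ hq) ht hal
  set E := ∏ i, (1 + C (-q * x i) * X) with hE
  set E' := ∏ i, (1 + C (-q⁻¹ * x i) * X) with hE'
  have hk : q ^ k ≠ 0 := pow_ne_zero _ hq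
  have e0 : μ * q ^ (2 * k) * q⁻¹ = -(q ^ 2)⁻¹ := by rw [hμ]; field_simp; ring
  have e1 : (1 : K⟦X⟧) - C (q ^ 2)⁻¹ = C (q⁻¹ * l) := by
    rw [← map_one C, ← map_sub, hlq]; congr 1; field_simp
  have e2 : C (-(q ^ 2)⁻¹) * C (q ^ 2) = (-1 : K⟦X⟧) := by
    rw [← map_mul, ← map_one C, ← map_neg]; congr 1; field_simp
  have e3 : C (q * q ^ (2 * k) * l) = (C (q⁻¹ * l) * C (q ^ (2 * k + 2)) : K⟦X⟧) := by
    rw [← map_mul]; congr 1; field_simp; ring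
  have e4 : C (μ ^ 2 * q ^ (2 * k) * q⁻¹) = (C (q⁻¹ * l) * C l⁻¹ * C (q⁻¹ ^ (2 * k + 2)) : K⟦X⟧) := by
    rw [← map_mul, ← map_mul]; congr 1; rw [hμ, inv_pow]; field_simp; ring
  apply mul_left_cancel₀ (a := (-1) ^ k * C (q⁻¹ * l))
    (mul_ne_zero (pow_ne_zero _ (by simp)) (by simpa using mul_ne_zero (inv_ne_zero hq) hl))
  have e5 : (1 - t) + C (μ * q ^ (2 * k) * q⁻¹) * (1 - t * C (q ^ 2)) = C (q⁻¹ * l) := by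
    rw [← e1, e0]
    rw [map_neg] at e2 ⊢
    linear_combination -t * e2
  rw [e5, e3, e4] at h
  linear_combination h + ((1 - t) * (p + C l⁻¹) - C μ * t) * C (q⁻¹ * l) * h1 -
    (1 - t * C (q ^ 2)) * C l⁻¹ * C (q⁻¹ * l) * h1'

end Relation

namespace Datum

open PowerSeries in
/-- The relation between power sums and elementary symmetric functions. -/
theorem TraceTower.relation {N : ℕ} {P : Datum N} {K : Type} [Field K] [Algebra ℂ K]
    (τ : P.TraceTower K) (hB : P.IsBMW) (hR : IsRMatrix P.R) {k : ℕ} (hk : P.HasHeight k)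
    (hd : ∀ t, 1 ≤ t → t ≤ k → 1 + P.mu * P.q ^ (2 * t) * P.q⁻¹ ≠ 0) {q μ l : K}
    (hq : q = algebraMap ℂ K P.q) (hμ : μ = algebraMap ℂ K P.mu) (hl : l = q - q⁻¹)
    {p t : K⟦X⟧} (hp : p = PowerSeries.mk fun m => if 1 ≤ m then τ.pw m else 0) (ht : t = C τ.ga * X ^ 2) :
    ((1 - t) * (p + C l⁻¹) - C μ * t) *
      (((1 - t) + C (μ * q ^ (2 * k) * q⁻¹) * (1 - t * C (q ^ 2))) *
        hookSum (C q) (-1) (fun i => C (τ.al i) * X ^ i) k -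
          t * C (q * q ^ (2 * k) * l) * hookSum (C q⁻¹) (-t) (fun i => C (τ.al i) * X ^ i) k) =
      (1 - t * C (q ^ 2)) *
        (((1 - t) + C (μ * q ^ (2 * k) * q⁻¹) * (1 - t * C (q ^ 2))) * C l⁻¹ *
          hookSum (C q⁻¹) (-1) (fun i => C (τ.al i) * X ^ i) k -
            C (μ ^ 2 * q ^ (2 * k) * q⁻¹) * t * hookSum (C q) (-t) (fun i => C (τ.al i) * X ^ i) k) := by
  have hq0 := hB.q_ne_zero
  have hn := hk.qnum_ne_zero
  have hd' : ∀ t, 1 ≤ t → t < k → P.q * (P.q ^ (2 * t))⁻¹ + P.mu ≠ 0 :=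
    fun t h1 h2 => den_ne_zero hq0 (hd t h1 h2.le)
  have h2 := hk.two_le
  set ι := algebraMap ℂ K with hι
  have hlι : l = ι (P.q - P.q⁻¹) := by rw [hl, hq, map_sub, map_inv₀]
  refine hook_series (n := fun i => ι (qnum P.q i)) (b := fun i => ι (coefR P.q i)) (η := ι P.eta)
    (c := fun i => ι (coefK P.q P.mu i)) (U := τ.U) (T := τ.T) (W := τ.W) (pw := τ.pw) (by omega)
    (by rw [hq]; exact (map_ne_zero ι).2 hq0) (by rw [hμ]; exact (map_ne_zero ι).2 hB.mu_ne_zero)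
    (by rw [hlι]; exact (map_ne_zero ι).2 hB.lam_ne) hl ?_ ?_ ?_ ?_ ?_ τ.al_zero (fun i w hw => τ.T_eq hw)
    τ.U_self ?_ ?_ ?_ ?_ ?_ ?_ ?_ hp ht
  · rw [hlι, hq, hμ, eta]
    simp only [map_div₀, map_mul, map_sub, map_add, map_inv₀]
  · intro i h3 h4
    have := (map_ne_zero ι).2 (hd i h3 h4)
    rw [hq, hμ]
    simpa only [map_add, map_mul, map_one, map_pow, map_inv₀] using this
  · intro i
    rw [hlι, hq, qnum]
    simp only [map_div₀, map_sub, map_inv₀, map_pow]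
  · intro i
    rw [hq, ← map_pow, ← map_mul, ← map_neg, coefR, sub_one_div _ hq0]
    congr 1
    have := pow_ne_zero i hq0
    field_simp
  · intro i h3 h4
    have e : P.q ^ i * coefK P.q P.mu i = -((P.q - P.q⁻¹) * (P.mu * P.q ^ (2 * i) * P.q⁻¹) /
        (1 + P.mu * P.q ^ (2 * i) * P.q⁻¹) * qnum P.q i) := by
      have h5 := hd i h3 h4
      have h6 := den_ne_zero hq0 h5
      have h7 := hB.mu_ne_zero
      have h8 := hB.lam_ne
      have h9 : P.q ^ i ≠ 0 := pow_ne_zero i hq0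
      have h10 : P.q * P.mu⁻¹ * (P.q ^ (2 * i))⁻¹ + 1 = (1 + P.mu * P.q ^ (2 * i) * P.q⁻¹) *
          (P.mu * P.q ^ (2 * i) * P.q⁻¹)⁻¹ := by
        field_simp
      rw [coefK, qnum, h10]
      have h11 : P.q ^ (2 * i) = P.q ^ i * P.q ^ i := by rw [two_mul, pow_add]
      set y := P.mu * P.q ^ (2 * i) * P.q⁻¹ with hy
      have h12 : y ≠ 0 := mul_ne_zero (mul_ne_zero h7 (pow_ne_zero _ hq0)) (inv_ne_zero hq0)
      clear_value y
      rw [h11]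
      generalize P.q - P.q⁻¹ = s at *
      field_simp
      ring
    have := congrArg ι e
    rw [hlι, hq, hμ]
    simpa only [map_add, map_mul, map_one, map_pow, map_inv₀, map_neg, map_div₀, map_sub] using this
  · intro m hm
    rw [U, ba, asymm, one_mul]; rfl
  · intro i m h3 h4 h5
    have := τ.U_succ hB hR hn hd' h3 h4 h5
    simpa only [Algebra.smul_def, map_pow, ← hι, ← hq] using this
  · intro m hm
    have := τ.U_height hB hR hn hd' (i := k - 1) (by omega) hm
      (hk.sandwich_eq_zero hB hR hd' hm (by omega))
    simpa only [Algebra.smul_def, map_pow, ← hι, ← hq] using this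
  · rw [τ.W_one_two hB hR hn hd', Algebra.smul_def]
  · intro m hm
    rw [τ.W_one hB hR hn hd' hm, Algebra.smul_def, hμ, map_inv₀]
  · intro i h3 h5
    have := τ.W_self hB hR hn hd' h3 h5
    simpa only [Algebra.smul_def, map_pow, map_add, map_mul, map_inv₀, ← hι, ← hq, ← hμ] using this
  · intro i m h3 h4 h5
    have := τ.W_succ hB hR hn hd' h3 h4 h5
    simpa only [Algebra.smul_def, map_pow, map_add, map_mul, map_inv₀, map_sub, ← hι, ← hq, ← hμ, ← hl] using this

end Datum

end QMA

namespace QMA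

/-! ### The interpolation identity for the weights -/

section Weights

open Polynomial Finset

theorem prod_pair {M : Type} [CommMonoid M] {r : ℕ} {f : Fin (2 * r) → M} {c : M}
    (h : ∀ i, f i * f i.rev = c) : ∏ i, f i = c ^ r := by
  have e : r + r = 2 * r := by ring
  rw [← Fin.prod_congr' f e, Fin.prod_univ_add, ← Equiv.prod_comp Fin.revPerm (fun i : Fin r => f (Fin.cast e (Fin.natAdd r i))),
    ← prod_mul_distrib]
  rw [show c ^ r = ∏ _i : Fin r, c by simp]
  refine prod_congr rfl fun i _ => ?_
  rw [← h (Fin.cast e (Fin.castAdd r i))]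
  congr 2
  ext
  simp [Fin.val_rev]
  omega

variable {K : Type} [Field K] {r : ℕ} {ν w : Fin (2 * r) → K} {z q l μ n1 n2 τ0 τ1 : K}

theorem rev_ne (i : Fin (2 * r)) : i.rev ≠ i := by
  intro h
  have := congrArg Fin.val h
  rw [Fin.val_rev] at this
  omega

/-- At `X = ±1/z` the pairing `ν_j ↦ z² / ν_j` turns each factor with `q⁻¹` into one with `q`, up to
a constant; these constants multiply to `q^{-2r}`. -/
theorem eval_reflect {ε : K} (hε : ε ^ 2 = 1) (hq : q ≠ 0) (hz : z ≠ 0) (hν : ∀ i, ν i * ν i.rev = z ^ 2) :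
    ∏ j, (1 - q⁻¹ * ν j * (ε * z⁻¹)) = (q ^ (2 * r))⁻¹ * ∏ j, (1 - q * ν j * (ε * z⁻¹)) := by
  have h0 : ∀ j, ν j ≠ 0 := fun j h => by
    have := hν j
    rw [h, zero_mul] at this
    exact pow_ne_zero 2 hz this.symm
  have h1 : ∀ j, 1 - q⁻¹ * ν j.rev * (ε * z⁻¹) = (-(ε * z * q⁻¹) * (ν j)⁻¹) * (1 - q * ν j * (ε * z⁻¹)) := by
    intro j
    have h2 : ν j.rev = z ^ 2 * (ν j)⁻¹ := by
      rw [← hν j]; have := h0 j; field_simp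
    rw [h2]
    have := h0 j
    field_simp
    linear_combination (-(ν j * q)) * hε
  rw [← Equiv.prod_comp Fin.revPerm]
  simp only [Fin.revPerm_apply]
  rw [prod_congr rfl fun j _ => h1 j, prod_mul_distrib, prod_mul_distrib,
    prod_inv_distrib, prod_pair hν, prod_const, card_univ, Fintype.card_fin]
  congr 1
  rw [pow_mul, show (-(ε * z * q⁻¹)) ^ 2 = z ^ 2 * (q ^ 2)⁻¹ by rw [neg_sq, mul_pow, mul_pow, hε]; ring, mul_pow,
    pow_mul]
  have := pow_ne_zero r (pow_ne_zero 2 hz)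
  rw [inv_pow]
  field_simp

/-- The weights interpolate the generating function of the power sums. -/
theorem weight_identity (hq : q ≠ 0) (hz : z ≠ 0) (hl : l ≠ 0) (hlq : l * q = q ^ 2 - 1)
    (hν : ∀ i, ν i * ν i.rev = z ^ 2) (hinj : Function.Injective ν)
    (hpos : ∀ i, q * ν i ≠ z) (hneg : ∀ i, q * ν i ≠ -z) (hzz : z ≠ -z)
    (hlead : n2 = -(z ^ 2 * μ ^ 2 * q ^ (4 * r)))
    (hw : ∀ i, w i * (1 - ν i.rev / ν i) = 1 + n1 * (q * ν i)⁻¹ + n2 * ((q * ν i)⁻¹) ^ 2)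
    (hp : (1 + n1 * z⁻¹ + n2 * (z⁻¹) ^ 2) * (q ^ (2 * r))⁻¹ * l⁻¹ = -μ + τ0 + τ1 * z⁻¹)
    (hm : (1 - n1 * z⁻¹ + n2 * (z⁻¹) ^ 2) * (q ^ (2 * r))⁻¹ * l⁻¹ = -μ + τ0 - τ1 * z⁻¹) :
    (1 - C (z ^ 2) * X ^ 2) * ∑ i, C (q⁻¹ * (w i * ∏ j ∈ univ.filter (fun j => j ≠ i ∧ j ≠ i.rev),
        (ν i - (q ^ 2)⁻¹ * ν j) / (ν i - ν j))) * ∏ j ∈ univ.erase i, (1 - C (q * ν j) * X) =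
      (1 + C n1 * X + C n2 * X ^ 2) * (∏ j, (1 - C (q⁻¹ * ν j) * X)) * C l⁻¹ -
        (C (μ ^ 2 * l⁻¹ - μ + τ0) + C τ1 * X - C (z ^ 2 * μ ^ 2 * l⁻¹) * X ^ 2) *
          ∏ j, (1 - C (q * ν j) * X) := by
  have h0 : ∀ j, ν j ≠ 0 := fun j h => by
    have := hν j
    rw [h, zero_mul] at this
    exact pow_ne_zero 2 hz this.symm
  have dlin : ∀ c : K, (1 - C c * X : K[X]).natDegree ≤ 1 := fun c => by compute_degree
  have dprod : ∀ (c : K) (s : Finset (Fin (2 * r))), (∏ j ∈ s, (1 - C (c * ν j) * X)).natDegree ≤ s.card := by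
    intro c s
    refine (natDegree_prod_le _ _).trans ((sum_le_sum fun j _ => dlin _).trans ?_)
    simp
  have cprod : ∀ c : K, (∏ j, (1 - C (c * ν j) * X)).coeff (2 * r) = c ^ (2 * r) * (z ^ 2) ^ r := by
    intro c
    have := coeff_prod_of_natDegree_le (s := univ) (fun j => (1 - C (c * ν j) * X)) 1 fun j _ => dlin _
    rw [card_univ, Fintype.card_fin, mul_one] at this
    rw [this]
    have h1 : ∀ j, (1 - C (c * ν j) * X : K[X]).coeff 1 = -(c * ν j) := fun j => by
      rw [coeff_sub, coeff_C_mul, coeff_X_one, coeff_one]; simp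
    rw [prod_congr rfl fun j _ => h1 j, prod_neg, prod_mul_distrib, prod_pair hν, prod_const, card_univ,
      Fintype.card_fin]
    simp
  rw [← sub_eq_zero]
  set S := ∑ i, C (q⁻¹ * (w i * ∏ j ∈ univ.filter (fun j => j ≠ i ∧ j ≠ i.rev),
        (ν i - (q ^ 2)⁻¹ * ν j) / (ν i - ν j))) * ∏ j ∈ univ.erase i, (1 - C (q * ν j) * X) with hS
  set N : K[X] := 1 + C n1 * X + C n2 * X ^ 2 with hN
  set M : K[X] := C (μ ^ 2 * l⁻¹ - μ + τ0) + C τ1 * X - C (z ^ 2 * μ ^ 2 * l⁻¹) * X ^ 2 with hM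
  set D' := ∏ j, (1 - C (q⁻¹ * ν j) * X) with hD'
  set D := ∏ j, (1 - C (q * ν j) * X) with hD
  have dN : N.natDegree ≤ 2 := by rw [hN]; compute_degree
  have dM : M.natDegree ≤ 2 := by rw [hM]; compute_degree
  have cN : N.coeff 2 = n2 := by rw [hN]; simp [coeff_one, coeff_X, coeff_C]
  have cM : M.coeff 2 = -(z ^ 2 * μ ^ 2 * l⁻¹) := by 
    rw [hM, coeff_sub, coeff_add, coeff_C_ne_zero (by omega), coeff_C_mul, coeff_C_mul, coeff_X, coeff_X_pow]; simp
  have dD : D.natDegree ≤ 2 * r := (dprod q univ).trans (by simp)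
  have dD' : D'.natDegree ≤ 2 * r := (dprod q⁻¹ univ).trans (by simp)
  have dS : S.natDegree ≤ 2 * r - 1 := by
    refine natDegree_sum_le_of_forall_le _ _ fun i _ => (natDegree_C_mul_le _ _).trans ((dprod _ _).trans ?_)
    rw [card_erase_of_mem (mem_univ i), card_univ, Fintype.card_fin]
  have dX : (1 - C (z ^ 2) * X ^ 2 : K[X]).natDegree ≤ 2 := by compute_degree
  -- The condition `hlead` removes the coefficient of degree `2r + 2`, so that vanishing at `2r + 2`
  -- points is enough.
  have top : ((1 - C (z ^ 2) * X ^ 2) * S - (N * D' * C l⁻¹ - M * D)).coeff (2 + 2 * r) = 0 := by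
    have h1 : ((1 - C (z ^ 2) * X ^ 2) * S).coeff (2 + 2 * r) = 0 := by
      rcases Nat.eq_zero_or_pos r with rfl | hr
      · have : S = 0 := by rw [hS]; exact sum_eq_zero fun i _ => absurd i.2 (by omega)
        rw [this, mul_zero, coeff_zero]
      · exact coeff_eq_zero_of_natDegree_lt (natDegree_mul_le.trans_lt (by omega))
    rw [coeff_sub, coeff_sub, h1, coeff_mul_C, coeff_mul_add_eq_of_natDegree_le dN dD',
      coeff_mul_add_eq_of_natDegree_le dM dD, cN, cM, cprod, cprod, hlead, inv_pow]
    have := pow_ne_zero (2 * r) hq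
    have e : q ^ (4 * r) = q ^ (2 * r) * q ^ (2 * r) := by rw [← pow_add]; congr 1; ring
    rw [e]
    field_simp
    ring
  have deg : ((1 - C (z ^ 2) * X ^ 2) * S - (N * D' * C l⁻¹ - M * D)).natDegree < 2 * r + 2 := by
    have h1 : ((1 - C (z ^ 2) * X ^ 2) * S - (N * D' * C l⁻¹ - M * D)).natDegree ≤ 2 * r + 2 := by
      refine (natDegree_sub_le_of_le (natDegree_mul_le_of_le dX dS) (natDegree_sub_le_of_le
        ((natDegree_mul_C_le _ _).trans (natDegree_mul_le_of_le dN dD')) (natDegree_mul_le_of_le dM dD))).trans ?_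
      simp
      omega
    refine lt_of_le_of_ne h1 fun h2 => ?_
    have h3 : ((1 - C (z ^ 2) * X ^ 2) * S - (N * D' * C l⁻¹ - M * D)).leadingCoeff = 0 := by
      rw [leadingCoeff, h2, add_comm, top]
    rw [leadingCoeff_eq_zero] at h3
    rw [h3, natDegree_zero] at h2
    omega
  -- The nodes are the points `1/(q ν_i)`, where the denominators of the partial fractions vanish,
  -- and `±1/z`, the zeros of `1 - z² X²`.
  refine eq_zero_of_natDegree_lt_card_of_eval_eq_zero _
    (f := (Sum.elim (fun i => (q * ν i)⁻¹) ![z⁻¹, -z⁻¹] : Fin (2 * r) ⊕ Fin 2 → K)) ?_ ?_ (by simpa using deg)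
  · refine Function.Injective.sumElim ?_ ?_ ?_
    · intro i j h
      exact hinj (mul_left_cancel₀ hq (inv_injective h))
    · intro i j h
      have h5 : z⁻¹ ≠ -z⁻¹ := by
        rw [← inv_neg]; exact fun h => hzz (inv_injective h)
      fin_cases i <;> fin_cases j <;> simp at h ⊢
      · exact h5 h
      · exact h5 h.symm
    · intro i j h
      fin_cases j
      · exact hpos i (inv_injective h)
      · refine hneg i (inv_injective ?_)
        rw [inv_neg]; exact h
  · have evprod : ∀ (c x : K) (s : Finset (Fin (2 * r))), eval x (∏ j ∈ s, (1 - C (c * ν j) * X)) =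
        ∏ j ∈ s, (1 - c * ν j * x) := by
      intro c x s
      rw [eval_prod]; simp
    rintro (i | i)
    -- At `1/(q ν_i)` only the `i`-th summand survives and `D` vanishes. The variable paired with
    -- `ν_i` is not in the product of ratios; `hw` accounts for its factor.
    · rw [Sum.elim_inl]
      have hi := h0 i
      have D0 : eval (q * ν i)⁻¹ D = 0 := by
        rw [hD, evprod]
        exact prod_eq_zero (mem_univ i) (by rw [mul_inv_cancel₀ (mul_ne_zero hq hi), sub_self])
      have evS : eval (q * ν i)⁻¹ S = (q⁻¹ * (w i * ∏ j ∈ univ.filter (fun j => j ≠ i ∧ j ≠ i.rev),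
          (ν i - (q ^ 2)⁻¹ * ν j) / (ν i - ν j))) * ∏ j ∈ univ.erase i, (1 - ν j / ν i) := by
        rw [hS, eval_finset_sum, sum_eq_single i]
        · rw [eval_mul, eval_C, evprod]
          congr 1
          refine prod_congr rfl fun j _ => ?_
          field_simp
        · intro j _ hj
          rw [eval_mul, evprod, prod_eq_zero (i := i) (mem_erase.2 ⟨hj.symm, mem_univ i⟩), mul_zero]
          rw [mul_inv_cancel₀ (mul_ne_zero hq hi), sub_self]
        · exact fun h => absurd (mem_univ i) h
      have hrev := rev_ne i
      have split : ∀ f : Fin (2 * r) → K, ∏ j ∈ univ.erase i, f j =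
          f i.rev * ∏ j ∈ univ.filter (fun j => j ≠ i ∧ j ≠ i.rev), f j := by
        intro f
        rw [← mul_prod_erase _ _ (mem_erase.2 ⟨hrev, mem_univ _⟩)]
        congr 1
        refine prod_congr ?_ fun _ _ => rfl
        ext j
        simp [and_comm]
      have hpr : (∏ j ∈ univ.filter (fun j => j ≠ i ∧ j ≠ i.rev), (ν i - (q ^ 2)⁻¹ * ν j) / (ν i - ν j)) *
          ∏ j ∈ univ.filter (fun j => j ≠ i ∧ j ≠ i.rev), (1 - ν j / ν i) =
          ∏ j ∈ univ.filter (fun j => j ≠ i ∧ j ≠ i.rev), (1 - q⁻¹ * ν j * (q * ν i)⁻¹) := by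
        rw [← prod_mul_distrib]
        refine prod_congr rfl fun j hj => ?_
        have h1 : ν i - ν j ≠ 0 := sub_ne_zero.2 fun h => (mem_filter.1 hj).2.1 (hinj h).symm
        field_simp
      have evD' : eval (q * ν i)⁻¹ D' = (1 - (q ^ 2)⁻¹) * ((1 - q⁻¹ * ν i.rev * (q * ν i)⁻¹) *
          ∏ j ∈ univ.filter (fun j => j ≠ i ∧ j ≠ i.rev), (1 - q⁻¹ * ν j * (q * ν i)⁻¹)) := by
        rw [hD', evprod, ← mul_prod_erase _ _ (mem_univ i), split]
        congr 1
        field_simp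
      have evN : eval (q * ν i)⁻¹ N = 1 + n1 * (q * ν i)⁻¹ + n2 * ((q * ν i)⁻¹) ^ 2 := by
        rw [hN]; simp
      have ev1 : eval (q * ν i)⁻¹ (1 - C (z ^ 2) * X ^ 2 : K[X]) = 1 - q⁻¹ * ν i.rev * (q * ν i)⁻¹ := by
        rw [← hν i]; simp only [eval_sub, eval_one, eval_mul, eval_C, eval_pow, eval_X]; field_simp
      have hql : (1 - (q ^ 2)⁻¹) * l⁻¹ = q⁻¹ := by
        field_simp; linear_combination -hlq
      rw [eval_sub, eval_sub, eval_mul, eval_mul, eval_mul, eval_mul, D0, mul_zero, sub_zero, eval_C, evS, evD', evN, ev1,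
        ← hw i, split, ← hpr]
      generalize ∏ j ∈ univ.filter (fun j => j ≠ i ∧ j ≠ i.rev), (ν i - (q ^ 2)⁻¹ * ν j) / (ν i - ν j) = a1
      generalize ∏ j ∈ univ.filter (fun j => j ≠ i ∧ j ≠ i.rev), (1 - ν j / ν i) = a2
      linear_combination (-(w i * (1 - ν i.rev / ν i) * (1 - q⁻¹ * ν i.rev * (q * ν i)⁻¹) * a1 * a2)) * hql
    -- At `±1/z` the left-hand side vanishes, and `eval_reflect` reduces the equality of the two
    -- terms on the right to `hp` and `hm`.
    · have main : ∀ ε : K, ε ^ 2 = 1 →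
          (1 + n1 * (ε * z⁻¹) + n2 * (ε * z⁻¹) ^ 2) * (q ^ (2 * r))⁻¹ * l⁻¹ = -μ + τ0 + τ1 * (ε * z⁻¹) →
          eval (ε * z⁻¹) ((1 - C (z ^ 2) * X ^ 2) * S - (N * D' * C l⁻¹ - M * D)) = 0 := by
        intro ε hε h1
        have hzz : z ^ 2 * (ε * z⁻¹) ^ 2 = 1 := by rw [mul_pow, hε]; field_simp
        have e1 : eval (ε * z⁻¹) (1 - C (z ^ 2) * X ^ 2 : K[X]) = 0 := by
          simp only [eval_sub, eval_one, eval_mul, eval_C, eval_pow, eval_X]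
          rw [hzz, sub_self]
        have e2 : eval (ε * z⁻¹) D' = (q ^ (2 * r))⁻¹ * eval (ε * z⁻¹) D := by
          rw [hD, hD', evprod, evprod]
          exact eval_reflect hε hq hz hν
        have e3 : eval (ε * z⁻¹) N = 1 + n1 * (ε * z⁻¹) + n2 * (ε * z⁻¹) ^ 2 := by rw [hN]; simp
        have e4 : eval (ε * z⁻¹) M = -μ + τ0 + τ1 * (ε * z⁻¹) := by
          rw [hM]; simp only [eval_sub, eval_add, eval_mul, eval_C, eval_pow, eval_X]
          linear_combination (-(μ ^ 2 * l⁻¹)) * hzz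
        rw [eval_sub, eval_sub, eval_mul, eval_mul, eval_mul, eval_mul, e1, e2, e3, e4, eval_C]
        linear_combination (-(eval (ε * z⁻¹) D)) * h1
      fin_cases i
      · have := main 1 (by ring) (by rw [one_mul]; exact hp)
        rw [one_mul] at this; exact this
      · have := main (-1) (by ring) (by linear_combination hm)
        rw [neg_one_mul] at this; exact this

end Weights

end QMA

/-! ### The Newton recursion and the partial fraction expansion of the power sums. -/

namespace QMA

section Newton

open PowerSeries Finset

variable {K : Type} [Field K] {q μ l g : K} {r : ℕ} {ν : Fin r → K} {pw : ℕ → K} {p t N B H : K⟦X⟧}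

theorem rescale_C' {S : Type} [CommRing S] (a b : S) : rescale a (C b) = C b := by
  ext n
  rw [coeff_rescale, coeff_C]
  split_ifs with h
  · rw [h, pow_zero, one_mul]
  · rw [mul_zero]

theorem rescale_prod (a : K) :
    rescale a (∏ i, (1 - C (ν i) * X)) = ∏ i, (1 - C (a * ν i) * X) := by
  rw [map_prod]
  refine prod_congr rfl fun i _ => ?_
  rw [map_sub, map_one, map_mul, rescale_X, rescale_C', ← mul_assoc, ← map_mul, mul_comm a]

theorem prod_one_sub_ne_zero (a : K) : (∏ i, (1 - C (a * ν i) * X) : K⟦X⟧) ≠ 0 := by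
  intro h
  have := congrArg constantCoeff h
  rw [map_prod] at this
  simp at this

/-- The denominators of `H(X/q)` and `H(qX)` are the two products in `hrel`; the condition `hB`
matches the numerators. -/
theorem newton_series (hl : l ≠ 0) (hq : q ≠ 0)
    (hrel : ((1 - t) * (p + C l⁻¹) - C μ * t) * ∏ i, (1 - C (q * ν i) * X) =
      N * (∏ i, (1 - C (q⁻¹ * ν i) * X)) * C l⁻¹)
    (hH : H * ∏ i, (1 - C (ν i) * X) = B)
    (hB : rescale q⁻¹ B * N = rescale q B * (1 - t * C (q ^ 2)⁻¹)) :
    rescale q⁻¹ H * ((1 - t) * (p + C l⁻¹) - C μ * t) =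
      rescale q H * (1 - t * C (q ^ 2)⁻¹) * C l⁻¹ := by
  have h1 := congrArg (rescale q) hH
  have h2 := congrArg (rescale q⁻¹) hH
  rw [map_mul, rescale_prod] at h1 h2
  apply mul_right_cancel₀ (mul_ne_zero (prod_one_sub_ne_zero (ν := ν) q) (prod_one_sub_ne_zero (ν := ν) q⁻¹))
  set D := (∏ i, (1 - C (q * ν i) * X) : K⟦X⟧)
  set D' := (∏ i, (1 - C (q⁻¹ * ν i) * X) : K⟦X⟧)
  linear_combination (rescale q⁻¹ H * D') * hrel + (N * D' * C l⁻¹) * h2 -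
    ((1 - t * C (q ^ 2)⁻¹) * C l⁻¹ * D') * h1 + D' * C l⁻¹ * hB

/-- The correction terms of the Newton recursion. -/
theorem newton_tail (hq : q ≠ 0) (ht : t = C g * X ^ 2) (h : ℕ → K) {R : K⟦X⟧}
    (hR : R = PowerSeries.mk fun m => ∑ i ∈ range (m / 2),
      (μ * q ^ (2 * ((i : ℤ) + 1) - m) + q ^ ((m : ℤ) - 2 * ((i : ℤ) + 1) - 1)) *
        (h (m - 2 * (i + 1)) * g ^ (i + 1))) :
    (1 - t) * R = t * (C μ * rescale q⁻¹ (PowerSeries.mk h) + C q⁻¹ * rescale q (PowerSeries.mk h)) := by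
  -- Multiplication by `t` moves the sum over powers of `g` by one term, so in `(1 - t) R` only the
  -- first term of each coefficient is left.
  rw [sub_mul, one_mul, sub_eq_iff_eq_add, ← mul_add]
  ext m
  rw [ht, mul_assoc, coeff_C_mul, coeff_X_pow_mul', hR, coeff_mk]
  split_ifs with hm
  · obtain ⟨m, rfl⟩ := Nat.exists_eq_add_of_le' hm
    rw [Nat.add_sub_cancel, map_add, map_add, coeff_C_mul, coeff_C_mul, coeff_rescale, coeff_rescale, coeff_mk, coeff_mk,
      show (m + 2) / 2 = m / 2 + 1 by omega, sum_range_succ', add_comm]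
    rw [mul_add g, mul_sum]
    congr 1
    · have e1 : q ^ (2 * (((0 : ℕ) : ℤ) + 1) - ((m + 2 : ℕ) : ℤ)) = q⁻¹ ^ m := by
        rw [inv_pow, ← zpow_natCast, ← zpow_neg]; congr 1; push_cast; ring
      have e2 : q ^ (((m + 2 : ℕ) : ℤ) - 2 * (((0 : ℕ) : ℤ) + 1) - 1) = q⁻¹ * q ^ m := by
        rw [← zpow_natCast, ← zpow_neg_one, ← zpow_add₀ hq]; congr 1; push_cast; ring
      rw [e1, e2, show m + 2 - 2 * (0 + 1) = m by omega]
      ring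
    · refine sum_congr rfl fun i hi => ?_
      have hi' := mem_range.1 hi
      rw [show m + 2 - 2 * (i + 1 + 1) = m - 2 * (i + 1) by omega,
        show 2 * (((i + 1 : ℕ) : ℤ) + 1) - ((m + 2 : ℕ) : ℤ) = 2 * ((i : ℤ) + 1) - m by push_cast; ring,
        show ((m + 2 : ℕ) : ℤ) - 2 * (((i + 1 : ℕ) : ℤ) + 1) - 1 = (m : ℤ) - 2 * ((i : ℤ) + 1) - 1 by push_cast; ring]
      ring
  · rw [show m / 2 = 0 by omega, sum_range_zero, mul_zero]

/-- Division by `1 - t` turns `hs` into `H(X/q) p = (H(qX) - H(X/q)) / l + R`, where `R` collects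
the terms with powers of `g`. Coefficients are then compared. -/
theorem newton_coeff (hl : l ≠ 0) (hq : q ≠ 0) (hlq : l = q - q⁻¹) (ht : t = C g * X ^ 2)
    (hp : p = PowerSeries.mk fun m => if 1 ≤ m then pw m else 0) (h : ℕ → K)
    (hs : rescale q⁻¹ (PowerSeries.mk h) * ((1 - t) * (p + C l⁻¹) - C μ * t) =
      rescale q (PowerSeries.mk h) * (1 - t * C (q ^ 2)⁻¹) * C l⁻¹) (m : ℕ) :
    ∑ i ∈ range (m + 1), (q ^ i)⁻¹ * (h i * pw (m + 1 - i)) =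
      (q ^ (m + 1) - (q ^ (m + 1))⁻¹) / l * h (m + 1) + ∑ i ∈ range ((m + 1) / 2),
      (μ * q ^ (2 * ((i : ℤ) + 1) - (m + 1 : ℕ)) + q ^ (((m + 1 : ℕ) : ℤ) - 2 * ((i : ℤ) + 1) - 1)) *
        (h (m + 1 - 2 * (i + 1)) * g ^ (i + 1)) := by
  have h1 := newton_tail (μ := μ) hq ht h rfl
  set R : K⟦X⟧ := PowerSeries.mk fun m => ∑ i ∈ range (m / 2),
      (μ * q ^ (2 * ((i : ℤ) + 1) - m) + q ^ ((m : ℤ) - 2 * ((i : ℤ) + 1) - 1)) *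
        (h (m - 2 * (i + 1)) * g ^ (i + 1)) with hR
  have ht0 : (1 : K⟦X⟧) - t ≠ 0 := by
    intro h0
    have := congrArg constantCoeff h0
    rw [ht] at this
    simp at this
  -- This splits `(1 - q⁻² t)/l` into `(1 - t)/l + q⁻¹ t`; the second part is one of the correction
  -- terms.
  have e1 : (C (q ^ 2)⁻¹ : K⟦X⟧) * C l⁻¹ = C l⁻¹ - C q⁻¹ := by
    rw [← map_mul, ← map_sub]; congr 1; field_simp; rw [hlq]; field_simp; ring
  have h2 : rescale q⁻¹ (PowerSeries.mk h) * p =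
      (rescale q (PowerSeries.mk h) - rescale q⁻¹ (PowerSeries.mk h)) * C l⁻¹ + R := by
    apply mul_left_cancel₀ ht0
    linear_combination hs - h1 - rescale q (PowerSeries.mk h) * t * e1
  have h3 := congrArg (coeff (m + 1)) h2
  rw [coeff_mul, Finset.Nat.sum_antidiagonal_eq_sum_range_succ_mk, map_add, coeff_mul_C, map_sub, hR, coeff_mk,
    coeff_rescale, coeff_rescale, coeff_mk, sum_range_succ, hp] at h3
  simp only [coeff_mk, coeff_rescale, Nat.sub_self] at h3
  rw [if_neg (by omega), mul_zero, add_zero] at h3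
  have h4 : ∀ i ∈ range (m + 1), (q ^ i)⁻¹ * (h i * pw (m + 1 - i)) =
      q⁻¹ ^ i * h i * if 1 ≤ m + 1 - i then pw (m + 1 - i) else 0 := by
    intro i hi
    have := mem_range.1 hi
    rw [if_pos (by omega), inv_pow, mul_assoc]
  rw [sum_congr rfl h4, h3, inv_pow]
  congr 1
  ring

/-- The Newton recursion determines the complete symmetric functions. -/
theorem Datum.newtonS_eq {N' : ℕ} (P : Datum N') [Algebra ℂ K] (hlP : P.q - P.q⁻¹ ≠ 0) (hq : q = algebraMap ℂ K P.q)
    (hμ : μ = algebraMap ℂ K P.mu) (hl : l = q - q⁻¹) (ht : t = C g * X ^ 2) {p' : ℕ → K}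
    (hpw : ∀ m, 1 ≤ m → p' m = pw m) (hq0 : P.q ≠ 0)
    (hp : p = PowerSeries.mk fun m => if 1 ≤ m then pw m else 0) (h : ℕ → K) (h0 : h 0 = 1)
    (hs : rescale q⁻¹ (PowerSeries.mk h) * ((1 - t) * (p + C l⁻¹) - C μ * t) =
      rescale q (PowerSeries.mk h) * (1 - t * C (q ^ 2)⁻¹) * C l⁻¹) {n : ℕ}
    (hn : ∀ i, 2 ≤ i → i ≤ n → qnum P.q i ≠ 0) : P.newtonS p' g n = h n := by
  have hlι : l = algebraMap ℂ K (P.q - P.q⁻¹) := by rw [hl, hq, map_sub, map_inv₀]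
  induction n using Nat.strong_induction_on with
  | _ n ih =>
    rcases n with _ | n
    · rw [newtonS, h0]
    · have hnn : qnum P.q (n + 1) ≠ 0 := by
        rcases Nat.eq_zero_or_pos n with rfl | hn0
        · rw [qnum, pow_one, div_self hlP]; exact one_ne_zero
        · exact hn _ (by omega) le_rfl
      have key := newton_coeff (by rw [hlι]; exact (map_ne_zero _).2 hlP)
        (by rw [hq]; exact (map_ne_zero _).2 hq0) hl ht hp h hs n
      have ih' : ∀ m < n + 1, P.newtonS p' g m = h m :=
        fun m hm => ih m hm fun i h1 h2 => hn i h1 (by omega)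
      rw [newtonS, inv_smul_eq_iff₀ hnn, sub_eq_iff_eq_add]
      rw [sum_range, sum_range] at key
      have e1 : ∀ i : Fin (n + 1), (P.q ^ (i : ℕ))⁻¹ • (P.newtonS p' g i * p' (n + 1 - i)) =
          (q ^ (i : ℕ))⁻¹ * (h i * pw (n + 1 - i)) := by
        intro i
        rw [ih' i i.2, hpw _ (by omega), Algebra.smul_def, map_inv₀, map_pow, ← hq]
      have e2 : ∀ i : Fin ((n + 1) / 2), (P.mu * P.q ^ (2 * (((i : ℕ) : ℤ) + 1) - ((n : ℤ) + 1)) +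
              P.q ^ (((n : ℤ) + 1) - 2 * (((i : ℕ) : ℤ) + 1) - 1)) •
            (P.newtonS p' g (n + 1 - 2 * ((i : ℕ) + 1)) * g ^ ((i : ℕ) + 1)) =
          (μ * q ^ (2 * (((i : ℕ) : ℤ) + 1) - (n + 1 : ℕ)) +
            q ^ (((n + 1 : ℕ) : ℤ) - 2 * (((i : ℕ) : ℤ) + 1) - 1)) *
          (h (n + 1 - 2 * ((i : ℕ) + 1)) * g ^ ((i : ℕ) + 1)) := by
        intro i
        rw [ih' _ (by omega), Algebra.smul_def, map_add, map_mul, map_zpow₀, map_zpow₀, ← hq, ← hμ]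
        push_cast
        rfl
      rw [Finset.sum_congr rfl fun i _ => e1 i, Finset.sum_congr rfl fun i _ => e2 i, key, Algebra.smul_def, qnum,
        map_div₀, map_sub, map_inv₀, map_pow, ← hlι, ← hq]

end Newton

section PowerSums

open PowerSeries Finset

variable {K : Type} [Field K] {q μ l z n1 n2 τ0 τ1 : K} {r : ℕ} {ν w : Fin (2 * r) → K} {p t Tl : K⟦X⟧}

/-- The power sums in terms of the spectral variables. -/
theorem powerSum_series (hq : q ≠ 0) (hz : z ≠ 0) (hl : l ≠ 0) (hlq : l * q = q ^ 2 - 1)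
    (hν : ∀ i, ν i * ν i.rev = z ^ 2) (hinj : Function.Injective ν)
    (hpos : ∀ i, q * ν i ≠ z) (hneg : ∀ i, q * ν i ≠ -z) (hzz : z ≠ -z)
    (hlead : n2 = -(z ^ 2 * μ ^ 2 * q ^ (4 * r)))
    (hw : ∀ i, w i * (1 - ν i.rev / ν i) = 1 + n1 * (q * ν i)⁻¹ + n2 * ((q * ν i)⁻¹) ^ 2)
    (hp : (1 + n1 * z⁻¹ + n2 * (z⁻¹) ^ 2) * (q ^ (2 * r))⁻¹ * l⁻¹ = -μ + τ0 + τ1 * z⁻¹)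
    (hm : (1 - n1 * z⁻¹ + n2 * (z⁻¹) ^ 2) * (q ^ (2 * r))⁻¹ * l⁻¹ = -μ + τ0 - τ1 * z⁻¹)
    (ht : t = C (z ^ 2) * X ^ 2) (hTl : (1 - t) * Tl = C τ0 + C τ1 * X)
    (hrel : ((1 - t) * (p + C l⁻¹) - C μ * t) * ∏ i, (1 - C (q * ν i) * X) =
      (1 + C n1 * X + C n2 * X ^ 2) * (∏ i, (1 - C (q⁻¹ * ν i) * X)) * C l⁻¹) :
    C (l⁻¹ + μ - μ ^ 2 * l⁻¹) + p = ∑ i, C (q⁻¹ * (w i *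
      ∏ j ∈ univ.filter (fun j => j ≠ i ∧ j ≠ i.rev), (ν i - (q ^ 2)⁻¹ * ν j) / (ν i - ν j))) *
        PowerSeries.mk (fun n => (q * ν i) ^ n) + Tl := by
  have key := congrArg Polynomial.coeToPowerSeries.ringHom
    (weight_identity hq hz hl hlq hν hinj hpos hneg hzz hlead hw hp hm)
  set d : Fin (2 * r) → K := fun i => q⁻¹ * (w i *
      ∏ j ∈ univ.filter (fun j => j ≠ i ∧ j ≠ i.rev), (ν i - (q ^ 2)⁻¹ * ν j) / (ν i - ν j)) with hd
  change Polynomial.coeToPowerSeries.ringHom (_ * ∑ i, Polynomial.C (d i) * _) = _ at key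
  simp only [map_sub, map_add, map_mul, map_sum, map_prod, map_one, map_pow,
    Polynomial.coeToPowerSeries.ringHom_apply, Polynomial.coe_C, Polynomial.coe_X] at key
  change C (l⁻¹ + μ - μ ^ 2 * l⁻¹) + p = ∑ i, C (d i) * _ + Tl
  clear_value d
  have ht0 : (1 : K⟦X⟧) - t ≠ 0 := by
    intro h0
    have := congrArg constantCoeff h0
    rw [ht] at this
    simp at this
  apply mul_left_cancel₀ ht0
  apply mul_right_cancel₀ (prod_one_sub_ne_zero (ν := ν) q)
  have e1 : (∑ i, C (d i) * PowerSeries.mk (fun n => (q * ν i) ^ n)) * ∏ i, (1 - C (q * ν i) * X) =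
      ∑ i, C (d i) * ∏ j ∈ univ.erase i, (1 - C (q * ν j) * X) := by
    rw [sum_mul]
    refine sum_congr rfl fun i _ => ?_
    rw [← mul_prod_erase _ _ (mem_univ i), ← mul_assoc, mul_assoc (C (d i)), mk_pow_mul, mul_one]
  simp only [map_mul, map_sub, map_add, map_pow] at e1 hrel ht ⊢
  set S := ∑ i, C (d i) * ∏ j ∈ univ.erase i, (1 - C q * C (ν j) * X)
  set D := (∏ i, (1 - C q * C (ν i) * X) : K⟦X⟧)
  set D' := (∏ i, (1 - C q⁻¹ * C (ν i) * X) : K⟦X⟧)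
  rw [← ht] at key
  linear_combination hrel - key - (1 - t) * e1 - D * hTl + (C μ ^ 2 * C l⁻¹ * D) * ht

end PowerSums

end QMA

namespace QMA

/-! ### The algebra of spectral variables is a domain -/

section Spectral

open Finset

theorem prod_pair_eq {M : Type} [CommMonoid M] {r : ℕ} {f k : Fin (2 * r) → M}
    (h : ∀ i, f i * f i.rev = k i * k i.rev) : ∏ i, f i = ∏ i, k i := by
  have e : r + r = 2 * r := by ring
  have key : ∀ f : Fin (2 * r) → M, ∏ i, f i =
      ∏ i : Fin r, f (Fin.cast e (Fin.castAdd r i)) * f (Fin.cast e (Fin.castAdd r i)).rev := by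
    intro f
    rw [← Fin.prod_congr' f e, Fin.prod_univ_add, ← Equiv.prod_comp Fin.revPerm (fun i : Fin r => f (Fin.cast e (Fin.natAdd r i))),
      ← prod_mul_distrib]
    refine prod_congr rfl fun i _ => ?_
    congr 2
    ext
    simp [Fin.val_rev]
    omega
  rw [key f, key k]
  exact prod_congr rfl fun i _ => h _

/-- The group of exponents of the spectral variables. -/
abbrev SpecExp (r : ℕ) : Type := ℤ × (Fin (2 * r) → ℤ)

/-- The exponents of the spectral variables. -/
def specExp (r : ℕ) : Fin (2 * r + 1) → SpecExp r :=
  Fin.cons (1, 0) fun i => (1, Pi.single i 1 - Pi.single i.rev 1)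

theorem specExp_injective (r : ℕ) : Function.Injective (specExp r) := by
  intro i j h
  have hr := fun i : Fin (2 * r) => (rev_ne i).symm
  have h1 := congrArg Prod.snd h
  refine Fin.cases ?_ (fun i => ?_) i (motive := fun i => (specExp r i).2 = (specExp r j).2 → i = j) h1
  · refine Fin.cases (fun _ => rfl) (fun j h => ?_) j
    have := congrFun h j
    simp [specExp, hr] at this
  · refine Fin.cases (fun h => ?_) (fun j h => ?_) j
    · have := congrFun h i
      simp [specExp, hr] at this
    · have := congrFun h i
      simp only [specExp, Fin.cons_succ, Pi.sub_apply, Pi.single_eq_same, Pi.single_eq_of_ne (hr i), sub_zero] at this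
      by_contra hij
      have hij' : i ≠ j := fun h => hij (congrArg _ h)
      rw [Pi.single_eq_of_ne hij'] at this
      have h2 : (0 : ℤ) ≤ (Pi.single j.rev 1 : Fin (2 * r) → ℤ) i := by
        rw [Pi.single_apply]; split_ifs <;> norm_num
      omega

/-- The monomial representation of the spectral variables. -/
noncomputable def specMap (r : ℕ) : MvPolynomial (Fin (2 * r + 1)) ℂ →ₐ[ℂ] AddMonoidAlgebra ℂ (SpecExp r) :=
  MvPolynomial.aeval fun i => AddMonoidAlgebra.single (specExp r i) 1

/-- The normal form of a monomial. -/
noncomputable def specNormal (r : ℕ) (g : SpecExp r) : SpecAlg r :=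
  (∏ i : Fin (2 * r), nu r i.succ ^ (g.2 i).toNat) * nu r 0 ^ (g.1 - ∑ i, ((g.2 i).toNat : ℤ)).toNat

theorem nu_mul_rev (r : ℕ) (i : Fin (2 * r)) : nu r i.succ * nu r i.rev.succ = nu r 0 ^ 2 := by
  rw [nu, nu, nu, ← map_mul, ← map_pow, Ideal.Quotient.eq]
  exact Ideal.subset_span ⟨i, rfl⟩

theorem specMap_monomial (r : ℕ) (e : Fin (2 * r + 1) →₀ ℕ) (c : ℂ) :
    specMap r (MvPolynomial.monomial e c) = AddMonoidAlgebra.single (∑ i, e i • specExp r i) c := by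
  have h1 : ∀ s : Finset (Fin (2 * r + 1)), ∏ i ∈ s, (AddMonoidAlgebra.single (specExp r i) (1 : ℂ)) ^ e i =
      AddMonoidAlgebra.single (∑ i ∈ s, e i • specExp r i) 1 := by
    intro s
    induction s using Finset.induction_on with
    | empty => rfl
    | insert a s ha ih =>
      rw [prod_insert ha, sum_insert ha, ih, AddMonoidAlgebra.single_pow, AddMonoidAlgebra.single_mul_single, one_pow,
        one_mul]
  rw [specMap, MvPolynomial.aeval_monomial, Finsupp.prod_fintype _ _ (fun i => pow_zero _), h1,
    ← Algebra.smul_def, AddMonoidAlgebra.smul_single, smul_eq_mul, mul_one]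

/-- Replacing paired variables by `ν_0²` as often as possible brings a monomial to a form that
depends only on the total degree and on the differences of paired exponents, hence only on its
image. -/
theorem specNormal_sum (r : ℕ) (e : Fin (2 * r + 1) →₀ ℕ) :
    specNormal r (∑ i, e i • specExp r i) = ∏ i, nu r i ^ e i := by
  have h1 : (∑ i, e i • specExp r i).1 = ((∑ i, e i : ℕ) : ℤ) := by
    rw [Prod.fst_sum]
    push_cast
    refine sum_congr rfl fun i _ => ?_
    have : (specExp r i).1 = 1 := by refine Fin.cases rfl (fun i => rfl) i
    simp [this]
  have h2 : ∀ j, (∑ i, e i • specExp r i).2 j = (e j.succ : ℤ) - e j.rev.succ := by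
    intro j
    rw [Prod.snd_sum, Fin.sum_univ_succ]
    simp only [specExp, Fin.cons_zero, Fin.cons_succ, Prod.smul_mk, smul_zero, zero_add, Finset.sum_apply, Pi.smul_apply,
      Pi.sub_apply, smul_sub, sum_sub_distrib, Pi.single_apply]
    congr 1
    · simp
    · rw [sum_eq_single j.rev]
      · simp
      · intro b _ hb
        rw [if_neg]
        · simp
        · rintro rfl; exact hb (Fin.rev_rev b).symm
      · simp
  have h3 : ∀ j : Fin (2 * r), ((e j.succ : ℤ) - e j.rev.succ).toNat + min (e j.succ) (e j.rev.succ) = e j.succ := by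
    intro j; omega
  have h4 : ((∑ i, e i : ℕ) : ℤ) - ∑ j : Fin (2 * r), (((e j.succ : ℤ) - e j.rev.succ).toNat : ℤ) =
      ((e 0 + ∑ j : Fin (2 * r), min (e j.succ) (e j.rev.succ) : ℕ) : ℤ) := by
    have : ∑ j : Fin (2 * r), e j.succ = ∑ j : Fin (2 * r), ((e j.succ : ℤ) - e j.rev.succ).toNat +
        ∑ j : Fin (2 * r), min (e j.succ) (e j.rev.succ) := by
      rw [← sum_add_distrib]
      exact sum_congr rfl fun j _ => (h3 j).symm
    rw [Fin.sum_univ_succ, this]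
    push_cast
    ring
  have h5 : ∏ j : Fin (2 * r), nu r j.succ ^ min (e j.succ) (e j.rev.succ) =
      ∏ j : Fin (2 * r), nu r 0 ^ min (e j.succ) (e j.rev.succ) := by
    refine prod_pair_eq fun i => ?_
    rw [Fin.rev_rev, min_comm (e i.rev.succ), ← mul_pow, ← mul_pow, nu_mul_rev, sq]
  rw [specNormal, h1]
  simp only [h2]
  rw [h4, Int.toNat_natCast, Fin.prod_univ_succ, pow_add, ← prod_pow_eq_pow_sum, ← h5, mul_left_comm, ← prod_mul_distrib]
  congr 1
  refine prod_congr rfl fun j _ => ?_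
  rw [← pow_add, h3]

/-- The linear extension of `specNormal` recovers the class of a polynomial from its image, which
yields injectivity on the quotient. Values of `specNormal` at exponents that do not occur are
immaterial. -/
theorem specMap_section (r : ℕ) (x : MvPolynomial (Fin (2 * r + 1)) ℂ) :
    Finsupp.linearCombination ℂ (specNormal r) (specMap r x).coeff = Ideal.Quotient.mk (specIdeal r) x := by
  induction x using MvPolynomial.induction_on' with
  | monomial e c =>
    rw [specMap_monomial, AddMonoidAlgebra.coeff_single, Finsupp.linearCombination_single, specNormal_sum,
      MvPolynomial.monomial_eq, map_mul, Finsupp.prod_fintype _ _ (fun i => pow_zero _), map_prod]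
    simp only [map_pow]
    exact Algebra.smul_def c (∏ i, nu r i ^ e i)
  | add p q hp hq => rw [map_add, map_add, AddMonoidAlgebra.coeff_add, map_add, hp, hq]

/-- The monomial representation of the algebra of spectral variables. -/
noncomputable def specHom (r : ℕ) : SpecAlg r →ₐ[ℂ] AddMonoidAlgebra ℂ (SpecExp r) :=
  Ideal.Quotient.liftₐ (specIdeal r) (specMap r) (by
    intro a ha
    refine Submodule.span_induction ?_ (map_zero _) (fun x y _ _ hx hy => ?_) (fun c x _ hx => ?_) ha
    · rintro _ ⟨i, rfl⟩
      rw [map_sub, map_mul, map_pow, specMap, MvPolynomial.aeval_X, MvPolynomial.aeval_X, MvPolynomial.aeval_X,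
        AddMonoidAlgebra.single_mul_single, AddMonoidAlgebra.single_pow, one_mul, one_pow, sub_eq_zero]
      congr 1
      ext j
      · simp [specExp]
      · simp [specExp]
    · rw [map_add, hx, hy, add_zero]
    · rw [smul_eq_mul, map_mul, hx, mul_zero])

theorem specHom_nu (r : ℕ) (i : Fin (2 * r + 1)) :
    specHom r (nu r i) = AddMonoidAlgebra.single (specExp r i) 1 := by
  change specMap r (MvPolynomial.X i) = _
  rw [specMap, MvPolynomial.aeval_X]

theorem specHom_injective (r : ℕ) : Function.Injective (specHom r) := by
  rw [injective_iff_map_eq_zero]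
  intro x
  obtain ⟨x, rfl⟩ := Ideal.Quotient.mk_surjective x
  intro h
  change specMap r x = 0 at h
  rw [← specMap_section, h]
  exact map_zero _

instance specAlg_isDomain (r : ℕ) : IsDomain (SpecAlg r) :=
  (specHom_injective r).isDomain (specHom r).toRingHom

/-- Distinct variables have distinct exponents, so their images are distinct basis elements of the
group algebra. -/
theorem nu_proportional {r : ℕ} {i j : Fin (2 * r + 1)} {c d : ℂ} (hc : c ≠ 0)
    (h : algebraMap ℂ (SpecAlg r) c * nu r i = algebraMap ℂ (SpecAlg r) d * nu r j) : i = j ∧ c = d := by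
  have h1 := congrArg (specHom r) h
  rw [← Algebra.smul_def, ← Algebra.smul_def, map_smul, map_smul, specHom_nu, specHom_nu, AddMonoidAlgebra.smul_single,
    AddMonoidAlgebra.smul_single, smul_eq_mul, smul_eq_mul, mul_one, mul_one] at h1
  have h2 := congrArg AddMonoidAlgebra.coeff h1
  rw [AddMonoidAlgebra.coeff_single, AddMonoidAlgebra.coeff_single, Finsupp.single_eq_single_iff] at h2
  rcases h2 with h2 | h2
  · exact ⟨specExp_injective r h2.1, h2.2⟩
  · exact absurd h2.1 hc

theorem nu_ne_zero (r : ℕ) (i : Fin (2 * r + 1)) : nu r i ≠ 0 := by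
  intro h
  have := nu_proportional (i := i) (j := i) (c := 1) (d := 2) one_ne_zero (by rw [h]; simp)
  norm_num at this

instance specAlgInv_isDomain (r : ℕ) : IsDomain (SpecAlgInv r) :=
  IsLocalization.isDomain_localization (powers_le_nonZeroDivisors_of_noZeroDivisors (nu_ne_zero r 0))

theorem specAlgInv_injective (r : ℕ) : Function.Injective (algebraMap (SpecAlg r) (SpecAlgInv r)) :=
  IsLocalization.injective _ (powers_le_nonZeroDivisors_of_noZeroDivisors (nu_ne_zero r 0))

end Spectral

end QMA

/-! ### Values of the power sums in a field containing the spectral variables. -/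

namespace QMA

section Values

open PowerSeries Finset

variable {r : ℕ} {K : Type} [Field K] [Algebra ℂ K] (f : SpecAlg r →ₐ[ℂ] K)

theorem pair_of_hom (i : Fin (2 * r)) : f (nu r i.succ) * f (nu r i.rev.succ) = f (nu r 0) ^ 2 := by
  rw [← map_mul, ← map_pow, nu_mul_rev]

variable {f} (hf : Function.Injective f)
include hf

theorem proportional_of_injective {i j : Fin (2 * r + 1)} {c d : ℂ} (hc : c ≠ 0)
    (h : algebraMap ℂ K c * f (nu r i) = algebraMap ℂ K d * f (nu r j)) : i = j ∧ c = d := by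
  refine nu_proportional hc (hf ?_)
  rwa [map_mul, map_mul, AlgHom.commutes, AlgHom.commutes]

theorem hom_nu_injective : Function.Injective fun i => f (nu r i) := fun i j h =>
  (proportional_of_injective hf (c := 1) (d := 1) one_ne_zero (by rw [map_one, one_mul, one_mul]; exact h)).1

theorem hom_nu_ne_zero (i : Fin (2 * r + 1)) : f (nu r i) ≠ 0 := fun h =>
  nu_ne_zero r i (hf (by rw [h, map_zero]))

omit hf in
/-- A quotient of power series by a series with constant coefficient one has coefficients in the
ring of the coefficients. -/
theorem coeff_mem_range {S : Type} [CommRing S] (f : S →+* K) {p : K⟦X⟧} {a b : S⟦X⟧} (ha : constantCoeff a = 1)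
    (h : p * PowerSeries.map f a = PowerSeries.map f b) (n : ℕ) : coeff n p ∈ Set.range f := by
  have h1 := mul_invOfUnit a 1 (by rw [ha]; rfl)
  have h2 : p = PowerSeries.map f (b * invOfUnit a 1) := by
    rw [map_mul, ← h, mul_assoc, ← map_mul, h1, map_one, mul_one]
  rw [h2, coeff_map]
  exact ⟨_, rfl⟩

/-- The values of the power sums. -/
theorem powerSum_values {N : ℕ} {P : Datum N} (hB : P.IsBMW) {p' : ℕ → K} (h0 : p' 0 = algebraMap ℂ K (P.mu * P.eta))
    {q μ l z : K} (hq : q = algebraMap ℂ K P.q) (hμ : μ = algebraMap ℂ K P.mu) (hl : l = q - q⁻¹)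
    (hz : z = f (nu r 0)) {ν w : Fin (2 * r) → K} (hν : ∀ i, ν i = f (nu r i.succ)) {n1 n2 τ0 τ1 : K}
    (hlead : n2 = -(z ^ 2 * μ ^ 2 * q ^ (4 * r)))
    (hw : ∀ i, w i * (1 - ν i.rev / ν i) = 1 + n1 * (q * ν i)⁻¹ + n2 * ((q * ν i)⁻¹) ^ 2)
    (hp : (1 + n1 * z⁻¹ + n2 * (z⁻¹) ^ 2) * (q ^ (2 * r))⁻¹ * l⁻¹ = -μ + τ0 + τ1 * z⁻¹)
    (hm : (1 - n1 * z⁻¹ + n2 * (z⁻¹) ^ 2) * (q ^ (2 * r))⁻¹ * l⁻¹ = -μ + τ0 - τ1 * z⁻¹)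
    {p t Tl : K⟦X⟧} (ht : t = C (z ^ 2) * X ^ 2) (hTl : (1 - t) * Tl = C τ0 + C τ1 * X)
    (hps : p = PowerSeries.mk fun m => if 1 ≤ m then p' m else 0)
    (hrel : ((1 - t) * (p + C l⁻¹) - C μ * t) * ∏ i, (1 - C (q * ν i) * X) =
      (1 + C n1 * X + C n2 * X ^ 2) * (∏ i, (1 - C (q⁻¹ * ν i) * X)) * C l⁻¹) (n : ℕ) :
    p' n = q ^ ((n : ℤ) - 1) * ∑ i, (w i *
      ∏ j ∈ univ.filter (fun j => j ≠ i ∧ j ≠ i.rev), (ν i - (q ^ 2)⁻¹ * ν j) / (ν i - ν j)) * ν i ^ n +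
        coeff n Tl := by
  set ι := algebraMap ℂ K with hι
  have hq0 : q ≠ 0 := by rw [hq]; exact (map_ne_zero ι).2 hB.q_ne_zero
  have hμ0 : μ ≠ 0 := by rw [hμ]; exact (map_ne_zero ι).2 hB.mu_ne_zero
  have hlι : l = ι (P.q - P.q⁻¹) := by rw [hl, hq, map_sub, map_inv₀]
  have hl0 : l ≠ 0 := by rw [hlι]; exact (map_ne_zero ι).2 hB.lam_ne
  have hlq : l * q = q ^ 2 - 1 := by rw [hl]; field_simp
  have key := powerSum_series (w := w) hq0 (by rw [hz]; exact hom_nu_ne_zero hf 0) hl0 hlq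
    (fun i => by rw [hν, hν, hz]; exact pair_of_hom f i)
    (fun i j h => by
      rw [hν, hν] at h
      exact Fin.succ_injective _ (hom_nu_injective hf h))
    (fun i h => by
      rw [hν, hz, hq] at h
      have := (proportional_of_injective hf (i := i.succ) (j := 0) (c := P.q) (d := 1) hB.q_ne_zero
        (by rw [map_one, one_mul]; exact h)).1
      exact Fin.succ_ne_zero i this)
    (fun i h => by
      rw [hν, hz, hq] at h
      have := (proportional_of_injective hf (i := i.succ) (j := 0) (c := P.q) (d := -1) hB.q_ne_zero
        (by rw [map_neg, map_one, neg_one_mul]; exact h)).1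
      exact Fin.succ_ne_zero i this)
    (fun h => by
      rw [hz] at h
      have := (proportional_of_injective hf (i := 0) (j := 0) (c := 1) (d := -1) one_ne_zero
        (by rw [map_neg, map_one, neg_one_mul, one_mul]; exact h)).2
      norm_num at this)
    hlead hw hp hm ht hTl hrel
  have h1 : coeff n (C (l⁻¹ + μ - μ ^ 2 * l⁻¹) + p) = p' n := by
    rw [map_add, hps, coeff_mk, coeff_C]
    rcases Nat.eq_zero_or_pos n with rfl | hn
    · rw [if_pos rfl, if_neg (by omega), add_zero, h0]
      -- The constant term in the partial fraction expansion is the trace of `D`, so the formula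
      -- includes `n = 0`.
      have e : P.mu * P.eta = (P.q - P.q⁻¹)⁻¹ + P.mu - P.mu ^ 2 * (P.q - P.q⁻¹)⁻¹ := by
        have h2 := hB.lam_ne
        have h3 := hB.mu_ne_zero
        have h4 := hB.q_ne_zero
        have h5 : (P.q - P.q⁻¹) * P.q = P.q ^ 2 - 1 := by field_simp
        rw [Datum.eta]
        generalize P.q - P.q⁻¹ = s at *
        field_simp
        linear_combination (-P.mu) * h5
      rw [e]
      simp only [map_add, map_sub, map_mul, map_pow, map_inv₀, ← hμ, hl, hq]
    · rw [if_neg (by omega), if_pos (by omega), zero_add]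
  rw [← h1, key, map_add, map_sum]
  congr 1
  rw [mul_sum]
  refine sum_congr rfl fun i _ => ?_
  rw [coeff_C_mul, coeff_mk, zpow_sub₀ hq0, zpow_natCast, zpow_one, mul_pow]
  field_simp

omit hf in
/-- The power sums are polynomials in the spectral variables. -/
theorem powerSum_mem_range {c0 : ℂ} {p' : ℕ → K} (h0 : p' 0 = algebraMap ℂ K c0)
    {q q' μ l' : ℂ} {n1 n2 : SpecAlg r} {p t : K⟦X⟧} (ht : t = C (f (nu r 0) ^ 2) * X ^ 2)
    (hps : p = PowerSeries.mk fun m => if 1 ≤ m then p' m else 0)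
    (hrel : ((1 - t) * (p + C (algebraMap ℂ K l')) - C (algebraMap ℂ K μ) * t) *
        ∏ i : Fin (2 * r), (1 - C (algebraMap ℂ K q * f (nu r i.succ)) * X) =
      (1 + C (f n1) * X + C (f n2) * X ^ 2) * (∏ i : Fin (2 * r), (1 - C (algebraMap ℂ K q' * f (nu r i.succ)) * X)) *
        C (algebraMap ℂ K l')) (n : ℕ) : p' n ∈ Set.range f := by
  rcases Nat.eq_zero_or_pos n with rfl | hn
  · exact ⟨algebraMap ℂ _ c0, by rw [h0]; exact f.commutes _⟩
  have h1 : p' n = coeff n p := by rw [hps, coeff_mk, if_pos (by omega)]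
  rw [h1]
  set ι := algebraMap ℂ (SpecAlg r) with hι
  have hc : ∀ c, algebraMap ℂ K c = f (ι c) := fun c => (f.commutes c).symm
  set t' : (SpecAlg r)⟦X⟧ := C (nu r 0 ^ 2) * X ^ 2 with ht'
  set D : (SpecAlg r)⟦X⟧ := ∏ i : Fin (2 * r), (1 - C (ι q * nu r i.succ) * X) with hD
  set D' : (SpecAlg r)⟦X⟧ := ∏ i : Fin (2 * r), (1 - C (ι q' * nu r i.succ) * X) with hD'
  -- The relation is solved for `p` over the algebra of spectral variables itself: the series
  -- multiplying `p` is `(1 - t) D`, with constant coefficient one.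
  refine coeff_mem_range (f : SpecAlg r →+* K) (a := (1 - t') * D)
    (b := (1 + C n1 * X + C n2 * X ^ 2) * D' * C (ι l') - ((1 - t') * C (ι l') - C (ι μ) * t') * D) ?_ ?_ n
  · rw [map_mul, hD, map_prod, ht']
    simp
  · simp only [map_mul, map_sub, map_add, map_one, map_prod, ht', hD, hD', PowerSeries.map_C, PowerSeries.map_X, map_pow,
      RingHom.coe_coe]
    simp only [hc, ht, map_mul, map_pow] at hrel
    linear_combination hrel

end Values

end QMA

/-! ### The three forms of the numerator and the resulting formulas. -/

namespace QMA

section Cases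

open PowerSeries Finset

variable {r : ℕ} {K : Type} [Field K] [Algebra ℂ K] {f : SpecAlg r →ₐ[ℂ] K} (hf : Function.Injective f)
  {N : ℕ} {P : Datum N} (hB : P.IsBMW) {p' : ℕ → K} (h0 : p' 0 = algebraMap ℂ K (P.mu * P.eta))
  {q μ l z : K} (hq : q = algebraMap ℂ K P.q) (hμ : μ = algebraMap ℂ K P.mu) (hl : l = q - q⁻¹)
  (hz : z = f (nu r 0)) {ν : Fin (2 * r) → K} (hν : ∀ i, ν i = f (nu r i.succ))
  {p t : K⟦X⟧} (ht : t = C (z ^ 2) * X ^ 2) (hps : p = PowerSeries.mk fun m => if 1 ≤ m then p' m else 0)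

theorem one_sub_sq_ne_zero (a : K) : (1 - C a * X ^ 2 : K⟦X⟧) ≠ 0 := by
  intro h
  have := congrArg constantCoeff h
  simp at this

theorem one_sub_mul_X_ne_zero (a : K) : (1 - C a * X : K⟦X⟧) ≠ 0 := by
  intro h
  have := congrArg constantCoeff h
  simp at this

include hB h0 hq hμ hl hz hν ht hps in
/-- A homogeneous numerator makes the power sums polynomial. -/
theorem powerSum_mem_range' {c1 c2 : ℂ} (hrel : ((1 - t) * (p + C l⁻¹) - C μ * t) * ∏ i, (1 - C (q * ν i) * X) =
      (1 + C (algebraMap ℂ K c1 * z) * X + C (algebraMap ℂ K c2 * z ^ 2) * X ^ 2) *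
        (∏ i, (1 - C (q⁻¹ * ν i) * X)) * C l⁻¹) (n : ℕ) : p' n ∈ Set.range f := by
  refine powerSum_mem_range (q := P.q) (q' := P.q⁻¹) (μ := P.mu) (l' := (P.q - P.q⁻¹)⁻¹)
    (n1 := algebraMap ℂ _ c1 * nu r 0) (n2 := algebraMap ℂ _ c2 * nu r 0 ^ 2) h0 (t := t) (p := p)
    (by rw [ht, hz]) hps ?_ n
  simp only [map_mul, map_pow, AlgHom.commutes, map_inv₀, map_sub, ← hq, ← hμ, ← hz, ← hl, ← hν] at hrel ⊢
  exact hrel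

include hB hq hμ hl ht hps in
/-- The Newton recursion in the spectral variables. -/
theorem newtonS_values {N' B : K⟦X⟧} (hrel : ((1 - t) * (p + C l⁻¹) - C μ * t) * ∏ i, (1 - C (q * ν i) * X) =
      N' * (∏ i, (1 - C (q⁻¹ * ν i) * X)) * C l⁻¹)
    (hBN : rescale q⁻¹ B * N' = rescale q B * (1 - t * C (q ^ 2)⁻¹)) (h : ℕ → K) (hh0 : h 0 = 1)
    (hH : PowerSeries.mk h = B * PowerSeries.mk fun n : ℕ => hsym ν n) {n : ℕ}
    (hn : ∀ i, 2 ≤ i → i ≤ n → qnum P.q i ≠ 0) : P.newtonS p' (z ^ 2) n = h n := by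
  have hq0 : q ≠ 0 := by rw [hq]; exact (map_ne_zero _).2 hB.q_ne_zero
  have hl0 : l ≠ 0 := by
    rw [hl, hq, ← map_inv₀, ← map_sub]; exact (map_ne_zero _).2 hB.lam_ne
  refine Datum.newtonS_eq P hB.lam_ne hq hμ hl ht (fun m _ => rfl) hB.q_ne_zero hps h hh0
    (newton_series hl0 hq0 hrel (B := B) ?_ hBN) hn
  rw [hH, mul_assoc, mk_hsym_mul, mul_one]

include hf hB h0 hq hμ hl hz hν ht hps

/-- The spectral values when the variables are completed by `ν_0` and `-ν_0`. -/
theorem values_pair {τ : K} (hμ2 : q ^ (4 * r) * μ ^ 2 * q ^ 2 = 1)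
    (hτ : (1 - (q ^ 2)⁻¹) * (q ^ (2 * r))⁻¹ * l⁻¹ = -μ + 2 * τ)
    (hE : ((1 - t) * (p + C l⁻¹) - C μ * t) *
        ∏ i, (1 + C (-q * (Fin.cons z (Fin.cons (-z) ν) : Fin (2 * r + 2) → K) i) * X) =
      (1 - t * C (q ^ 2)) * C l⁻¹ *
        ∏ i, (1 + C (-q⁻¹ * (Fin.cons z (Fin.cons (-z) ν) : Fin (2 * r + 2) → K) i) * X)) (n : ℕ) :
    ((∀ i, 2 ≤ i → i ≤ n → qnum P.q i ≠ 0) → P.newtonS p' (z ^ 2) n = hsym ν n) ∧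
    p' n = q ^ ((n : ℤ) - 1) * ∑ i, ((ν i - (q ^ 4)⁻¹ * ν i.rev) / (ν i - ν i.rev) *
      ∏ j ∈ univ.filter (fun j => j ≠ i ∧ j ≠ i.rev), (ν i - (q ^ 2)⁻¹ * ν j) / (ν i - ν j)) * ν i ^ n +
        (1 + (-1) ^ n) * τ * z ^ n ∧
    p' n ∈ Set.range f := by
  have hq0 : q ≠ 0 := by rw [hq]; exact (map_ne_zero _).2 hB.q_ne_zero
  have hz0 : z ≠ 0 := by rw [hz]; exact hom_nu_ne_zero hf 0
  -- On the left the factors of `±ν_0` multiply to `1 - q² t` and cancel against the same factor on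
  -- the right; the factors on the right leave the numerator `1 - q⁻² t`.
  have hrel : ((1 - t) * (p + C l⁻¹) - C μ * t) * ∏ i, (1 - C (q * ν i) * X) =
      (1 + C (algebraMap ℂ K 0 * z) * X + C (algebraMap ℂ K (-(P.q ^ 2)⁻¹) * z ^ 2) * X ^ 2) *
        (∏ i, (1 - C (q⁻¹ * ν i) * X)) * C l⁻¹ := by
    apply mul_left_cancel₀ (one_sub_sq_ne_zero (q ^ 2 * z ^ 2))
    rw [Fin.prod_univ_succ, Fin.prod_univ_succ, Fin.prod_univ_succ, Fin.prod_univ_succ] at hE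
    simp only [Fin.cons_zero, Fin.cons_succ, neg_mul, mul_neg, neg_neg, map_neg, ← sub_eq_add_neg, map_mul] at hE
    simp only [map_mul, map_pow, map_neg, map_zero, map_inv₀, ← hq]
    have e8 : C (q ^ 2)⁻¹ = (C q⁻¹ ^ 2 : K⟦X⟧) := by rw [← map_pow, inv_pow]
    rw [ht] at hE ⊢
    rw [e8]
    simp only [map_mul, map_pow] at hE ⊢
    linear_combination hE
  have hlead : algebraMap ℂ K (-(P.q ^ 2)⁻¹) * z ^ 2 = -(z ^ 2 * μ ^ 2 * q ^ (4 * r)) := by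
    rw [map_neg, map_inv₀, map_pow, ← hq]
    have : (q ^ 2)⁻¹ = q ^ (4 * r) * μ ^ 2 := by field_simp; linear_combination -hμ2
    rw [this]; ring
  have e2 : algebraMap ℂ K (-(P.q ^ 2)⁻¹) * z ^ 2 * (z⁻¹) ^ 2 = -(q ^ 2)⁻¹ := by
    rw [map_neg, map_inv₀, map_pow, ← hq]; field_simp
  refine ⟨fun hn => ?_, ?_, powerSum_mem_range' hB h0 hq hμ hl hz hν ht hps hrel n⟩
  · refine newtonS_values hB hq hμ hl ht hps (B := 1) hrel ?_ (fun n => hsym ν n) ?_ (one_mul _).symm hn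
    · rw [map_one, map_one, map_zero, zero_mul, map_zero, zero_mul, add_zero, one_mul, one_mul, ht, map_neg, map_inv₀,
        map_pow, ← hq, neg_mul, map_neg, map_mul]
      ring
    · simp [hsym]
  · have key := powerSum_values hf hB h0 hq hμ hl hz hν (w := fun i => (ν i - (q ^ 4)⁻¹ * ν i.rev) / (ν i - ν i.rev))
      (τ0 := 2 * τ) (τ1 := 0) hlead ?_ ?_ ?_ ht (Tl := PowerSeries.mk fun n => (1 + (-1) ^ n) * τ * z ^ n) ?_ hps hrel n
    · rw [key, coeff_mk]
    · intro i
      have h1 : ν i ≠ 0 := by rw [hν]; exact hom_nu_ne_zero hf _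
      have h2 : ν i - ν i.rev ≠ 0 := sub_ne_zero.2 fun h => by
        rw [hν, hν] at h
        exact rev_ne i (Fin.succ_injective _ (hom_nu_injective hf h)).symm
      have h3 : ν i * ν i.rev = z ^ 2 := by rw [hν, hν, hz]; exact pair_of_hom f i
      rw [map_zero, zero_mul, zero_mul, add_zero, ← h3, map_neg, map_inv₀, map_pow, ← hq]
      field_simp
      ring
    · rw [e2, map_zero, zero_mul, zero_mul, add_zero, add_zero, ← hτ]; ring
    · rw [e2, map_zero, zero_mul, zero_mul, sub_zero, sub_zero, ← hτ]; ring
    -- The tail is `τ/(1 - ν_0 X) + τ/(1 + ν_0 X)`, the part with poles at `±1/ν_0`. In the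
    -- applications `τ` is `0` for the symplectic type and `μ` for `O^-`.
    · have e3 : (PowerSeries.mk fun n => (1 + (-1) ^ n) * τ * z ^ n) =
          C τ * (PowerSeries.mk (fun n => z ^ n) + PowerSeries.mk (fun n => (-z) ^ n)) := by
        ext n
        rw [coeff_mk, coeff_C_mul, map_add, coeff_mk, coeff_mk, neg_pow]; ring
      have e4 := mk_pow_mul z
      have e5 := mk_pow_mul (-z)
      rw [map_neg] at e5
      rw [e3, ht, map_zero, zero_mul, add_zero, map_pow, map_mul, map_ofNat]
      linear_combination C τ * (1 + C z * X) * e4 + C τ * (1 - C z * X) * e5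

/-- The spectral values when the variables are complete. -/
theorem values_even (hμ1 : μ * q ^ (2 * r) = q)
    (hE : ((1 - t) * (p + C l⁻¹) - C μ * t) * ∏ i, (1 + C (-q * ν i) * X) =
      (1 - t * C (q ^ 2)) * C l⁻¹ * ∏ i, (1 + C (-q⁻¹ * ν i) * X)) (n : ℕ) :
    ((∀ i, 2 ≤ i → i ≤ n → qnum P.q i ≠ 0) →
      P.newtonS p' (z ^ 2) n = hsym ν n - z ^ 2 * hsym ν ((n : ℤ) - 2)) ∧
    p' n = q ^ ((n : ℤ) - 1) * ∑ i,
      (∏ j ∈ univ.filter (fun j => j ≠ i ∧ j ≠ i.rev), (ν i - (q ^ 2)⁻¹ * ν j) / (ν i - ν j)) * ν i ^ n ∧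
    p' n ∈ Set.range f := by
  have hq0 : q ≠ 0 := by rw [hq]; exact (map_ne_zero _).2 hB.q_ne_zero
  have hl0 : l ≠ 0 := by
    rw [hl, hq, ← map_inv₀, ← map_sub]; exact (map_ne_zero _).2 hB.lam_ne
  have hz0 : z ≠ 0 := by rw [hz]; exact hom_nu_ne_zero hf 0
  have hrel : ((1 - t) * (p + C l⁻¹) - C μ * t) * ∏ i, (1 - C (q * ν i) * X) =
      (1 + C (algebraMap ℂ K 0 * z) * X + C (algebraMap ℂ K (-P.q ^ 2) * z ^ 2) * X ^ 2) *
        (∏ i, (1 - C (q⁻¹ * ν i) * X)) * C l⁻¹ := by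
    simp only [neg_mul, map_neg, ← sub_eq_add_neg] at hE
    rw [hE, ht]
    simp only [map_zero, zero_mul, map_neg, map_pow, ← hq, map_mul, neg_mul]
    ring
  have e2 : algebraMap ℂ K (-P.q ^ 2) * z ^ 2 * (z⁻¹) ^ 2 = -q ^ 2 := by
    rw [map_neg, map_pow, ← hq]; field_simp
  have e6 : (1 - q ^ 2) * (q ^ (2 * r))⁻¹ * l⁻¹ = -μ := by
    have hq2 : q ^ (2 * r) ≠ 0 := pow_ne_zero _ hq0
    have : l * q = q ^ 2 - 1 := by rw [hl]; field_simp
    field_simp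
    linear_combination this + l * hμ1
  refine ⟨fun hn => ?_, ?_, powerSum_mem_range' hB h0 hq hμ hl hz hν ht hps hrel n⟩
  -- With numerator `1 - q² t` the choice `B = 1 - t` works, since `B(X/q) = 1 - q⁻² t` and `B(qX) =
  -- 1 - q² t`. It produces the term `-ν_0² h_{n-2}`.
  · refine newtonS_values hB hq hμ hl ht hps (B := 1 - t) hrel ?_
      (fun n => hsym ν n - z ^ 2 * hsym ν ((n : ℤ) - 2)) ?_ ?_ hn
    · rw [ht]
      simp only [map_zero, zero_mul, map_sub, map_one, map_mul, map_pow, rescale_X, rescale_C', mul_pow, map_neg, ← hq]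
      have e7 : C (q ^ 2)⁻¹ = (C q⁻¹ ^ 2 : K⟦X⟧) := by rw [← map_pow, inv_pow]
      rw [e7]
      ring
    · simp [hsym]
    · have e7 := mk_hsym_sub ν 2
      ext m
      have := congrArg (coeff m) e7
      rw [coeff_mk] at this
      rw [sub_mul, one_mul, map_sub, coeff_mk, coeff_mk, ht, mul_assoc, coeff_C_mul, ← this]
      rfl
  · have key := powerSum_values hf hB h0 hq hμ hl hz hν (w := fun i => 1)
      (τ0 := 0) (τ1 := 0) (n1 := algebraMap ℂ K 0 * z) (n2 := algebraMap ℂ K (-P.q ^ 2) * z ^ 2) ?_ ?_ ?_ ?_ ht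
      (Tl := 0) ?_ hps hrel n
    · rw [key, map_zero, add_zero]; simp only [one_mul]
    · rw [map_neg, map_pow, ← hq, show 4 * r = 2 * r + 2 * r by ring, pow_add]
      linear_combination z ^ 2 * (μ * q ^ (2 * r) + q) * hμ1
    · intro i
      have h1 : ν i ≠ 0 := by rw [hν]; exact hom_nu_ne_zero hf _
      have h3 : ν i * ν i.rev = z ^ 2 := by rw [hν, hν, hz]; exact pair_of_hom f i
      rw [map_zero, zero_mul, zero_mul, add_zero, ← h3, map_neg, map_pow, ← hq]
      field_simp
      ring
    · rw [e2, map_zero, zero_mul, zero_mul, add_zero, add_zero, add_zero, ← e6]; ring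
    · rw [e2, map_zero, zero_mul, zero_mul, sub_zero, sub_zero, add_zero, ← e6]; ring
    · simp

/-- The spectral values when the variables are completed by `ν_0`. -/
theorem values_odd (hμ1 : μ * q ^ (2 * r) = 1)
    (hE : ((1 - t) * (p + C l⁻¹) - C μ * t) *
        ∏ i, (1 + C (-q * (Fin.cons z ν : Fin (2 * r + 1) → K) i) * X) =
      (1 - t * C (q ^ 2)) * C l⁻¹ *
        ∏ i, (1 + C (-q⁻¹ * (Fin.cons z ν : Fin (2 * r + 1) → K) i) * X)) (n : ℕ) :
    ((∀ i, 2 ≤ i → i ≤ n → qnum P.q i ≠ 0) →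
      P.newtonS p' (z ^ 2) n = hsym ν n + z * hsym ν ((n : ℤ) - 1)) ∧
    p' n = q ^ ((n : ℤ) - 1) * ∑ i, ((ν i - (q ^ 2)⁻¹ * z) / (ν i - z) *
      ∏ j ∈ univ.filter (fun j => j ≠ i ∧ j ≠ i.rev), (ν i - (q ^ 2)⁻¹ * ν j) / (ν i - ν j)) * ν i ^ n +
        μ * z ^ n ∧
    p' n ∈ Set.range f := by
  have hq0 : q ≠ 0 := by rw [hq]; exact (map_ne_zero _).2 hB.q_ne_zero
  have hl0 : l ≠ 0 := by
    rw [hl, hq, ← map_inv₀, ← map_sub]; exact (map_ne_zero _).2 hB.lam_ne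
  have hz0 : z ≠ 0 := by rw [hz]; exact hom_nu_ne_zero hf 0
  have hlι : algebraMap ℂ K (P.q - P.q⁻¹) = l := by rw [hl, hq, map_sub, map_inv₀]
  have e7 : C q⁻¹ * C q = (1 : K⟦X⟧) := by rw [← map_mul, inv_mul_cancel₀ hq0, map_one]
  -- After cancelling `1 - q ν_0 X` from `1 - q² t`, the factor `1 + q ν_0 X` remains, and the other
  -- product contributes `1 - q⁻¹ ν_0 X`.
  have hN : (1 + C (algebraMap ℂ K (P.q - P.q⁻¹) * z) * X + C (algebraMap ℂ K (-1) * z ^ 2) * X ^ 2 : K⟦X⟧) =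
      (1 + C (q * z) * X) * (1 - C (q⁻¹ * z) * X) := by
    rw [hlι, hl]
    simp only [map_mul, map_pow, map_neg, map_one, map_sub]
    linear_combination C z ^ 2 * X ^ 2 * e7
  have hrel : ((1 - t) * (p + C l⁻¹) - C μ * t) * ∏ i, (1 - C (q * ν i) * X) =
      (1 + C (algebraMap ℂ K (P.q - P.q⁻¹) * z) * X + C (algebraMap ℂ K (-1) * z ^ 2) * X ^ 2) *
        (∏ i, (1 - C (q⁻¹ * ν i) * X)) * C l⁻¹ := by
    rw [hN]
    apply mul_left_cancel₀ (one_sub_mul_X_ne_zero (q * z))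
    rw [Fin.prod_univ_succ, Fin.prod_univ_succ] at hE
    simp only [Fin.cons_zero, Fin.cons_succ, neg_mul, map_neg, ← sub_eq_add_neg] at hE
    rw [ht] at hE ⊢
    simp only [map_mul, map_pow] at hE ⊢
    linear_combination hE
  have e3 : (1 - z * z⁻¹) = 0 := by rw [mul_inv_cancel₀ hz0, sub_self]
  have hl1 : l * l⁻¹ = 1 := mul_inv_cancel₀ hl0
  have hq2 : (q ^ (2 * r))⁻¹ = μ := by rw [inv_eq_iff_eq_inv]; exact eq_inv_of_mul_eq_one_right hμ1
  refine ⟨fun hn => ?_, ?_, powerSum_mem_range' hB h0 hq hμ hl hz hν ht hps hrel n⟩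
  -- Here `B(qX)` is the first factor of the numerator, and `B(X/q)` times the second is `1 - q⁻²
  -- t`.
  · refine newtonS_values hB hq hμ hl ht hps (B := 1 + C z * X) hrel ?_
      (fun n => hsym ν n + z * hsym ν ((n : ℤ) - 1)) ?_ ?_ hn
    · rw [hN, ht]
      simp only [map_add, map_one, map_mul, map_pow, rescale_X, rescale_C', mul_pow]
      have e8 : C (q ^ 2)⁻¹ = (C q⁻¹ ^ 2 : K⟦X⟧) := by rw [← map_pow, inv_pow]
      rw [e8]
      ring
    · simp [hsym]
    · have e8 := mk_hsym_sub ν 1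
      ext m
      have := congrArg (coeff m) e8
      rw [coeff_mk, pow_one] at this
      rw [add_mul, one_mul, map_add, coeff_mk, coeff_mk, mul_assoc, coeff_C_mul, ← this]
      rfl
  · have key := powerSum_values hf hB h0 hq hμ hl hz hν (w := fun i => (ν i - (q ^ 2)⁻¹ * z) / (ν i - z))
      (τ0 := μ) (τ1 := μ * z) (n1 := algebraMap ℂ K (P.q - P.q⁻¹) * z) (n2 := algebraMap ℂ K (-1) * z ^ 2) ?_ ?_ ?_ ?_ ht
      (Tl := C μ * PowerSeries.mk fun n => z ^ n) ?_ hps hrel n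
    · rw [key, coeff_C_mul, coeff_mk]
    · have e9 : μ ^ 2 * q ^ (4 * r) = 1 := by
        rw [show 4 * r = 2 * r + 2 * r by ring, pow_add]
        linear_combination (μ * q ^ (2 * r) + 1) * hμ1
      rw [map_neg, map_one]
      linear_combination z ^ 2 * e9
    · intro i
      have h1 : ν i ≠ 0 := by rw [hν]; exact hom_nu_ne_zero hf _
      have h2 : ν i - z ≠ 0 := sub_ne_zero.2 fun h => by
        rw [hν, hz] at h
        exact Fin.succ_ne_zero i (hom_nu_injective hf h)
      have h3 : ν i.rev = z ^ 2 / ν i := by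
        rw [eq_div_iff h1, mul_comm, hν, hν, hz]; exact pair_of_hom f i
      rw [hlι, hl, h3, map_neg, map_one]
      field_simp
      ring
    · rw [hlι, hq2, map_neg, map_one]
      field_simp
      ring
    · rw [hlι, hq2, map_neg, map_one]
      field_simp
      ring
    · have e4 := mk_pow_mul z
      rw [ht, map_pow, map_mul]
      linear_combination C μ * (1 + C z * X) * e4

end Cases

end QMA

namespace QMA

/-! ### The spectral homomorphisms -/

/-- The pairing of the variables `ν_0, -ν_0, ν_1, …, ν_{2r}`. -/
def pairTwo (r : ℕ) : Equiv.Perm (Fin (2 * r + 2)) :=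
  Function.Involutive.toPerm
    (Fin.cons 0 (Fin.cons 1 fun i : Fin (2 * r) => i.rev.succ.succ) : Fin (2 * r + 2) → Fin (2 * r + 2)) fun i => by
      refine Fin.cases rfl (fun i => ?_) i
      refine Fin.cases rfl (fun i => ?_) i
      simp only [Fin.cons_succ, Fin.rev_rev]

/-- The pairing of the variables `ν_0, ν_1, …, ν_{2r}`. -/
def pairOne (r : ℕ) : Equiv.Perm (Fin (2 * r + 1)) :=
  Function.Involutive.toPerm
    (Fin.cons 0 fun i : Fin (2 * r) => i.rev.succ : Fin (2 * r + 1) → Fin (2 * r + 1)) fun i => by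
      refine Fin.cases rfl (fun i => ?_) i
      simp only [Fin.cons_succ, Fin.rev_rev]

section Pair

variable {K : Type} [CommRing K] {r : ℕ} {z : K} {ν : Fin (2 * r) → K}

theorem mul_pairTwo (hν : ∀ i, ν i * ν i.rev = z ^ 2) (i : Fin (2 * r + 2)) :
    (Fin.cons z (Fin.cons (-z) ν) : Fin (2 * r + 2) → K) i *
      (Fin.cons z (Fin.cons (-z) ν) : Fin (2 * r + 2) → K) (pairTwo r i) = z ^ 2 := by
  refine Fin.cases (sq z).symm (fun i => ?_) i
  refine Fin.cases ?_ (fun i => hν i) i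
  change -z * -z = _
  ring

theorem mul_pairOne (hν : ∀ i, ν i * ν i.rev = z ^ 2) (i : Fin (2 * r + 1)) :
    (Fin.cons z ν : Fin (2 * r + 1) → K) i * (Fin.cons z ν : Fin (2 * r + 1) → K) (pairOne r i) = z ^ 2 :=
  Fin.cases (sq z).symm (fun i => hν i) i

end Pair

theorem esym_comp_cons {m : ℕ} {S K : Type} [CommRing S] [Algebra ℂ S] [CommRing K] [Algebra ℂ K] (j : S →ₐ[ℂ] K)
    (z : S) (ν : Fin m → S) (n : ℕ) :
    j (esym (Fin.cons z ν : Fin (m + 1) → S) n) = esym (Fin.cons (j z) (fun i => j (ν i)) : Fin (m + 1) → K) n := by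
  rw [esym_map]
  congr 1
  funext i
  refine Fin.cases rfl (fun i => rfl) i

theorem esym_comp_cons_cons {m : ℕ} {S K : Type} [CommRing S] [Algebra ℂ S] [CommRing K] [Algebra ℂ K] (j : S →ₐ[ℂ] K)
    (z w : S) (ν : Fin m → S) (n : ℕ) :
    j (esym (Fin.cons z (Fin.cons w ν) : Fin (m + 2) → S) n) =
      esym (Fin.cons (j z) (Fin.cons (j w) fun i => j (ν i)) : Fin (m + 2) → K) n := by
  rw [esym_comp_cons]
  congr 2
  funext i
  refine Fin.cases rfl (fun i => rfl) i

namespace Datum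

open PowerSeries

variable {N : ℕ} {P : Datum N} {A : Type} [Ring A] [Algebra ℂ A] {M : Matrix (Fin N) (Fin N) A}
  {C' : Subalgebra ℂ A} (hC : P.charSub M ≤ C') {K : Type} [Field K] [Algebra ℂ K] (φ : C' →ₐ[ℂ] K)
  (hP : IsCompatiblePair P.R P.F)
  (hM : toAlg A (site P.R 2 0) * P.copies M 2 = P.copies M 2 * toAlg A (site P.R 2 0))
  {q μ l : K} (hq : q = algebraMap ℂ K P.q) (hμ : μ = algebraMap ℂ K P.mu) (hl : l = q - q⁻¹)
  {p' : ℕ → K} (hp' : ∀ n, p' n = φ ⟨P.powerSum M n, hC (P.powerSum_mem M n)⟩) {g : K}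
  (hg : φ ⟨P.contraction M, hC (P.contraction_mem M)⟩ = g) {p t : K⟦X⟧}
  (hps : p = PowerSeries.mk fun m => if 1 ≤ m then p' m else 0) (ht : t = C g * X ^ 2)

include hP hp' in
theorem powerSum_zero_value (hB : P.IsBMW) : p' 0 = algebraMap ℂ K (P.mu * P.eta) := by
  rw [hp' 0, ← trace_matD hP hB, ← φ.commutes]
  rfl

include hC hP hM in
theorem asymElt_values {k m : ℕ} {x : Fin m → K}
    (ha : ∀ i, 1 ≤ i → i ≤ k → φ ⟨P.asymElt M i, hC (P.asymElt_mem M i)⟩ = esym x i) (j : ℕ) (hj : j ≤ k) :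
    (tower hC φ hP hM).al j = esym x j := by
  rcases Nat.eq_zero_or_pos j with rfl | h
  · rw [TraceTower.al_zero, esym_zero]
  · rw [tower_al, ha j h hj]

include hC hP hM hp' hps in
theorem powerSeries_tower :
    p = PowerSeries.mk fun m => if 1 ≤ m then (tower hC φ hP hM).pw m else 0 := by
  rw [hps]
  ext m
  rw [coeff_mk, coeff_mk]
  split_ifs with h
  · rw [hp', tower_pw hC φ hP hM h]
  · rfl

include hP hM hq hμ hl hp' hg hps ht

theorem IsSpType.relation {k : ℕ} (hS : P.IsSpType k) {z : K} (hz : z ≠ 0) (hgz : g = z ^ 2)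
    {ν : Fin (2 * k) → K} (hν : ∀ i, ν i * ν i.rev = z ^ 2)
    (ha : ∀ i, 1 ≤ i → i ≤ k → φ ⟨P.asymElt M i, hC (P.asymElt_mem M i)⟩ =
      esym (Fin.cons z (Fin.cons (-z) ν) : Fin (2 * k + 2) → K) i) :
    ((1 - t) * (p + C l⁻¹) - C μ * t) *
        ∏ i, (1 + C (-q * (Fin.cons z (Fin.cons (-z) ν) : Fin (2 * k + 2) → K) i) * X) =
      (1 - t * C (q ^ 2)) * C l⁻¹ *
        ∏ i, (1 + C (-q⁻¹ * (Fin.cons z (Fin.cons (-z) ν) : Fin (2 * k + 2) → K) i) * X) := by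
  have hB := hS.bmw
  have hq0 : q ≠ 0 := by rw [hq]; exact (map_ne_zero _).2 hB.q_ne_zero
  have hl0 : l ≠ 0 := by
    rw [hl, hq, ← map_inv₀, ← map_sub]; exact (map_ne_zero _).2 hB.lam_ne
  have hga := (tower_ga hC φ hP hM).trans hg
  refine relation_symplectic hq0 hl0 hl ?_ (g := z ^ 2) (pow_ne_zero 2 hz) ?_ (hgz ▸ ht) (pairTwo k)
    (mul_pairTwo hν) ?_ (asymElt_values hC φ hP hM ha)
    ((tower hC φ hP hM).relation hB hP.rmatrix_left hS.height (fun t h1 h2 => hS.one_add_ne_zero h1 h2) hq hμ hl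
      (powerSeries_tower hC φ hP hM hp' hps) (by rw [hga]; exact ht))
  · rw [hμ, hS.mu_eq, hq]
    simp only [map_neg, map_inv₀, map_pow]
  · have := (map_ne_zero (algebraMap ℂ K)).2 (two_ne_zero (α := ℂ))
    rwa [map_ofNat] at this
  · rw [Fin.prod_univ_succ, Fin.prod_univ_succ]
    simp only [Fin.cons_zero, Fin.cons_succ]
    rw [prod_pair hν]
    ring

theorem IsOType.relation {k : ℕ} (hO : P.IsOType k) {x : Fin k → K} (σ : Equiv.Perm (Fin k))
    (hσ : ∀ i, x i * x (σ i) = g)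
    (ha : ∀ i, 1 ≤ i → i ≤ k → φ ⟨P.asymElt M i, hC (P.asymElt_mem M i)⟩ = esym x i) :
    ((1 - t) * (p + C l⁻¹) - C μ * t) * ∏ i, (1 + C (-q * x i) * X) =
      (1 - t * C (q ^ 2)) * C l⁻¹ * ∏ i, (1 + C (-q⁻¹ * x i) * X) := by
  have hB := hO.bmw
  have hq0 : q ≠ 0 := by rw [hq]; exact (map_ne_zero _).2 hB.q_ne_zero
  have hl0 : l ≠ 0 := by
    rw [hl, hq, ← map_inv₀, ← map_sub]; exact (map_ne_zero _).2 hB.lam_ne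
  have hga := (tower_ga hC φ hP hM).trans hg
  refine relation_orthogonal hq0 hl0 ?_ ?_ ht σ hσ (asymElt_values hC φ hP hM ha)
    ((tower hC φ hP hM).relation hB hP.rmatrix_left hO.height (fun t h1 h2 => hO.one_add_ne_zero h2) hq hμ hl
      (powerSeries_tower hC φ hP hM hp' hps) (by rw [hga]; exact ht))
  · rw [hμ, hO.mu_eq', hq]
    simp only [map_mul, map_inv₀, map_pow]
  · have h1 := hO.one_add_ne_zero le_rfl
    have h2 : 1 + P.mu * P.q ^ (2 * k) * P.q⁻¹ = 1 + P.q ^ k := by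
      have h3 : P.q ^ k ≠ 0 := pow_ne_zero _ hB.q_ne_zero
      have h4 := hB.q_ne_zero
      rw [hO.mu_eq', two_mul, pow_add]
      field_simp
    rw [h2] at h1
    have := (map_ne_zero (algebraMap ℂ K)).2 h1
    rwa [map_add, map_one, map_pow, ← hq] at this

omit hq hμ hl hp' hps ht in
theorem IsOType.asymElt_sq {k : ℕ} (hO : P.IsOType k) (hg0 : g ≠ 0) :
    φ ⟨P.asymElt M k, hC (P.asymElt_mem M k)⟩ ^ 2 = g ^ k := by
  have hga := (tower_ga hC φ hP hM).trans hg
  have := (tower hC φ hP hM).al_sq hO.bmw hP.rmatrix_left hO.height.qnum_ne_zero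
    (fun t h1 h2 => den_ne_zero hO.bmw.q_ne_zero (hO.one_add_ne_zero h2.le)) hO.rank_eq_one
    (fun j hj => hO.nestC_ne_zero hj) (by rw [hga]; exact hg0)
  rwa [tower_al, hga] at this

end Datum

end QMA

/-! ### The four types of spectral homomorphisms. -/

namespace QMA

/-- The embedding of `E_{2r}` into its field of fractions. -/
noncomputable def fracHom (r : ℕ) : SpecAlg r →ₐ[ℂ] SpecFrac r :=
  IsScalarTower.toAlgHom ℂ (SpecAlg r) (SpecFrac r)

theorem fracHom_injective (r : ℕ) : Function.Injective (fracHom r) :=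
  IsFractionRing.injective (SpecAlg r) (SpecFrac r)

/-- The embedding of `E^•_{2r}` into its field of fractions. -/
noncomputable def invFracHom (r : ℕ) : SpecAlgInv r →ₐ[ℂ] SpecFracInv r :=
  IsScalarTower.toAlgHom ℂ (SpecAlgInv r) (SpecFracInv r)

theorem invFracHom_injective (r : ℕ) : Function.Injective (invFracHom r) :=
  IsFractionRing.injective (SpecAlgInv r) (SpecFracInv r)

/-- The embedding of `E_{2r}` into the field of fractions of `E^•_{2r}`. -/
noncomputable def fracHomInv (r : ℕ) : SpecAlg r →ₐ[ℂ] SpecFracInv r :=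
  (invFracHom r).comp (IsScalarTower.toAlgHom ℂ (SpecAlg r) (SpecAlgInv r))

theorem fracHomInv_injective (r : ℕ) : Function.Injective (fracHomInv r) :=
  (invFracHom_injective r).comp (specAlgInv_injective r)

theorem isUnit_nuF_sub {r : ℕ} {i j : Fin (2 * r + 1)} (h : i ≠ j) : IsUnit (nuF r i - nuF r j) :=
  isUnit_iff_ne_zero.2 (sub_ne_zero.2 fun h' => h (hom_nu_injective (fracHom_injective r) h'))

theorem isUnit_nuFInv_sub {r : ℕ} {i j : Fin (2 * r + 1)} (h : i ≠ j) : IsUnit (nuFInv r i - nuFInv r j) :=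
  isUnit_iff_ne_zero.2 (sub_ne_zero.2 fun h' => h (hom_nu_injective (fracHomInv_injective r) h'))

theorem mem_range_of_fracHomInv {r : ℕ} {x : SpecAlgInv r} (h : invFracHom r x ∈ Set.range (fracHomInv r)) :
    x ∈ Set.range (algebraMap (SpecAlg r) (SpecAlgInv r)) := by
  obtain ⟨y, hy⟩ := h
  exact ⟨y, invFracHom_injective r hy⟩

theorem div_eq_ratio {K : Type} [Field K] [Algebra ℂ K] (c : ℂ) (m : ℕ) (x y : K) :
    (x - (algebraMap ℂ K c ^ m)⁻¹ * y) / (x - y) = ratio (c ^ m)⁻¹ x y := by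
  rw [ratio, Ring.inverse_eq_inv, Algebra.smul_def, div_eq_mul_inv, map_inv₀, map_pow]

namespace Datum

/-- The relation between `g` and its inverse is imposed on elements of a free algebra; naturality
transfers it to the contraction of the quotient. -/
theorem ch_map {N n : ℕ} {P : Datum N} {A B : Type} [Ring A] [Algebra ℂ A] [Ring B] [Algebra ℂ B] (f : A →ₐ[ℂ] B)
    (M : Matrix (Fin N) (Fin N) A) (Y : Op N n ℂ) : f (P.ch M n Y) = P.ch (M.map f) n Y := by
  unfold ch rTrace
  rw [map_sum]
  refine Finset.sum_congr rfl fun i _ => ?_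
  rw [map_sum]
  refine Finset.sum_congr rfl fun j _ => ?_
  rw [map_smul, ← copies_map, ← toAlg_map f Y, ← Matrix.map_mul]
  rfl

open PowerSeries

variable {N : ℕ} {P : Datum N} (hP : IsCompatiblePair P.R P.F) (n : ℕ)

include hP

theorem IsSpType.values {k : ℕ} (hS : P.IsSpType k) {π : P.CharAlg →ₐ[ℂ] SpecAlg k} (hπ : P.IsSpectralSp k π) :
    ((∀ i, 2 ≤ i → i ≤ n → qnum P.q i ≠ 0) → π (P.s n) = hsym (fun j : Fin (2 * k) => nu k j.succ) n) ∧
    algebraMap (SpecAlg k) (SpecFrac k) (π (P.p n)) =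
      P.q ^ ((n : ℤ) - 1) • ∑ i : Fin (2 * k), P.weightSp k i * nuF k i.succ ^ n := by
  set K := SpecFrac k
  set ι := algebraMap ℂ K with hι
  set φ := (fracHom k).comp π with hφ
  set z := nuF k 0 with hz
  set ν : Fin (2 * k) → K := fun i => nuF k i.succ with hν
  have hg : φ (P.g) = z ^ 2 := by
    rw [hφ, AlgHom.comp_apply, hπ.1, map_pow]; rfl
  have ha : ∀ i, 1 ≤ i → i ≤ k → φ (P.a i) = esym (Fin.cons z (Fin.cons (-z) ν) : Fin (2 * k + 2) → K) i := by
    intro i h1 h2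
    rw [hφ, AlgHom.comp_apply, hπ.2 i h1 h2, esym_comp_cons_cons, map_neg]; rfl
  have hz0 : z ≠ 0 := hom_nu_ne_zero (fracHom_injective k) 0
  have hrel := hS.relation (le_refl _) φ hP gen_exchange (q := ι P.q) (μ := ι P.mu) rfl rfl rfl
    (p' := fun n => φ (P.p n)) (fun n => rfl) hg rfl rfl hz0 rfl (ν := ν) (pair_of_hom (fracHom k)) ha
  have hB := hS.bmw
  have hq := hB.q_ne_zero
  obtain ⟨h1, h2, -⟩ := values_pair (fracHom_injective k) hB (p' := fun n => φ (P.p n))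
    (powerSum_zero_value (le_refl _) φ hP (fun n => rfl) hB) (q := ι P.q) (μ := ι P.mu) rfl rfl rfl
    (z := z) rfl (ν := ν) (fun i => rfl) rfl rfl (τ := 0) (by
      rw [← map_pow, ← map_pow, ← map_pow, ← map_mul, ← map_mul, hS.mu_eq, ← map_one ι]
      congr 1
      field_simp
      ring) (by
      rw [mul_zero, add_zero, ← map_one ι]
      simp only [← map_pow, ← map_inv₀, ← map_sub, ← map_mul, ← map_neg]
      congr 1
      have h3 := hB.lam_ne
      have h4 : P.q ^ 2 - 1 ≠ 0 := sub_ne_zero.2 hB.q_sq_ne_one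
      rw [hS.mu_eq, show P.q - P.q⁻¹ = (P.q ^ 2 - 1) / P.q by field_simp]
      field_simp
      ring) hrel n
  refine ⟨fun hn => fracHom_injective k ?_, ?_⟩
  · rw [hsym_map]
    refine Eq.trans ?_ (h1 hn)
    rw [← hg]
    exact newtonS_map P φ P.p P.g n
  · refine Eq.trans h2 ?_
    rw [mul_zero, zero_mul, add_zero, Algebra.smul_def, map_zpow₀]
    congr 1
    refine Finset.sum_congr rfl fun i _ => ?_
    congr 1
    exact congrArg₂ (· * ·) (div_eq_ratio P.q 4 _ _) (Finset.prod_congr rfl fun j _ => div_eq_ratio P.q 2 _ _)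

theorem IsOType.values_plus {l : ℕ} (hO : P.IsOType (2 * l)) {π : P.CompCharAlg l 1 →ₐ[ℂ] SpecAlgInv l}
    (hπ : P.IsSpectralOPlus l π) :
    ((∀ i, 2 ≤ i → i ≤ n → qnum P.q i ≠ 0) →
      π (P.compS l 1 n) = hsym (fun j : Fin (2 * l) => nuInv l j.succ) n -
        nuInv l 0 ^ 2 * hsym (fun j : Fin (2 * l) => nuInv l j.succ) ((n : ℤ) - 2)) ∧
    algebraMap (SpecAlgInv l) (SpecFracInv l) (π (P.toComp l 1 (P.extP n))) =
      P.q ^ ((n : ℤ) - 1) • ∑ i : Fin (2 * l), P.weightOPlus l i * nuFInv l i.succ ^ n ∧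
    π (P.toComp l 1 (P.extP n)) ∈ Set.range (algebraMap (SpecAlg l) (SpecAlgInv l)) := by
  set K := SpecFracInv l
  set ι := algebraMap ℂ K with hι
  set φ := (invFracHom l).comp (π.comp (P.toComp l 1)) with hφ
  set z := nuFInv l 0 with hz
  set ν : Fin (2 * l) → K := fun i => nuFInv l i.succ with hν
  have hg : φ (P.extG) = z ^ 2 := by
    rw [hφ, AlgHom.comp_apply, AlgHom.comp_apply, hπ.1, map_pow]; rfl
  have ha : ∀ i, 1 ≤ i → i ≤ 2 * l → φ (P.extA i) = esym ν i := by
    intro i h1 h2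
    rw [hφ, AlgHom.comp_apply, AlgHom.comp_apply, hπ.2 i h1 h2, esym_map]; rfl
  have hrel := hO.relation (P.charSub_le _ _) φ hP extGen_exchange (q := ι P.q) (μ := ι P.mu) rfl rfl rfl
    (p' := fun n => φ (P.extP n)) (fun n => rfl) hg rfl rfl (x := ν) Fin.revPerm (pair_of_hom (fracHomInv l)) ha
  have hB := hO.bmw
  have hq := hB.q_ne_zero
  obtain ⟨h1, h2, h3⟩ := values_even (fracHomInv_injective l) hB (p' := fun n => φ (P.extP n))
    (powerSum_zero_value (P.charSub_le _ _) φ hP (fun n => rfl) hB) (q := ι P.q) (μ := ι P.mu) rfl rfl rfl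
    (z := z) rfl (ν := ν) (fun i => rfl) rfl rfl (by
      rw [← map_pow, ← map_mul, hO.mu_eq']
      congr 1
      field_simp) hrel n
  refine ⟨fun hn => invFracHom_injective l ?_, ?_, mem_range_of_fracHomInv h3⟩
  · rw [map_sub, map_mul, map_pow, hsym_map, hsym_map]
    refine Eq.trans ?_ (h1 hn)
    rw [← hg]
    exact newtonS_map P φ P.extP P.extG n
  · refine Eq.trans h2 ?_
    rw [Algebra.smul_def, map_zpow₀]
    congr 1
    refine Finset.sum_congr rfl fun i _ => ?_
    congr 1
    exact Finset.prod_congr rfl fun j _ => div_eq_ratio P.q 2 _ _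

theorem IsOType.values_minus {r : ℕ} (hO : P.IsOType (2 * (r + 1)))
    {π : P.CompCharAlg (r + 1) (-1) →ₐ[ℂ] SpecAlgInv r} (hπ : P.IsSpectralOMinus (r + 1) π) :
    ((∀ i, 2 ≤ i → i ≤ n → qnum P.q i ≠ 0) →
      π (P.compS (r + 1) (-1) n) = hsym (fun j : Fin (2 * r) => nuInv r j.succ) n) ∧
    algebraMap (SpecAlgInv r) (SpecFracInv r) (π (P.toComp (r + 1) (-1) (P.extP n))) =
      P.q ^ ((n : ℤ) - 1) • ∑ i : Fin (2 * r), P.weightOMinus r i * nuFInv r i.succ ^ n +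
        ((1 + (-1) ^ n) * P.q ^ (1 - 2 * ((r + 1 : ℕ) : ℤ))) • nuFInv r 0 ^ n ∧
    π (P.toComp (r + 1) (-1) (P.extP n)) ∈ Set.range (algebraMap (SpecAlg r) (SpecAlgInv r)) := by
  set K := SpecFracInv r
  set ι := algebraMap ℂ K with hι
  set φ := (invFracHom r).comp (π.comp (P.toComp (r + 1) (-1))) with hφ
  set z := nuFInv r 0 with hz
  set ν : Fin (2 * r) → K := fun i => nuFInv r i.succ with hν
  have hg : φ (P.extG) = z ^ 2 := by
    rw [hφ, AlgHom.comp_apply, AlgHom.comp_apply, hπ.1, map_pow]; rfl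
  have ha : ∀ i, 1 ≤ i → i ≤ 2 * (r + 1) →
      φ (P.extA i) = esym (Fin.cons z (Fin.cons (-z) ν) : Fin (2 * r + 2) → K) i := by
    intro i h1 h2
    rw [hφ, AlgHom.comp_apply, AlgHom.comp_apply, hπ.2 i h1 h2]
    refine (esym_comp_cons_cons (invFracHom r) (nuInv r 0) (-nuInv r 0)
      (fun j : Fin (2 * r) => nuInv r j.succ) i).trans ?_
    rw [map_neg]; rfl
  have hrel := hO.relation (P.charSub_le _ _) φ hP extGen_exchange (q := ι P.q) (μ := ι P.mu) rfl rfl rfl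
    (p' := fun n => φ (P.extP n)) (fun n => rfl) hg rfl rfl
    (x := (Fin.cons z (Fin.cons (-z) ν) : Fin (2 * r + 2) → K)) (pairTwo r)
    (mul_pairTwo (pair_of_hom (fracHomInv r))) ha
  have hB := hO.bmw
  have hq := hB.q_ne_zero
  have hμ := hO.mu_eq'
  rw [show 2 * (r + 1) = 2 * r + 2 by ring, pow_add] at hμ
  obtain ⟨h1, h2, h3⟩ := values_pair (fracHomInv_injective r) hB (p' := fun n => φ (P.extP n))
    (powerSum_zero_value (P.charSub_le _ _) φ hP (fun n => rfl) hB) (q := ι P.q) (μ := ι P.mu) rfl rfl rfl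
    (z := z) rfl (ν := ν) (fun i => rfl) rfl rfl (τ := ι P.mu) (by
      rw [← map_pow, ← map_pow, ← map_pow, ← map_mul, ← map_mul, hμ, ← map_one ι]
      congr 1
      field_simp
      ring) (by
      rw [two_mul (ι P.mu), neg_add_cancel_left, ← map_one ι]
      simp only [← map_pow, ← map_inv₀, ← map_sub, ← map_mul]
      congr 1
      have h3 := hB.lam_ne
      have h4 : P.q ^ 2 - 1 ≠ 0 := sub_ne_zero.2 hB.q_sq_ne_one
      rw [hμ, show P.q - P.q⁻¹ = (P.q ^ 2 - 1) / P.q by field_simp]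
      field_simp) hrel n
  refine ⟨fun hn => invFracHom_injective r ?_, ?_, mem_range_of_fracHomInv h3⟩
  · rw [hsym_map]
    refine Eq.trans ?_ (h1 hn)
    rw [← hg]
    exact newtonS_map P φ P.extP P.extG n
  · refine Eq.trans h2 ?_
    rw [Algebra.smul_def, Algebra.smul_def, map_zpow₀]
    congr 1
    · congr 1
      refine Finset.sum_congr rfl fun i _ => ?_
      congr 1
      exact congrArg₂ (· * ·) (div_eq_ratio P.q 4 _ _) (Finset.prod_congr rfl fun j _ => div_eq_ratio P.q 2 _ _)
    · have e2 : (1 : ℤ) - 2 * ((r + 1 : ℕ) : ℤ) = 1 - ((2 * (r + 1) : ℕ) : ℤ) := by push_cast; ring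
      rw [e2, ← hO.mu_eq, map_mul, map_add, map_pow, map_neg, map_one]

theorem IsOType.values_odd {r : ℕ} (hO : P.IsOType (2 * r + 1))
    {π : P.ExtCharAlg →ₐ[ℂ] SpecAlgInv r} (hπ : P.IsSpectralOOdd (r + 1) π) :
    ((∀ i, 2 ≤ i → i ≤ n → qnum P.q i ≠ 0) →
      π (P.extS n) = hsym (fun j : Fin (2 * r) => nuInv r j.succ) n +
        nuInv r 0 * hsym (fun j : Fin (2 * r) => nuInv r j.succ) ((n : ℤ) - 1)) ∧
    algebraMap (SpecAlgInv r) (SpecFracInv r) (π (P.extP n)) =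
      P.q ^ ((n : ℤ) - 1) • ∑ i : Fin (2 * r), P.weightOOdd r i * nuFInv r i.succ ^ n +
        P.q ^ (2 - 2 * ((r + 1 : ℕ) : ℤ)) • nuFInv r 0 ^ n ∧
    π (P.extP n) ∈ Set.range (algebraMap (SpecAlg r) (SpecAlgInv r)) := by
  set K := SpecFracInv r
  set ι := algebraMap ℂ K with hι
  set φ := (invFracHom r).comp π with hφ
  set z := nuFInv r 0 with hz
  set ν : Fin (2 * r) → K := fun i => nuFInv r i.succ with hν
  have hinv : φ P.extGInv * φ P.extG = 1 := by
    rw [← map_mul, ← map_one φ]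
    refine congrArg φ (Subtype.ext ?_)
    change P.extInv * P.contraction P.extGen = 1
    have h1 := RingQuot.mkAlgHom_rel ℂ (ExtRel.inv_mul (P := P))
    rw [map_mul, map_one] at h1
    rw [← h1]
    congr 1
    rw [contraction, contraction, map_smul]
    congr 1
    exact (ch_map (RingQuot.mkAlgHom ℂ P.ExtRel) (extFreeGen N) _).symm
  have hg0 : φ P.extG ≠ 0 := right_ne_zero_of_mul_eq_one hinv
  have hroot : φ P.extGInv ^ r * φ (P.extA (2 * r + 1)) = z := by
    rw [← map_pow, ← map_mul]
    exact congrArg (invFracHom r) hπ.1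
  have hsq := hO.asymElt_sq (P.charSub_le _ _) φ hP extGen_exchange rfl hg0
  -- Only the image of `g^{-r} a_{2r+1}` is prescribed. Its square is `g^{-2r} a_{2r+1}² = g`, by
  -- the rank one identity `a_{2r+1}² = g^{2r+1}`.
  have hg : φ P.extG = z ^ 2 := by
    rw [← hroot, mul_pow]
    have h1 : (φ P.extGInv * φ P.extG) ^ (2 * r) = 1 := by rw [hinv, one_pow]
    change φ (P.extA (2 * r + 1)) ^ 2 = φ P.extG ^ (2 * r + 1) at hsq
    rw [mul_pow] at h1
    rw [hsq, pow_succ _ (2 * r), ← pow_mul, mul_comm r 2, ← mul_assoc, h1, one_mul]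
  have ha : ∀ i, 1 ≤ i → i ≤ 2 * r + 1 → φ (P.extA i) = esym (Fin.cons z ν : Fin (2 * r + 1) → K) i := by
    intro i h1 h2
    rw [hφ, AlgHom.comp_apply, hπ.2 i h1 h2]
    exact esym_comp_cons (invFracHom r) (nuInv r 0) (fun j : Fin (2 * r) => nuInv r j.succ) i
  have hrel := hO.relation (P.charSub_le _ _) φ hP extGen_exchange (q := ι P.q) (μ := ι P.mu) rfl rfl rfl
    (p' := fun n => φ (P.extP n)) (fun n => rfl) hg rfl rfl
    (x := (Fin.cons z ν : Fin (2 * r + 1) → K)) (pairOne r)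
    (mul_pairOne (pair_of_hom (fracHomInv r))) ha
  have hB := hO.bmw
  have hq := hB.q_ne_zero
  have hμ := hO.mu_eq'
  rw [pow_succ] at hμ
  obtain ⟨h1, h2, h3⟩ := QMA.values_odd (fracHomInv_injective r) hB (p' := fun n => φ (P.extP n))
    (powerSum_zero_value (P.charSub_le _ _) φ hP (fun n => rfl) hB) (q := ι P.q) (μ := ι P.mu) rfl rfl rfl
    (z := z) rfl (ν := ν) (fun i => rfl) rfl rfl (by
      rw [← map_pow, ← map_mul, hμ, ← map_one ι]
      congr 1
      field_simp) hrel n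
  refine ⟨fun hn => invFracHom_injective r ?_, ?_, mem_range_of_fracHomInv h3⟩
  · rw [map_add, map_mul, hsym_map, hsym_map]
    refine Eq.trans ?_ (h1 hn)
    rw [← hg]
    exact newtonS_map P φ P.extP P.extG n
  · refine Eq.trans h2 ?_
    rw [Algebra.smul_def, Algebra.smul_def, map_zpow₀]
    congr 1
    · congr 1
      refine Finset.sum_congr rfl fun i _ => ?_
      congr 1
      exact congrArg₂ (· * ·) (div_eq_ratio P.q 2 _ _) (Finset.prod_congr rfl fun j _ => div_eq_ratio P.q 2 _ _)
    · have e := hO.mu_eq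
      have e2 : (1 : ℤ) - ((2 * r + 1 : ℕ) : ℤ) = 2 - 2 * ((r + 1 : ℕ) : ℤ) := by push_cast; ring
      rw [← e2, ← e]

end Datum

end QMA

theorem corollary6p4 {N : ℕ} (P : QMA.Datum N) (hP : QMA.IsCompatiblePair P.R P.F)
    (n : ℕ) (hq : ∀ i, 2 ≤ i → i ≤ n → QMA.qnum P.q i ≠ 0) :
    -- the type Sp(2k)
    (∀ k : ℕ, P.IsSpType k →
      ∀ π : P.CharAlg →ₐ[ℂ] QMA.SpecAlg k, P.IsSpectralSp k π →
        π (P.s n) = QMA.hsym (fun j : Fin (2 * k) => QMA.nu k j.succ) n ∧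
        (∀ i j : Fin (2 * k + 1), i ≠ j → IsUnit (QMA.nuF k i - QMA.nuF k j)) ∧
        algebraMap (QMA.SpecAlg k) (QMA.SpecFrac k) (π (P.p n)) =
          P.q ^ ((n : ℤ) - 1) •
            ∑ i : Fin (2 * k), P.weightSp k i * QMA.nuF k i.succ ^ n) ∧
    -- the type O^+(2l)
    (∀ l : ℕ, 1 ≤ l → P.IsOType (2 * l) →
      ∀ π : P.CompCharAlg l 1 →ₐ[ℂ] QMA.SpecAlgInv l, P.IsSpectralOPlus l π →
        π (P.compS l 1 n) =
          QMA.hsym (fun j : Fin (2 * l) => QMA.nuInv l j.succ) n -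
            QMA.nuInv l 0 ^ 2 *
              QMA.hsym (fun j : Fin (2 * l) => QMA.nuInv l j.succ) ((n : ℤ) - 2) ∧
        (∀ i j : Fin (2 * l + 1), i ≠ j → IsUnit (QMA.nuFInv l i - QMA.nuFInv l j)) ∧
        algebraMap (QMA.SpecAlgInv l) (QMA.SpecFracInv l) (π (P.toComp l 1 (P.extP n))) =
          P.q ^ ((n : ℤ) - 1) •
            ∑ i : Fin (2 * l), P.weightOPlus l i * QMA.nuFInv l i.succ ^ n ∧
        π (P.toComp l 1 (P.extP n)) ∈
          Set.range (algebraMap (QMA.SpecAlg l) (QMA.SpecAlgInv l))) ∧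
    -- the type O^-(2l)
    (∀ l : ℕ, 1 ≤ l → P.IsOType (2 * l) →
      ∀ π : P.CompCharAlg l (-1) →ₐ[ℂ] QMA.SpecAlgInv (l - 1), P.IsSpectralOMinus l π →
        π (P.compS l (-1) n) =
          QMA.hsym (fun j : Fin (2 * (l - 1)) => QMA.nuInv (l - 1) j.succ) n ∧
        (∀ i j : Fin (2 * (l - 1) + 1), i ≠ j →
          IsUnit (QMA.nuFInv (l - 1) i - QMA.nuFInv (l - 1) j)) ∧
        algebraMap (QMA.SpecAlgInv (l - 1)) (QMA.SpecFracInv (l - 1))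
            (π (P.toComp l (-1) (P.extP n))) =
          P.q ^ ((n : ℤ) - 1) •
            ∑ i : Fin (2 * (l - 1)), P.weightOMinus (l - 1) i * QMA.nuFInv (l - 1) i.succ ^ n +
          ((1 + (-1) ^ n) * P.q ^ (1 - 2 * (l : ℤ))) • QMA.nuFInv (l - 1) 0 ^ n ∧
        π (P.toComp l (-1) (P.extP n)) ∈
          Set.range (algebraMap (QMA.SpecAlg (l - 1)) (QMA.SpecAlgInv (l - 1)))) ∧
    -- the type O^•(2l-1)
    (∀ l : ℕ, 2 ≤ l → P.IsOType (2 * l - 1) →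
      ∀ π : P.ExtCharAlg →ₐ[ℂ] QMA.SpecAlgInv (l - 1), P.IsSpectralOOdd l π →
        π (P.extS n) =
          QMA.hsym (fun j : Fin (2 * (l - 1)) => QMA.nuInv (l - 1) j.succ) n +
            QMA.nuInv (l - 1) 0 *
              QMA.hsym (fun j : Fin (2 * (l - 1)) => QMA.nuInv (l - 1) j.succ) ((n : ℤ) - 1) ∧
        (∀ i j : Fin (2 * (l - 1) + 1), i ≠ j →
          IsUnit (QMA.nuFInv (l - 1) i - QMA.nuFInv (l - 1) j)) ∧
        algebraMap (QMA.SpecAlgInv (l - 1)) (QMA.SpecFracInv (l - 1)) (π (P.extP n)) =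
          P.q ^ ((n : ℤ) - 1) •
            ∑ i : Fin (2 * (l - 1)), P.weightOOdd (l - 1) i * QMA.nuFInv (l - 1) i.succ ^ n +
          P.q ^ (2 - 2 * (l : ℤ)) • QMA.nuFInv (l - 1) 0 ^ n ∧
        π (P.extP n) ∈
          Set.range (algebraMap (QMA.SpecAlg (l - 1)) (QMA.SpecAlgInv (l - 1)))) := by
  refine ⟨fun k hS π hπ => ?_, fun l _ hO π hπ => ?_, fun l hl hO π hπ => ?_, fun l hl hO π hπ => ?_⟩
  · have h := hS.values hP n hπ
    exact ⟨h.1 hq, fun i j => QMA.isUnit_nuF_sub, h.2⟩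
  · have h := hO.values_plus hP n hπ
    exact ⟨h.1 hq, fun i j => QMA.isUnit_nuFInv_sub, h.2⟩
  · obtain ⟨r, rfl⟩ : ∃ r, l = r + 1 := ⟨l - 1, by omega⟩
    have h := hO.values_minus hP n hπ
    exact ⟨h.1 hq, fun i j => QMA.isUnit_nuFInv_sub, h.2⟩
  · obtain ⟨r, rfl⟩ : ∃ r, l = r + 1 := ⟨l - 1, by omega⟩
    have h := QMA.Datum.IsOType.values_odd hP n (r := r) hO hπ
    exact ⟨h.1 hq, fun i j => QMA.isUnit_nuFInv_sub, h.2⟩
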